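/- Let $k\ge 0$ be an integer. There is an integer $m$, depending only on $k$, such that the following holds. Let $a<b$, $T>0$, $\varepsilon>0$, $1<\alpha<2$, $\beta>0$, $\sigma>0$, $\Omega=[a,b]$. For a function $w$ on $\mathbb R$ and $s>0$ let $${}_{-\infty}I_x^{s}w(x)=\frac1{\Gamma(s)}\int_{-\infty}^x (x-t)^{s-1}w(t)\,dt,\qquad {}_xI_\infty^{s}w(x)=\frac1{\Gamma(s)}\int_x^\infty (t-x)^{s-1}w(t)\,dt,$$ $$\Delta_{-s/2}w=\frac{{}_{-\infty}I_x^{s}w+{}_xI_\infty^{s}w}{2\cos(s\pi/2)}\quad(0<s<1),\qquad -(-\Delta)^{\alpha/2}w=-\frac{1}{2\cos(\alpha\pi/2)}\frac{d^2}{dx^2}\left({}_{-\infty}I_x^{2-\alpha}w+{}_xI_\infty^{2-\alpha}w\right).$$ Let $u:\mathbb R\times[0,T]\to\mathbb R$ be of class $C^m$, with $u(x,t)=0$ for $x\notin\Omega$, and suppose that $u_t=-\varepsilon(-\Delta)^{\alpha/2}u+g$ on $(a,b)\times(0,T]$ for a given source term $g$ (the case $g=0$ is included). For a partition $a=x_{1/2}<x_{3/2}<\dots<x_{K+1/2}=b$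 with cells $I_i=[x_{i-1/2},x_{i+1/2}]$ of length $\Delta x_i$ put $h=\max_i\Delta x_i$ and let $V_h$ be the space of functions whose restriction to each $I_i$ is a polynomial of degree at most $k$, extended by $0$ outside $\Omega$. Let $v^\pm_{i+1/2}$ be the one-sided limits at $x_{i+1/2}$ (so the limits from outside $\Omega$ are $0$), and $[\![v]\!]=v^+-v^-$. The semi-discrete LDG scheme asks for $u_h(t),p_h(t),q_h(t)\in V_h$, with $u_h$ continuous in $t\in[0,T]$ and differentiable in $t\in(0,T]$, such that for all $t\in(0,T]$, all $v,w,z\in V_h$ and all $i$ $$((u_h)_t,v)_{I_i}-\sqrt\varepsilon\,\hat q_h v\Big|_{x_{i-1/2}^+}^{x_{i+1/2}^-}+\sqrt\varepsilon\,(q_h,v_x)_{I_i}=(g,v)_{I_i},$$ $$(q_h,w)_{I_i}-(\Delta_{(\alpha-2)/2}p_h,w)_{I_i}=0,$$ $$(p_h,z)_{I_i}-\sqrt\varepsilon\,\hat u_h z\Big|_{x_{i-1/2}^+}^{x_{i+1/2}^-}+\sqrt\varepsilon\,(u_h,z_x)_{I_i}=0,$$ $$(u_h(\cdot,0),v)_{I_i}=(u(\cdot,0),v)_{I_i},$$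 with one of the two choices of numerical fluxes (subscripts $h$ dropped): (i) $\hat u=u^-$ at the interior nodes, $\hat u=0$ at $a$ and $b$; $\hat q=q^+$ at all nodes except $b$, and $\hat q=q^-+\frac{\beta}{h}[\![u]\!]$ at $b$; (ii) $\hat u=u^+$ at the interior nodes, $\hat u=0$ at $a$ and $b$; $\hat q=q^-$ at all nodes except $a$, and $\hat q=q^++\frac{\beta}{h}[\![u]\!]$ at $a$. Then for each choice of fluxes there are constants $C>0$ and $h_0>0$ (which may depend on all the data above, $\sigma$ and $u$ included, but not on the partition) such that for every partition with $h\le h_0$ that is quasi-uniform in the sense $h\le\sigma\,\Delta x_i$ for all $i$, and every solution $(u_h,p_h,q_h)$ of the scheme, $$\|u(\cdot,t)-u_h(\cdot,t)\|_{L^2(\Omega)}\le C\,h^{k+1}\qquad\text{for all }t\in[0,T].$$ -/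

import Mathlib

open Set
open scoped Polynomial

namespace LDG

noncomputable section

/-! ### Fractional calculus on the line -/

/-- The left fractional integral of order `s` over `(-∞, x]`. -/
def leftFracInt (s : ℝ) (u : ℝ → ℝ) (x : ℝ) : ℝ :=
  (1 / Real.Gamma s) * ∫ t in Iic x, (x - t) ^ (s - 1) * u t

/-- The right fractional integral of order `s` over `[x, ∞)`. -/
def rightFracInt (s : ℝ) (u : ℝ → ℝ) (x : ℝ) : ℝ :=
  (1 / Real.Gamma s) * ∫ t in Ici x, (t - x) ^ (s - 1) * u t

/-- The left Riemann-Liouville derivative of non-integer order `α`: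
`D^n I^(n-α) u` with `n - 1 < α < n`. -/
def leftRLDeriv (α : ℝ) (u : ℝ → ℝ) (x : ℝ) : ℝ :=
  iteratedDeriv ⌈α⌉₊ (leftFracInt (⌈α⌉₊ - α) u) x

/-- The right Riemann-Liouville derivative of non-integer order `α`:
`(-D)^n I^(n-α) u` with `n - 1 < α < n`. -/
def rightRLDeriv (α : ℝ) (u : ℝ → ℝ) (x : ℝ) : ℝ :=
  (-1) ^ ⌈α⌉₊ * iteratedDeriv ⌈α⌉₊ (rightFracInt (⌈α⌉₊ - α) u) x

/-- The operator `-(-Δ)^(α/2)`, `1 < α < 2`, as the Riesz derivative. -/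
def negFracLaplacian (α : ℝ) (u : ℝ → ℝ) (x : ℝ) : ℝ :=
  -(leftRLDeriv α u x + rightRLDeriv α u x) / (2 * Real.cos (α * Real.pi / 2))

/-- The fractional integral operator `Δ_{-s/2}`, `0 < s < 1`. -/
def fracLaplacianInt (s : ℝ) (u : ℝ → ℝ) (x : ℝ) : ℝ :=
  (leftFracInt s u x + rightFracInt s u x) / (2 * Real.cos (s * Real.pi / 2))

/-! ### The exact solution -/

/-- `u` is a classical solution of `u_t = -ε (-Δ)^(α/2) u + g` on `(a, b) × (0, T]` which vanishes
outside `[a, b]` (homogeneous exterior Dirichlet condition). The first argument of `u` and `g` is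
the space variable, the second one is time. -/
structure IsExactSolution (a b T ε α : ℝ) (g u : ℝ → ℝ → ℝ) : Prop where
  exterior : ∀ t ∈ Icc 0 T, ∀ x ∉ Icc a b, u x t = 0
  equation : ∀ t ∈ Ioc 0 T, ∀ x ∈ Ioo a b,
    HasDerivWithinAt (fun s => u x s)
      (ε * negFracLaplacian α (fun y => u y t) x + g x t) (Icc 0 T) t

/-- `u` is of class `C^m` on `ℝ × [0, T]`, jointly in space and time. -/
def IsSmooth (m : ℕ) (T : ℝ) (u : ℝ → ℝ → ℝ) : Prop :=
  ContDiffOn ℝ m (fun z : ℝ × ℝ => u z.1 z.2) (univ ×ˢ Icc 0 T)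

/-! ### Meshes and piecewise polynomials -/

/-- A partition `a = x_0 < x_1 < ⋯ < x_K = b`; the cells are `I_i = [x_i, x_{i+1}]`, `i < K`. -/
structure Mesh (a b : ℝ) where
  K : ℕ
  node : Fin (K + 1) → ℝ
  strictMono : StrictMono node
  first : node 0 = a
  last : node (Fin.last K) = b

namespace Mesh

variable {a b : ℝ}

/-- The left end point of the cell `I_i`. -/
def left (M : Mesh a b) (i : Fin M.K) : ℝ := M.node i.castSucc

/-- The right end point of the cell `I_i`. -/
def right (M : Mesh a b) (i : Fin M.K) : ℝ := M.node i.succ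

/-- The length of the cell `I_i`. -/
def width (M : Mesh a b) (i : Fin M.K) : ℝ := M.right i - M.left i

/-- The mesh size `h`, the maximal length of a cell. -/
def size (M : Mesh a b) : ℝ := ⨆ i, M.width i

/-- Quasi-uniformity with ratio `σ`. -/
def IsQuasiUniform (M : Mesh a b) (σ : ℝ) : Prop := ∀ i, M.size ≤ σ * M.width i

/-- The space `V_h`: one polynomial of degree at most `k` on every cell. -/
abbrev Space (M : Mesh a b) (k : ℕ) : Type := Fin M.K → Polynomial.degreeLE ℝ (k : WithBot ℕ)

end Mesh

variable {a b : ℝ} {M : Mesh a b} {k : ℕ}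

/-- The value at `x` of the polynomial of `v` on the cell `I_i`. -/
def cellVal (v : M.Space k) (i : Fin M.K) (x : ℝ) : ℝ := (v i : ℝ[X]).eval x

/-- The value at `x` of the derivative of the polynomial of `v` on the cell `I_i`. -/
def cellDer (v : M.Space k) (i : Fin M.K) (x : ℝ) : ℝ := (v i : ℝ[X]).derivative.eval x

/-- The piecewise polynomial as a function on the line, equal to zero outside of `(a, b]`.
At a node it takes the value from the left; nodes are a null set. -/
def toFun (v : M.Space k) (x : ℝ) : ℝ :=
  ∑ i, (Ioc (M.left i) (M.right i)).indicator (cellVal v i) x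

/-- The limit `v^-` from the left at the node `x_j`; at `x_0 = a` it is the exterior value `0`. -/
def traceMinus (v : M.Space k) (j : Fin (M.K + 1)) : ℝ :=
  if hj : j ≠ 0 then cellVal v (j.pred hj) (M.node j) else 0

/-- The limit `v^+` from the right at the node `x_j`; at `x_K = b` it is the exterior value `0`. -/
def tracePlus (v : M.Space k) (j : Fin (M.K + 1)) : ℝ :=
  if hj : j ≠ Fin.last M.K then cellVal v (j.castPred hj) (M.node j) else 0

/-- The jump `v^+ - v^-` at the node `x_j`. -/
def jump (v : M.Space k) (j : Fin (M.K + 1)) : ℝ := tracePlus v j - traceMinus v j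

/-! ### The scheme -/

/-- The two choices of the alternating fluxes: `u^-` with `q^+`, or `u^+` with `q^-`. -/
inductive FluxChoice
  | minusPlus
  | plusMinus

/-- The numerical flux of `u` at the node `x_j`. On the boundary of `[a, b]` it is the boundary
value `0` of the exact solution. -/
def fluxU (c : FluxChoice) (u : M.Space k) (j : Fin (M.K + 1)) : ℝ :=
  if j = 0 ∨ j = Fin.last M.K then 0
  else match c with
    | .minusPlus => traceMinus u j
    | .plusMinus => tracePlus u j

/-- The numerical flux of `q` at the node `x_j`, with the penalty `β / h` times the jump of `u`
at `b` (for `minusPlus`) or at `a` (for `plusMinus`). -/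
def fluxQ (c : FluxChoice) (β : ℝ) (u q : M.Space k) (j : Fin (M.K + 1)) : ℝ :=
  match c with
  | .minusPlus =>
      if j = Fin.last M.K then traceMinus q j + β / M.size * jump u j else tracePlus q j
  | .plusMinus =>
      if j = 0 then tracePlus q j + β / M.size * jump u j else traceMinus q j

/-- `F̂ v` at the right end point minus `F̂ v` at the left end point of the cell `I_i`, where `v` is
evaluated from inside the cell. -/
def bdry (F : Fin (M.K + 1) → ℝ) (v : M.Space k) (i : Fin M.K) : ℝ :=
  F i.succ * cellVal v i (M.right i) - F i.castSucc * cellVal v i (M.left i)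

/-- `(u_h, p_h, q_h)` solves the semi-discrete local discontinuous Galerkin scheme on `[0, T]` with
the source term `g` and the initial value `u₀`. -/
structure IsLDGSolution (c : FluxChoice) (T ε α β : ℝ) (g : ℝ → ℝ → ℝ) (u₀ : ℝ → ℝ)
    (uh ph qh : ℝ → M.Space k) : Prop where
  continuous : ∀ i x, ContinuousOn (fun s => cellVal (uh s) i x) (Icc 0 T)
  differentiable : ∀ i x, ∀ t ∈ Ioc 0 T,
    DifferentiableWithinAt ℝ (fun s => cellVal (uh s) i x) (Icc 0 T) t
  evolution : ∀ t ∈ Ioc 0 T, ∀ (v : M.Space k) (i : Fin M.K),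
    (∫ x in M.left i..M.right i,
        derivWithin (fun s => cellVal (uh s) i x) (Icc 0 T) t * cellVal v i x)
      - √ε * bdry (fluxQ c β (uh t) (qh t)) v i
      + √ε * (∫ x in M.left i..M.right i, cellVal (qh t) i x * cellDer v i x)
    = ∫ x in M.left i..M.right i, g x t * cellVal v i x
  flux : ∀ t ∈ Ioc 0 T, ∀ (w : M.Space k) (i : Fin M.K),
    (∫ x in M.left i..M.right i, cellVal (qh t) i x * cellVal w i x)
      - (∫ x in M.left i..M.right i,
          fracLaplacianInt (2 - α) (toFun (ph t)) x * cellVal w i x) = 0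
  gradient : ∀ t ∈ Ioc 0 T, ∀ (z : M.Space k) (i : Fin M.K),
    (∫ x in M.left i..M.right i, cellVal (ph t) i x * cellVal z i x)
      - √ε * bdry (fluxU c (uh t)) z i
      + √ε * (∫ x in M.left i..M.right i, cellVal (uh t) i x * cellDer z i x) = 0
  initial : ∀ (v : M.Space k) (i : Fin M.K),
    (∫ x in M.left i..M.right i, cellVal (uh 0) i x * cellVal v i x)
      - (∫ x in M.left i..M.right i, u₀ x * cellVal v i x) = 0

/-- The norm of `w` in `L²(a, b)`. -/
def normL2 (a b : ℝ) (w : ℝ → ℝ) : ℝ := √(∫ x in a..b, w x ^ 2)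

end

end LDG

namespace LDG
open MeasureTheory

/-! ### Cauchy-Schwarz and Schur tests -/

/-! Put `s = 2 - α`, let `I` be the Riesz potential `rieszInt s`, `D` the discrete gradient
`dgGrad`, `Π` the `L²` projection onto piecewise polynomials, and `A(v, w) = (I v, w)` the form
`rieszForm`.

Eliminating `p_h` and `q_h`, and using that alternating fluxes make the two discrete gradients
adjoint up to the penalty (`formQ_add_formU`), the scheme becomes `(u_h', v) + γ A(D u_h, D v) +
penalty = (g, v)` with `A` nonnegative. Let `P` be the Gauss-Radau projection of `u`, exact at the
end points from which the flux of `u` is taken; then `D P = Π u_x` (`IsRadau.dgGrad`). Let `Q` be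
the Gauss-Radau projection of `I u_x` with the opposite end points; the flux of `q` is then exact
except at the penalized end (`IsRadau.exists_flux`), and this defect is absorbed by the penalty.
There remains the residual `R = Π I Π u_x - Q`, of size `h^(k+1)` in `L²`, tested with a discrete
gradient. The form `A` controls gradients only in a negative norm, so a direct estimate would lose a
power of `h`.

The loss is avoided by a corrector `δ` with `A(D δ, D v) = (R, D v)` for all `v`. The function `P -
δ - u_h` satisfies an energy identity from which `R` has disappeared (`error_identity`), and
Gronwall's inequality finishes, provided that `‖δ‖ ≤ C ‖R‖` uniformly in the mesh; by linearity the
same bound applies to the time derivatives.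

This bound is `exists_corrector`, the heart of the proof. The function `ψ = D δ` has mean zero and
solves `Π I ψ = R + const`, and `δ` is the Gauss-Radau projection of the primitive of `ψ`.
Coercivity of `A` on piecewise polynomials (`exists_rieszForm_ge`) gives `h^s ‖ψ‖ ≤ C ‖R‖`, and the
projection error of `I ψ` is at most `C h^s ‖ψ‖`; hence `I ψ` is within `C ‖R‖` of a constant. It
remains to bound the primitive of a mean-zero `ψ` by the distance in `L²(a, b)` of `I ψ` from the
constants (`exists_integral_sq_primitive_le`), an estimate without any mesh.

That estimate has two halves. An Abel transform of `I ψ`, paired with the primitive in the weight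
`x^(2s-2)`, is exactly a positive multiple of the weighted square norm of the primitive
(`abel_form_eq`), and the Abel transform is bounded by a Hardy inequality. The constant is removed
with the equilibrium density, whose potential is constant on the interval: it annihilates potentials
of mean-zero functions (`integral_equil_rieszInt`). -/

theorem sq_integral_mul_le {X : Type*} [MeasurableSpace X] {μ : Measure X} {f g : X → ℝ}
    (hf : Integrable (fun x => f x ^ 2) μ) (hg : Integrable (fun x => g x ^ 2) μ)
    (hfg : Integrable (fun x => f x * g x) μ) :
    (∫ x, f x * g x ∂μ) ^ 2 ≤ (∫ x, f x ^ 2 ∂μ) * ∫ x, g x ^ 2 ∂μ := by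
  have key : ∀ t : ℝ, 0 ≤ (∫ x, g x ^ 2 ∂μ) * (t * t) + (2 * ∫ x, f x * g x ∂μ) * t
      + ∫ x, f x ^ 2 ∂μ := by
    intro t
    have h : ∫ x, (f x + t * g x) ^ 2 ∂μ
        = (∫ x, g x ^ 2 ∂μ) * (t * t) + (2 * ∫ x, f x * g x ∂μ) * t + ∫ x, f x ^ 2 ∂μ := by
      have : ∀ x, (f x + t * g x) ^ 2 = (t * t) * g x ^ 2 + (2 * t) * (f x * g x) + f x ^ 2 :=
        fun x => by ring
      simp_rw [this]
      rw [integral_add _ hf, integral_add (hg.const_mul _) (hfg.const_mul _),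
        integral_const_mul, integral_const_mul]
      · ring
      · exact (hg.const_mul _).add (hfg.const_mul _)
    rw [← h]
    exact integral_nonneg fun x => sq_nonneg _
  have := discrim_le_zero key
  unfold discrim at this
  nlinarith

/-- Cauchy-Schwarz for `K f = (K χ)^(1/2) (K χ⁻¹ f²)^(1/2)` uses the row bound; Tonelli and the
column bound finish. Working in `ENNReal` postpones all questions of integrability. -/
theorem lintegral_sq_le_of_schur {X Y : Type*} [MeasurableSpace X] [MeasurableSpace Y]
    {μ : Measure X} {ν : Measure Y} [SFinite μ] [SFinite ν] {K : X → Y → ENNReal}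
    (hK : Measurable (Function.uncurry K)) {φ : X → ENNReal} {χ : Y → ENNReal}
    (hφ : Measurable φ) (hχ : Measurable χ) (hχ0 : ∀ y, χ y ≠ 0) (hχt : ∀ y, χ y ≠ ⊤)
    {C : ENNReal}
    (h1 : ∀ᵐ x ∂μ, ∫⁻ y, K x y * χ y ∂ν ≤ C * φ x)
    (h2 : ∀ᵐ y ∂ν, ∫⁻ x, K x y * φ x ∂μ ≤ C * χ y) {f : Y → ENNReal} (hf : Measurable f) :
    ∫⁻ x, (∫⁻ y, K x y * f y ∂ν) ^ 2 ∂μ ≤ C ^ 2 * ∫⁻ y, f y ^ 2 ∂ν := by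
  have hKx : ∀ x, Measurable (K x) := fun x => hK.of_uncurry_left
  have hM : ∀ x, Measurable fun y => K x y * ((χ y)⁻¹ * f y ^ 2) := fun x =>
    (hKx x).mul (hχ.inv.mul (hf.pow_const 2))
  have cs : ∀ x, (∫⁻ y, K x y * f y ∂ν) ^ 2
      ≤ (∫⁻ y, K x y * χ y ∂ν) * ∫⁻ y, K x y * ((χ y)⁻¹ * f y ^ 2) ∂ν := by
    intro x
    have hold := ENNReal.lintegral_mul_le_Lp_mul_Lq ν (p := 2) (q := 2)
      ⟨by norm_num, by norm_num, by norm_num⟩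
      (f := fun y => (K x y * χ y) ^ (1 / 2 : ℝ))
      (g := fun y => (K x y * ((χ y)⁻¹ * f y ^ 2)) ^ (1 / 2 : ℝ))
      (((hKx x).mul hχ).pow_const _).aemeasurable
      ((hM x).pow_const _).aemeasurable
    have e0 : ∀ z : ENNReal, (z ^ (1 / 2 : ℝ)) ^ (2 : ℝ) = z := fun z => by
      rw [← ENNReal.rpow_mul]; norm_num
    have e1 : ∀ y, ((fun y => (K x y * χ y) ^ (1 / 2 : ℝ)) *
        fun y => (K x y * ((χ y)⁻¹ * f y ^ 2)) ^ (1 / 2 : ℝ)) y = K x y * f y := by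
      intro y
      simp only [Pi.mul_apply]
      rw [← ENNReal.mul_rpow_of_nonneg _ _ (by norm_num)]
      have : K x y * χ y * (K x y * ((χ y)⁻¹ * f y ^ 2)) = (K x y * f y) ^ (2 : ℝ) := by
        rw [show (2 : ℝ) = ((2 : ℕ) : ℝ) by norm_num, ENNReal.rpow_natCast]
        calc _ = (χ y * (χ y)⁻¹) * (K x y * f y) ^ 2 := by ring
          _ = _ := by rw [ENNReal.mul_inv_cancel (hχ0 y) (hχt y), one_mul]
      rw [this, ← ENNReal.rpow_mul]; norm_num
    simp only [e0] at hold
    rw [lintegral_congr e1] at hold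
    calc _ ≤ _ := pow_le_pow_left' hold 2
      _ = _ := by
        rw [mul_pow, ← ENNReal.rpow_natCast, ← ENNReal.rpow_natCast, ← ENNReal.rpow_mul,
          ← ENNReal.rpow_mul]
        norm_num
  calc ∫⁻ x, (∫⁻ y, K x y * f y ∂ν) ^ 2 ∂μ
      ≤ ∫⁻ x, (C * φ x) * ∫⁻ y, K x y * ((χ y)⁻¹ * f y ^ 2) ∂ν ∂μ := by
        apply lintegral_mono_ae
        filter_upwards [h1] with x hx
        exact (cs x).trans (mul_le_mul' hx le_rfl)
    _ = C * ∫⁻ x, ∫⁻ y, K x y * φ x * ((χ y)⁻¹ * f y ^ 2) ∂ν ∂μ := by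
        have : ∀ x, (C * φ x) * ∫⁻ y, K x y * ((χ y)⁻¹ * f y ^ 2) ∂ν
            = C * ∫⁻ y, K x y * φ x * ((χ y)⁻¹ * f y ^ 2) ∂ν := by
          intro x
          rw [mul_assoc, ← lintegral_const_mul _ (hM x)]
          congr 1
          exact lintegral_congr fun y => by ring
        simp_rw [this]
        rw [lintegral_const_mul]
        refine Measurable.lintegral_prod_right' (f := fun z : X × Y =>
          K z.1 z.2 * φ z.1 * ((χ z.2)⁻¹ * f z.2 ^ 2)) ?_
        exact (hK.mul (hφ.comp measurable_fst)).mul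
          ((hχ.comp measurable_snd).inv.mul ((hf.comp measurable_snd).pow_const 2))
    _ = C * ∫⁻ y, ∫⁻ x, K x y * φ x * ((χ y)⁻¹ * f y ^ 2) ∂μ ∂ν := by
        rw [lintegral_lintegral_swap]
        exact ((hK.mul (hφ.comp measurable_fst)).mul
          ((hχ.comp measurable_snd).inv.mul ((hf.comp measurable_snd).pow_const 2))).aemeasurable
    _ ≤ C * ∫⁻ y, C * f y ^ 2 ∂ν := by
        refine mul_le_mul' le_rfl (lintegral_mono_ae ?_)
        filter_upwards [h2] with y hy
        have hm : Measurable fun x => K x y * φ x := (hK.of_uncurry_right).mul hφ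
        rw [lintegral_mul_const _ hm]
        calc _ ≤ C * χ y * ((χ y)⁻¹ * f y ^ 2) := mul_le_mul' hy le_rfl
          _ = (χ y * (χ y)⁻¹) * (C * f y ^ 2) := by ring
          _ = _ := by rw [ENNReal.mul_inv_cancel (hχ0 y) (hχt y), one_mul]
    _ = _ := by rw [lintegral_const_mul _ (hf.pow_const 2)]; ring

/-- Schur's test for real integrands. -/
theorem integral_sq_le_of_schur {X Y : Type*} [MeasurableSpace X] [MeasurableSpace Y]
    {μ : Measure X} {ν : Measure Y} [SFinite μ] [SFinite ν] {K : X → Y → ℝ}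
    (hK : Measurable (Function.uncurry K)) {φ : X → ℝ} {χ : Y → ℝ}
    (hφ : Measurable φ) (hχ : Measurable χ) (hχ0 : ∀ y, 0 < χ y) {C : ℝ} (hC : 0 ≤ C)
    (h1 : ∀ᵐ x ∂μ, ∫⁻ y, ENNReal.ofReal |K x y| * ENNReal.ofReal (χ y) ∂ν
      ≤ ENNReal.ofReal C * ENNReal.ofReal (φ x))
    (h2 : ∀ᵐ y ∂ν, ∫⁻ x, ENNReal.ofReal |K x y| * ENNReal.ofReal (φ x) ∂μ
      ≤ ENNReal.ofReal C * ENNReal.ofReal (χ y)) {f : Y → ℝ} (hf : Measurable f)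
    (hfi : Integrable (fun y => f y ^ 2) ν) {g : X → ℝ}
    (hg : AEStronglyMeasurable g μ) (hgK : ∀ᵐ x ∂μ, g x = ∫ y, K x y * f y ∂ν) :
    Integrable (fun x => g x ^ 2) μ ∧ ∫ x, g x ^ 2 ∂μ ≤ C ^ 2 * ∫ y, f y ^ 2 ∂ν := by
  have hKm : Measurable (Function.uncurry fun x y => ENNReal.ofReal |K x y|) :=
    (hK.norm).ennreal_ofReal
  have main := lintegral_sq_le_of_schur (μ := μ) (ν := ν) hKm
    hφ.ennreal_ofReal hχ.ennreal_ofReal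
    (fun y => by simpa using hχ0 y) (fun y => ENNReal.ofReal_ne_top) h1 h2
    (hf.norm.ennreal_ofReal)
  have hsq : ∀ z : ℝ, ENNReal.ofReal ‖z‖ ^ 2 = ENNReal.ofReal (z ^ 2) := fun z => by
    rw [← ENNReal.ofReal_pow (norm_nonneg _), Real.norm_eq_abs, sq_abs]
  have hle : ∫⁻ x, ENNReal.ofReal (g x ^ 2) ∂μ
      ≤ ENNReal.ofReal (C ^ 2 * ∫ y, f y ^ 2 ∂ν) := by
    calc ∫⁻ x, ENNReal.ofReal (g x ^ 2) ∂μ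
        ≤ ∫⁻ x, (∫⁻ y, ENNReal.ofReal |K x y| * ENNReal.ofReal ‖f y‖ ∂ν) ^ 2 ∂μ := by
          apply lintegral_mono_ae
          filter_upwards [hgK] with x hx
          rw [← hsq, hx]
          refine pow_le_pow_left' ?_ 2
          rw [ofReal_norm]
          refine (enorm_integral_le_lintegral_enorm _).trans (le_of_eq ?_)
          refine lintegral_congr fun y => ?_
          rw [← ofReal_norm, norm_mul, ENNReal.ofReal_mul (norm_nonneg _)]
          rfl
      _ ≤ _ := main
      _ = _ := by
          rw [ENNReal.ofReal_mul (by positivity), ENNReal.ofReal_pow hC]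
          simp_rw [hsq]
          rw [ofReal_integral_eq_lintegral_ofReal hfi (Filter.Eventually.of_forall
            fun y => sq_nonneg _)]
  have hint : Integrable (fun x => g x ^ 2) μ := by
    refine ⟨hg.pow 2, ?_⟩
    rw [hasFiniteIntegral_iff_ofReal (Filter.Eventually.of_forall fun y => sq_nonneg _)]
    exact hle.trans_lt ENNReal.ofReal_lt_top
  refine ⟨hint, ?_⟩
  rw [← ofReal_integral_eq_lintegral_ofReal hint (Filter.Eventually.of_forall
    fun y => sq_nonneg _)] at hle
  exact (ENNReal.ofReal_le_ofReal_iff (mul_nonneg (sq_nonneg _)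
    (integral_nonneg fun y => sq_nonneg _))).1 hle

/-! ### The Riesz kernel -/

/-- Bounded measurable functions which vanish outside of `[a, b]`. -/
structure BddSupp (a b : ℝ) (f : ℝ → ℝ) : Prop where
  meas : Measurable f
  bdd : ∃ B, ∀ x, |f x| ≤ B
  supp : ∀ x ∉ Icc a b, f x = 0

/-- The unnormalized Riesz potential of order `s`. -/
noncomputable def rieszInt (s : ℝ) (f : ℝ → ℝ) (x : ℝ) : ℝ := ∫ y, |x - y| ^ (s - 1) * f y

theorem BddSupp.exists_bound {a b : ℝ} {f : ℝ → ℝ} (hf : BddSupp a b f) :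
    ∃ B > 0, ∀ x, |f x| ≤ B := by
  obtain ⟨B, hB⟩ := hf.bdd
  exact ⟨|B| + 1, by positivity, fun x => (hB x).trans ((le_abs_self B).trans (by linarith))⟩

theorem BddSupp.integrable_mul {a b : ℝ} {f k : ℝ → ℝ} (hf : BddSupp a b f)
    (hk : IntegrableOn k (Icc a b)) : Integrable (fun y => k y * f y) := by
  obtain ⟨B, -, hB⟩ := hf.exists_bound
  have h1 : IntegrableOn (fun y => k y * f y) (Icc a b) :=
    hk.mul_bdd (c := B) hf.meas.aestronglyMeasurable
      (Filter.Eventually.of_forall fun x => by simpa using hB x)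
  rw [integrableOn_iff_integrable_of_support_subset] at h1
  · exact h1
  · intro x hx
    by_contra h
    exact hx (by simp [hf.supp x h])

theorem BddSupp.integrable {a b : ℝ} {f : ℝ → ℝ} (hf : BddSupp a b f) : Integrable f := by
  have := hf.integrable_mul (k := fun _ => 1) (by simp)
  simpa using this

theorem BddSupp.sq {a b : ℝ} {f : ℝ → ℝ} (hf : BddSupp a b f) :
    BddSupp a b (fun x => f x ^ 2) := by
  obtain ⟨B, hB0, hB⟩ := hf.exists_bound
  refine ⟨hf.meas.pow_const 2, ⟨B ^ 2, fun x => ?_⟩, fun x hx => by simp [hf.supp x hx]⟩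
  rw [abs_pow]
  exact pow_le_pow_left₀ (abs_nonneg _) (hB x) 2

theorem BddSupp.integral_eq {a b : ℝ} {f : ℝ → ℝ} (hf : BddSupp a b f) (k : ℝ → ℝ) :
    ∫ y, k y * f y = ∫ y in Icc a b, k y * f y := by
  rw [setIntegral_eq_integral_of_forall_compl_eq_zero]
  intro x hx
  simp [hf.supp x hx]

theorem locallyIntegrable_abs_rpow {s : ℝ} (hs : 0 < s) :
    LocallyIntegrable (fun y : ℝ => |y| ^ (s - 1)) := by
  have h : ∀ R : ℝ, 0 < R → IntegrableOn (fun y : ℝ => |y| ^ (s - 1)) (Icc (-R) R) := by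
    intro R hR
    have h0 : IntegrableOn (fun y : ℝ => |y| ^ (s - 1)) (Ioc 0 R) := by
      have := (intervalIntegral.intervalIntegrable_rpow' (a := 0) (b := R)
        (show -1 < s - 1 by linarith)).1
      refine this.congr_fun (fun y hy => ?_) measurableSet_Ioc
      simp [abs_of_pos hy.1]
    have h1 : IntegrableOn (fun y : ℝ => |y| ^ (s - 1)) (Ico (-R) 0) := by
      have := h0.comp_neg
      have e : -(Ioc 0 R) = Ico (-R) 0 := by simp
      rw [e] at this
      simpa using this
    have h2 : IntegrableOn (fun y : ℝ => |y| ^ (s - 1)) ({0} : Set ℝ) := by simp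
    refine ((h0.union h1).union h2).mono_set fun y hy => ?_
    rcases lt_trichotomy y 0 with h | h | h
    · exact Or.inl (Or.inr ⟨hy.1, h⟩)
    · exact Or.inr h
    · exact Or.inl (Or.inl ⟨h, hy.2⟩)
  intro x
  refine ⟨Icc (-(|x| + 1)) (|x| + 1), Icc_mem_nhds ?_ ?_, h _ (by positivity)⟩
  · linarith [neg_abs_le x]
  · linarith [le_abs_self x]

theorem integrableOn_abs_sub_rpow {s : ℝ} (hs : 0 < s) (x a b : ℝ) :
    IntegrableOn (fun y : ℝ => |x - y| ^ (s - 1)) (Icc a b) := by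
  have h := (locallyIntegrable_abs_rpow hs).integrableOn_isCompact
    (isCompact_Icc (a := x - b) (b := x - a))
  have hp : MeasurePreserving (fun y : ℝ => x - y) volume volume :=
    Measure.measurePreserving_sub_left volume x
  rw [← hp.integrableOn_comp_preimage (MeasurableEquiv.subLeft x).measurableEmbedding] at h
  have e : (fun y => x - y) ⁻¹' (Icc (x - b) (x - a)) = Icc a b := by
    ext y; simp
  rwa [e] at h

theorem measurable_abs_sub_rpow (s : ℝ) :
    Measurable (fun z : ℝ × ℝ => |z.1 - z.2| ^ (s - 1)) :=
  ((measurable_fst.sub measurable_snd).norm).pow_const _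

theorem integral_sub_rpow {s : ℝ} (hs : 0 < s) {x a : ℝ} :
    ∫ y in a..x, (x - y) ^ (s - 1) = (x - a) ^ s / s := by
  rw [intervalIntegral.integral_comp_sub_left (fun y => y ^ (s - 1)) x,
    integral_rpow (Or.inl (by linarith)), sub_self, sub_add_cancel, Real.zero_rpow hs.ne', sub_zero]

theorem integral_rpow_sub {s : ℝ} (hs : 0 < s) {x b : ℝ} :
    ∫ y in x..b, (y - x) ^ (s - 1) = (b - x) ^ s / s := by
  rw [intervalIntegral.integral_comp_sub_right (fun y => y ^ (s - 1)) x,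
    integral_rpow (Or.inl (by linarith)), sub_self, sub_add_cancel, Real.zero_rpow hs.ne', sub_zero]

theorem integral_abs_sub_rpow {s : ℝ} (hs : 0 < s) {x a b : ℝ} (hx : x ∈ Icc a b) :
    ∫ y in a..b, |x - y| ^ (s - 1) = ((x - a) ^ s + (b - x) ^ s) / s := by
  have hi : ∀ c d, IntervalIntegrable (fun y : ℝ => |x - y| ^ (s - 1)) volume c d := fun c d =>
    (integrableOn_abs_sub_rpow hs x _ _).intervalIntegrable
  rw [← intervalIntegral.integral_add_adjacent_intervals (hi a x) (hi x b), add_div,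
    ← integral_sub_rpow hs, ← integral_rpow_sub hs]
  congr 1
  · refine intervalIntegral.integral_congr fun y hy => ?_
    rw [uIcc_of_le hx.1] at hy
    rw [abs_of_nonneg (by linarith [hy.2])]
  · refine intervalIntegral.integral_congr fun y hy => ?_
    rw [uIcc_of_le hx.2] at hy
    rw [abs_sub_comm, abs_of_nonneg (by linarith [hy.1])]

theorem integral_abs_sub_rpow_le {s : ℝ} (hs : 0 < s) {x a b : ℝ} (hx : x ∈ Icc a b) :
    ∫ y in Icc a b, |x - y| ^ (s - 1) ≤ 2 * (b - a) ^ s / s := by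
  rw [integral_Icc_eq_integral_Ioc, ← intervalIntegral.integral_of_le (hx.1.trans hx.2),
    integral_abs_sub_rpow hs hx]
  have h1 : (x - a) ^ s ≤ (b - a) ^ s :=
    Real.rpow_le_rpow (by linarith [hx.1]) (by linarith [hx.2]) hs.le
  have h2 : (b - x) ^ s ≤ (b - a) ^ s :=
    Real.rpow_le_rpow (by linarith [hx.2]) (by linarith [hx.1]) hs.le
  gcongr
  linarith

theorem abs_rieszInt_le {s : ℝ} (hs : 0 < s) {a b B : ℝ} {f : ℝ → ℝ} (hf : BddSupp a b f)
    (hB : ∀ x, |f x| ≤ B) {x : ℝ} (hx : x ∈ Icc a b) :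
    |rieszInt s f x| ≤ 2 * (b - a) ^ s / s * B := by
  have hB0 : 0 ≤ B := (abs_nonneg _).trans (hB 0)
  rw [rieszInt, hf.integral_eq]
  calc |∫ y in Icc a b, |x - y| ^ (s - 1) * f y|
      ≤ ∫ y in Icc a b, |x - y| ^ (s - 1) * B := by
        rw [← Real.norm_eq_abs]
        refine norm_integral_le_of_norm_le ((integrableOn_abs_sub_rpow hs x a b).mul_const B)
          (Filter.Eventually.of_forall fun y => ?_)
        rw [norm_mul, Real.norm_of_nonneg (by positivity), Real.norm_eq_abs]
        exact mul_le_mul_of_nonneg_left (hB y) (by positivity)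
    _ ≤ _ := by
        rw [integral_mul_const]
        exact mul_le_mul_of_nonneg_right (integral_abs_sub_rpow_le hs hx) hB0

theorem measurable_rieszInt (s : ℝ) {f : ℝ → ℝ} (hf : Measurable f) :
    Measurable (rieszInt s f) := by
  have : StronglyMeasurable (Function.uncurry fun x y : ℝ => |x - y| ^ (s - 1) * f y) :=
    ((measurable_abs_sub_rpow s).mul (hf.comp measurable_snd)).stronglyMeasurable
  exact (StronglyMeasurable.integral_prod_right (E := ℝ) (ν := (volume : Measure ℝ)) this).measurable

end LDG

namespace LDG
open MeasureTheory

/-! ### A coercivity identity for the Riesz potential on an interval -/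

/-- The substitution is `τ = (x - t) / (y - t)`. It turns `y - t` into `(y - x) / (1 - τ)` and `x -
t` into `τ` times this, so products of powers of the two distances become functions of `τ` alone, up
to powers of `y - x`. -/
theorem setIntegral_Ioo_moebius {x y : ℝ} (hx : 0 < x) (hxy : x < y) (f : ℝ → ℝ) :
    ∫ t in Ioo 0 x, f t
      = ∫ τ in Ioo 0 (x / y), (y - x) / (1 - τ) ^ 2 * f ((x - τ * y) / (1 - τ)) := by
  have hy : 0 < y := hx.trans hxy
  have h1 : ∀ τ ∈ Ioo 0 (x / y), τ < 1 := fun τ hτ => hτ.2.trans ((div_lt_one hy).2 hxy)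
  have himg : (fun τ => (x - τ * y) / (1 - τ)) '' Ioo 0 (x / y) = Ioo 0 x := by
    ext t
    constructor
    · rintro ⟨τ, hτ, rfl⟩
      have h3 : τ * y < x := (lt_div_iff₀ hy).1 hτ.2
      have h4 := h1 τ hτ
      refine ⟨div_pos (by linarith) (by linarith), ?_⟩
      rw [div_lt_iff₀ (by linarith)]
      nlinarith [hτ.1]
    · rintro ⟨ht0, ht1⟩
      have h5 : 0 < y - t := by linarith
      have h6 : y - x ≠ 0 := by linarith
      have h7 : y - t - (x - t) ≠ 0 := by linarith
      refine ⟨(x - t) / (y - t), ⟨div_pos (by linarith) h5, ?_⟩, ?_⟩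
      · rw [div_lt_div_iff₀ h5 hy]
        nlinarith
      · have h8 : 1 - (x - t) / (y - t) = (y - x) / (y - t) := by field_simp; ring
        simp only [h8]
        field_simp
        ring
  rw [← himg, integral_image_eq_integral_abs_deriv_smul measurableSet_Ioo
    (f' := fun τ => -((y - x) / (1 - τ) ^ 2))]
  · refine setIntegral_congr_fun measurableSet_Ioo fun τ hτ => ?_
    have h4 := h1 τ hτ
    simp only [smul_eq_mul]
    rw [abs_neg, abs_of_pos (div_pos (by linarith) (by nlinarith))]
  · intro τ hτ
    have h4 := h1 τ hτ
    have h9 : (1 - τ) ≠ 0 := by linarith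
    have h10 : HasDerivAt (fun τ => x - τ * y) (-(1 * y)) τ :=
      ((hasDerivAt_id' τ).mul_const y).const_sub x
    have h11 : HasDerivAt (fun τ => 1 - τ) (-1 : ℝ) τ := (hasDerivAt_id' τ).const_sub 1
    refine ((h10.div h11 h9).congr_deriv ?_).hasDerivWithinAt
    rw [← neg_div]
    congr 1
    ring
  · intro τ hτ τ' hτ' h
    have h4 := h1 τ hτ
    have h4' := h1 τ' hτ'
    simp only at h
    rw [div_eq_div_iff (by linarith) (by linarith)] at h
    have : (τ - τ') * (y - x) = 0 := by linarith
    rcases mul_eq_zero.1 this with h | h <;> linarith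

/-- The exponents `-s` and `s - 1` add up to `-1`, so the powers of `(x - y) / (1 - τ)` cancel
against the Jacobian up to one factor `1 / (1 - τ)`. Only the upper limit `y / x` remembers the two
points. -/
theorem setIntegral_rpow_mul_rpow_left {s x y : ℝ} (hy : 0 < y) (hyx : y < x) :
    ∫ t in Ioo 0 y, (x - t) ^ (-s) * (y - t) ^ (s - 1)
      = ∫ τ in Ioo 0 (y / x), τ ^ (s - 1) / (1 - τ) := by
  have hx : 0 < x := hy.trans hyx
  rw [setIntegral_Ioo_moebius hy hyx]
  refine setIntegral_congr_fun measurableSet_Ioo fun τ hτ => ?_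
  have h1 : τ < 1 := hτ.2.trans ((div_lt_one hx).2 hyx)
  have h2 : 0 < 1 - τ := by linarith
  have h3 : 0 < (x - y) / (1 - τ) := div_pos (by linarith) h2
  have e1 : x - (y - τ * x) / (1 - τ) = (x - y) / (1 - τ) := by field_simp; ring
  have e2 : y - (y - τ * x) / (1 - τ) = τ * ((x - y) / (1 - τ)) := by field_simp; ring
  simp only [e1, e2]
  rw [Real.mul_rpow hτ.1.le h3.le, mul_left_comm ((_ : ℝ) ^ (-s)), ← Real.rpow_add h3,
    show -s + (s - 1) = -1 by ring, Real.rpow_neg_one]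
  have h4 : x - y ≠ 0 := by linarith
  field_simp

theorem setIntegral_rpow_mul_rpow_right {s x y : ℝ} (hx : 0 < x) (hxy : x < y) :
    ∫ t in Ioo 0 x, (x - t) ^ (-s) * (y - t) ^ (s - 1)
      = ∫ τ in Ioo 0 (x / y), τ ^ (-s) / (1 - τ) := by
  have hy : 0 < y := hx.trans hxy
  rw [setIntegral_Ioo_moebius hx hxy]
  refine setIntegral_congr_fun measurableSet_Ioo fun τ hτ => ?_
  have h1 : τ < 1 := hτ.2.trans ((div_lt_one hy).2 hxy)
  have h2 : 0 < 1 - τ := by linarith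
  have h3 : 0 < (y - x) / (1 - τ) := div_pos (by linarith) h2
  have e1 : y - (x - τ * y) / (1 - τ) = (y - x) / (1 - τ) := by field_simp; ring
  have e2 : x - (x - τ * y) / (1 - τ) = τ * ((y - x) / (1 - τ)) := by field_simp; ring
  simp only [e1, e2]
  rw [Real.mul_rpow hτ.1.le h3.le, mul_assoc ((_ : ℝ) ^ (-s)), ← Real.rpow_add h3,
    show -s + (s - 1) = -1 by ring, Real.rpow_neg_one]
  have h4 : y - x ≠ 0 := by linarith
  field_simp

/-- The constant `B(1 - s, s)`. -/
noncomputable def betaConst (s : ℝ) : ℝ := ∫ τ in Ioo (0 : ℝ) 1, τ ^ (-s) * (1 - τ) ^ (s - 1)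

theorem setIntegral_Ioo_affine {c d : ℝ} (hd : d ≠ 0) (f : ℝ → ℝ) {S : Set ℝ}
    (hS : MeasurableSet S) :
    ∫ t in (fun τ => c + d * τ) '' S, f t = ∫ τ in S, |d| * f (c + d * τ) := by
  rw [integral_image_eq_integral_abs_deriv_smul hS (f' := fun _ => d)]
  · simp
  · intro τ _
    have := ((hasDerivAt_id τ).const_mul d).const_add c
    simpa using this.hasDerivWithinAt
  · intro τ _ τ' _ h
    simpa [hd] using h

/-- Since the exponents add up to `-1`, the integral is invariant under affine maps and does not
depend on the interval. -/
theorem setIntegral_rpow_mul_rpow_mid {s x y : ℝ} (hyx : y < x) :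
    ∫ t in Ioo y x, (x - t) ^ (-s) * (t - y) ^ (s - 1) = betaConst s := by
  have hd : 0 < x - y := by linarith
  have himg : (fun τ => x + (-(x - y)) * τ) '' Ioo (0 : ℝ) 1 = Ioo y x := by
    ext t
    constructor
    · rintro ⟨τ, hτ, rfl⟩
      constructor <;> nlinarith [hτ.1, hτ.2]
    · rintro ⟨h1, h2⟩
      refine ⟨(x - t) / (x - y), ⟨div_pos (by linarith) hd, ?_⟩, ?_⟩
      · rw [div_lt_one hd]; linarith
      · field_simp; ring
  rw [← himg, setIntegral_Ioo_affine (by linarith) _ measurableSet_Ioo, betaConst]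
  refine setIntegral_congr_fun measurableSet_Ioo fun τ hτ => ?_
  have e1 : x - (x + (-(x - y)) * τ) = (x - y) * τ := by ring
  have e2 : x + (-(x - y)) * τ - y = (x - y) * (1 - τ) := by ring
  simp only [e1, e2, abs_neg]
  have h1 : (0 : ℝ) ≤ 1 - τ := by linarith [hτ.2]
  rw [Real.mul_rpow hd.le hτ.1.le, Real.mul_rpow hd.le h1, abs_of_pos hd]
  calc _ = ((x - y) * ((x - y) ^ (-s) * (x - y) ^ (s - 1))) * (τ ^ (-s) * (1 - τ) ^ (s - 1)) := by
        ring
    _ = _ := by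
        rw [← Real.rpow_add hd, show -s + (s - 1) = -1 by ring, Real.rpow_neg_one,
          mul_inv_cancel₀ hd.ne', one_mul]

theorem integrableOn_beta {p q : ℝ} (hp : -1 < p) (hp0 : p ≤ 0) (hq : -1 < q) (hq0 : q ≤ 0) :
    IntegrableOn (fun τ : ℝ => τ ^ p * (1 - τ) ^ q) (Ioo 0 1) := by
  have h1 : IntegrableOn (fun τ : ℝ => τ ^ p) (Ioo 0 1) :=
    ((intervalIntegral.intervalIntegrable_rpow' (a := 0) (b := 1) hp).1).mono_set
      Ioo_subset_Ioc_self
  have h2 : IntegrableOn (fun τ : ℝ => (1 - τ) ^ q) (Ioo 0 1) := by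
    have := (integrableOn_abs_sub_rpow (show 0 < q + 1 by linarith) 1 0 1).mono_set
      Ioo_subset_Icc_self
    refine this.congr_fun (fun τ hτ => ?_) measurableSet_Ioo
    simp only
    rw [abs_of_pos (by linarith [hτ.2]), add_sub_cancel_right]
  have hm : Measurable fun τ : ℝ => τ ^ p * (1 - τ) ^ q := by fun_prop
  -- On each half of `(0, 1)` one of the two factors has its base at least `1/2`, hence is bounded
  -- by `2 ^ (-q)` or `2 ^ (-p)`; the sum dominates on both halves.
  have hsum : IntegrableOn (fun τ : ℝ => 2 ^ (-q) * τ ^ p + 2 ^ (-p) * (1 - τ) ^ q)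
      (Ioo 0 1) := (h1.const_mul _).add (h2.const_mul _)
  refine hsum.mono' hm.aestronglyMeasurable ?_
  refine (ae_restrict_iff' measurableSet_Ioo).2 (Filter.Eventually.of_forall fun τ hτ => ?_)
  have h3 : 0 < 1 - τ := by linarith [hτ.2]
  have h0 := hτ.1
  rw [Real.norm_of_nonneg (by positivity)]
  rcases le_total τ (1 / 2) with h | h
  · have : (1 - τ) ^ q ≤ (1 / 2 : ℝ) ^ q :=
      Real.rpow_le_rpow_of_nonpos (by norm_num) (by linarith) hq0
    rw [one_div, Real.inv_rpow (by norm_num), ← Real.rpow_neg (by norm_num)] at this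
    have h4 : τ ^ p * (1 - τ) ^ q ≤ τ ^ p * 2 ^ (-q) := by gcongr
    have h5 : 0 ≤ (2 : ℝ) ^ (-p) * (1 - τ) ^ q := by positivity
    linarith
  · have : τ ^ p ≤ (1 / 2 : ℝ) ^ p :=
      Real.rpow_le_rpow_of_nonpos (by norm_num) h hp0
    rw [one_div, Real.inv_rpow (by norm_num), ← Real.rpow_neg (by norm_num)] at this
    have h4 : τ ^ p * (1 - τ) ^ q ≤ 2 ^ (-p) * (1 - τ) ^ q := by gcongr
    have h5 : 0 ≤ (2 : ℝ) ^ (-q) * τ ^ p := by positivity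
    linarith

theorem integrableOn_betaConst {s : ℝ} (hs0 : 0 < s) (hs1 : s < 1) :
    IntegrableOn (fun τ : ℝ => τ ^ (-s) * (1 - τ) ^ (s - 1)) (Ioo 0 1) :=
  integrableOn_beta (by linarith) (by linarith) (by linarith) (by linarith)

/-- The weakly singular constant which complements `betaConst`. -/
noncomputable def jumpConst (s : ℝ) : ℝ :=
  ∫ τ in Ioo (0 : ℝ) 1, (τ ^ (s - 1) / (1 - τ) - τ ^ (-s) / (1 - τ))

/-- Each of the two terms has a nonintegrable pole at `τ = 1`, which cancels in the difference.
After multiplication by `1 - τ` the bounds read `τ ^ (1 - s) ≤ τ ^ (s - 1)` and `τ ^ s ≤ τ ^ (-s)`.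
-/
theorem abs_jump_integrand_le {s τ : ℝ} (hs0 : 0 < s) (hs1 : s < 1) (hτ : τ ∈ Ioo (0 : ℝ) 1) :
    -τ ^ (-s) ≤ τ ^ (s - 1) / (1 - τ) - τ ^ (-s) / (1 - τ) ∧
      τ ^ (s - 1) / (1 - τ) - τ ^ (-s) / (1 - τ) ≤ τ ^ (s - 1) := by
  have h3 : 0 < 1 - τ := by linarith [hτ.2]
  have h0 := hτ.1
  rw [← sub_div, le_div_iff₀ h3, div_le_iff₀ h3]
  have e1 : τ ^ (-s) * τ = τ ^ (1 - s) := by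
    rw [← Real.rpow_add_one h0.ne']; ring_nf
  have e2 : τ ^ (s - 1) * τ = τ ^ s := by
    rw [← Real.rpow_add_one h0.ne']; ring_nf
  have h4 : τ ^ (1 - s) ≤ τ ^ (s - 1) :=
    Real.rpow_le_rpow_of_exponent_ge h0 hτ.2.le (by linarith)
  have h5 : τ ^ s ≤ τ ^ (-s) :=
    Real.rpow_le_rpow_of_exponent_ge h0 hτ.2.le (by linarith)
  constructor <;> nlinarith

theorem integrableOn_Ioo_rpow {r : ℝ} (hr : -1 < r) (L : ℝ) :
    IntegrableOn (fun τ : ℝ => τ ^ r) (Ioo 0 L) :=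
  ((intervalIntegral.intervalIntegrable_rpow' (a := 0) (b := L) hr).1).mono_set
    Ioo_subset_Ioc_self

theorem integrableOn_jumpConst {s : ℝ} (hs0 : 0 < s) (hs1 : s < 1) :
    IntegrableOn (fun τ : ℝ => τ ^ (s - 1) / (1 - τ) - τ ^ (-s) / (1 - τ)) (Ioo 0 1) := by
  have hm : Measurable fun τ : ℝ => τ ^ (s - 1) / (1 - τ) - τ ^ (-s) / (1 - τ) := by fun_prop
  refine ((integrableOn_Ioo_rpow (show -1 < s - 1 by linarith) 1).add
    (integrableOn_Ioo_rpow (show -1 < -s by linarith) 1)).mono' hm.aestronglyMeasurable ?_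
  refine (ae_restrict_iff' measurableSet_Ioo).2 (Filter.Eventually.of_forall fun τ hτ => ?_)
  have h := abs_jump_integrand_le hs0 hs1 hτ
  have h0 := hτ.1
  have h1 : 0 ≤ τ ^ (s - 1) := by positivity
  have h2 : 0 ≤ τ ^ (-s) := by positivity
  rw [Real.norm_eq_abs, abs_le]
  simp only [Pi.add_apply]
  constructor <;> linarith [h.1, h.2]

/-- The sum of the integrands is at least `τ ^ (-s) * ((1 - τ) ^ (s - 1) - 1)`, by the lower bound
for the jump integrand, and this is at least `(1 - s) * τ ^ (1 - s)`. -/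
theorem betaConst_add_jumpConst_pos {s : ℝ} (hs0 : 0 < s) (hs1 : s < 1) :
    0 < betaConst s + jumpConst s := by
  rw [betaConst, jumpConst, ← integral_add (integrableOn_betaConst hs0 hs1)
    (integrableOn_jumpConst hs0 hs1)]
  have hle : ∫ τ in Ioo (0 : ℝ) 1, (1 - s) * τ ^ (1 - s) ≤ ∫ τ in Ioo (0 : ℝ) 1,
      (τ ^ (-s) * (1 - τ) ^ (s - 1) + (τ ^ (s - 1) / (1 - τ) - τ ^ (-s) / (1 - τ))) := by
    refine setIntegral_mono_on ((integrableOn_Ioo_rpow (by linarith) 1).const_mul _)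
      ((integrableOn_betaConst hs0 hs1).add (integrableOn_jumpConst hs0 hs1))
      measurableSet_Ioo fun τ hτ => ?_
    have h3 : 0 < 1 - τ := by linarith [hτ.2]
    have h0 := hτ.1
    have h := (abs_jump_integrand_le hs0 hs1 hτ).1
    have e1 : τ ^ (-s) * τ = τ ^ (1 - s) := by
      rw [← Real.rpow_add_one h0.ne']; ring_nf
    -- A Bernoulli inequality, from `1 + z ≤ exp z` with `z = (s - 1) log (1 - τ)` and `log (1 - τ)
    -- ≤ -τ`.
    have h4 : 1 + (1 - s) * τ ≤ (1 - τ) ^ (s - 1) := by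
      rw [Real.rpow_def_of_pos h3]
      have h5 := Real.add_one_le_exp (Real.log (1 - τ) * (s - 1))
      have h6 := Real.log_le_sub_one_of_pos h3
      nlinarith
    have h7 : 0 ≤ τ ^ (-s) := by positivity
    nlinarith
  refine lt_of_lt_of_le ?_ hle
  rw [integral_const_mul, ← integral_Ioc_eq_integral_Ioo,
    ← intervalIntegral.integral_of_le zero_le_one, integral_rpow (Or.inl (by linarith))]
  rw [Real.one_rpow, Real.zero_rpow (by linarith), sub_zero]
  have : 0 < 1 - s + 1 := by linarith
  have : 0 < 1 - s := by linarith
  positivity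

end LDG

/-! ### The Abel transform of a Riesz potential -/

namespace LDG
open MeasureTheory

/-- The primitive of `ψ` which vanishes at the origin. -/
noncomputable def prim (ψ : ℝ → ℝ) (x : ℝ) : ℝ := ∫ y in (0 : ℝ)..x, ψ y

/-- Fubini for a superposition of windows `(lo τ, hi τ)` with density `k`: the pairing with `ψ`
becomes a superposition of increments of the primitive of `ψ`. Only `|k| * (hi - lo)` has to be
integrable, so `k` may have a pole where the window shrinks to a point, as `1 / (1 - τ)` does. -/
theorem integral_indicator_swap {ψ k lo hi : ℝ → ℝ} {B : ℝ} {T : Set ℝ} (hψ : Measurable ψ)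
    (hψi : Integrable ψ) (hB : ∀ y, |ψ y| ≤ B) (hk : Measurable k) (hlo : Measurable lo)
    (hhi : Measurable hi) (hT : MeasurableSet T) (hle : ∀ τ ∈ T, lo τ ≤ hi τ)
    (hint : IntegrableOn (fun τ => |k τ| * (hi τ - lo τ)) T) :
    Integrable (fun y => ψ y * ∫ τ in T, if lo τ < y ∧ y < hi τ then k τ else 0) ∧
    ∫ y, ψ y * (∫ τ in T, if lo τ < y ∧ y < hi τ then k τ else 0)
      = ∫ τ in T, k τ * ∫ y in lo τ..hi τ, ψ y := by
  have hE : MeasurableSet {z : ℝ × ℝ | lo z.1 < z.2 ∧ z.2 < hi z.1} :=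
    (measurableSet_lt (hlo.comp measurable_fst) measurable_snd).inter
      (measurableSet_lt measurable_snd (hhi.comp measurable_fst))
  have hm : Measurable (fun z : ℝ × ℝ => ψ z.2 * if lo z.1 < z.2 ∧ z.2 < hi z.1 then k z.1 else 0) :=
    (hψ.comp measurable_snd).mul (Measurable.ite hE (hk.comp measurable_fst) measurable_const)
  have hslice : ∀ τ, (fun y => ψ y * if lo τ < y ∧ y < hi τ then k τ else 0)
      = (Ioo (lo τ) (hi τ)).indicator (fun y => k τ * ψ y) := by
    intro τ
    ext y
    by_cases h : lo τ < y ∧ y < hi τ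
    · rw [indicator_of_mem (show y ∈ Ioo (lo τ) (hi τ) from h), if_pos h, mul_comm]
    · rw [indicator_of_notMem (show y ∉ Ioo (lo τ) (hi τ) from h), if_neg h, mul_zero]
  have hprod : Integrable (fun z : ℝ × ℝ => ψ z.2 * if lo z.1 < z.2 ∧ z.2 < hi z.1
      then k z.1 else 0) ((volume.restrict T).prod volume) := by
    rw [integrable_prod_iff hm.aestronglyMeasurable]
    refine ⟨Filter.Eventually.of_forall fun τ => ?_, ?_⟩
    · show Integrable (fun y => ψ y * if lo τ < y ∧ y < hi τ then k τ else 0)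
      rw [hslice]
      exact (hψi.const_mul _).indicator measurableSet_Ioo
    · refine (hint.const_mul B).mono' ?_ ?_
      · exact hm.aestronglyMeasurable.norm.integral_prod_right'
      · refine (ae_restrict_iff' hT).2 (Filter.Eventually.of_forall fun τ hτ => ?_)
        rw [Real.norm_of_nonneg (integral_nonneg fun y => norm_nonneg _)]
        have e : ∀ y, ‖ψ y * if lo τ < y ∧ y < hi τ then k τ else 0‖
            = (Ioo (lo τ) (hi τ)).indicator (fun y => ‖k τ * ψ y‖) y := by
          intro y
          rw [show (ψ y * if lo τ < y ∧ y < hi τ then k τ else 0) = _ from congrFun (hslice τ) y,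
            norm_indicator_eq_indicator_norm]
        simp only [e]
        rw [integral_indicator measurableSet_Ioo]
        calc ∫ y in Ioo (lo τ) (hi τ), ‖k τ * ψ y‖
            ≤ ∫ y in Ioo (lo τ) (hi τ), |k τ| * B := by
              refine setIntegral_mono_on (hψi.const_mul _).norm.integrableOn
                (integrableOn_const (by simp)) measurableSet_Ioo fun y _ => ?_
              rw [norm_mul]
              exact mul_le_mul_of_nonneg_left (hB y) (abs_nonneg _)
          _ = B * (|k τ| * (hi τ - lo τ)) := by
              rw [setIntegral_const, Real.volume_real_Ioo_of_le (hle τ hτ), smul_eq_mul]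
              ring
  have hpull : ∀ y, ψ y * (∫ τ in T, if lo τ < y ∧ y < hi τ then k τ else 0)
      = ∫ τ in T, ψ y * if lo τ < y ∧ y < hi τ then k τ else 0 := fun y =>
    (integral_const_mul _ _).symm
  simp_rw [hpull]
  refine ⟨hprod.integral_prod_right, ?_⟩
  rw [← integral_integral_swap hprod]
  refine setIntegral_congr_fun hT fun τ hτ => ?_
  show ∫ y, ψ y * (if lo τ < y ∧ y < hi τ then k τ else 0) = _
  rw [hslice, integral_indicator measurableSet_Ioo, integral_const_mul,
    intervalIntegral.integral_of_le (hle τ hτ), integral_Ioc_eq_integral_Ioo]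

section
variable {s L : ℝ} {ψ : ℝ → ℝ}

theorem abelInt_rieszInt_swap (hs0 : 0 < s) (hs1 : s < 1) (hψ : BddSupp 0 L ψ) {x : ℝ}
    (hx : x ∈ Ioo 0 L) :
    ∫ t in Ioo 0 x, (x - t) ^ (-s) * rieszInt s ψ t
      = ∫ y, ψ y * ∫ t in Ioo 0 x, (x - t) ^ (-s) * |t - y| ^ (s - 1) := by
  obtain ⟨B, hB0, hB⟩ := hψ.exists_bound
  have hm : Measurable (fun z : ℝ × ℝ => (x - z.1) ^ (-s) * (|z.1 - z.2| ^ (s - 1) * ψ z.2)) :=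
    ((measurable_const.sub measurable_fst).pow_const _).mul
      ((measurable_abs_sub_rpow s).mul (hψ.meas.comp measurable_snd))
  have hA : IntegrableOn (fun t : ℝ => (x - t) ^ (-s)) (Ioo 0 x) := by
    have := (integrableOn_abs_sub_rpow (s := 1 - s) (by linarith) x 0 x).mono_set
      Ioo_subset_Icc_self
    refine this.congr_fun (fun t ht => ?_) measurableSet_Ioo
    simp only
    rw [abs_of_pos (by linarith [ht.2])]
    ring_nf
  have hprod : Integrable (fun z : ℝ × ℝ => (x - z.1) ^ (-s) * (|z.1 - z.2| ^ (s - 1) * ψ z.2))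
      ((volume.restrict (Ioo 0 x)).prod volume) := by
    rw [integrable_prod_iff hm.aestronglyMeasurable]
    refine ⟨Filter.Eventually.of_forall fun t => ?_, ?_⟩
    · exact (hψ.integrable_mul (integrableOn_abs_sub_rpow hs0 t 0 L)).const_mul ((x - t) ^ (-s))
    · refine (hA.mul_const (2 * (L - 0) ^ s / s * B)).mono' ?_ ?_
      · exact hm.aestronglyMeasurable.norm.integral_prod_right'
      · refine (ae_restrict_iff' measurableSet_Ioo).2 (Filter.Eventually.of_forall fun t ht => ?_)
        have ht' : 0 < x - t := by linarith [ht.2]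
        rw [Real.norm_of_nonneg (integral_nonneg fun y => norm_nonneg _)]
        have e : ∀ y, ‖(x - t) ^ (-s) * (|t - y| ^ (s - 1) * ψ y)‖
            = (x - t) ^ (-s) * (|t - y| ^ (s - 1) * |ψ y|) := by
          intro y
          rw [norm_mul, norm_mul, Real.norm_of_nonneg (by positivity),
            Real.norm_of_nonneg (by positivity), Real.norm_eq_abs]
        simp only [e]
        rw [integral_const_mul]
        have hψ' : BddSupp 0 L (fun y => |ψ y|) :=
          ⟨hψ.meas.norm, ⟨B, fun y => by simpa using hB y⟩, fun y hy => by simp [hψ.supp y hy]⟩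
        have := abs_rieszInt_le hs0 hψ' (fun y => by simpa using hB y) (x := t)
          ⟨ht.1.le, (ht.2.trans hx.2).le⟩
        exact mul_le_mul_of_nonneg_left ((le_abs_self _).trans this) (by positivity)
  have h1 := integral_integral_swap
    (f := fun t y => (x - t) ^ (-s) * (|t - y| ^ (s - 1) * ψ y)) hprod
  simp only [integral_const_mul] at h1
  unfold rieszInt
  rw [h1]
  refine integral_congr_ae (Filter.Eventually.of_forall fun y => ?_)
  simp only
  rw [← integral_const_mul]
  exact integral_congr_ae (Filter.Eventually.of_forall fun t => by simp only; ring)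

/-- For `y < x` the integral is split at `y`: the piece over `(y, x)` is the beta constant, the
piece over `(0, y)` an incomplete integral up to `y / x`. For `y > x` there is only an incomplete
integral up to `x / y`. These are written over all of `(0, 1)` with window conditions on `y`, the
form required by `integral_indicator_swap`. The truncation at `L` changes nothing for `y < L` but
keeps the windows bounded as `τ → 0`. -/
theorem abel_kernel_eq (hs0 : 0 < s) (hs1 : s < 1) {x y : ℝ} (hx : x ∈ Ioo 0 L) (hy0 : 0 < y)
    (hyL : y < L) (hyx : y ≠ x) :
    ∫ t in Ioo 0 x, (x - t) ^ (-s) * |t - y| ^ (s - 1)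
      = (Ioo 0 x).indicator (fun _ => betaConst s) y
        + (∫ τ in Ioo (0 : ℝ) 1, if τ * x < y ∧ y < x then τ ^ (s - 1) / (1 - τ) else 0)
        + ∫ τ in Ioo (0 : ℝ) 1, if x < y ∧ y < min (x / τ) L then τ ^ (-s) / (1 - τ) else 0 := by
  have key : ∀ (k : ℝ → ℝ) (P : ℝ → Prop) [DecidablePred P] (r : ℝ), r ≤ 1 →
      (∀ τ ∈ Ioo (0 : ℝ) 1, (P τ ↔ τ < r)) →
      ∫ τ in Ioo (0 : ℝ) 1, (if P τ then k τ else 0) = ∫ τ in Ioo 0 r, k τ := by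
    intro k P _ r hr hP
    have : ∀ τ ∈ Ioo (0 : ℝ) 1, (if P τ then k τ else 0) = (Ioo 0 r).indicator k τ := by
      intro τ hτ
      by_cases h : τ < r
      · rw [if_pos ((hP τ hτ).2 h), indicator_of_mem (show τ ∈ Ioo 0 r from ⟨hτ.1, h⟩)]
      · rw [if_neg (fun h' => h ((hP τ hτ).1 h')), indicator_of_notMem (fun h' => h h'.2)]
    rw [setIntegral_congr_fun measurableSet_Ioo this, setIntegral_indicator measurableSet_Ioo,
      inter_eq_self_of_subset_right (Ioo_subset_Ioo_right hr)]
  have zero : ∀ (k : ℝ → ℝ) (P : ℝ → Prop) [DecidablePred P], (∀ τ ∈ Ioo (0 : ℝ) 1, ¬ P τ) →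
      ∫ τ in Ioo (0 : ℝ) 1, (if P τ then k τ else 0) = 0 := by
    intro k P _ hP
    rw [setIntegral_congr_fun measurableSet_Ioo (g := fun _ => 0)]
    · simp
    · intro τ hτ
      simp [hP τ hτ]
  rcases lt_or_gt_of_ne hyx with h | h
  · rw [indicator_of_mem (show y ∈ Ioo 0 x from ⟨hy0, h⟩),
      zero _ (fun τ => x < y ∧ y < min (x / τ) L) (fun τ _ hc => by linarith [hc.1]),
      key _ _ (y / x) ((div_lt_one hx.1).2 h).le
        (fun τ hτ => by rw [lt_div_iff₀ hx.1]; exact and_iff_left h),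
      ← setIntegral_rpow_mul_rpow_left hy0 h, ← setIntegral_rpow_mul_rpow_mid h, add_zero]
    have hi : IntegrableOn (fun t => (x - t) ^ (-s) * |t - y| ^ (s - 1)) (Ioo y x) := by
      -- The integral of a nonintegrable function is `0` by convention, whereas this one is known to
      -- equal the positive number `betaConst s`.
      by_contra hni
      have h0 := setIntegral_rpow_mul_rpow_mid (s := s) h
      have hb : 0 < betaConst s := by
        rw [betaConst, setIntegral_pos_iff_support_of_nonneg_ae]
        · refine lt_of_lt_of_le (b := volume (Ioo (0 : ℝ) 1)) (by simp) (measure_mono ?_)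
          intro τ hτ
          have h3 : 0 < 1 - τ := by linarith [hτ.2]
          have h0 := hτ.1
          refine ⟨?_, hτ⟩
          rw [Function.mem_support]
          positivity
        · refine (ae_restrict_iff' measurableSet_Ioo).2 (Filter.Eventually.of_forall fun τ hτ => ?_)
          have h3 : 0 < 1 - τ := by linarith [hτ.2]
          have h0 := hτ.1
          simp only [Pi.zero_apply]
          positivity
        · exact integrableOn_betaConst hs0 hs1
      have h1 : ∫ t in Ioo y x, (x - t) ^ (-s) * (t - y) ^ (s - 1)
          = ∫ t in Ioo y x, (x - t) ^ (-s) * |t - y| ^ (s - 1) :=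
        setIntegral_congr_fun measurableSet_Ioo fun t ht => by
          rw [abs_of_pos (by linarith [ht.1] : 0 < t - y)]
      rw [integral_undef hni] at h1
      linarith
    -- On `(0, y]` the factor `(x - t) ^ (-s)` is bounded by `(x - y) ^ (-s)`, so only the
    -- singularity at `y` matters.
    have hi2 : IntegrableOn (fun t => (x - t) ^ (-s) * |t - y| ^ (s - 1)) (Ioc 0 y) := by
      have h3 := ((integrableOn_abs_sub_rpow hs0 y 0 y).mono_set Ioc_subset_Icc_self).const_mul
        ((x - y) ^ (-s))
      have hm : Measurable fun t => (x - t) ^ (-s) * |t - y| ^ (s - 1) := by fun_prop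
      refine h3.mono' hm.aestronglyMeasurable ?_
      refine (ae_restrict_iff' measurableSet_Ioc).2 (Filter.Eventually.of_forall fun t ht => ?_)
      have h4 : 0 < x - y := by linarith
      have h5 : 0 < x - t := by linarith [ht.2]
      rw [Real.norm_of_nonneg (by positivity), abs_sub_comm t y]
      exact mul_le_mul_of_nonneg_right (Real.rpow_le_rpow_of_nonpos h4 (by linarith [ht.2])
        (by linarith)) (by positivity)
    rw [← Ioc_union_Ioo_eq_Ioo hy0.le h, setIntegral_union _ measurableSet_Ioo hi2 hi, add_comm,
      integral_Ioc_eq_integral_Ioo]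
    · congr 1
      · refine setIntegral_congr_fun measurableSet_Ioo fun t ht => ?_
        rw [abs_of_pos (by linarith [ht.1])]
      · refine setIntegral_congr_fun measurableSet_Ioo fun t ht => ?_
        rw [abs_sub_comm, abs_of_pos (by linarith [ht.2])]
    · exact disjoint_left.2 fun t ht ht' => by linarith [ht.2, ht'.1]
  · rw [indicator_of_notMem (fun h' : y ∈ Ioo 0 x => by linarith [h'.2]),
      zero _ (fun τ => τ * x < y ∧ y < x) (fun τ _ hc => by linarith [hc.2]),
      key _ _ (x / y) ((div_lt_one hy0).2 h).le
        (fun τ hτ => by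
          rw [lt_min_iff, lt_div_iff₀ hτ.1, lt_div_iff₀ hy0, mul_comm]
          exact ⟨fun h' => h'.2.1, fun h' => ⟨h, h', hyL⟩⟩),
      ← setIntegral_rpow_mul_rpow_right hx.1 h, zero_add, zero_add]
    refine setIntegral_congr_fun measurableSet_Ioo fun t ht => ?_
    rw [abs_sub_comm, abs_of_pos (by linarith [ht.2])]

end

end LDG

/-! ### The Abel transform in terms of the primitive, and the coercivity identity -/

namespace LDG
open MeasureTheory

section
variable {s L : ℝ} {ψ : ℝ → ℝ}

theorem prim_sub_prim (hψ : BddSupp 0 L ψ) (u v : ℝ) : prim ψ v - prim ψ u = ∫ y in u..v, ψ y :=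
  intervalIntegral.integral_interval_sub_left hψ.integrable.intervalIntegrable
    hψ.integrable.intervalIntegrable

theorem abs_prim_sub_le (hψ : BddSupp 0 L ψ) {B : ℝ} (hB : ∀ x, |ψ x| ≤ B) (u v : ℝ) :
    |prim ψ v - prim ψ u| ≤ B * |v - u| := by
  rw [prim_sub_prim hψ]
  exact intervalIntegral.norm_integral_le_of_norm_le_const (f := ψ) fun x _ => hB x

theorem prim_zero : prim ψ 0 = 0 := intervalIntegral.integral_same

theorem prim_of_le (hψ : BddSupp 0 L ψ) {x : ℝ} (hx : L ≤ x) : prim ψ x = prim ψ L := by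
  rw [← sub_eq_zero, prim_sub_prim hψ, intervalIntegral.integral_of_le hx]
  refine setIntegral_eq_zero_of_forall_eq_zero fun y hy => hψ.supp y fun h => ?_
  linarith [hy.1, h.2]

theorem continuous_prim (hψ : BddSupp 0 L ψ) : Continuous (prim ψ) :=
  intervalIntegral.continuous_primitive (fun _ _ => hψ.integrable.intervalIntegrable) 0

/-- The primitive is Lipschitz, so its increment over `(τ x, x)` cancels the pole at `τ = 1`. -/
theorem abs_left_term_le (hψ : BddSupp 0 L ψ) {B : ℝ} (hB0 : 0 < B) (hB : ∀ x, |ψ x| ≤ B)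
    {x τ : ℝ} (hx : x ∈ Ioo 0 L) (hτ : τ ∈ Ioo (0 : ℝ) 1) :
    |τ ^ (s - 1) / (1 - τ) * (prim ψ x - prim ψ (τ * x))| ≤ B * L * τ ^ (s - 1) := by
  have h3 : 0 < 1 - τ := by linarith [hτ.2]
  have h0 := hτ.1
  have h1 := hx.1
  have h2 := abs_prim_sub_le hψ hB (τ * x) x
  rw [abs_of_pos (by nlinarith : 0 < x - τ * x)] at h2
  rw [abs_mul, abs_of_pos (by positivity)]
  calc _ ≤ τ ^ (s - 1) / (1 - τ) * (B * (x - τ * x)) := by gcongr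
    _ = B * x * τ ^ (s - 1) := by field_simp
    _ ≤ _ := by gcongr; exact hx.2.le

/-- For `τ ≤ 1/2` the truncation at `L` gives the bound; for `τ ≥ 1/2` it comes from `x / τ - x = x
(1 - τ) / τ`. -/
theorem min_div_sub_le {x τ : ℝ} (hx : x ∈ Ioo 0 L) (hτ : τ ∈ Ioo (0 : ℝ) 1) :
    min (x / τ) L - x ≤ 2 * L * (1 - τ) := by
  have h3 : 0 < 1 - τ := by linarith [hτ.2]
  have h0 := hτ.1
  have h1 := hx.1
  rcases le_total τ (1 / 2) with h | h
  · have := min_le_right (x / τ) L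
    nlinarith [hx.2]
  · have h4 : x / τ - x ≤ 2 * L * (1 - τ) := by
      rw [div_sub' h0.ne', div_le_iff₀ h0]
      have : x * (1 - τ) ≤ L * (1 - τ) := by nlinarith [hx.2]
      have h5 : L * (1 - τ) ≤ 2 * L * (1 - τ) * τ := by
        have : 0 ≤ L * (1 - τ) := by nlinarith [hx.2]
        nlinarith
      linarith
    linarith [min_le_left (x / τ) L]

theorem prim_min (hψ : BddSupp 0 L ψ) (z : ℝ) : prim ψ (min z L) = prim ψ z := by
  rcases le_total z L with h | h
  · rw [min_eq_left h]
  · rw [min_eq_right h, prim_of_le hψ h]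

theorem abs_right_term_le (hψ : BddSupp 0 L ψ) {B : ℝ} (hB0 : 0 < B) (hB : ∀ x, |ψ x| ≤ B)
    {x τ : ℝ} (hx : x ∈ Ioo 0 L) (hτ : τ ∈ Ioo (0 : ℝ) 1) :
    |τ ^ (-s) / (1 - τ) * (prim ψ x - prim ψ (x / τ))| ≤ 2 * B * L * τ ^ (-s) := by
  have h3 : 0 < 1 - τ := by linarith [hτ.2]
  have h0 := hτ.1
  have h1 := hx.1
  have h2 := abs_prim_sub_le hψ hB x (min (x / τ) L)
  have h4 : x ≤ min (x / τ) L :=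
    le_min ((le_div_iff₀ h0).2 (by nlinarith [hτ.2])) hx.2.le
  rw [abs_of_nonneg (by linarith : 0 ≤ min (x / τ) L - x), prim_min hψ, abs_sub_comm] at h2
  rw [abs_mul, abs_of_pos (by positivity)]
  calc _ ≤ τ ^ (-s) / (1 - τ) * (B * (2 * L * (1 - τ))) := by
        refine mul_le_mul_of_nonneg_left (h2.trans ?_) (by positivity)
        exact mul_le_mul_of_nonneg_left (min_div_sub_le hx hτ) hB0.le
    _ = _ := by field_simp

/-- Pairing `abel_kernel_eq` with `ψ` turns every window into an increment of `prim ψ`: the windows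
`(τ x, x)` give the first difference, and the windows `(x, x / τ)` the second one with the opposite
sign. The truncation at `L` disappears because `prim ψ` is constant beyond `L`. -/
theorem abelInt_rieszInt (hs0 : 0 < s) (hs1 : s < 1) (hψ : BddSupp 0 L ψ) {x : ℝ}
    (hx : x ∈ Ioo 0 L) :
    ∫ t in Ioo 0 x, (x - t) ^ (-s) * rieszInt s ψ t
      = betaConst s * prim ψ x + ∫ τ in Ioo (0 : ℝ) 1,
          (τ ^ (s - 1) / (1 - τ) * (prim ψ x - prim ψ (τ * x))
            - τ ^ (-s) / (1 - τ) * (prim ψ x - prim ψ (x / τ))) := by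
  obtain ⟨B, hB0, hB⟩ := hψ.exists_bound
  have hw := continuous_prim hψ
  have hwm : Measurable (prim ψ) := hw.measurable
  have I1 := integral_indicator_swap (k := fun τ => τ ^ (s - 1) / (1 - τ)) (lo := fun τ => τ * x)
    (hi := fun _ => x) (T := Ioo 0 1) hψ.meas hψ.integrable hB (by fun_prop) (by fun_prop)
    (by fun_prop) measurableSet_Ioo (fun τ hτ => by nlinarith [hx.1, hτ.2]) (by
      have h : IntegrableOn (fun τ : ℝ => x * τ ^ (s - 1)) (Ioo 0 1) :=
        (integrableOn_Ioo_rpow (show -1 < s - 1 by linarith) 1).const_mul x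
      refine h.congr_fun (fun τ hτ => ?_) measurableSet_Ioo
      have h3 : 0 < 1 - τ := by linarith [hτ.2]
      have h0 := hτ.1
      simp only
      rw [abs_of_pos (by positivity)]
      field_simp)
  have I2 := integral_indicator_swap (k := fun τ => τ ^ (-s) / (1 - τ)) (lo := fun _ => x)
    (hi := fun τ => min (x / τ) L) (T := Ioo 0 1) hψ.meas hψ.integrable hB (by fun_prop)
    (by fun_prop) (by fun_prop) measurableSet_Ioo
    (fun τ hτ => le_min ((le_div_iff₀ hτ.1).2 (by nlinarith [hτ.2, hx.1])) hx.2.le) (by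
      refine ((integrableOn_Ioo_rpow (show -1 < -s by linarith) 1).const_mul (2 * L)).mono'
        (Measurable.aestronglyMeasurable (by fun_prop)) ?_
      refine (ae_restrict_iff' measurableSet_Ioo).2 (Filter.Eventually.of_forall fun τ hτ => ?_)
      have h3 : 0 < 1 - τ := by linarith [hτ.2]
      have h0 := hτ.1
      have h4 : x ≤ min (x / τ) L :=
        le_min ((le_div_iff₀ h0).2 (by nlinarith [hτ.2, hx.1])) hx.2.le
      rw [Real.norm_of_nonneg (mul_nonneg (abs_nonneg _) (by linarith)), abs_of_pos (by positivity)]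
      calc _ ≤ τ ^ (-s) / (1 - τ) * (2 * L * (1 - τ)) :=
            mul_le_mul_of_nonneg_left (min_div_sub_le hx hτ) (by positivity)
        _ = _ := by field_simp)
  have hI0 : Integrable (fun y => ψ y * (Ioo 0 x).indicator (fun _ => betaConst s) y) := by
    have e : (fun y => ψ y * (Ioo 0 x).indicator (fun _ => betaConst s) y)
        = (Ioo 0 x).indicator (fun y => ψ y * betaConst s) := by
      ext y; by_cases h : y ∈ Ioo 0 x <;> simp [h]
    rw [e]
    exact (hψ.integrable.mul_const _).indicator measurableSet_Ioo
  have hI0' : ∫ y, ψ y * (Ioo 0 x).indicator (fun _ => betaConst s) y = betaConst s * prim ψ x := by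
    have e : (fun y => ψ y * (Ioo 0 x).indicator (fun _ => betaConst s) y)
        = (Ioo 0 x).indicator (fun y => ψ y * betaConst s) := by
      ext y; by_cases h : y ∈ Ioo 0 x <;> simp [h]
    rw [e, integral_indicator measurableSet_Ioo, integral_mul_const, mul_comm, prim,
      intervalIntegral.integral_of_le hx.1.le, integral_Ioc_eq_integral_Ioo]
  rw [abelInt_rieszInt_swap hs0 hs1 hψ hx]
  have hae : ∀ᵐ y : ℝ, ψ y * (∫ t in Ioo 0 x, (x - t) ^ (-s) * |t - y| ^ (s - 1))
      = ψ y * (Ioo 0 x).indicator (fun _ => betaConst s) y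
        + ψ y * (∫ τ in Ioo (0 : ℝ) 1, if τ * x < y ∧ y < x then τ ^ (s - 1) / (1 - τ) else 0)
        + ψ y * ∫ τ in Ioo (0 : ℝ) 1,
          if x < y ∧ y < min (x / τ) L then τ ^ (-s) / (1 - τ) else 0 := by
    have hn : ∀ c : ℝ, ∀ᵐ y : ℝ, y ≠ c := fun c => by
      simp [ae_iff]
    filter_upwards [hn 0, hn L, hn x] with y h0 hL hyx
    by_cases hy : y ∈ Icc 0 L
    · rw [abel_kernel_eq hs0 hs1 hx (lt_of_le_of_ne hy.1 (Ne.symm h0)) (lt_of_le_of_ne hy.2 hL) hyx]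
      ring
    · simp [hψ.supp y hy]
  have hI01 : Integrable (fun y => ψ y * (Ioo 0 x).indicator (fun _ => betaConst s) y
      + ψ y * ∫ τ in Ioo (0 : ℝ) 1, if τ * x < y ∧ y < x then τ ^ (s - 1) / (1 - τ) else 0) :=
    hI0.add I1.1
  rw [integral_congr_ae hae, integral_add hI01 I2.1, integral_add hI0 I1.1, hI0', I1.2,
    I2.2, add_assoc]
  congr 1
  have hint1 : IntegrableOn (fun τ => τ ^ (s - 1) / (1 - τ) * (prim ψ x - prim ψ (τ * x)))
      (Ioo 0 1) := by
    refine ((integrableOn_Ioo_rpow (show -1 < s - 1 by linarith) 1).const_mul (B * L)).mono'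
      (Measurable.aestronglyMeasurable (by fun_prop)) ?_
    exact (ae_restrict_iff' measurableSet_Ioo).2 (Filter.Eventually.of_forall fun τ hτ =>
      abs_left_term_le hψ hB0 hB hx hτ)
  have hint2 : IntegrableOn (fun τ => τ ^ (-s) / (1 - τ) * (prim ψ x - prim ψ (x / τ)))
      (Ioo 0 1) := by
    refine ((integrableOn_Ioo_rpow (show -1 < -s by linarith) 1).const_mul (2 * B * L)).mono'
      (Measurable.aestronglyMeasurable (by fun_prop)) ?_
    exact (ae_restrict_iff' measurableSet_Ioo).2 (Filter.Eventually.of_forall fun τ hτ =>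
      abs_right_term_le hψ hB0 hB hx hτ)
  rw [integral_sub hint1 hint2]
  have e1 : ∫ τ in Ioo (0 : ℝ) 1, τ ^ (s - 1) / (1 - τ) * ∫ y in τ * x..x, ψ y
      = ∫ τ in Ioo (0 : ℝ) 1, τ ^ (s - 1) / (1 - τ) * (prim ψ x - prim ψ (τ * x)) := by
    simp_rw [prim_sub_prim hψ]
  have e2 : ∫ τ in Ioo (0 : ℝ) 1, τ ^ (-s) / (1 - τ) * ∫ y in x..min (x / τ) L, ψ y
      = -∫ τ in Ioo (0 : ℝ) 1, τ ^ (-s) / (1 - τ) * (prim ψ x - prim ψ (x / τ)) := by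
    rw [← integral_neg]
    refine integral_congr_ae (Filter.Eventually.of_forall fun τ => ?_)
    simp only
    rw [← prim_sub_prim hψ, prim_min hψ]
    ring
  rw [e1, e2, sub_eq_add_neg (∫ τ in Ioo (0 : ℝ) 1,
    τ ^ (s - 1) / (1 - τ) * (prim ψ x - prim ψ (τ * x)))]

/-- With `w = prim ψ`, the weight `x ^ (2 s - 2)` is chosen so that the dilation `x ↦ τ x` carries
the cross term `w(x) w(x / τ)` to `τ ^ (2 s - 1)` times the cross term `w(x) w(τ x)`. Since `q τ * τ
^ (2 s - 1) = p τ`, the two cross terms cancel, and `∫ (p - q)` over `(0, 1)` is `jumpConst s`.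
Vanishing mean is needed so that `w` vanishes beyond `L`. -/
theorem abel_form_eq (hs0 : 0 < s) (hs1 : s < 1) (hψ : BddSupp 0 L ψ) (hL : 0 < L)
    (hmean : prim ψ L = 0) :
    ∫ x in Ioo 0 L, x ^ (2 * s - 2) * prim ψ x * ∫ t in Ioo 0 x, (x - t) ^ (-s) * rieszInt s ψ t
      = (betaConst s + jumpConst s) * ∫ x in Ioo 0 L, x ^ (2 * s - 2) * prim ψ x ^ 2 := by
  obtain ⟨B, hB0, hB⟩ := hψ.exists_bound
  have hw := continuous_prim hψ
  have hwm : Measurable (prim ψ) := hw.measurable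
  have hwx : ∀ x, 0 < x → |prim ψ x| ≤ B * x := fun x hx => by
    have := abs_prim_sub_le hψ hB 0 x
    rwa [prim_zero, sub_zero, sub_zero, abs_of_pos hx] at this
  have hwL : ∀ x, 0 ≤ x → |prim ψ x| ≤ B * L := fun x hx => by
    rcases le_total L x with h | h
    · rw [prim_of_le hψ h, hmean, abs_zero]; positivity
    · rcases hx.eq_or_lt with h0 | h0
      · rw [← h0, prim_zero, abs_zero]; positivity
      · exact (hwx x h0).trans (mul_le_mul_of_nonneg_left h hB0.le)
  -- The weight alone need not be integrable at `0`; it becomes so because the primitive is `O(x)`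
  -- there.
  have hVb : ∀ x ∈ Ioo 0 L, |x ^ (2 * s - 2) * prim ψ x| ≤ B * x ^ (2 * s - 1) := fun x hx => by
    have h1 := hx.1
    rw [abs_mul, abs_of_pos (by positivity)]
    calc _ ≤ x ^ (2 * s - 2) * (B * x) := mul_le_mul_of_nonneg_left (hwx x h1) (by positivity)
      _ = B * (x ^ (2 * s - 2) * x) := by ring
      _ = _ := by rw [← Real.rpow_add_one h1.ne']; ring_nf
  have hVint : ∀ (g : ℝ → ℝ) (C : ℝ), Measurable g → (∀ x ∈ Ioo 0 L, |g x| ≤ C) →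
      IntegrableOn (fun x => x ^ (2 * s - 2) * prim ψ x * g x) (Ioo 0 L) := fun g C hg hC => by
    refine (((integrableOn_Ioo_rpow (show -1 < 2 * s - 1 by linarith) L).const_mul B).mul_const
      C).mono' (Measurable.aestronglyMeasurable (by fun_prop)) ?_
    refine (ae_restrict_iff' measurableSet_Ioo).2 (Filter.Eventually.of_forall fun x hx => ?_)
    rw [norm_mul]
    exact mul_le_mul (hVb x hx) (hC x hx) (norm_nonneg _) (by have := hx.1; positivity)
  have hsq : IntegrableOn (fun x => x ^ (2 * s - 2) * prim ψ x * prim ψ x) (Ioo 0 L) :=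
    hVint _ (B * L) hwm fun x hx => hwL x hx.1.le
  set p : ℝ → ℝ := fun τ => τ ^ (s - 1) / (1 - τ) with hp
  set q : ℝ → ℝ := fun τ => τ ^ (-s) / (1 - τ) with hq
  have hpm : Measurable p := by rw [hp]; fun_prop
  have hqm : Measurable q := by rw [hq]; fun_prop
  have hm : Measurable (fun z : ℝ × ℝ => z.1 ^ (2 * s - 2) * prim ψ z.1 *
      (p z.2 * (prim ψ z.1 - prim ψ (z.2 * z.1)) - q z.2 * (prim ψ z.1 - prim ψ (z.1 / z.2)))) := by
    fun_prop
  have hprod : Integrable (fun z : ℝ × ℝ => z.1 ^ (2 * s - 2) * prim ψ z.1 *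
      (p z.2 * (prim ψ z.1 - prim ψ (z.2 * z.1)) - q z.2 * (prim ψ z.1 - prim ψ (z.1 / z.2))))
      ((volume.restrict (Ioo 0 L)).prod (volume.restrict (Ioo 0 1))) := by
    have h1 : IntegrableOn (fun τ : ℝ => B * L * τ ^ (s - 1) + 2 * B * L * τ ^ (-s)) (Ioo 0 1) :=
      ((integrableOn_Ioo_rpow (show -1 < s - 1 by linarith) 1).const_mul _).add
        ((integrableOn_Ioo_rpow (show -1 < -s by linarith) 1).const_mul _)
    refine (((integrableOn_Ioo_rpow (show -1 < 2 * s - 1 by linarith) L).const_mul B).mul_prod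
      h1).mono' hm.aestronglyMeasurable ?_
    rw [Measure.prod_restrict]
    refine (ae_restrict_iff' (measurableSet_Ioo.prod measurableSet_Ioo)).2
      (Filter.Eventually.of_forall fun z hz => ?_)
    rw [norm_mul]
    refine mul_le_mul (hVb z.1 hz.1) ?_ (norm_nonneg _) (by have := hz.1.1; positivity)
    exact (norm_sub_le _ _).trans (add_le_add (abs_left_term_le hψ hB0 hB hz.1 hz.2)
      (abs_right_term_le hψ hB0 hB hz.1 hz.2))
  have hscale : ∀ τ ∈ Ioo (0 : ℝ) 1, ∫ x in Ioo 0 L, x ^ (2 * s - 2) * prim ψ x * prim ψ (x / τ)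
      = τ ^ (2 * s - 1) * ∫ x in Ioo 0 L, x ^ (2 * s - 2) * prim ψ x * prim ψ (τ * x) := by
    intro τ hτ
    have h0 := hτ.1
    have himg : (fun y => 0 + τ * y) '' Ioo 0 L = Ioo 0 (τ * L) := by
      ext x
      constructor
      · rintro ⟨y, hy, rfl⟩
        simp only [zero_add]
        exact ⟨mul_pos h0 hy.1, by nlinarith [hy.2]⟩
      · rintro ⟨h1, h2⟩
        exact ⟨x / τ, ⟨div_pos h1 h0, by rw [div_lt_iff₀ h0]; linarith⟩, by field_simp; ring⟩
    -- For `x ≥ τ L` the factor `prim ψ (x / τ)` is zero, so only `(0, τ L)` counts, and this is the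
    -- dilate of `(0, L)`.
    have hsub : Ioo 0 (τ * L) ⊆ Ioo 0 L := Ioo_subset_Ioo_right (by nlinarith [hτ.2])
    rw [setIntegral_eq_of_subset_of_forall_sdiff_eq_zero measurableSet_Ioo hsub, ← himg,
      setIntegral_Ioo_affine h0.ne' _ measurableSet_Ioo, ← integral_const_mul]
    · refine setIntegral_congr_fun measurableSet_Ioo fun x hx => ?_
      have h1 := hx.1
      simp only [zero_add]
      rw [abs_of_pos h0, Real.mul_rpow h0.le h1.le, mul_div_cancel_left₀ _ h0.ne',
        show (2 * s - 1) = (2 * s - 2) + 1 by ring, Real.rpow_add_one h0.ne']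
      ring
    · intro x hx
      have h1 : L ≤ x / τ := by
        rw [le_div_iff₀ h0]
        by_contra hc
        exact hx.2 ⟨hx.1.1, by linarith⟩
      rw [prim_of_le hψ h1, hmean, mul_zero]
  have hform : ∫ x in Ioo 0 L, x ^ (2 * s - 2) * prim ψ x *
      ∫ t in Ioo 0 x, (x - t) ^ (-s) * rieszInt s ψ t
      = ∫ x in Ioo 0 L, (betaConst s * (x ^ (2 * s - 2) * prim ψ x * prim ψ x)
        + ∫ τ in Ioo (0 : ℝ) 1, x ^ (2 * s - 2) * prim ψ x * (p τ * (prim ψ x - prim ψ (τ * x))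
          - q τ * (prim ψ x - prim ψ (x / τ)))) := by
    refine setIntegral_congr_fun measurableSet_Ioo fun x hx => ?_
    rw [abelInt_rieszInt hs0 hs1 hψ hx, integral_const_mul]
    ring
  rw [hform, integral_add (hsq.const_mul _) hprod.integral_prod_left, integral_const_mul,
    integral_integral_swap hprod]
  have hinner : ∀ τ ∈ Ioo (0 : ℝ) 1, ∫ x in Ioo 0 L, x ^ (2 * s - 2) * prim ψ x *
      (p τ * (prim ψ x - prim ψ (τ * x)) - q τ * (prim ψ x - prim ψ (x / τ)))
      = (p τ - q τ) * ∫ x in Ioo 0 L, x ^ (2 * s - 2) * prim ψ x * prim ψ x := by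
    intro τ hτ
    have h0 := hτ.1
    have i2 : IntegrableOn (fun x => x ^ (2 * s - 2) * prim ψ x * prim ψ (τ * x)) (Ioo 0 L) :=
      hVint _ (B * L) (by fun_prop) fun x hx => hwL _ (mul_pos h0 hx.1).le
    have i3 : IntegrableOn (fun x => x ^ (2 * s - 2) * prim ψ x * prim ψ (x / τ)) (Ioo 0 L) :=
      hVint _ (B * L) (by fun_prop) fun x hx => hwL _ (div_pos hx.1 h0).le
    have e : ∀ x, x ^ (2 * s - 2) * prim ψ x *
        (p τ * (prim ψ x - prim ψ (τ * x)) - q τ * (prim ψ x - prim ψ (x / τ)))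
        = (p τ - q τ) * (x ^ (2 * s - 2) * prim ψ x * prim ψ x)
          - p τ * (x ^ (2 * s - 2) * prim ψ x * prim ψ (τ * x))
          + q τ * (x ^ (2 * s - 2) * prim ψ x * prim ψ (x / τ)) := fun x => by ring
    simp_rw [e]
    have i4 : IntegrableOn (fun x => (p τ - q τ) * (x ^ (2 * s - 2) * prim ψ x * prim ψ x)
        - p τ * (x ^ (2 * s - 2) * prim ψ x * prim ψ (τ * x))) (Ioo 0 L) :=
      (hsq.const_mul _).sub (i2.const_mul _)
    rw [integral_add i4 (i3.const_mul _),
      integral_sub (hsq.const_mul _) (i2.const_mul _), integral_const_mul, integral_const_mul,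
      integral_const_mul, hscale τ hτ]
    have : q τ * τ ^ (2 * s - 1) = p τ := by
      rw [hp, hq]
      simp only
      rw [div_mul_eq_mul_div, ← Real.rpow_add h0]
      ring_nf
    rw [← mul_assoc (q τ), this]
    ring
  rw [setIntegral_congr_fun measurableSet_Ioo hinner, integral_mul_const, jumpConst, add_mul]
  congr 2 <;> refine setIntegral_congr_fun measurableSet_Ioo fun x hx => ?_ <;> ring

end
end LDG

namespace LDG
open MeasureTheory

/-! ### A Hardy inequality and the a priori estimate -/

theorem setLIntegral_eq_of_subset {S T : Set ℝ} (hS : MeasurableSet S) (hT : MeasurableSet T)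
    (hST : S ⊆ T) {f : ℝ → ENNReal} (hf : ∀ x ∈ T \ S, f x = 0) :
    ∫⁻ x in S, f x = ∫⁻ x in T, f x := by
  rw [← lintegral_indicator hS, ← lintegral_indicator hT]
  refine lintegral_congr fun x => ?_
  by_cases h : x ∈ S
  · rw [indicator_of_mem h, indicator_of_mem (hST h)]
  · by_cases h' : x ∈ T
    · rw [indicator_of_notMem h, indicator_of_mem h', hf x ⟨h', h⟩]
    · rw [indicator_of_notMem h, indicator_of_notMem h']

theorem lintegral_Ioo_scale {x : ℝ} (hx : 0 < x) (f : ℝ → ENNReal) :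
    ∫⁻ t in Ioo 0 x, f t = ENNReal.ofReal x * ∫⁻ θ in Ioo (0 : ℝ) 1, f (x * θ) := by
  have himg : (fun θ => x * θ) '' Ioo (0 : ℝ) 1 = Ioo 0 x := by
    rw [image_mul_left_Ioo hx]; simp
  rw [← himg, lintegral_image_eq_lintegral_abs_deriv_mul measurableSet_Ioo (f' := fun _ => x),
    abs_of_pos hx, lintegral_const_mul' _ _ ENNReal.ofReal_ne_top]
  · intro τ _
    simpa using ((hasDerivAt_id τ).const_mul x).hasDerivWithinAt
  · intro τ _ τ' _ h
    simpa [hx.ne'] using h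

theorem lintegral_Ioi_inv_scale {t : ℝ} (ht : 0 < t) (f : ℝ → ENNReal) :
    ∫⁻ x in Ioi t, f x = ∫⁻ θ in Ioo (0 : ℝ) 1, ENNReal.ofReal (t / θ ^ 2) * f (t / θ) := by
  have himg : (fun θ => t / θ) '' Ioo (0 : ℝ) 1 = Ioi t := by
    ext x
    constructor
    · rintro ⟨θ, hθ, rfl⟩
      rw [mem_Ioi, lt_div_iff₀ hθ.1]
      nlinarith [hθ.2]
    · intro hx
      have hx0 : 0 < x := ht.trans hx
      exact ⟨t / x, ⟨div_pos ht hx0, (div_lt_one hx0).2 hx⟩, by field_simp⟩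
  rw [← himg, lintegral_image_eq_lintegral_abs_deriv_mul measurableSet_Ioo
    (f' := fun θ => -(t / θ ^ 2))]
  · refine setLIntegral_congr_fun measurableSet_Ioo fun θ hθ => ?_
    have := hθ.1
    rw [abs_neg, abs_of_pos (by positivity)]
  · intro θ hθ
    have h : HasDerivAt (fun θ => t / θ) (t * -(θ ^ 2)⁻¹) θ := by
      simpa [div_eq_mul_inv] using (hasDerivAt_inv hθ.1.ne').const_mul t
    refine (h.congr_deriv ?_).hasDerivWithinAt
    rw [div_eq_mul_inv]; ring
  · intro τ hτ τ' hτ' h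
    simp only at h
    rw [div_eq_div_iff hτ.1.ne' hτ'.1.ne'] at h
    exact (mul_left_cancel₀ ht.ne' h).symm

/-- The kernel of the weighted Abel operator. -/
noncomputable def hardyKernel (s x t : ℝ) : ℝ :=
  if t < x then x ^ (s - 1) * (x - t) ^ (-s) else 0

/-- The weight in the Schur test for `hardyKernel`. -/
noncomputable def hardyWeight (x : ℝ) : ℝ := if 0 < x then x ^ (-(1 / 2) : ℝ) else 1

theorem measurable_hardyKernel (s : ℝ) : Measurable (Function.uncurry (hardyKernel s)) := by
  refine Measurable.ite (measurableSet_lt measurable_snd measurable_fst) ?_ measurable_const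
  exact (measurable_fst.pow_const _).mul ((measurable_fst.sub measurable_snd).pow_const _)

theorem measurable_hardyWeight : Measurable hardyWeight :=
  Measurable.ite measurableSet_Ioi (measurable_id.pow_const _) measurable_const

theorem hardyWeight_pos (x : ℝ) : 0 < hardyWeight x := by
  unfold hardyWeight
  split_ifs with h
  · positivity
  · exact one_pos

/-- The constant of the Hardy inequality. -/
noncomputable def hardyConst (s : ℝ) : ℝ :=
  ∫ θ in Ioo (0 : ℝ) 1, θ ^ (-(1 / 2) : ℝ) * (1 - θ) ^ (-s)

theorem lintegral_hardyConst {s : ℝ} (hs0 : 0 < s) (hs1 : s < 1) :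
    ∫⁻ θ in Ioo (0 : ℝ) 1, ENNReal.ofReal (θ ^ (-(1 / 2) : ℝ) * (1 - θ) ^ (-s))
      = ENNReal.ofReal (hardyConst s) := by
  rw [hardyConst, ofReal_integral_eq_lintegral_ofReal
    (integrableOn_beta (by norm_num) (by norm_num) (by linarith) (by linarith))]
  refine (ae_restrict_iff' measurableSet_Ioo).2 (Filter.Eventually.of_forall fun θ hθ => ?_)
  have h3 : 0 < 1 - θ := by linarith [hθ.2]
  have h0 := hθ.1
  simp only [Pi.zero_apply]
  positivity

theorem hardyConst_nonneg (s : ℝ) : 0 ≤ hardyConst s :=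
  setIntegral_nonneg measurableSet_Ioo fun θ hθ => by
    have h3 : 0 < 1 - θ := by linarith [hθ.2]
    have h0 := hθ.1
    positivity

/-- The kernel is homogeneous of degree `-1`, so by the scaling `t = x θ` it maps the power `t ^
(-1/2)` to a multiple of itself. -/
theorem hardy_row {s L x : ℝ} (hs0 : 0 < s) (hs1 : s < 1) (hx : 0 < x) (hxL : x < L) :
    ∫⁻ t in Ioo 0 L, ENNReal.ofReal |hardyKernel s x t| * ENNReal.ofReal (hardyWeight t)
      ≤ ENNReal.ofReal (hardyConst s) * ENNReal.ofReal (hardyWeight x) := by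
  have h1 : ∫⁻ t in Ioo 0 L, ENNReal.ofReal |hardyKernel s x t| * ENNReal.ofReal (hardyWeight t)
      = ∫⁻ t in Ioo 0 x, ENNReal.ofReal (x ^ (s - 1) * (x - t) ^ (-s) * t ^ (-(1 / 2) : ℝ)) := by
    rw [← setLIntegral_eq_of_subset measurableSet_Ioo measurableSet_Ioo
      (Ioo_subset_Ioo_right hxL.le)]
    · refine setLIntegral_congr_fun measurableSet_Ioo fun t ht => ?_
      have h0 := ht.1
      have h3 : 0 < x - t := by linarith [ht.2]
      rw [hardyKernel, if_pos ht.2, hardyWeight, if_pos h0, abs_of_pos (by positivity),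
        ← ENNReal.ofReal_mul (by positivity)]
    · intro t ht
      have : ¬ t < x := fun h => ht.2 ⟨ht.1.1, h⟩
      simp [hardyKernel, this]
  rw [h1, lintegral_Ioo_scale hx, ← lintegral_const_mul' _ _ ENNReal.ofReal_ne_top,
    ← lintegral_hardyConst hs0 hs1, ← lintegral_mul_const' _ _ ENNReal.ofReal_ne_top]
  refine le_of_eq (setLIntegral_congr_fun measurableSet_Ioo fun θ hθ => ?_)
  have h0 := hθ.1
  have h3 : 0 < 1 - θ := by linarith [hθ.2]
  rw [← ENNReal.ofReal_mul hx.le, ← ENNReal.ofReal_mul (by positivity), hardyWeight, if_pos hx,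
    show x - x * θ = x * (1 - θ) by ring, Real.mul_rpow hx.le h3.le, Real.mul_rpow hx.le h0.le]
  congr 1
  calc _ = (x * (x ^ (s - 1) * x ^ (-s))) * x ^ (-(1 / 2) : ℝ)
        * (θ ^ (-(1 / 2) : ℝ) * (1 - θ) ^ (-s)) := by ring
    _ = _ := by
      rw [← Real.rpow_add hx, show s - 1 + -s = -1 by ring, Real.rpow_neg_one,
        mul_inv_cancel₀ hx.ne']
      ring

/-- The integral is first extended to `(t, ∞)`; the substitution `x = t / θ` then shows that the
transposed kernel reproduces the same power with the same constant. -/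
theorem hardy_col {s L t : ℝ} (hs0 : 0 < s) (hs1 : s < 1) (ht : 0 < t) :
    ∫⁻ x in Ioo 0 L, ENNReal.ofReal |hardyKernel s x t| * ENNReal.ofReal (hardyWeight x)
      ≤ ENNReal.ofReal (hardyConst s) * ENNReal.ofReal (hardyWeight t) := by
  have h1 : ∫⁻ x in Ioo 0 L, ENNReal.ofReal |hardyKernel s x t| * ENNReal.ofReal (hardyWeight x)
      ≤ ∫⁻ x in Ioi t, ENNReal.ofReal |hardyKernel s x t| * ENNReal.ofReal (hardyWeight x) := by
    rw [← setLIntegral_eq_of_subset measurableSet_Ioo measurableSet_Ioo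
      (Ioo_subset_Ioo_left ht.le)]
    · exact lintegral_mono_set Ioo_subset_Ioi_self
    · intro x hx
      have : ¬ t < x := fun h => hx.2 ⟨h, hx.1.2⟩
      simp [hardyKernel, this]
  refine h1.trans ?_
  rw [lintegral_Ioi_inv_scale ht, ← lintegral_hardyConst hs0 hs1,
    ← lintegral_mul_const' _ _ ENNReal.ofReal_ne_top]
  refine le_of_eq (setLIntegral_congr_fun measurableSet_Ioo fun θ hθ => ?_)
  have h0 := hθ.1
  have h3 : 0 < 1 - θ := by linarith [hθ.2]
  have h4 : t < t / θ := by rw [lt_div_iff₀ h0]; nlinarith [hθ.2]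
  have h5 : 0 < t / θ := ht.trans h4
  have e : t / θ - t = t / θ * (1 - θ) := by field_simp
  rw [hardyKernel, if_pos h4, hardyWeight, if_pos h5, hardyWeight, if_pos ht, e,
    abs_of_pos (by positivity), ← ENNReal.ofReal_mul (by positivity),
    ← ENNReal.ofReal_mul (by positivity), ← ENNReal.ofReal_mul (by positivity),
    Real.mul_rpow h5.le h3.le]
  congr 1
  calc _ = (t / θ ^ 2) * ((t / θ) ^ (s - 1) * (t / θ) ^ (-s)) * (t / θ) ^ (-(1 / 2) : ℝ)
        * (1 - θ) ^ (-s) := by ring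
    _ = θ⁻¹ * (t / θ) ^ (-(1 / 2) : ℝ) * (1 - θ) ^ (-s) := by
      rw [← Real.rpow_add h5, show s - 1 + -s = -1 by ring, Real.rpow_neg_one]
      congr 2
      field_simp
    _ = _ := by
      have e2 : θ⁻¹ = θ ^ (-(1 / 2) : ℝ) * θ ^ (-(1 / 2) : ℝ) := by
        rw [← Real.rpow_add h0]; norm_num [Real.rpow_neg_one]
      have e3 : θ ^ (-(1 / 2) : ℝ) ≠ 0 := (Real.rpow_pos_of_pos h0 _).ne'
      rw [Real.div_rpow ht.le h0.le, e2]
      field_simp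

theorem hardy_inequality {s L : ℝ} (hs0 : 0 < s) (hs1 : s < 1) {Φ : ℝ → ℝ} (hΦ : Measurable Φ)
    (hΦi : IntegrableOn (fun t => Φ t ^ 2) (Ioo 0 L)) :
    AEStronglyMeasurable (fun x => x ^ (s - 1) * ∫ t in Ioo 0 x, (x - t) ^ (-s) * Φ t)
      (volume.restrict (Ioo 0 L)) ∧
    IntegrableOn (fun x => (x ^ (s - 1) * ∫ t in Ioo 0 x, (x - t) ^ (-s) * Φ t) ^ 2) (Ioo 0 L) ∧
    ∫ x in Ioo 0 L, (x ^ (s - 1) * ∫ t in Ioo 0 x, (x - t) ^ (-s) * Φ t) ^ 2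
      ≤ hardyConst s ^ 2 * ∫ t in Ioo 0 L, Φ t ^ 2 := by
  have heq : ∀ x ∈ Ioo 0 L, x ^ (s - 1) * ∫ t in Ioo 0 x, (x - t) ^ (-s) * Φ t
      = ∫ t in Ioo 0 L, hardyKernel s x t * Φ t := by
    intro x hx
    rw [← integral_const_mul]
    rw [setIntegral_eq_of_subset_of_forall_sdiff_eq_zero measurableSet_Ioo
      (Ioo_subset_Ioo_right hx.2.le) (f := fun t => hardyKernel s x t * Φ t)]
    · refine setIntegral_congr_fun measurableSet_Ioo fun t ht => ?_
      rw [hardyKernel, if_pos ht.2, mul_assoc]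
    · intro t ht
      have : ¬ t < x := fun h => ht.2 ⟨ht.1.1, h⟩
      simp [hardyKernel, this]
  have hmeas : StronglyMeasurable fun x => ∫ t in Ioo 0 L, hardyKernel s x t * Φ t :=
    StronglyMeasurable.integral_prod_right (E := ℝ) (ν := volume.restrict (Ioo 0 L))
      (f := fun x t => hardyKernel s x t * Φ t)
      ((measurable_hardyKernel s).mul (hΦ.comp measurable_snd)).stronglyMeasurable
  have hmeas' : AEStronglyMeasurable
      (fun x => x ^ (s - 1) * ∫ t in Ioo 0 x, (x - t) ^ (-s) * Φ t)
      (volume.restrict (Ioo 0 L)) := by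
    refine hmeas.aestronglyMeasurable.congr ?_
    exact (ae_restrict_iff' measurableSet_Ioo).2 (Filter.Eventually.of_forall fun x hx =>
      (heq x hx).symm)
  refine ⟨hmeas', ?_⟩
  refine integral_sq_le_of_schur (μ := volume.restrict (Ioo 0 L)) (ν := volume.restrict (Ioo 0 L))
    (measurable_hardyKernel s) measurable_hardyWeight measurable_hardyWeight hardyWeight_pos
    (hardyConst_nonneg s) ?_ ?_ hΦ hΦi hmeas' ?_
  · exact (ae_restrict_iff' measurableSet_Ioo).2 (Filter.Eventually.of_forall fun x hx =>
      hardy_row hs0 hs1 hx.1 hx.2)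
  · exact (ae_restrict_iff' measurableSet_Ioo).2 (Filter.Eventually.of_forall fun x hx =>
      hardy_col hs0 hs1 hx.1)
  · exact (ae_restrict_iff' measurableSet_Ioo).2 (Filter.Eventually.of_forall fun x hx =>
      heq x hx)

theorem integrableOn_sq_of_bdd {f : ℝ → ℝ} (hf : Measurable f) {S : Set ℝ} (hS : MeasurableSet S)
    (hSf : volume S ≠ ⊤) {B : ℝ} (hB : ∀ x ∈ S, |f x| ≤ B) : IntegrableOn (fun x => f x ^ 2) S := by
  refine Measure.integrableOn_of_bounded (M := B ^ 2) hSf (hf.pow_const 2).aestronglyMeasurable ?_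
  refine (ae_restrict_iff' hS).2 (Filter.Eventually.of_forall fun x hx => ?_)
  rw [norm_pow]
  exact pow_le_pow_left₀ (norm_nonneg _) (hB x hx) 2

/-- The primitive of a mean-zero function is controlled in `L²` by its Riesz potential on the
interval. -/
theorem exists_prim_sq_le_rieszInt_sq {s L : ℝ} (hs0 : 0 < s) (hs1 : s < 1) (hL : 0 < L) :
    ∃ C > 0, ∀ ψ : ℝ → ℝ, BddSupp 0 L ψ → prim ψ L = 0 →
      ∫ x in Ioo 0 L, prim ψ x ^ 2 ≤ C * ∫ x in Ioo 0 L, rieszInt s ψ x ^ 2 := by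
  -- The constant of the coercivity identity; dividing by it is legitimate because it is positive.
  set c := betaConst s + jumpConst s with hc
  have hc0 : 0 < c := betaConst_add_jumpConst_pos hs0 hs1
  refine ⟨L ^ (2 - 2 * s) * (hardyConst s ^ 2 / c ^ 2) + 1,
    by have := Real.rpow_pos_of_pos hL (2 - 2 * s); positivity, fun ψ hψ hmean => ?_⟩
  obtain ⟨B, hB0, hB⟩ := hψ.exists_bound
  have hw := continuous_prim hψ
  have hΦb : ∀ x ∈ Ioo 0 L, |rieszInt s ψ x| ≤ 2 * (L - 0) ^ s / s * B := fun x hx =>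
    abs_rieszInt_le hs0 hψ hB (Ioo_subset_Icc_self hx)
  have hΦm := measurable_rieszInt s hψ.meas
  have hΦi : IntegrableOn (fun x => rieszInt s ψ x ^ 2) (Ioo 0 L) :=
    integrableOn_sq_of_bdd hΦm measurableSet_Ioo (by simp) hΦb
  obtain ⟨hGm, hHi, hH⟩ := hardy_inequality hs0 hs1 hΦm hΦi
  -- The weight `x ^ (2 s - 2)` is shared equally between the Abel transform and the primitive, so
  -- that the identity reads `∫ v G = c ∫ v²` and the Hardy inequality bounds `G` in `L²`.
  set G : ℝ → ℝ := fun x => x ^ (s - 1) * ∫ t in Ioo 0 x, (x - t) ^ (-s) * rieszInt s ψ t with hG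
  set v : ℝ → ℝ := fun x => x ^ (s - 1) * prim ψ x with hv
  have hvm : Measurable v := by rw [hv]; have := hw.measurable; fun_prop
  have hvb : ∀ x ∈ Ioo 0 L, |v x| ≤ B * L ^ s := by
    intro x hx
    have h1 := hx.1
    have h2 := abs_prim_sub_le hψ hB 0 x
    rw [prim_zero, sub_zero, sub_zero, abs_of_pos h1] at h2
    rw [hv]
    simp only
    rw [abs_mul, abs_of_pos (by positivity)]
    calc _ ≤ x ^ (s - 1) * (B * x) := mul_le_mul_of_nonneg_left h2 (by positivity)
      _ = B * (x ^ (s - 1) * x) := by ring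
      _ = B * x ^ s := by rw [← Real.rpow_add_one h1.ne', sub_add_cancel]
      _ ≤ _ := mul_le_mul_of_nonneg_left (Real.rpow_le_rpow h1.le hx.2.le hs0.le) hB0.le
  have hvi : IntegrableOn (fun x => v x ^ 2) (Ioo 0 L) :=
    integrableOn_sq_of_bdd hvm measurableSet_Ioo (by simp) hvb
  have hsplit : ∀ x ∈ Ioo 0 L, x ^ (2 * s - 2) = x ^ (s - 1) * x ^ (s - 1) := fun x hx => by
    rw [← Real.rpow_add hx.1]; ring_nf
  have hform := abel_form_eq hs0 hs1 hψ hL hmean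
  have e1 : ∫ x in Ioo 0 L, x ^ (2 * s - 2) * prim ψ x ^ 2 = ∫ x in Ioo 0 L, v x ^ 2 :=
    setIntegral_congr_fun measurableSet_Ioo fun x hx => by
      simp only [hv]; rw [hsplit x hx]; ring
  have e2 : ∫ x in Ioo 0 L, x ^ (2 * s - 2) * prim ψ x *
      ∫ t in Ioo 0 x, (x - t) ^ (-s) * rieszInt s ψ t = ∫ x in Ioo 0 L, v x * G x :=
    setIntegral_congr_fun measurableSet_Ioo fun x hx => by
      simp only [hv, hG]; rw [hsplit x hx]; ring
  rw [e1, e2] at hform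
  have hvG : IntegrableOn (fun x => v x * G x) (Ioo 0 L) := by
    have hv2 : MemLp v 2 (volume.restrict (Ioo 0 L)) :=
      (memLp_two_iff_integrable_sq hvm.aestronglyMeasurable).2 hvi
    have hG2 : MemLp G 2 (volume.restrict (Ioo 0 L)) :=
      (memLp_two_iff_integrable_sq hGm).2 hHi
    exact hv2.integrable_mul hG2
  have hcs := sq_integral_mul_le hvi hHi hvG
  rw [hform] at hcs
  set V := ∫ x in Ioo 0 L, v x ^ 2 with hV
  have hV0 : 0 ≤ V := integral_nonneg fun x => sq_nonneg _
  have hP0 : 0 ≤ ∫ x in Ioo 0 L, rieszInt s ψ x ^ 2 := integral_nonneg fun x => sq_nonneg _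
  have hVle : V ≤ hardyConst s ^ 2 / c ^ 2 * ∫ x in Ioo 0 L, rieszInt s ψ x ^ 2 := by
    rw [div_mul_eq_mul_div, le_div_iff₀ (by positivity)]
    rcases hV0.eq_or_lt with h | h
    · rw [← h, zero_mul]; positivity
    · have h1 : (c * V) ^ 2 ≤ V * (hardyConst s ^ 2 * ∫ x in Ioo 0 L, rieszInt s ψ x ^ 2) :=
        hcs.trans (mul_le_mul_of_nonneg_left hH hV0)
      have h2 : V * (V * c ^ 2)
          ≤ V * (hardyConst s ^ 2 * ∫ x in Ioo 0 L, rieszInt s ψ x ^ 2) := by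
        calc _ = (c * V) ^ 2 := by ring
          _ ≤ _ := h1
      exact le_of_mul_le_mul_left h2 h
  calc ∫ x in Ioo 0 L, prim ψ x ^ 2 ≤ ∫ x in Ioo 0 L, L ^ (2 - 2 * s) * v x ^ 2 := by
        refine setIntegral_mono_on ?_ (hvi.const_mul _) measurableSet_Ioo fun x hx => ?_
        · exact integrableOn_sq_of_bdd hw.measurable measurableSet_Ioo (by simp) (B := B * L)
            fun x hx => by
              have h2 := abs_prim_sub_le hψ hB 0 x
              rw [prim_zero, sub_zero, sub_zero, abs_of_pos hx.1] at h2
              exact h2.trans (mul_le_mul_of_nonneg_left hx.2.le hB0.le)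
        · have h1 := hx.1
          -- Since `2 - 2 s > 0`, the weight is removed at the cost of `L ^ (2 - 2 s)`.
          have e3 : prim ψ x ^ 2 = x ^ (2 - 2 * s) * v x ^ 2 := by
            rw [hv]
            simp only
            rw [mul_pow, sq (x ^ (s - 1)), ← hsplit x hx, ← mul_assoc, ← Real.rpow_add h1,
              show 2 - 2 * s + (2 * s - 2) = 0 by ring, Real.rpow_zero, one_mul]
          rw [e3]
          exact mul_le_mul_of_nonneg_right
            (Real.rpow_le_rpow h1.le hx.2.le (by linarith)) (sq_nonneg _)
    _ = L ^ (2 - 2 * s) * V := by rw [integral_const_mul]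
    _ ≤ L ^ (2 - 2 * s) * (hardyConst s ^ 2 / c ^ 2 * ∫ x in Ioo 0 L, rieszInt s ψ x ^ 2) :=
        mul_le_mul_of_nonneg_left hVle (Real.rpow_nonneg hL.le _)
    _ ≤ _ := by nlinarith

end LDG

namespace LDG
open MeasureTheory

/-! ### The equilibrium density -/

/-- The density whose Riesz potential is constant on `(0, L)`. -/
noncomputable def equil (s L y : ℝ) : ℝ := y ^ (-(s / 2)) * (L - y) ^ (-(s / 2))

/-- The beta integral over `(0, 1)` with exponents `p` and `q`. -/
noncomputable def betaInt (p q : ℝ) : ℝ := ∫ r in Ioo (0 : ℝ) 1, r ^ p * (1 - r) ^ q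

theorem betaInt_pos {p q : ℝ} (hp : -1 < p) (hp0 : p ≤ 0) (hq : -1 < q) (hq0 : q ≤ 0) :
    0 < betaInt p q := by
  rw [betaInt, setIntegral_pos_iff_support_of_nonneg_ae]
  · refine lt_of_lt_of_le (b := volume (Ioo (0 : ℝ) 1)) (by simp) (measure_mono ?_)
    intro τ hτ
    have h3 : 0 < 1 - τ := by linarith [hτ.2]
    have h0 := hτ.1
    refine ⟨?_, hτ⟩
    rw [Function.mem_support]
    positivity
  · refine (ae_restrict_iff' measurableSet_Ioo).2 (Filter.Eventually.of_forall fun τ hτ => ?_)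
    have h3 : 0 < 1 - τ := by linarith [hτ.2]
    have h0 := hτ.1
    simp only [Pi.zero_apply]
    positivity
  · exact integrableOn_beta hp hp0 hq hq0

theorem lintegral_beta {p q : ℝ} (hp : -1 < p) (hp0 : p ≤ 0) (hq : -1 < q) (hq0 : q ≤ 0) :
    ∫⁻ r in Ioo (0 : ℝ) 1, ENNReal.ofReal (r ^ p * (1 - r) ^ q) = ENNReal.ofReal (betaInt p q) := by
  rw [betaInt, ofReal_integral_eq_lintegral_ofReal (integrableOn_beta hp hp0 hq hq0)]
  refine (ae_restrict_iff' measurableSet_Ioo).2 (Filter.Eventually.of_forall fun θ hθ => ?_)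
  have h3 : 0 < 1 - θ := by linarith [hθ.2]
  have h0 := hθ.1
  simp only [Pi.zero_apply]
  positivity

theorem lintegral_beta_scale {p q x : ℝ} (hp : -1 < p) (hp0 : p ≤ 0) (hq : -1 < q) (hq0 : q ≤ 0)
    (hx : 0 < x) : ∫⁻ t in Ioo 0 x, ENNReal.ofReal (t ^ p * (x - t) ^ q)
      = ENNReal.ofReal (x ^ (p + q + 1) * betaInt p q) := by
  rw [lintegral_Ioo_scale hx, ENNReal.ofReal_mul (by positivity), ← lintegral_beta hp hp0 hq hq0,
    ← lintegral_const_mul' _ _ ENNReal.ofReal_ne_top,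
    ← lintegral_const_mul' _ _ ENNReal.ofReal_ne_top]
  refine setLIntegral_congr_fun measurableSet_Ioo fun θ hθ => ?_
  have h0 := hθ.1
  have h3 : 0 < 1 - θ := by linarith [hθ.2]
  rw [← ENNReal.ofReal_mul hx.le, ← ENNReal.ofReal_mul (by positivity),
    show x - x * θ = x * (1 - θ) by ring, Real.mul_rpow hx.le h3.le, Real.mul_rpow hx.le h0.le,
    Real.rpow_add hx, Real.rpow_add hx, Real.rpow_one]
  congr 1
  ring

/-- A positive Bochner integral certifies integrability, because nonintegrable functions have
integral `0` by convention. Explicit evaluations thus carry over to `ENNReal` without a separate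
integrability proof. -/
theorem lintegral_ofReal_of_integral_pos {S : Set ℝ} (hS : MeasurableSet S) {f : ℝ → ℝ}
    (hf : ∀ x ∈ S, 0 ≤ f x) (h : 0 < ∫ x in S, f x) :
    ∫⁻ x in S, ENNReal.ofReal (f x) = ENNReal.ofReal (∫ x in S, f x) := by
  have hi : IntegrableOn f S := by
    by_contra hn
    rw [integral_undef hn] at h
    exact lt_irrefl _ h
  rw [ofReal_integral_eq_lintegral_ofReal hi]
  exact (ae_restrict_iff' hS).2 (Filter.Eventually.of_forall hf)

section
variable {s L : ℝ}

/-- This factors the Riesz kernel through two one-sided Abel kernels of half the order, up to powers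
of `x` and `y`. The substitution `τ = (x - t) / (y - t)` reduces to the interval `(0, x / y)`, and
the scaling `τ = (x / y) r` to a beta integral. -/
theorem factor_integral {x y : ℝ} (hx : 0 < x) (hxy : x < y) :
    ∫ t in Ioo 0 x, t ^ (-s) * ((x - t) ^ (s / 2 - 1) * (y - t) ^ (s / 2 - 1))
      = x ^ (-(s / 2)) * y ^ (-(s / 2)) * (y - x) ^ (s - 1) * betaInt (s / 2 - 1) (-s) := by
  have hy : 0 < y := hx.trans hxy
  have hd : 0 < y - x := by linarith
  have hxy0 : 0 < x / y := by positivity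
  have himg : (fun r => 0 + x / y * r) '' Ioo (0 : ℝ) 1 = Ioo 0 (x / y) := by
    simp only [zero_add]
    rw [image_mul_left_Ioo hxy0]; simp
  rw [setIntegral_Ioo_moebius hx hxy, ← himg, setIntegral_Ioo_affine hxy0.ne' _ measurableSet_Ioo,
    betaInt, ← integral_const_mul]
  refine setIntegral_congr_fun measurableSet_Ioo fun r hr => ?_
  have h0 := hr.1
  have h3 : 0 < 1 - r := by linarith [hr.2]
  simp only [zero_add]
  set τ := x / y * r with hτ
  have hτ0 : 0 < τ := by positivity
  have hτ1 : 0 < 1 - τ := by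
    have : x / y < 1 := (div_lt_one hy).2 hxy
    have : τ < 1 := by rw [hτ]; nlinarith [hr.2]
    linarith
  have e0 : x - τ * y = x * (1 - r) := by rw [hτ]; field_simp
  have e1 : y - (x - τ * y) / (1 - τ) = (y - x) / (1 - τ) := by field_simp; ring
  have e2 : x - (x - τ * y) / (1 - τ) = τ * ((y - x) / (1 - τ)) := by field_simp; ring
  rw [e1, e2, e0, abs_of_pos hxy0]
  -- Here `z` is `y - t` in the old variable, and `x - t = τ z`.
  set z := (y - x) / (1 - τ) with hz
  have hz0 : 0 < z := div_pos hd hτ1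
  have e3 : (y - x) / (1 - τ) ^ 2 = z ^ 2 / (y - x) := by rw [hz]; field_simp
  have e4 : 1 - τ = (y - x) / z := by rw [hz]; field_simp
  rw [e3, e4, Real.mul_rpow hτ0.le hz0.le, hτ, Real.mul_rpow hxy0.le h0.le, Real.div_rpow hx.le hy.le,
    Real.div_rpow (by positivity) (by positivity), Real.mul_rpow hx.le h3.le,
    Real.div_rpow hd.le hz0.le]
  have a1 : x ^ (s / 2 - 1) = x ^ (-(s / 2)) * x ^ s * x⁻¹ := by
    rw [← Real.rpow_add hx, ← Real.rpow_neg_one x, ← Real.rpow_add hx]; ring_nf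
  have a2 : y ^ (s / 2 - 1) = y ^ (s / 2) * y⁻¹ := by
    rw [← Real.rpow_neg_one y, ← Real.rpow_add hy]; ring_nf
  have a3 : z ^ (s / 2 - 1) * z ^ (s / 2 - 1) = z ^ s * (z ^ 2)⁻¹ := by
    rw [← Real.rpow_add hz0, ← Real.rpow_natCast, ← Real.rpow_neg hz0.le, ← Real.rpow_add hz0]
    norm_num
    ring_nf
  have a4 : (y - x) ^ (s - 1) = (y - x) ^ s * (y - x)⁻¹ := by
    rw [← Real.rpow_neg_one (y - x), ← Real.rpow_add hd]; ring_nf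
  have a5 : x ^ (-s) = (x ^ s)⁻¹ := Real.rpow_neg hx.le _
  have a6 : z ^ (-s) = (z ^ s)⁻¹ := Real.rpow_neg hz0.le _
  have a7 : (y - x) ^ (-s) = ((y - x) ^ s)⁻¹ := Real.rpow_neg hd.le _
  have a8 : y ^ (-(s / 2)) = (y ^ (s / 2))⁻¹ := Real.rpow_neg hy.le _
  have p1 : x ^ s ≠ 0 := by positivity
  have p2 : z ^ s ≠ 0 := by positivity
  have p3 : (y - x) ^ s ≠ 0 := by positivity
  have p4 : y ^ (s / 2) ≠ 0 := by positivity
  have hd' := hd.ne'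
  calc _ = x / y * (z ^ 2 / (y - x) * (x ^ (-s) * (1 - r) ^ (-s) / ((y - x) ^ (-s) / z ^ (-s)) *
        (x ^ (s / 2 - 1) / y ^ (s / 2 - 1) * r ^ (s / 2 - 1)
          * (z ^ (s / 2 - 1) * z ^ (s / 2 - 1))))) := by ring
    _ = _ := by
      rw [a1, a2, a3, a4, a5, a6, a7, a8]
      field_simp

/-- One factor of the Riesz kernel. -/
noncomputable def abelKernel (s x t : ℝ) : ℝ := if t < x then (x - t) ^ (s / 2 - 1) else 0

theorem abelKernel_nonneg (s x t : ℝ) : 0 ≤ abelKernel s x t := by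
  unfold abelKernel
  split_ifs with h
  · exact Real.rpow_nonneg (by linarith) _
  · exact le_rfl

theorem measurable_abelKernel (s : ℝ) : Measurable (Function.uncurry (abelKernel s)) :=
  Measurable.ite (measurableSet_lt measurable_snd measurable_fst)
    ((measurable_fst.sub measurable_snd).pow_const _) measurable_const

theorem lintegral_factor (hs0 : 0 < s) (hs1 : s < 1) {x y : ℝ} (hx : 0 < x) (hy : 0 < y)
    (hxy : x ≠ y) :
    ∫⁻ t in Ioi 0, ENNReal.ofReal (t ^ (-s) * (abelKernel s x t * abelKernel s y t))
      = ENNReal.ofReal (x ^ (-(s / 2)) * y ^ (-(s / 2)) * |x - y| ^ (s - 1)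
          * betaInt (s / 2 - 1) (-s)) := by
  wlog h : x < y generalizing x y with H
  · rw [abs_sub_comm x y, mul_comm (x ^ _) (y ^ _), ← H hy hx hxy.symm
      (lt_of_le_of_ne (not_lt.1 h) hxy.symm)]
    simp_rw [mul_comm (abelKernel s x _)]
  have hb := betaInt_pos (p := s / 2 - 1) (q := -s) (by linarith) (by linarith) (by linarith)
    (by linarith)
  have hd : 0 < y - x := by linarith
  rw [abs_sub_comm, abs_of_pos hd, ← factor_integral hx h, ← lintegral_ofReal_of_integral_pos
    measurableSet_Ioo]
  · rw [← setLIntegral_eq_of_subset measurableSet_Ioo measurableSet_Ioi Ioo_subset_Ioi_self]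
    · refine setLIntegral_congr_fun measurableSet_Ioo fun t ht => ?_
      rw [abelKernel, if_pos ht.2, abelKernel, if_pos (ht.2.trans h)]
    · intro t ht
      have : ¬ t < x := fun h => ht.2 ⟨ht.1, h⟩
      simp [abelKernel, this]
  · intro t ht
    have h1 := ht.1
    have h2 : 0 < x - t := by linarith [ht.2]
    have h3 : 0 < y - t := by linarith [ht.2]
    positivity
  · rw [factor_integral hx h]
    positivity

/-- The exponents `-s/2` and `s/2 - 1` add up to `-1`, so the value is independent of `t`. This is
what fixes the exponent of the equilibrium density at `L`. -/
theorem lintegral_abelKernel_const (hs0 : 0 < s) (hs1 : s < 1) {t : ℝ} (ht : 0 < t) (htL : t < L) :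
    ∫⁻ y in Ioo 0 L, ENNReal.ofReal ((L - y) ^ (-(s / 2)) * abelKernel s y t)
      = ENNReal.ofReal (betaConst (s / 2)) := by
  have hb : 0 < betaConst (s / 2) :=
    betaInt_pos (p := -(s / 2)) (q := s / 2 - 1) (by linarith) (by linarith) (by linarith)
      (by linarith)
  rw [← setIntegral_rpow_mul_rpow_mid htL, ← lintegral_ofReal_of_integral_pos measurableSet_Ioo,
    ← setLIntegral_eq_of_subset measurableSet_Ioo measurableSet_Ioo (Ioo_subset_Ioo_left ht.le)]
  · refine setLIntegral_congr_fun measurableSet_Ioo fun y hy => ?_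
    rw [abelKernel, if_pos hy.1]
  · intro y hy
    have : ¬ t < y := fun h => hy.2 ⟨h, hy.1.2⟩
    simp [abelKernel, this]
  · intro y hy
    have h1 : 0 < L - y := by linarith [hy.2]
    have h2 : 0 < y - t := by linarith [hy.1]
    positivity
  · rwa [setIntegral_rpow_mul_rpow_mid htL]

/-- After factoring the Riesz kernel and exchanging the integrals, the integral over `y` is a
constant. What is left, `∫ t ^ (-s) (x - t) ^ (s/2 - 1)` over `(0, x)`, is a multiple of `x ^
(-s/2)`, which the prefactor `x ^ (s/2)` cancels. Everything is nonnegative, so Tonelli applies. -/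
theorem lintegral_equil (hs0 : 0 < s) (hs1 : s < 1) {x : ℝ} (hx : x ∈ Ioo 0 L) :
    ENNReal.ofReal (betaInt (s / 2 - 1) (-s)) *
      ∫⁻ y in Ioo 0 L, ENNReal.ofReal (|x - y| ^ (s - 1) * equil s L y)
      = ENNReal.ofReal (betaConst (s / 2)) * ENNReal.ofReal (betaInt (-s) (s / 2 - 1)) := by
  have hx0 := hx.1
  have hb := betaInt_pos (p := s / 2 - 1) (q := -s) (by linarith) (by linarith) (by linarith)
    (by linarith)
  have hkx : Measurable (abelKernel s x) := (measurable_abelKernel s).of_uncurry_left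
  have hky : ∀ t, Measurable fun y => abelKernel s y t := fun t =>
    (measurable_abelKernel s).of_uncurry_right
  rw [← lintegral_const_mul' _ _ ENNReal.ofReal_ne_top]
  have hform : ∫⁻ y in Ioo 0 L, ENNReal.ofReal (betaInt (s / 2 - 1) (-s)) *
      ENNReal.ofReal (|x - y| ^ (s - 1) * equil s L y)
      = ∫⁻ y in Ioo 0 L, ∫⁻ t in Ioi 0, ENNReal.ofReal (x ^ (s / 2)) *
        (ENNReal.ofReal (t ^ (-s) * abelKernel s x t) *
          ENNReal.ofReal ((L - y) ^ (-(s / 2)) * abelKernel s y t)) := by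
    refine lintegral_congr_ae ?_
    have hn : ∀ᵐ y : ℝ ∂volume.restrict (Ioo 0 L), y ≠ x :=
      ae_restrict_of_ae (by simp [ae_iff])
    filter_upwards [hn, ae_restrict_mem measurableSet_Ioo] with y hyx hy
    have hy0 := hy.1
    have hyL : 0 < L - y := by linarith [hy.2]
    rw [lintegral_const_mul' _ _ ENNReal.ofReal_ne_top]
    have e : ∀ t ∈ Ioi (0 : ℝ), ENNReal.ofReal (t ^ (-s) * abelKernel s x t) *
        ENNReal.ofReal ((L - y) ^ (-(s / 2)) * abelKernel s y t)
        = ENNReal.ofReal ((L - y) ^ (-(s / 2))) *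
          ENNReal.ofReal (t ^ (-s) * (abelKernel s x t * abelKernel s y t)) := by
      intro t ht
      have h1 := abelKernel_nonneg s x t
      have h2 := abelKernel_nonneg s y t
      have h3 : 0 ≤ t ^ (-s) := Real.rpow_nonneg (le_of_lt ht) _
      rw [← ENNReal.ofReal_mul (by positivity), ← ENNReal.ofReal_mul (by positivity)]
      congr 1
      ring
    rw [setLIntegral_congr_fun measurableSet_Ioi e, lintegral_const_mul' _ _ ENNReal.ofReal_ne_top,
      lintegral_factor hs0 hs1 hx0 hy0 (Ne.symm hyx), ← ENNReal.ofReal_mul (by positivity),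
      ← ENNReal.ofReal_mul (by positivity), ← ENNReal.ofReal_mul (by positivity), equil]
    congr 1
    have : x ^ (s / 2) * x ^ (-(s / 2)) = 1 := by
      rw [← Real.rpow_add hx0, add_neg_cancel, Real.rpow_zero]
    calc _ = 1 * (betaInt (s / 2 - 1) (-s) * (|x - y| ^ (s - 1) *
          (y ^ (-(s / 2)) * (L - y) ^ (-(s / 2))))) := by ring
      _ = _ := by rw [← this]; ring
  rw [hform, lintegral_lintegral_swap]
  · have hinner : ∀ t ∈ Ioi (0 : ℝ), ∫⁻ y in Ioo 0 L, ENNReal.ofReal (x ^ (s / 2)) *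
        (ENNReal.ofReal (t ^ (-s) * abelKernel s x t) *
          ENNReal.ofReal ((L - y) ^ (-(s / 2)) * abelKernel s y t))
        = ENNReal.ofReal (x ^ (s / 2)) * ENNReal.ofReal (betaConst (s / 2)) *
          ENNReal.ofReal (t ^ (-s) * abelKernel s x t) := by
      intro t ht
      rw [lintegral_const_mul' _ _ ENNReal.ofReal_ne_top,
        lintegral_const_mul' _ _ ENNReal.ofReal_ne_top]
      by_cases h : t < x
      · rw [lintegral_abelKernel_const hs0 hs1 ht (h.trans hx.2)]
        ring
      · simp [abelKernel, h]
    rw [setLIntegral_congr_fun measurableSet_Ioi hinner,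
      lintegral_const_mul' _ _ (ENNReal.mul_ne_top ENNReal.ofReal_ne_top ENNReal.ofReal_ne_top),
      ← setLIntegral_eq_of_subset measurableSet_Ioo measurableSet_Ioi
        (show Ioo 0 x ⊆ Ioi 0 from fun t ht => ht.1)]
    · have e : ∀ t ∈ Ioo 0 x, ENNReal.ofReal (t ^ (-s) * abelKernel s x t)
          = ENNReal.ofReal (t ^ (-s) * (x - t) ^ (s / 2 - 1)) := fun t ht => by
        rw [abelKernel, if_pos ht.2]
      rw [setLIntegral_congr_fun measurableSet_Ioo e, lintegral_beta_scale (by linarith)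
        (by linarith) (by linarith) (by linarith) hx0, mul_comm (ENNReal.ofReal (x ^ _)),
        mul_assoc, ← ENNReal.ofReal_mul (by positivity), ← mul_assoc (x ^ _), ← Real.rpow_add hx0,
        show s / 2 + (-s + (s / 2 - 1) + 1) = 0 by ring, Real.rpow_zero, one_mul]
    · intro t ht
      have : ¬ t < x := fun h => ht.2 ⟨ht.1, h⟩
      simp [abelKernel, this]
  · refine Measurable.aemeasurable ?_
    have h1 : Measurable fun z : ℝ × ℝ => abelKernel s x z.2 := hkx.comp measurable_snd
    have h2 : Measurable fun z : ℝ × ℝ => abelKernel s z.1 z.2 := measurable_abelKernel s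
    have h3 : Measurable fun z : ℝ × ℝ => ENNReal.ofReal (z.2 ^ (-s) * abelKernel s x z.2) :=
      (Measurable.mul (by fun_prop) h1).ennreal_ofReal
    have h4 : Measurable fun z : ℝ × ℝ =>
        ENNReal.ofReal ((L - z.1) ^ (-(s / 2)) * abelKernel s z.1 z.2) :=
      (Measurable.mul (by fun_prop) h2).ennreal_ofReal
    exact (h3.mul h4).const_mul _

theorem equil_pos {y : ℝ} (hy : y ∈ Ioo 0 L) : 0 < equil s L y := by
  have h0 := hy.1
  have h1 : 0 < L - y := by linarith [hy.2]
  rw [equil]; positivity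

theorem measurable_equil (s L : ℝ) : Measurable (equil s L) := by
  unfold equil; fun_prop

theorem integrableOn_of_lintegral_ne_top {S : Set ℝ} (hS : MeasurableSet S) {f : ℝ → ℝ}
    (hm : Measurable f) (hf : ∀ x ∈ S, 0 ≤ f x) (h : ∫⁻ x in S, ENNReal.ofReal (f x) ≠ ⊤) :
    IntegrableOn f S := by
  refine ⟨hm.aestronglyMeasurable, ?_⟩
  rw [hasFiniteIntegral_iff_ofReal ((ae_restrict_iff' hS).2 (Filter.Eventually.of_forall hf))]
  exact h.lt_top

theorem integrableOn_equil_sq (hs0 : 0 < s) (hs1 : s < 1) (hL : 0 < L) :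
    IntegrableOn (fun y => equil s L y ^ 2) (Ioo 0 L) := by
  refine integrableOn_of_lintegral_ne_top measurableSet_Ioo ((measurable_equil s L).pow_const 2)
    (fun _ _ => sq_nonneg _) ?_
  have e : ∀ y ∈ Ioo 0 L, ENNReal.ofReal (equil s L y ^ 2)
      = ENNReal.ofReal (y ^ (-s) * (L - y) ^ (-s)) := fun y hy => by
    have h0 := hy.1
    have h1 : 0 < L - y := by linarith [hy.2]
    rw [equil, mul_pow, ← Real.rpow_natCast, ← Real.rpow_natCast, ← Real.rpow_mul h0.le,
      ← Real.rpow_mul h1.le]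
    norm_num
  rw [setLIntegral_congr_fun measurableSet_Ioo e, lintegral_beta_scale (by linarith) (by linarith)
    (by linarith) (by linarith) hL]
  exact ENNReal.ofReal_ne_top

theorem exists_equil_potential (hs0 : 0 < s) (hs1 : s < 1) :
    ∃ c : ℝ, ∀ x ∈ Ioo 0 L, ∫ y in Ioo 0 L, |x - y| ^ (s - 1) * equil s L y = c := by
  have hb := betaInt_pos (p := s / 2 - 1) (q := -s) (by linarith) (by linarith) (by linarith)
    (by linarith)
  refine ⟨(ENNReal.ofReal (betaConst (s / 2)) * ENNReal.ofReal (betaInt (-s) (s / 2 - 1))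
    / ENNReal.ofReal (betaInt (s / 2 - 1) (-s))).toReal, fun x hx => ?_⟩
  have hm : Measurable fun y => |x - y| ^ (s - 1) * equil s L y := by
    have := measurable_equil s L
    fun_prop
  have hnn : ∀ y ∈ Ioo 0 L, 0 ≤ |x - y| ^ (s - 1) * equil s L y := fun y hy => by
    have := equil_pos (s := s) hy
    positivity
  rw [← lintegral_equil hs0 hs1 hx, mul_comm, ENNReal.mul_div_cancel_right
    (by simpa using hb) ENNReal.ofReal_ne_top, integral_eq_lintegral_of_nonneg_ae]
  · exact (ae_restrict_iff' measurableSet_Ioo).2 (Filter.Eventually.of_forall hnn)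
  · exact hm.aestronglyMeasurable

/-- The Riesz kernel is symmetric, so the potential can be moved to the equilibrium density, where
it is a constant; a constant pairs to zero with a mean-zero function. -/
theorem integral_equil_rieszInt (hs0 : 0 < s) (hs1 : s < 1) (hL : 0 < L) {ψ : ℝ → ℝ}
    (hψ : BddSupp 0 L ψ) (hmean : prim ψ L = 0) :
    ∫ x in Ioo 0 L, equil s L x * rieszInt s ψ x = 0 := by
  obtain ⟨B, hB0, hB⟩ := hψ.exists_bound
  obtain ⟨c, hc⟩ := exists_equil_potential (s := s) (L := L) hs0 hs1
  have hem := measurable_equil s L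
  have he2 : MemLp (equil s L) 2 (volume.restrict (Ioo 0 L)) :=
    (memLp_two_iff_integrable_sq hem.aestronglyMeasurable).2 (integrableOn_equil_sq hs0 hs1 hL)
  have he : IntegrableOn (equil s L) (Ioo 0 L) := by
    have : IsFiniteMeasure (volume.restrict (Ioo 0 L)) := ⟨by simp⟩
    exact he2.integrable one_le_two
  have hm : Measurable (fun z : ℝ × ℝ => equil s L z.1 * (|z.1 - z.2| ^ (s - 1) * ψ z.2)) :=
    (hem.comp measurable_fst).mul ((measurable_abs_sub_rpow s).mul (hψ.meas.comp measurable_snd))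
  have hprod : Integrable (fun z : ℝ × ℝ => equil s L z.1 * (|z.1 - z.2| ^ (s - 1) * ψ z.2))
      ((volume.restrict (Ioo 0 L)).prod volume) := by
    rw [integrable_prod_iff hm.aestronglyMeasurable]
    refine ⟨Filter.Eventually.of_forall fun t => ?_, ?_⟩
    · exact (hψ.integrable_mul (integrableOn_abs_sub_rpow hs0 t 0 L)).const_mul (equil s L t)
    · refine (he.mul_const (2 * (L - 0) ^ s / s * B)).mono' ?_ ?_
      · exact hm.aestronglyMeasurable.norm.integral_prod_right'
      · refine (ae_restrict_iff' measurableSet_Ioo).2 (Filter.Eventually.of_forall fun t ht => ?_)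
        have ht' := equil_pos (s := s) ht
        rw [Real.norm_of_nonneg (integral_nonneg fun y => norm_nonneg _)]
        have e : ∀ y, ‖equil s L t * (|t - y| ^ (s - 1) * ψ y)‖
            = equil s L t * (|t - y| ^ (s - 1) * |ψ y|) := by
          intro y
          rw [norm_mul, norm_mul, Real.norm_of_nonneg (by positivity),
            Real.norm_of_nonneg (by positivity), Real.norm_eq_abs]
        simp only [e]
        rw [integral_const_mul]
        have hψ' : BddSupp 0 L (fun y => |ψ y|) :=
          ⟨hψ.meas.norm, ⟨B, fun y => by simpa using hB y⟩, fun y hy => by simp [hψ.supp y hy]⟩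
        have := abs_rieszInt_le hs0 hψ' (fun y => by simpa using hB y) (x := t)
          (Ioo_subset_Icc_self ht)
        exact mul_le_mul_of_nonneg_left ((le_abs_self _).trans this) ht'.le
  have h1 := integral_integral_swap
    (f := fun t y => equil s L t * (|t - y| ^ (s - 1) * ψ y)) hprod
  simp only [integral_const_mul] at h1
  unfold rieszInt
  rw [h1]
  have h2 : ∀ᵐ y : ℝ, ∫ x in Ioo 0 L, equil s L x * (|x - y| ^ (s - 1) * ψ y) = c * ψ y := by
    have hn : ∀ c : ℝ, ∀ᵐ y : ℝ, y ≠ c := fun c => by simp [ae_iff]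
    filter_upwards [hn 0, hn L] with y h0 hyL
    by_cases hy : y ∈ Icc 0 L
    · rw [← hc y ⟨lt_of_le_of_ne hy.1 (Ne.symm h0), lt_of_le_of_ne hy.2 hyL⟩,
        ← integral_mul_const]
      refine integral_congr_ae (Filter.Eventually.of_forall fun x => ?_)
      simp only
      rw [abs_sub_comm x y]
      ring
    · simp [hψ.supp y hy]
  rw [integral_congr_ae h2, integral_const_mul]
  have h3 : ∫ y, ψ y = prim ψ L := by
    have := hψ.integral_eq (fun _ => 1)
    simp only [one_mul] at this
    rw [this, prim, intervalIntegral.integral_of_le hL.le, integral_Icc_eq_integral_Ioc]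
  rw [h3, hmean, mul_zero]

/-- If the Riesz potential of a mean-zero function is close to a constant, it is small. -/
theorem exists_rieszInt_sq_le (hs0 : 0 < s) (hs1 : s < 1) (hL : 0 < L) :
    ∃ C > 0, ∀ ψ : ℝ → ℝ, BddSupp 0 L ψ → prim ψ L = 0 → ∀ κ : ℝ,
      ∫ x in Ioo 0 L, rieszInt s ψ x ^ 2 ≤ C * ∫ x in Ioo 0 L, (rieszInt s ψ x - κ) ^ 2 := by
  set m := ∫ x in Ioo 0 L, equil s L x with hm
  set E := ∫ x in Ioo 0 L, equil s L x ^ 2 with hE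
  have hem := measurable_equil s L
  have hE2 := integrableOn_equil_sq (s := s) (L := L) hs0 hs1 hL
  have he2 : MemLp (equil s L) 2 (volume.restrict (Ioo 0 L)) :=
    (memLp_two_iff_integrable_sq hem.aestronglyMeasurable).2 hE2
  have hfin : IsFiniteMeasure (volume.restrict (Ioo 0 L)) := ⟨by simp⟩
  have he : IntegrableOn (equil s L) (Ioo 0 L) := he2.integrable one_le_two
  have hm0 : 0 < m := by
    rw [hm, setIntegral_pos_iff_support_of_nonneg_ae]
    · refine lt_of_lt_of_le (b := volume (Ioo (0 : ℝ) L)) (by simpa using hL) (measure_mono ?_)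
      exact fun y hy => ⟨(equil_pos hy).ne', hy⟩
    · exact (ae_restrict_iff' measurableSet_Ioo).2 (Filter.Eventually.of_forall fun y hy =>
        (equil_pos hy).le)
    · exact he
  have hE0 : 0 ≤ E := integral_nonneg fun _ => sq_nonneg _
  refine ⟨2 + 2 * L * E / m ^ 2, by positivity, fun ψ hψ hmean κ => ?_⟩
  obtain ⟨B, hB0, hB⟩ := hψ.exists_bound
  have hΦm := measurable_rieszInt s hψ.meas
  have hΦb : ∀ x ∈ Ioo 0 L, |rieszInt s ψ x| ≤ 2 * (L - 0) ^ s / s * B := fun x hx =>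
    abs_rieszInt_le hs0 hψ hB (Ioo_subset_Icc_self hx)
  have hΦi : IntegrableOn (fun x => rieszInt s ψ x ^ 2) (Ioo 0 L) :=
    integrableOn_sq_of_bdd hΦm measurableSet_Ioo (by simp) hΦb
  have hRm : Measurable fun x => rieszInt s ψ x - κ := hΦm.sub_const κ
  have hRi : IntegrableOn (fun x => (rieszInt s ψ x - κ) ^ 2) (Ioo 0 L) :=
    integrableOn_sq_of_bdd hRm measurableSet_Ioo (by simp)
      (fun x hx => (abs_sub _ _).trans (add_le_add_left (hΦb x hx) _))
  set R := ∫ x in Ioo 0 L, (rieszInt s ψ x - κ) ^ 2 with hR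
  have hR0 : 0 ≤ R := integral_nonneg fun _ => sq_nonneg _
  have hRL : MemLp (fun x => rieszInt s ψ x - κ) 2 (volume.restrict (Ioo 0 L)) :=
    (memLp_two_iff_integrable_sq hRm.aestronglyMeasurable).2 hRi
  have heR : IntegrableOn (fun x => equil s L x * (rieszInt s ψ x - κ)) (Ioo 0 L) :=
    he2.integrable_mul hRL
  -- Pairing with the equilibrium density annihilates the potential and isolates `κ`. Cauchy-Schwarz
  -- then bounds `κ`, because the density is square integrable for `s < 1`.
  have hκ : ∫ x in Ioo 0 L, equil s L x * (rieszInt s ψ x - κ) = -(κ * m) := by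
    have e : ∀ x, equil s L x * rieszInt s ψ x
        = equil s L x * (rieszInt s ψ x - κ) + κ * equil s L x := fun x => by ring
    have h := integral_equil_rieszInt hs0 hs1 hL hψ hmean
    simp_rw [e] at h
    rw [integral_add heR (he.const_mul κ), integral_const_mul] at h
    linarith
  have hcs := sq_integral_mul_le hE2 hRi heR
  rw [hκ] at hcs
  have hκ2 : κ ^ 2 ≤ E * R / m ^ 2 := by
    rw [le_div_iff₀ (by positivity)]
    calc κ ^ 2 * m ^ 2 = (-(κ * m)) ^ 2 := by ring
      _ ≤ _ := hcs
  calc ∫ x in Ioo 0 L, rieszInt s ψ x ^ 2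
      ≤ ∫ x in Ioo 0 L, (2 * (rieszInt s ψ x - κ) ^ 2 + 2 * κ ^ 2) := by
        refine setIntegral_mono_on hΦi ((hRi.const_mul 2).add (integrable_const _))
          measurableSet_Ioo fun x _ => ?_
        nlinarith [sq_nonneg (rieszInt s ψ x - 2 * κ)]
    _ = 2 * R + 2 * κ ^ 2 * L := by
        rw [integral_add (hRi.const_mul 2) (integrable_const _), integral_const_mul,
          setIntegral_const, Real.volume_real_Ioo_of_le hL.le, sub_zero, smul_eq_mul]
        ring
    _ ≤ 2 * R + 2 * (E * R / m ^ 2) * L := by gcongr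
    _ = _ := by ring

end
end LDG

namespace LDG
open MeasureTheory

/-! ### Positivity of the Riesz form -/

section
variable {s a b : ℝ} {ψ : ℝ → ℝ}

/-- The kernel `D ^ (s - 1)` is a positive superposition of the hat functions `max (r - D) 0`. The
normalization comes from `1 / (1 - s) - 1 / (2 - s) = 1 / ((1 - s) (2 - s))`. -/
theorem rpow_eq_integral_hat (hs1 : s < 1) {D : ℝ} (hD : 0 < D) :
    IntegrableOn (fun r : ℝ => r ^ (s - 3) * max (r - D) 0) (Ioi 0) ∧
    (1 - s) * (2 - s) * ∫ r in Ioi (0 : ℝ), r ^ (s - 3) * max (r - D) 0 = D ^ (s - 1) := by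
  have h1 : IntegrableOn (fun r : ℝ => r ^ (s - 2)) (Ioi D) :=
    integrableOn_Ioi_rpow_of_lt (by linarith) hD
  have h2 : IntegrableOn (fun r : ℝ => D * r ^ (s - 3)) (Ioi D) :=
    (integrableOn_Ioi_rpow_of_lt (by linarith) hD).const_mul D
  have e : EqOn (fun r : ℝ => r ^ (s - 2) - D * r ^ (s - 3))
      (fun r : ℝ => r ^ (s - 3) * max (r - D) 0) (Ioi D) := fun r hr => by
    have hr0 : 0 < r := hD.trans hr
    simp only
    rw [max_eq_left (by linarith [mem_Ioi.1 hr]), show s - 2 = s - 3 + 1 by ring,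
      Real.rpow_add_one hr0.ne']
    ring
  have hz : ∀ r ∈ Ioi (0 : ℝ) \ Ioi D, r ^ (s - 3) * max (r - D) 0 = 0 := fun r hr => by
    have : r ≤ D := not_lt.1 hr.2
    rw [max_eq_right (by linarith), mul_zero]
  have hsub : Ioi D ⊆ Ioi (0 : ℝ) := Ioi_subset_Ioi hD.le
  have hi : IntegrableOn (fun r : ℝ => r ^ (s - 3) * max (r - D) 0) (Ioi D) := by
    have h3 : IntegrableOn (fun r : ℝ => r ^ (s - 2) - D * r ^ (s - 3)) (Ioi D) := h1.sub h2
    exact h3.congr_fun e measurableSet_Ioi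
  refine ⟨hi.of_forall_sdiff_eq_zero measurableSet_Ioi hz, ?_⟩
  rw [setIntegral_eq_of_subset_of_forall_sdiff_eq_zero measurableSet_Ioi hsub hz,
    ← setIntegral_congr_fun measurableSet_Ioi e, integral_sub h1 h2, integral_const_mul,
    integral_Ioi_rpow_of_lt (by linarith) hD, integral_Ioi_rpow_of_lt (by linarith) hD]
  have h4 : s - 2 + 1 ≠ 0 := by linarith
  have h5 : s - 3 + 1 ≠ 0 := by linarith
  have h6 : s - 3 + 1 = s - 2 := by ring
  have h7 : s - 2 + 1 = s - 1 := by ring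
  rw [h6] at h5
  rw [h7] at h4
  rw [h6, h7]
  have h8 : D * D ^ (s - 2) = D ^ (s - 1) := by
    rw [mul_comm, ← Real.rpow_add_one hD.ne', h7]
  have h9 : D * (-D ^ (s - 2) / (s - 2)) = -D ^ (s - 1) / (s - 2) := by
    rw [← h8]; ring
  rw [h9]
  field_simp
  ring

/-- The number `max (r - |x - y|) 0` is the length of the set of `t` for which both `x` and `y` lie
in `(t, t + r]`. Hence the hat kernel is an integral of products, and its quadratic form an integral
of squares of window integrals. -/
theorem integral_window_sq (hψ : BddSupp a b ψ) {r : ℝ} (hr : 0 < r) :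
    Integrable (fun t => (∫ y in t..t + r, ψ y) ^ 2) ∧
    ∫ z : ℝ × ℝ, ψ z.1 * ψ z.2 * max (r - |z.1 - z.2|) 0 = ∫ t, (∫ y in t..t + r, ψ y) ^ 2 := by
  have hψi := hψ.integrable
  have hE : MeasurableSet {z : ℝ × ℝ | z.2 ∈ Ioc z.1 (z.1 + r)} :=
    (measurableSet_lt measurable_fst measurable_snd).inter
      (measurableSet_le measurable_snd (measurable_fst.add_const r))
  set g : ℝ → ℝ → ℝ := fun t x => (Ioc t (t + r)).indicator ψ x with hg
  have hgm : Measurable (fun z : ℝ × ℝ => g z.1 z.2) := by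
    have : (fun z : ℝ × ℝ => g z.1 z.2)
        = {z : ℝ × ℝ | z.2 ∈ Ioc z.1 (z.1 + r)}.indicator (fun z => ψ z.2) := by
      ext z
      by_cases h : z.2 ∈ Ioc z.1 (z.1 + r)
      · have h' : z ∈ {z : ℝ × ℝ | z.2 ∈ Ioc z.1 (z.1 + r)} := h
        simp only [hg, indicator_of_mem h, indicator_of_mem h']
      · have h' : z ∉ {z : ℝ × ℝ | z.2 ∈ Ioc z.1 (z.1 + r)} := h
        simp only [hg, indicator_of_notMem h, indicator_of_notMem h']
    rw [this]
    exact (hψ.meas.comp measurable_snd).indicator hE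
  have hgg : ∀ z : ℝ × ℝ, ∀ t, g t z.1 * g t z.2
      = (Ico (max z.1 z.2 - r) (min z.1 z.2)).indicator (fun _ => ψ z.1 * ψ z.2) t := by
    intro z t
    simp only [hg]
    by_cases h1 : z.1 ∈ Ioc t (t + r)
    · by_cases h2 : z.2 ∈ Ioc t (t + r)
      · rw [indicator_of_mem h1, indicator_of_mem h2, indicator_of_mem]
        exact ⟨by rw [sub_le_iff_le_add]; exact max_le h1.2 h2.2, lt_min h1.1 h2.1⟩
      · rw [indicator_of_notMem h2, mul_zero, indicator_of_notMem]
        intro h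
        refine h2 ⟨lt_of_lt_of_le h.2 (min_le_right _ _), ?_⟩
        linarith [h.1, le_max_right z.1 z.2]
    · rw [indicator_of_notMem h1, zero_mul, indicator_of_notMem]
      intro h
      refine h1 ⟨lt_of_lt_of_le h.2 (min_le_left _ _), ?_⟩
      linarith [h.1, le_max_left z.1 z.2]
  have hvol : ∀ z : ℝ × ℝ, volume.real (Ico (max z.1 z.2 - r) (min z.1 z.2))
      = max (r - |z.1 - z.2|) 0 := by
    intro z
    rw [Measure.real, Real.volume_Ico, ENNReal.toReal_ofReal', ← max_sub_min_eq_abs]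
    congr 1
    rw [max_comm z.2, min_comm z.2]
    ring
  have hm : Measurable (fun z : (ℝ × ℝ) × ℝ => g z.2 z.1.1 * g z.2 z.1.2) :=
    (hgm.comp (measurable_snd.prodMk (measurable_fst.fst))).mul
      (hgm.comp (measurable_snd.prodMk (measurable_fst.snd)))
  have hprod2 : Integrable (fun z : ℝ × ℝ => ψ z.1 * ψ z.2) (volume.prod volume) :=
    hψi.mul_prod hψi
  have hprod : Integrable (fun z : (ℝ × ℝ) × ℝ => g z.2 z.1.1 * g z.2 z.1.2)
      ((volume.prod volume).prod volume) := by
    rw [integrable_prod_iff hm.aestronglyMeasurable]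
    refine ⟨Filter.Eventually.of_forall fun z => ?_, ?_⟩
    · simp_rw [hgg]
      exact (integrable_indicator_iff measurableSet_Ico).2 (integrableOn_const (by simp))
    · refine (hprod2.norm.mul_const r).mono' hm.aestronglyMeasurable.norm.integral_prod_right'
        (Filter.Eventually.of_forall fun z => ?_)
      simp_rw [hgg, norm_indicator_eq_indicator_norm]
      rw [integral_indicator measurableSet_Ico, setIntegral_const, hvol, smul_eq_mul,
        Real.norm_of_nonneg (by positivity), mul_comm]
      refine mul_le_mul_of_nonneg_left (max_le ?_ hr.le) (norm_nonneg _)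
      linarith [abs_nonneg (z.1 - z.2)]
  have hswap := integral_integral_swap (f := fun (z : ℝ × ℝ) (t : ℝ) => g t z.1 * g t z.2) hprod
  have hin : ∀ t, ∫ z : ℝ × ℝ, g t z.1 * g t z.2 ∂(volume.prod volume)
      = (∫ y in t..t + r, ψ y) ^ 2 := by
    intro t
    rw [integral_prod_mul, hg]
    simp only
    rw [integral_indicator measurableSet_Ioc, intervalIntegral.integral_of_le (by linarith), sq]
  constructor
  · have := hprod.integral_prod_right
    simp only [hin] at this
    exact this
  · rw [← integral_congr_ae (Filter.Eventually.of_forall hin), ← hswap]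
    refine integral_congr_ae (Filter.Eventually.of_forall fun z => ?_)
    simp only
    simp_rw [hgg]
    rw [integral_indicator measurableSet_Ico, setIntegral_const, hvol, smul_eq_mul]
    ring

theorem integrable_riesz_form (hs0 : 0 < s) (hψ : BddSupp a b ψ) {φ : ℝ → ℝ}
    (hφ : BddSupp a b φ) :
    Integrable (fun z : ℝ × ℝ => |z.1 - z.2| ^ (s - 1) * (φ z.1 * ψ z.2)) (volume.prod volume) := by
  obtain ⟨B, hB0, hB⟩ := hψ.exists_bound
  have hm : Measurable (fun z : ℝ × ℝ => |z.1 - z.2| ^ (s - 1) * (φ z.1 * ψ z.2)) :=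
    (measurable_abs_sub_rpow s).mul ((hφ.meas.comp measurable_fst).mul
      (hψ.meas.comp measurable_snd))
  rw [integrable_prod_iff hm.aestronglyMeasurable]
  refine ⟨Filter.Eventually.of_forall fun t => ?_, ?_⟩
  · have := (hψ.integrable_mul (integrableOn_abs_sub_rpow hs0 t a b)).const_mul (φ t)
    refine this.congr (Filter.Eventually.of_forall fun y => ?_)
    simp only
    ring
  · refine (hφ.integrable.norm.mul_const (2 * (b - a) ^ s / s * B)).mono' ?_ ?_
    · exact hm.aestronglyMeasurable.norm.integral_prod_right'
    · refine Filter.Eventually.of_forall fun t => ?_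
      rw [Real.norm_of_nonneg (integral_nonneg fun y => norm_nonneg _)]
      by_cases ht : t ∈ Icc a b
      · have e : ∀ y, ‖|t - y| ^ (s - 1) * (φ t * ψ y)‖ = ‖φ t‖ * (|t - y| ^ (s - 1) * |ψ y|) := by
          intro y
          rw [norm_mul, norm_mul, Real.norm_of_nonneg (by positivity : 0 ≤ |t - y| ^ (s - 1)),
            Real.norm_eq_abs (ψ y)]
          ring
        simp only [e]
        rw [integral_const_mul]
        have hψ' : BddSupp a b (fun y => |ψ y|) :=
          ⟨hψ.meas.norm, ⟨B, fun y => by simpa using hB y⟩, fun y hy => by simp [hψ.supp y hy]⟩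
        have := abs_rieszInt_le hs0 hψ' (fun y => by simpa using hB y) ht
        exact mul_le_mul_of_nonneg_left ((le_abs_self _).trans this) (norm_nonneg _)
      · simp [hφ.supp t ht]

theorem integral_mul_rieszInt (hs0 : 0 < s) (hψ : BddSupp a b ψ) {φ : ℝ → ℝ}
    (hφ : BddSupp a b φ) :
    ∫ x, φ x * rieszInt s ψ x
      = ∫ z : ℝ × ℝ, |z.1 - z.2| ^ (s - 1) * (φ z.1 * ψ z.2) := by
  rw [Measure.volume_eq_prod, integral_prod _ (integrable_riesz_form hs0 hψ hφ)]
  refine integral_congr_ae (Filter.Eventually.of_forall fun x => ?_)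
  simp only [rieszInt]
  rw [← integral_const_mul]
  exact integral_congr_ae (Filter.Eventually.of_forall fun y => by simp only; ring)

/-- Combining the hat representation of the kernel with the window representation of a hat exhibits
the Riesz form as a superposition of squares. Unlike a Fourier argument, this can be localized to
cells. -/
theorem riesz_form_eq (hs0 : 0 < s) (hs1 : s < 1) (hψ : BddSupp a b ψ) :
    IntegrableOn (fun r => r ^ (s - 3) * ∫ t, (∫ y in t..t + r, ψ y) ^ 2) (Ioi 0) ∧
    ∫ x, ψ x * rieszInt s ψ x
      = (1 - s) * (2 - s) * ∫ r in Ioi 0, r ^ (s - 3) * ∫ t, (∫ y in t..t + r, ψ y) ^ 2 := by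
  have hc : 0 < (1 - s) * (2 - s) := mul_pos (by linarith) (by linarith)
  have hform := integrable_riesz_form hs0 hψ hψ
  -- The hat representation needs `x ≠ y`; the diagonal is a null set.
  have hdiag : ∀ᵐ z : ℝ × ℝ ∂(volume.prod volume), 0 < |z.1 - z.2| := by
    have hms : MeasurableSet {z : ℝ × ℝ | 0 < |z.1 - z.2|} :=
      measurableSet_lt measurable_const (measurable_fst.sub measurable_snd).norm
    rw [Measure.ae_prod_iff_ae_ae hms]
    refine Filter.Eventually.of_forall fun x => ?_
    have hn : ∀ᵐ y : ℝ, y ≠ x := by simp [ae_iff]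
    filter_upwards [hn] with y hy
    exact abs_pos.2 (sub_ne_zero.2 (Ne.symm hy))
  have hm : Measurable (fun z : (ℝ × ℝ) × ℝ =>
      ψ z.1.1 * ψ z.1.2 * (z.2 ^ (s - 3) * max (z.2 - |z.1.1 - z.1.2|) 0)) := by
    have h1 : Measurable fun z : (ℝ × ℝ) × ℝ => ψ z.1.1 * ψ z.1.2 :=
      (hψ.meas.comp measurable_fst.fst).mul (hψ.meas.comp measurable_fst.snd)
    have h2 : Measurable fun z : (ℝ × ℝ) × ℝ => z.2 ^ (s - 3) * max (z.2 - |z.1.1 - z.1.2|) 0 :=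
      (measurable_snd.pow_const _).mul
        ((measurable_snd.sub (measurable_fst.fst.sub measurable_fst.snd).norm).max
          measurable_const)
    exact h1.mul h2
  have hprod : Integrable (fun z : (ℝ × ℝ) × ℝ =>
      ψ z.1.1 * ψ z.1.2 * (z.2 ^ (s - 3) * max (z.2 - |z.1.1 - z.1.2|) 0))
      ((volume.prod volume).prod (volume.restrict (Ioi 0))) := by
    rw [integrable_prod_iff hm.aestronglyMeasurable]
    refine ⟨?_, ?_⟩
    · filter_upwards [hdiag] with z hz
      exact (rpow_eq_integral_hat hs1 hz).1.const_mul (ψ z.1 * ψ z.2)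
    · refine (hform.norm.const_mul ((1 - s) * (2 - s))⁻¹).mono'
        hm.aestronglyMeasurable.norm.integral_prod_right' ?_
      filter_upwards [hdiag] with z hz
      rw [Real.norm_of_nonneg (integral_nonneg fun y => norm_nonneg _)]
      have e : ∀ r ∈ Ioi (0 : ℝ), ‖ψ z.1 * ψ z.2 * (r ^ (s - 3) * max (r - |z.1 - z.2|) 0)‖
          = ‖ψ z.1 * ψ z.2‖ * (r ^ (s - 3) * max (r - |z.1 - z.2|) 0) := fun r hr => by
        rw [norm_mul, Real.norm_of_nonneg (mul_nonneg (Real.rpow_nonneg (le_of_lt hr) _)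
          (le_max_right _ _))]
      rw [setIntegral_congr_fun measurableSet_Ioi e, integral_const_mul, norm_mul (|z.1 - z.2| ^ _),
        Real.norm_of_nonneg (by positivity : 0 ≤ |z.1 - z.2| ^ (s - 1)),
        ← (rpow_eq_integral_hat hs1 hz).2]
      apply le_of_eq
      rw [eq_comm, ← mul_assoc, mul_comm _ ‖ψ z.1 * ψ z.2‖, ← mul_assoc, mul_assoc ‖_‖]
      have h21 : (1 - s) * (2 - s) ≠ 0 := hc.ne'
      generalize (∫ (a : ℝ) in Ioi 0, a ^ (s - 3) * max (a - |z.1 - z.2|) 0) = I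
      rw [mul_assoc, ← mul_assoc (1 - s), inv_mul_cancel_left₀ h21]
  have hswap := integral_integral_swap (f := fun (z : ℝ × ℝ) (r : ℝ) =>
    ψ z.1 * ψ z.2 * (r ^ (s - 3) * max (r - |z.1 - z.2|) 0)) hprod
  have hin : ∀ r ∈ Ioi (0 : ℝ), ∫ z : ℝ × ℝ, ψ z.1 * ψ z.2 * (r ^ (s - 3) *
      max (r - |z.1 - z.2|) 0) ∂(volume.prod volume)
      = r ^ (s - 3) * ∫ t, (∫ y in t..t + r, ψ y) ^ 2 := by
    intro r hr
    rw [← (integral_window_sq hψ hr).2, ← integral_const_mul]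
    exact integral_congr_ae (Filter.Eventually.of_forall fun z => by simp only; ring)
  constructor
  · have h := hprod.integral_prod_right
    have h' : IntegrableOn (fun r => ∫ z : ℝ × ℝ, ψ z.1 * ψ z.2 * (r ^ (s - 3) *
      max (r - |z.1 - z.2|) 0) ∂(volume.prod volume)) (Ioi 0) := h
    exact h'.congr_fun hin measurableSet_Ioi
  · rw [← setIntegral_congr_fun measurableSet_Ioi hin, ← hswap, integral_mul_rieszInt hs0 hψ hψ,
      ← integral_const_mul, Measure.volume_eq_prod]
    refine integral_congr_ae ?_
    filter_upwards [hdiag] with z hz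
    rw [integral_const_mul, ← (rpow_eq_integral_hat hs1 hz).2]
    ring

theorem sum_setIntegral_le {ι : Type*} [Fintype ι] {S : ι → Set ℝ}
    (hS : ∀ i, MeasurableSet (S i)) (hd : Pairwise (Function.onFun Disjoint S)) {g : ℝ → ℝ}
    (hg : Integrable g) (hg0 : ∀ x, 0 ≤ g x) : ∑ i, ∫ x in S i, g x ≤ ∫ x, g x := by
  rw [← integral_iUnion_fintype hS hd fun i => hg.integrableOn]
  exact setIntegral_le_integral hg (Filter.Eventually.of_forall hg0)

/-- Every contribution to the sum of squares is nonnegative, so for each cell only windows of length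
`r` in `(h/4, h/2)` starting in the left half are kept; these never leave the cell. For them `r ^ (s
- 3) ≥ h ^ (s - 3)`, the exponent being negative. -/
theorem riesz_form_ge (hs0 : 0 < s) (hs1 : s < 1) (hψ : BddSupp a b ψ) {ι : Type*} [Fintype ι]
    {l h : ι → ℝ} (hh : ∀ i, 0 < h i)
    (hd : Pairwise (Function.onFun Disjoint fun i => Ioo (l i) (l i + h i / 2))) :
    (1 - s) * (2 - s) * ∑ i, h i ^ (s - 3) * ∫ r in Ioo (h i / 4) (h i / 2),
        ∫ t in Ioo (l i) (l i + h i / 2), (∫ y in t..t + r, ψ y) ^ 2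
      ≤ ∫ x, ψ x * rieszInt s ψ x := by
  have hc : 0 < (1 - s) * (2 - s) := mul_pos (by linarith) (by linarith)
  obtain ⟨hi, he⟩ := riesz_form_eq hs0 hs1 hψ
  rw [he]
  refine mul_le_mul_of_nonneg_left ?_ hc.le
  obtain ⟨B, hB0, hB⟩ := hψ.exists_bound
  have hwin : ∀ t r, |∫ y in t..t + r, ψ y| ≤ B * |r| := fun t r => by
    have := intervalIntegral.norm_integral_le_of_norm_le_const (f := ψ) (a := t) (b := t + r)
      fun x _ => hB x
    simpa using this
  have hcont : Continuous fun z : ℝ × ℝ => (∫ y in z.1..z.1 + z.2, ψ y) ^ 2 := by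
    have hp : Continuous fun x => ∫ y in (0 : ℝ)..x, ψ y :=
      intervalIntegral.continuous_primitive (fun _ _ => hψ.integrable.intervalIntegrable) 0
    have e : ∀ z : ℝ × ℝ, ∫ y in z.1..z.1 + z.2, ψ y
        = (∫ y in (0 : ℝ)..z.1 + z.2, ψ y) - ∫ y in (0 : ℝ)..z.1, ψ y := fun z =>
      (intervalIntegral.integral_interval_sub_left hψ.integrable.intervalIntegrable
        hψ.integrable.intervalIntegrable).symm
    simp_rw [e]
    exact ((hp.comp (continuous_fst.add continuous_snd)).sub (hp.comp continuous_fst)).pow 2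
  set D : ι → ℝ → ℝ := fun i r => ∫ t in Ioo (l i) (l i + h i / 2), (∫ y in t..t + r, ψ y) ^ 2
    with hD
  have hD0 : ∀ i r, 0 ≤ D i r := fun i r => integral_nonneg fun t => sq_nonneg _
  have hDm : ∀ i, AEStronglyMeasurable (D i) volume := fun i =>
    (StronglyMeasurable.integral_prod_right (E := ℝ) (ν := volume.restrict (Ioo (l i) (l i + h i / 2)))
      (f := fun r t => (∫ y in t..t + r, ψ y) ^ 2)
      ((hcont.comp continuous_swap).stronglyMeasurable)).aestronglyMeasurable
  have hDb : ∀ i, ∀ r ∈ Ioo (h i / 4) (h i / 2), |D i r| ≤ (B * (h i / 2)) ^ 2 * (h i / 2) := by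
    intro i r hr
    have hr0 : 0 < r := lt_trans (by linarith [hh i]) hr.1
    have := norm_setIntegral_le_of_norm_le_const (μ := volume) (s := Ioo (l i) (l i + h i / 2))
      (f := fun t => (∫ y in t..t + r, ψ y) ^ 2) (C := (B * (h i / 2)) ^ 2) (by simp)
      (fun t _ => by
        rw [norm_pow]
        refine pow_le_pow_left₀ (norm_nonneg _) ((hwin t r).trans ?_) 2
        rw [abs_of_pos hr0]
        exact mul_le_mul_of_nonneg_left hr.2.le hB0.le)
    rwa [Real.volume_real_Ioo_of_le (by linarith [hh i]), add_sub_cancel_left] at this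
  have hDi : ∀ i, IntegrableOn (D i) (Ioo (h i / 4) (h i / 2)) := fun i =>
    Measure.integrableOn_of_bounded (by simp) (hDm i)
      ((ae_restrict_iff' measurableSet_Ioo).2 (Filter.Eventually.of_forall (hDb i)))
  have hind : ∀ i, Integrable ((Ioo (h i / 4) (h i / 2)).indicator
      fun r => h i ^ (s - 3) * D i r) (volume.restrict (Ioi 0)) := fun i => by
    have h1 : IntegrableOn (fun r => h i ^ (s - 3) * D i r) (Ioo (h i / 4) (h i / 2)) :=
      (hDi i).const_mul _
    exact (h1.integrable_indicator measurableSet_Ioo).restrict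
  calc ∑ i, h i ^ (s - 3) * ∫ r in Ioo (h i / 4) (h i / 2), D i r
      = ∑ i, ∫ r in Ioi 0, (Ioo (h i / 4) (h i / 2)).indicator (fun r => h i ^ (s - 3) * D i r) r := by
        refine Finset.sum_congr rfl fun i _ => ?_
        rw [setIntegral_indicator measurableSet_Ioo, inter_eq_self_of_subset_right,
          integral_const_mul]
        exact fun r hr => lt_trans (by linarith [hh i]) hr.1
    _ = ∫ r in Ioi 0, ∑ i, (Ioo (h i / 4) (h i / 2)).indicator (fun r => h i ^ (s - 3) * D i r) r :=
        (integral_finsetSum _ fun i _ => hind i).symm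
    _ ≤ _ := by
        refine setIntegral_mono_on (integrable_finsetSum _ fun i _ => hind i) hi measurableSet_Ioi
          fun r hr => ?_
        have hr0 : 0 < r := hr
        have hW := integral_window_sq hψ hr0
        calc _ ≤ ∑ i, r ^ (s - 3) * D i r := by
              refine Finset.sum_le_sum fun i _ => ?_
              by_cases hri : r ∈ Ioo (h i / 4) (h i / 2)
              · rw [indicator_of_mem hri]
                refine mul_le_mul_of_nonneg_right ?_ (hD0 i r)
                exact Real.rpow_le_rpow_of_nonpos hr0 (by linarith [hri.2, hh i]) (by linarith)
              · rw [indicator_of_notMem hri]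
                exact mul_nonneg (by positivity) (hD0 i r)
          _ = r ^ (s - 3) * ∑ i, D i r := by rw [Finset.mul_sum]
          _ ≤ _ := mul_le_mul_of_nonneg_left
              (sum_setIntegral_le (fun i => measurableSet_Ioo) hd hW.1 fun t => sq_nonneg _)
              (by positivity)

end
end LDG

namespace LDG
open MeasureTheory

/-! ### Regularity of Riesz potentials in the mean -/

section
variable {s a b : ℝ} {ψ : ℝ → ℝ}

theorem BddSupp.mono (hψ : BddSupp a b ψ) {c d : ℝ} (h : Icc a b ⊆ Icc c d) : BddSupp c d ψ :=
  ⟨hψ.meas, hψ.bdd, fun x hx => hψ.supp x fun h' => hx (h h')⟩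

/-- Left of `p` and right of `q` the difference has a sign, so its integral is a difference of
explicit integrals and at most `(q - p) ^ s / s`. Between the points the triangle inequality gives
twice this amount. -/
theorem integral_abs_rpow_sub_rpow_le_of_le (hs0 : 0 < s) (hs1 : s < 1) {p q : ℝ} (hpq : p ≤ q)
    (c d : ℝ) :
    ∫ y in Icc c d, |(|p - y| ^ (s - 1) - |q - y| ^ (s - 1))| ≤ 4 * (q - p) ^ s / s := by
  set F : ℝ → ℝ := fun y => |(|p - y| ^ (s - 1) - |q - y| ^ (s - 1))| with hF
  have hI : ∀ p e f : ℝ, IntervalIntegrable (fun y : ℝ => |p - y| ^ (s - 1)) volume e f :=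
    fun p e f => (integrableOn_abs_sub_rpow hs0 p _ _).intervalIntegrable
  have hFi : ∀ e f : ℝ, IntervalIntegrable F volume e f := fun e f => ((hI p e f).sub (hI q e f)).abs
  -- The interval is enlarged so as to contain `p` and `q`; the integrand is nonnegative.
  set c' := min c p
  set d' := max d q
  have hc' : c' ≤ p := min_le_right _ _
  have hd' : q ≤ d' := le_max_right _ _
  have h0 : ∫ y in Icc c d, F y ≤ ∫ y in c'..d', F y := by
    rw [intervalIntegral.integral_of_le (hc'.trans (hpq.trans hd')), ← integral_Icc_eq_integral_Ioc]
    refine setIntegral_mono_set ?_ (Filter.Eventually.of_forall fun y => abs_nonneg _)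
      (Icc_subset_Icc (min_le_left _ _) (le_max_left _ _)).eventuallyLE
    rw [integrableOn_Icc_iff_integrableOn_Ioc,
      ← intervalIntegrable_iff_integrableOn_Ioc_of_le (hc'.trans (hpq.trans hd'))]
    exact hFi _ _
  refine h0.trans ?_
  rw [← intervalIntegral.integral_add_adjacent_intervals (hFi c' p) (hFi p d'),
    ← intervalIntegral.integral_add_adjacent_intervals (hFi p q) (hFi q d')]
  have e1 : ∫ y in c'..p, F y ≤ (q - p) ^ s / s := by
    have : ∫ y in c'..p, F y ≤ ∫ y in c'..p, (|p - y| ^ (s - 1) - |q - y| ^ (s - 1)) := by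
      refine intervalIntegral.integral_mono_on_of_le_Ioo hc' (hFi _ _) ((hI _ _ _).sub (hI _ _ _))
        fun y hy => ?_
      simp only [hF]
      rw [abs_of_nonneg]
      rw [sub_nonneg, abs_of_pos (by linarith [hy.2]), abs_of_pos (by linarith [hy.2])]
      exact Real.rpow_le_rpow_of_nonpos (by linarith [hy.2]) (by linarith) (by linarith)
    refine this.trans ?_
    rw [intervalIntegral.integral_sub (hI _ _ _) (hI _ _ _),
      integral_abs_sub_rpow hs0 (right_mem_Icc.2 hc'), sub_self, Real.zero_rpow hs0.ne', add_zero]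
    have := integral_abs_sub_rpow hs0 (show q ∈ Icc c' q from right_mem_Icc.2 (hc'.trans hpq))
    have h2 := integral_abs_sub_rpow hs0 (show q ∈ Icc p q from right_mem_Icc.2 hpq)
    rw [sub_self, Real.zero_rpow hs0.ne', add_zero] at this h2
    have h3 := intervalIntegral.integral_add_adjacent_intervals (hI q c' p) (hI q p q)
    have h4 : (p - c') ^ s ≤ (q - c') ^ s :=
      Real.rpow_le_rpow (by linarith) (by linarith) hs0.le
    have h5 := div_le_div_of_nonneg_right h4 hs0.le
    linarith
  have e3 : ∫ y in q..d', F y ≤ (q - p) ^ s / s := by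
    have : ∫ y in q..d', F y ≤ ∫ y in q..d', (|q - y| ^ (s - 1) - |p - y| ^ (s - 1)) := by
      refine intervalIntegral.integral_mono_on_of_le_Ioo hd' (hFi _ _) ((hI _ _ _).sub (hI _ _ _))
        fun y hy => ?_
      simp only [hF]
      rw [abs_sub_comm, abs_of_nonneg]
      rw [sub_nonneg, abs_sub_comm, abs_sub_comm q, abs_of_pos (by linarith [hy.1]),
        abs_of_pos (by linarith [hy.1])]
      exact Real.rpow_le_rpow_of_nonpos (by linarith [hy.1]) (by linarith) (by linarith)
    refine this.trans ?_
    rw [intervalIntegral.integral_sub (hI _ _ _) (hI _ _ _),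
      integral_abs_sub_rpow hs0 (left_mem_Icc.2 hd'), sub_self, Real.zero_rpow hs0.ne', zero_add]
    have := integral_abs_sub_rpow hs0 (show p ∈ Icc p d' from left_mem_Icc.2 (hpq.trans hd'))
    have h2 := integral_abs_sub_rpow hs0 (show p ∈ Icc p q from left_mem_Icc.2 hpq)
    rw [sub_self, Real.zero_rpow hs0.ne', zero_add] at this h2
    have h3 := intervalIntegral.integral_add_adjacent_intervals (hI p p q) (hI p q d')
    have h4 : (d' - q) ^ s ≤ (d' - p) ^ s :=
      Real.rpow_le_rpow (by linarith) (by linarith) hs0.le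
    have h5 := div_le_div_of_nonneg_right h4 hs0.le
    linarith
  have e2 : ∫ y in p..q, F y ≤ 2 * ((q - p) ^ s / s) := by
    have : ∫ y in p..q, F y ≤ ∫ y in p..q, (|p - y| ^ (s - 1) + |q - y| ^ (s - 1)) := by
      refine intervalIntegral.integral_mono_on hpq (hFi _ _) ((hI _ _ _).add (hI _ _ _))
        fun y _ => ?_
      refine (abs_sub _ _).trans ?_
      rw [abs_of_nonneg (Real.rpow_nonneg (abs_nonneg (p - y)) _),
        abs_of_nonneg (Real.rpow_nonneg (abs_nonneg (q - y)) _)]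
    refine this.trans ?_
    have h1 := integral_abs_sub_rpow hs0 (show p ∈ Icc p q from left_mem_Icc.2 hpq)
    have h2 := integral_abs_sub_rpow hs0 (show q ∈ Icc p q from right_mem_Icc.2 hpq)
    rw [sub_self, Real.zero_rpow hs0.ne'] at h1 h2
    rw [intervalIntegral.integral_add (hI _ _ _) (hI _ _ _), h1, h2]
    apply le_of_eq
    ring
  have : 4 * (q - p) ^ s / s = (q - p) ^ s / s + 2 * ((q - p) ^ s / s) + (q - p) ^ s / s := by ring
  linarith

theorem integral_abs_rpow_sub_rpow_le (hs0 : 0 < s) (hs1 : s < 1) (p q c d : ℝ) :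
    ∫ y in Icc c d, |(|p - y| ^ (s - 1) - |q - y| ^ (s - 1))| ≤ 4 * |p - q| ^ s / s := by
  rcases le_total p q with h | h
  · rw [abs_sub_comm p q, abs_of_nonneg (sub_nonneg.2 h)]
    exact integral_abs_rpow_sub_rpow_le_of_le hs0 hs1 h c d
  · rw [abs_of_nonneg (sub_nonneg.2 h)]
    refine (le_of_eq ?_).trans (integral_abs_rpow_sub_rpow_le_of_le hs0 hs1 h c d)
    simp_rw [abs_sub_comm]

/-- Schur's test with unit weights for the difference kernel: Riesz potentials have an `L²` modulus
of continuity of order `|τ| ^ s`. -/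
theorem integral_sq_rieszInt_sub_le (hs0 : 0 < s) (hs1 : s < 1) (hψ : BddSupp a b ψ) (c d τ : ℝ) :
    ∫ x in Icc c d, (rieszInt s ψ (x + τ) - rieszInt s ψ x) ^ 2
      ≤ (4 * |τ| ^ s / s) ^ 2 * ∫ y in Icc a b, ψ y ^ 2 := by
  set K : ℝ → ℝ → ℝ := fun x y => |x + τ - y| ^ (s - 1) - |x - y| ^ (s - 1) with hK
  have hm := measurable_abs_sub_rpow s
  have hKm : Measurable (Function.uncurry K) :=
    (hm.comp (((measurable_fst.add_const τ)).prodMk measurable_snd)).sub hm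
  have hKi : ∀ x, IntegrableOn (K x) (Icc a b) := fun x =>
    (integrableOn_abs_sub_rpow hs0 (x + τ) a b).sub (integrableOn_abs_sub_rpow hs0 x a b)
  have hC : 0 ≤ 4 * |τ| ^ s / s := by positivity
  refine (integral_sq_le_of_schur hKm (φ := fun _ => 1) (χ := fun _ => 1) measurable_const
    measurable_const (fun _ => one_pos) hC ?_ ?_ hψ.meas hψ.sq.integrable.integrableOn
    (g := fun x => rieszInt s ψ (x + τ) - rieszInt s ψ x) ?_ ?_).2
  · refine Filter.Eventually.of_forall fun x => ?_
    simp only [ENNReal.ofReal_one, mul_one]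
    rw [← ofReal_integral_eq_lintegral_ofReal (hKi x).abs
      (Filter.Eventually.of_forall fun _ => abs_nonneg _)]
    have := integral_abs_rpow_sub_rpow_le hs0 hs1 (x + τ) x a b
    rw [add_sub_cancel_left] at this
    exact ENNReal.ofReal_le_ofReal this
  · refine Filter.Eventually.of_forall fun y => ?_
    simp only [ENNReal.ofReal_one, mul_one]
    have e : ∀ x, |K x y| = |(|y - τ - x| ^ (s - 1) - |y - x| ^ (s - 1))| := fun x => by
      simp only [hK]
      rw [abs_sub_comm (x + τ), abs_sub_comm x, sub_sub, add_comm τ]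
    simp_rw [e]
    have hi : IntegrableOn (fun x => |(|y - τ - x| ^ (s - 1) - |y - x| ^ (s - 1))|) (Icc c d) :=
      ((integrableOn_abs_sub_rpow hs0 (y - τ) c d).sub (integrableOn_abs_sub_rpow hs0 y c d)).abs
    rw [← ofReal_integral_eq_lintegral_ofReal hi
      (Filter.Eventually.of_forall fun _ => abs_nonneg _)]
    have := integral_abs_rpow_sub_rpow_le hs0 hs1 (y - τ) y c d
    rw [sub_sub_cancel_left, abs_neg] at this
    exact ENNReal.ofReal_le_ofReal this
  · have h := measurable_rieszInt s hψ.meas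
    exact ((h.comp (measurable_id.add_const τ)).sub h).aestronglyMeasurable
  · refine Filter.Eventually.of_forall fun x => ?_
    simp only [rieszInt, hK]
    rw [← integral_sub (hψ.integrable_mul (integrableOn_abs_sub_rpow hs0 _ a b))
      (hψ.integrable_mul (integrableOn_abs_sub_rpow hs0 _ a b)), ← hψ.integral_eq]
    exact integral_congr_ae (Filter.Eventually.of_forall fun y => by simp only; ring)

/-- The variance on an interval is controlled by the mean square difference. -/
theorem integral_sq_sub_average_le {l r B : ℝ} (hlr : l < r) {f : ℝ → ℝ} (hf : Measurable f)
    (hB : ∀ x ∈ Icc l r, |f x| ≤ B) :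
    ∫ x in Ioo l r, (f x - (r - l)⁻¹ * ∫ y in Ioo l r, f y) ^ 2
      ≤ (r - l)⁻¹ * ∫ x in Ioo l r, ∫ y in Ioo l r, (f y - f x) ^ 2 := by
  have hrl : 0 < r - l := sub_pos.2 hlr
  have hbd : ∀ g : ℝ → ℝ, Measurable g → (∃ D, ∀ x ∈ Icc l r, |g x| ≤ D) →
      IntegrableOn g (Ioo l r) := fun g hg ⟨D, hD⟩ =>
    Measure.integrableOn_of_bounded (by simp) hg.aestronglyMeasurable (M := D)
      ((ae_restrict_iff' measurableSet_Ioo).2 (Filter.Eventually.of_forall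
        fun x hx => hD x (Ioo_subset_Icc_self hx)))
  have hf1 := hbd f hf ⟨B, hB⟩
  have hf2 : IntegrableOn (fun x => f x ^ 2) (Ioo l r) := hbd _ (hf.pow_const 2) ⟨B ^ 2, fun x hx => by
    rw [abs_pow]; exact pow_le_pow_left₀ (abs_nonneg _) (hB x hx) 2⟩
  set A := ∫ y in Ioo l r, f y
  set S := ∫ y in Ioo l r, f y ^ 2
  have hv : ∀ c : ℝ, ∫ y in Ioo l r, (f y - c) ^ 2 = S - 2 * c * A + c ^ 2 * (r - l) := by
    intro c
    have e : ∀ y, (f y - c) ^ 2 = f y ^ 2 - 2 * c * f y + c ^ 2 := fun y => by ring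
    simp_rw [e]
    have i1 : IntegrableOn (fun y => f y ^ 2 - 2 * c * f y) (Ioo l r) := hf2.sub (hf1.const_mul _)
    rw [integral_add i1 (by simp), integral_sub hf2 (hf1.const_mul _), integral_const_mul,
      setIntegral_const, Real.volume_real_Ioo_of_le hlr.le, smul_eq_mul]
    ring
  rw [hv]
  simp_rw [hv]
  have i2 : IntegrableOn (fun x => S - 2 * f x * A) (Ioo l r) := by
    have : IntegrableOn (fun x => 2 * f x * A) (Ioo l r) := (hf1.const_mul 2).mul_const A
    have h0 : IntegrableOn (fun _ : ℝ => S) (Ioo l r) := by simp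
    exact h0.sub this
  have i3 : IntegrableOn (fun x => f x ^ 2 * (r - l)) (Ioo l r) := hf2.mul_const _
  rw [integral_add i2 i3, integral_sub (by simp) ((hf1.const_mul 2).mul_const A), integral_mul_const,
    integral_mul_const, integral_const_mul, setIntegral_const, Real.volume_real_Ioo_of_le hlr.le,
    smul_eq_mul]
  have h1 : 0 ≤ S - 2 * ((r - l)⁻¹ * A) * A + ((r - l)⁻¹ * A) ^ 2 * (r - l) := by
    rw [← hv]; exact integral_nonneg fun _ => sq_nonneg _
  -- The normalized double integral is exactly twice the variance.
  have h2 : (r - l)⁻¹ * ((r - l) * S - 2 * A * A + S * (r - l))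
      = 2 * (S - 2 * ((r - l)⁻¹ * A) * A + ((r - l)⁻¹ * A) ^ 2 * (r - l)) := by
    field_simp
    ring
  change _ ≤ (r - l)⁻¹ * ((r - l) * S - 2 * A * A + S * (r - l))
  rw [h2]
  linarith

theorem sum_setIntegral_le_of_subset {ι : Type*} [Fintype ι] {S : ι → Set ℝ} {E : Set ℝ}
    (hS : ∀ i, MeasurableSet (S i)) (hd : Pairwise (Function.onFun Disjoint S))
    (hSE : ∀ i, S i ⊆ E) {g : ℝ → ℝ}
    (hg : IntegrableOn g E) (hg0 : ∀ x, 0 ≤ g x) : ∑ i, ∫ x in S i, g x ≤ ∫ x in E, g x := by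
  rw [← integral_iUnion_fintype hS hd fun i => hg.mono_set (hSE i)]
  exact setIntegral_mono_set hg (Filter.Eventually.of_forall hg0)
    (iUnion_subset hSE).eventuallyLE

/-- The variance on a cell is an average over pairs of points at distance less than `h`. Writing the
pair as `x, x + τ`, summing over the cells and integrating first over `x` leaves the `L²` modulus of
continuity. The factor `2 σ` comes from `1 / width ≤ σ / h` and from the length `2 h` of the range
of `τ`. -/
theorem sum_integral_sq_rieszInt_sub_average_le (hs0 : 0 < s) (hs1 : s < 1) (hψ : BddSupp a b ψ)
    {ι : Type*} [Fintype ι] {l r : ι → ℝ} {h σ : ℝ} (hh : 0 < h) (hσ : 0 < σ) (hlr : ∀ i, l i < r i)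
    (hle : ∀ i, r i - l i ≤ h) (hge : ∀ i, h ≤ σ * (r i - l i))
    (hd : Pairwise (Function.onFun Disjoint fun i => Ioo (l i) (r i)))
    (hsub : ∀ i, Icc (l i) (r i) ⊆ Icc a b) :
    ∑ i, ∫ x in Ioo (l i) (r i), (rieszInt s ψ x - (r i - l i)⁻¹ *
        ∫ y in Ioo (l i) (r i), rieszInt s ψ y) ^ 2
      ≤ 2 * σ * (4 * h ^ s / s) ^ 2 * ∫ y in Icc a b, ψ y ^ 2 := by
  set f := rieszInt s ψ with hf
  have hfm : Measurable f := measurable_rieszInt s hψ.meas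
  obtain ⟨B, hB0, hB⟩ := hψ.exists_bound
  -- Shifted points may leave `[a, b]` by at most `h`, so the potential is bounded on the enlarged
  -- interval, in which `ψ` is still supported.
  obtain ⟨D, hD⟩ : ∃ D, ∀ x ∈ Icc (a - h) (b + h), |f x| ≤ D :=
    ⟨_, fun x hx => abs_rieszInt_le hs0
      (hψ.mono (Icc_subset_Icc (by linarith : a - h ≤ a) (by linarith : b ≤ b + h))) hB hx⟩
  have hsub' : Icc a b ⊆ Icc (a - h) (b + h) := Icc_subset_Icc (by linarith) (by linarith)
  have hGm : Measurable (fun z : ℝ × ℝ => (f (z.1 + z.2) - f z.1) ^ 2) :=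
    ((hfm.comp (measurable_fst.add measurable_snd)).sub (hfm.comp measurable_fst)).pow_const 2
  have hGb : ∀ x ∈ Icc a b, ∀ τ ∈ Ioo (-h) h, (f (x + τ) - f x) ^ 2 ≤ (D + D) ^ 2 := by
    intro x hx τ hτ
    rw [← sq_abs]
    refine pow_le_pow_left₀ (abs_nonneg _) ((abs_sub _ _).trans (add_le_add (hD _ ⟨?_, ?_⟩)
      (hD _ (hsub' hx)))) 2
    · linarith [hx.1, hτ.1]
    · linarith [hx.2, hτ.2]
  have hint : Integrable (fun z : ℝ × ℝ => (f (z.1 + z.2) - f z.1) ^ 2)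
      ((volume.restrict (Icc a b)).prod (volume.restrict (Ioo (-h) h))) := by
    rw [Measure.prod_restrict]
    refine Measure.integrableOn_of_bounded ?_ hGm.aestronglyMeasurable (M := (D + D) ^ 2)
      ((ae_restrict_iff' (measurableSet_Icc.prod measurableSet_Ioo)).2
        (Filter.Eventually.of_forall fun z hz => ?_))
    · rw [Measure.prod_prod]
      simp [ENNReal.mul_eq_top]
    · rw [Real.norm_of_nonneg (sq_nonneg _)]
      exact hGb _ hz.1 _ hz.2
  have hGx : ∀ x ∈ Icc a b, IntegrableOn (fun τ => (f (x + τ) - f x) ^ 2) (Ioo (-h) h) := by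
    intro x hx
    refine Measure.integrableOn_of_bounded (by simp)
      (hGm.comp measurable_prodMk_left).aestronglyMeasurable (M := (D + D) ^ 2)
      ((ae_restrict_iff' measurableSet_Ioo).2 (Filter.Eventually.of_forall fun τ hτ => ?_))
    rw [Real.norm_of_nonneg (sq_nonneg _)]
    exact hGb _ hx _ hτ
  have hcell : ∀ i, ∫ x in Ioo (l i) (r i), (f x - (r i - l i)⁻¹ *
        ∫ y in Ioo (l i) (r i), f y) ^ 2
      ≤ σ / h * ∫ x in Ioo (l i) (r i), ∫ τ in Ioo (-h) h, (f (x + τ) - f x) ^ 2 := by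
    intro i
    have hpos : 0 < r i - l i := sub_pos.2 (hlr i)
    refine (integral_sq_sub_average_le (hlr i) hfm fun x hx => hD x (hsub' (hsub i hx))).trans ?_
    refine mul_le_mul ?_ ?_ (integral_nonneg fun _ => integral_nonneg fun _ => sq_nonneg _)
      (by positivity)
    · rw [inv_le_iff_one_le_mul₀ hpos, div_mul_eq_mul_div, one_le_div hh]
      exact hge i
    · refine integral_mono_of_nonneg (Filter.Eventually.of_forall fun _ => integral_nonneg
        fun _ => sq_nonneg _) ?_ ((ae_restrict_iff' measurableSet_Ioo).2
          (Filter.Eventually.of_forall fun x hx => ?_))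
      · have h1 := hint.integral_prod_left
        have h2 : IntegrableOn (fun x => ∫ τ in Ioo (-h) h, (f (x + τ) - f x) ^ 2) (Icc a b) := h1
        exact h2.mono_set (Ioo_subset_Icc_self.trans (hsub i))
      · have hx' := hsub i (Ioo_subset_Icc_self hx)
        have e : ∫ y in Ioo (l i) (r i), (f y - f x) ^ 2
            = ∫ τ in Ioo (l i - x) (r i - x), (f (x + τ) - f x) ^ 2 := by
          rw [← integral_Ioc_eq_integral_Ioo, ← integral_Ioc_eq_integral_Ioo,
            ← intervalIntegral.integral_of_le (hlr i).le,
            ← intervalIntegral.integral_of_le (by linarith [hlr i]),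
            intervalIntegral.integral_comp_add_left (fun y => (f y - f x) ^ 2)]
          simp
        simp only
        rw [e]
        exact setIntegral_mono_set (hGx x hx') (Filter.Eventually.of_forall fun _ => sq_nonneg _)
          (Ioo_subset_Ioo (by linarith [hle i, hx.2]) (by linarith [hle i, hx.1])).eventuallyLE
  refine (Finset.sum_le_sum fun i _ => hcell i).trans ?_
  rw [← Finset.mul_sum]
  have h1 : IntegrableOn (fun x => ∫ τ in Ioo (-h) h, (f (x + τ) - f x) ^ 2) (Icc a b) :=
    hint.integral_prod_left
  calc _ ≤ σ / h * ∫ x in Icc a b, ∫ τ in Ioo (-h) h, (f (x + τ) - f x) ^ 2 := by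
        refine mul_le_mul_of_nonneg_left (sum_setIntegral_le_of_subset (fun _ => measurableSet_Ioo)
          hd (fun i => Ioo_subset_Icc_self.trans (hsub i)) h1
          fun x => integral_nonneg fun _ => sq_nonneg _) (by positivity)
    _ = σ / h * ∫ τ in Ioo (-h) h, ∫ x in Icc a b, (f (x + τ) - f x) ^ 2 := by
        rw [integral_integral_swap (f := fun x τ => (f (x + τ) - f x) ^ 2) hint]
    _ ≤ σ / h * ∫ τ in Ioo (-h) h, (4 * h ^ s / s) ^ 2 * ∫ y in Icc a b, ψ y ^ 2 := by
        refine mul_le_mul_of_nonneg_left (integral_mono_of_nonneg (Filter.Eventually.of_forall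
          fun _ => integral_nonneg fun _ => sq_nonneg _) (integrableOn_const (by simp))
          ((ae_restrict_iff' measurableSet_Ioo).2
          (Filter.Eventually.of_forall fun τ hτ => ?_))) (by positivity)
        refine (integral_sq_rieszInt_sub_le hs0 hs1 hψ a b τ).trans ?_
        have : |τ| ≤ h := abs_le.2 ⟨hτ.1.le, hτ.2.le⟩
        refine mul_le_mul_of_nonneg_right (pow_le_pow_left₀ (by positivity) ?_ 2)
          (integral_nonneg fun _ => sq_nonneg _)
        gcongr
    _ = _ := by
        rw [setIntegral_const, Real.volume_real_Ioo_of_le (by linarith), smul_eq_mul]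
        field_simp
        ring

end

end LDG

namespace LDG
open MeasureTheory

/-! ### Polynomials on a cell -/

section

/-- The quotient of the two functions is continuous on the compact unit sphere, and homogeneity
extends the bound. All inequalities on the reference cell come from here, so their constants do not
see the mesh. -/
theorem exists_le_mul_of_homogeneous {n : ℕ} {Q₁ Q₂ : (Fin n → ℝ) → ℝ} (h1 : Continuous Q₁)
    (h2 : Continuous Q₂) (s1 : ∀ (t : ℝ) v, Q₁ (t • v) = t ^ 2 * Q₁ v)
    (s2 : ∀ (t : ℝ) v, Q₂ (t • v) = t ^ 2 * Q₂ v) (hpos : ∀ v, v ≠ 0 → 0 < Q₁ v) :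
    ∃ C > 0, ∀ v, Q₂ v ≤ C * Q₁ v := by
  have z1 : Q₁ 0 = 0 := by simpa using s1 0 0
  have z2 : Q₂ 0 = 0 := by simpa using s2 0 0
  have hne : ∀ v ∈ Metric.sphere (0 : Fin n → ℝ) 1, Q₁ v ≠ 0 := fun v hv =>
    (hpos v (by rintro rfl; simp at hv)).ne'
  obtain ⟨C, hC⟩ := (isCompact_sphere (0 : Fin n → ℝ) 1).bddAbove_image
    (h2.continuousOn.div h1.continuousOn hne)
  refine ⟨|C| + 1, by positivity, fun v => ?_⟩
  rcases eq_or_ne v 0 with rfl | hv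
  · rw [z1, z2, mul_zero]
  have hn : ‖v‖ ≠ 0 := norm_ne_zero_iff.2 hv
  have hs : ‖v‖⁻¹ • v ∈ Metric.sphere (0 : Fin n → ℝ) 1 := by
    simp [norm_smul, hn]
  have h := hC (mem_image_of_mem _ hs)
  simp only [Pi.div_apply, s1, s2] at h
  rw [mul_div_mul_left _ _ (by positivity), div_le_iff₀ (hpos v hv)] at h
  refine h.trans (mul_le_mul_of_nonneg_right ?_ (hpos v hv).le)
  linarith [le_abs_self C]

/-- The polynomial with the given coefficients. -/
noncomputable def ofCoeffs {n : ℕ} (c : Fin n → ℝ) : ℝ[X] :=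
  ∑ j : Fin n, Polynomial.monomial (j : ℕ) (c j)

variable {n k : ℕ}

theorem eval_ofCoeffs (c : Fin n → ℝ) (x : ℝ) : (ofCoeffs c).eval x = ∑ j, c j * x ^ (j : ℕ) := by
  simp [ofCoeffs, Polynomial.eval_finsetSum]

theorem coeff_ofCoeffs (c : Fin n → ℝ) (j : Fin n) : (ofCoeffs c).coeff j = c j := by
  simp [ofCoeffs, Polynomial.finsetSum_coeff, Polynomial.coeff_monomial, Fin.val_inj]

theorem ofCoeffs_ne_zero {c : Fin n → ℝ} (hc : c ≠ 0) : ofCoeffs c ≠ 0 := by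
  obtain ⟨j, hj⟩ := Function.ne_iff.1 hc
  intro h
  have := coeff_ofCoeffs c j
  rw [h, Polynomial.coeff_zero] at this
  exact hj this.symm

theorem natDegree_ofCoeffs_le (c : Fin (k + 1) → ℝ) : (ofCoeffs c).natDegree ≤ k :=
  Polynomial.natDegree_sum_le_of_forall_le _ _ fun j _ =>
    (Polynomial.natDegree_monomial_le _).trans (Nat.lt_succ_iff.1 j.2)

theorem ofCoeffs_coeff {p : ℝ[X]} (hp : p.natDegree ≤ k) :
    ofCoeffs (fun j : Fin (k + 1) => p.coeff j) = p := by
  rw [ofCoeffs, Fin.sum_univ_eq_sum_range fun j => Polynomial.monomial j (p.coeff j)]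
  exact (p.as_sum_range' (k + 1) (Nat.lt_succ_of_le hp)).symm

theorem eq_zero_of_eval_eq_zero {p : ℝ[X]} {l r : ℝ} (hlr : l < r)
    (h : ∀ x ∈ Ioo l r, p.eval x = 0) : p = 0 :=
  Polynomial.eq_zero_of_infinite_isRoot p ((Ioo_infinite hlr).mono h)

theorem continuous_eval_ofCoeffs :
    Continuous fun z : (Fin n → ℝ) × ℝ => (ofCoeffs z.1).eval z.2 := by
  simp_rw [eval_ofCoeffs]
  fun_prop

theorem eval_ofCoeffs_smul (t : ℝ) (c : Fin n → ℝ) (x : ℝ) :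
    (ofCoeffs (t • c)).eval x = t * (ofCoeffs c).eval x := by
  simp [eval_ofCoeffs, Finset.mul_sum, mul_assoc]

theorem eqOn_zero_of_integral_eq_zero {f : ℝ → ℝ} (hf : Continuous f) {l r : ℝ} (hlr : l < r)
    (h0 : ∀ x ∈ Icc l r, 0 ≤ f x) (hi : ∫ x in l..r, f x = 0) : ∀ x ∈ Icc l r, f x = 0 := by
  by_contra! hc
  obtain ⟨x, hx, hfx⟩ := hc
  have := intervalIntegral.integral_pos hlr hf.continuousOn
    (fun y hy => h0 y (Ioc_subset_Icc_self hy)) ⟨x, hx, lt_of_le_of_ne (h0 x hx) (Ne.symm hfx)⟩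
  linarith

theorem integral_mul_eval_eq_zero {f : ℝ → ℝ} (hf : Continuous f)
    (h : ∀ j < n, ∫ x in (0 : ℝ)..1, f x * x ^ j = 0) {q : ℝ[X]} (hq : q.natDegree < n) :
    ∫ x in (0 : ℝ)..1, f x * q.eval x = 0 := by
  have e : ∀ x, f x * q.eval x = ∑ j ∈ Finset.range n, q.coeff j * (f x * x ^ j) := fun x => by
    rw [Polynomial.eval_eq_sum_range' hq, Finset.mul_sum]
    exact Finset.sum_congr rfl fun j _ => by ring
  simp_rw [e]
  rw [intervalIntegral.integral_finsetSum fun j _ => Continuous.intervalIntegrable (by fun_prop) _ _]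
  refine Finset.sum_eq_zero fun j hj => ?_
  rw [intervalIntegral.integral_const_mul, h j (Finset.mem_range.1 hj), mul_zero]

/-- A polynomial is determined by its value at an end point and by its lower moments. -/
theorem eq_zero_of_moments {e : ℝ} (he : e = 0 ∨ e = 1) {p : ℝ[X]} (hp : p.natDegree ≤ k)
    (hpe : p.eval e = 0) (h : ∀ j < k, ∫ x in (0 : ℝ)..1, p.eval x * x ^ j = 0) : p = 0 := by
  -- Write `p = (X - e) q`. Testing with `q`, of degree less than `k`, gives `∫ (x - e) q² = 0`, and
  -- `x - e` has a fixed sign because `e` is an end point.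
  obtain ⟨q, rfl⟩ := Polynomial.dvd_iff_isRoot.2 hpe
  by_contra hne
  have hq0 : q ≠ 0 := right_ne_zero_of_mul hne
  rw [Polynomial.natDegree_mul (Polynomial.X_sub_C_ne_zero e) hq0,
    Polynomial.natDegree_X_sub_C] at hp
  have hi := integral_mul_eval_eq_zero (Polynomial.continuous _) h (show q.natDegree < k by omega)
  have hz : ∀ x ∈ Icc (0 : ℝ) 1, |x - e| * q.eval x ^ 2 = 0 := by
    refine eqOn_zero_of_integral_eq_zero (by fun_prop) one_pos (fun x _ => by positivity) ?_
    rcases he with rfl | rfl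
    · refine Eq.trans ?_ hi
      refine intervalIntegral.integral_congr fun x hx => ?_
      rw [uIcc_of_le zero_le_one] at hx
      simp only [Polynomial.eval_mul, Polynomial.eval_sub, Polynomial.eval_X, Polynomial.eval_C]
      rw [abs_of_nonneg (by linarith [hx.1])]
      ring
    · rw [← neg_eq_zero, ← intervalIntegral.integral_neg]
      refine Eq.trans ?_ hi
      refine intervalIntegral.integral_congr fun x hx => ?_
      rw [uIcc_of_le zero_le_one] at hx
      simp only [Polynomial.eval_mul, Polynomial.eval_sub, Polynomial.eval_X, Polynomial.eval_C]
      rw [abs_of_nonpos (by linarith [hx.2])]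
      ring
  refine hq0 (eq_zero_of_eval_eq_zero (one_pos (α := ℝ)) fun x hx => ?_)
  have hxe : |x - e| ≠ 0 := by
    rw [abs_ne_zero, sub_ne_zero]
    rcases he with rfl | rfl
    · exact hx.1.ne'
    · exact hx.2.ne
  simpa [hxe] using hz x (Ioo_subset_Icc_self hx)

/-- By `eq_zero_of_moments` the right-hand side is positive definite in the coefficients. -/
theorem exists_sum_abs_sq_le_moments (k : ℕ) {e : ℝ} (he : e = 0 ∨ e = 1) :
    ∃ C > 0, ∀ c : Fin (k + 1) → ℝ, (∑ j, |c j|) ^ 2 ≤ C * ((ofCoeffs c).eval e ^ 2 +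
      ∑ j ∈ Finset.range k, (∫ x in (0 : ℝ)..1, (ofCoeffs c).eval x * x ^ j) ^ 2) := by
  refine exists_le_mul_of_homogeneous (Q₁ := fun c => (ofCoeffs c).eval e ^ 2 +
      ∑ j ∈ Finset.range k, (∫ x in (0 : ℝ)..1, (ofCoeffs c).eval x * x ^ j) ^ 2)
      (Q₂ := fun c : Fin (k + 1) → ℝ => (∑ j, |c j|) ^ 2) ?_ (by fun_prop) ?_ ?_ ?_
  · have h1 : Continuous fun c : Fin (k + 1) → ℝ => (ofCoeffs c).eval e :=
      continuous_eval_ofCoeffs.comp (Continuous.prodMk_left e)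
    refine (h1.pow 2).add (continuous_finsetSum _ fun j _ => Continuous.pow ?_ 2)
    exact intervalIntegral.continuous_parametric_intervalIntegral_of_continuous'
      (f := fun (c : Fin (k + 1) → ℝ) x => (ofCoeffs c).eval x * x ^ j)
      (continuous_eval_ofCoeffs.mul (continuous_snd.pow j)) 0 1
  · intro t c
    simp_rw [eval_ofCoeffs_smul, mul_assoc, intervalIntegral.integral_const_mul, mul_pow]
    rw [← Finset.mul_sum, mul_add]
  · intro t c
    simp_rw [Pi.smul_apply, smul_eq_mul, abs_mul]
    rw [← Finset.mul_sum, mul_pow, sq_abs]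
  · intro c hc
    by_contra! hn
    have h2 : 0 ≤ ∑ j ∈ Finset.range k, (∫ x in (0 : ℝ)..1, (ofCoeffs c).eval x * x ^ j) ^ 2 :=
      Finset.sum_nonneg fun _ _ => sq_nonneg _
    have h1 := sq_nonneg ((ofCoeffs c).eval e)
    have h3 : ∑ j ∈ Finset.range k, (∫ x in (0 : ℝ)..1, (ofCoeffs c).eval x * x ^ j) ^ 2 = 0 := by
      linarith
    rw [Finset.sum_eq_zero_iff_of_nonneg fun _ _ => sq_nonneg _] at h3
    refine ofCoeffs_ne_zero hc (eq_zero_of_moments he (natDegree_ofCoeffs_le c) ?_ fun j hj => ?_)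
    · exact pow_eq_zero_iff two_ne_zero |>.1 (by linarith)
    · exact pow_eq_zero_iff two_ne_zero |>.1 (h3 j (Finset.mem_range.2 hj))

theorem abs_eval_ofCoeffs_le (c : Fin n → ℝ) {x : ℝ} (hx : x ∈ Icc (0 : ℝ) 1) :
    |(ofCoeffs c).eval x| ≤ ∑ j, |c j| := by
  rw [eval_ofCoeffs]
  refine (Finset.abs_sum_le_sum_abs _ _).trans (Finset.sum_le_sum fun j _ => ?_)
  rw [abs_mul, abs_of_nonneg (pow_nonneg hx.1 _)]
  exact mul_le_of_le_one_right (abs_nonneg _) (pow_le_one₀ hx.1 hx.2)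

/-- The polynomial `p` transported to the reference cell `[0, 1]`. -/
noncomputable def refPoly (l r : ℝ) (p : ℝ[X]) : ℝ[X] :=
  p.comp (Polynomial.C l + Polynomial.C (r - l) * Polynomial.X)

theorem eval_refPoly (l r : ℝ) (p : ℝ[X]) (x : ℝ) :
    (refPoly l r p).eval x = p.eval (l + (r - l) * x) := by
  simp [refPoly, Polynomial.eval_comp]

theorem natDegree_refPoly_le {l r : ℝ} {p : ℝ[X]} (hp : p.natDegree ≤ k) :
    (refPoly l r p).natDegree ≤ k := by
  refine Polynomial.natDegree_comp_le.trans ?_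
  have : (Polynomial.C l + Polynomial.C (r - l) * Polynomial.X : ℝ[X]).natDegree ≤ 1 := by
    compute_degree
  calc _ ≤ k * 1 := Nat.mul_le_mul hp this
    _ = k := mul_one k

/-- Stability in the sup norm of the Gauss-Radau projections. -/
theorem exists_abs_eval_le_of_radau (k : ℕ) :
    ∃ C > 0, ∀ (l r e : ℝ), l < r → (e = l ∨ e = r) → ∀ (p : ℝ[X]), p.natDegree ≤ k →
      ∀ (f : ℝ → ℝ) (B : ℝ), (∀ x ∈ Icc l r, |f x| ≤ B) → p.eval e = f e →
      (∀ z : ℝ[X], z.natDegree ≤ k → ∫ x in l..r, p.eval x * z.derivative.eval x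
        = ∫ x in l..r, f x * z.derivative.eval x) →
      ∀ x ∈ Icc l r, |p.eval x| ≤ C * B := by
  obtain ⟨C₀, hC₀, h₀⟩ := exists_sum_abs_sq_le_moments k (Or.inl rfl)
  obtain ⟨C₁, hC₁, h₁⟩ := exists_sum_abs_sq_le_moments k (Or.inr rfl)
  refine ⟨√((C₀ + C₁) * (1 + k)), by positivity, ?_⟩
  intro l r e hlr he p hp f B hB hpe hz x hx
  have hh : 0 < r - l := sub_pos.2 hlr
  have hB0 : 0 ≤ B := (abs_nonneg _).trans (hB l (left_mem_Icc.2 hlr.le))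
  set P := refPoly l r p with hP
  set c : Fin (k + 1) → ℝ := fun j => P.coeff j with hc
  have hPc : ofCoeffs c = P := ofCoeffs_coeff (natDegree_refPoly_le hp)
  have hmom : ∀ j ∈ Finset.range k, (∫ y in (0 : ℝ)..1, P.eval y * y ^ j) ^ 2 ≤ B ^ 2 := by
    intro j hj
    have hj' : j + 1 ≤ k := Finset.mem_range.1 hj
    -- Its derivative is `(r - l)⁻¹ ((x - l) / (r - l)) ^ j`, so the Radau condition for `z`
    -- expresses the `j`-th moment on the reference cell by `f`. That moment is then at most `B` in
    -- absolute value.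
    set z : ℝ[X] := Polynomial.C (((r - l) ^ (j + 1) * (j + 1))⁻¹) *
      (Polynomial.X - Polynomial.C l) ^ (j + 1) with hzd
    have hzdeg : z.natDegree ≤ k := by
      refine (Polynomial.natDegree_C_mul_le _ _).trans ?_
      rw [Polynomial.natDegree_pow, Polynomial.natDegree_X_sub_C, mul_one]
      exact hj'
    have hzder : ∀ x, z.derivative.eval x = (r - l)⁻¹ * ((x - l) / (r - l)) ^ j := by
      intro x
      have hjj : (j : ℝ) + 1 ≠ 0 := by positivity
      simp only [hzd, Polynomial.derivative_C_mul, Polynomial.derivative_X_sub_C_pow,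
        Polynomial.eval_mul, Polynomial.eval_C, Polynomial.eval_pow, Polynomial.eval_sub,
        Polynomial.eval_X, Nat.add_sub_cancel, Nat.cast_add, Nat.cast_one]
      field_simp
      rw [div_pow, pow_succ]
      field_simp
    have e1 : ∫ y in (0 : ℝ)..1, P.eval y * y ^ j
        = ∫ x in l..r, p.eval x * z.derivative.eval x := by
      have := intervalIntegral.integral_comp_add_mul
        (fun x => p.eval x * z.derivative.eval x) (a := 0) (b := 1) hh.ne' l
      rw [mul_zero, mul_one, add_zero, add_sub_cancel, smul_eq_mul,
        eq_inv_mul_iff_mul_eq₀ hh.ne'] at this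
      rw [← this, ← intervalIntegral.integral_const_mul]
      refine intervalIntegral.integral_congr fun y _ => ?_
      rw [hzder, hP, eval_refPoly, add_sub_cancel_left, mul_div_cancel_left₀ _ hh.ne']
      field_simp
    rw [e1, hz z hzdeg, ← sq_abs]
    refine pow_le_pow_left₀ (abs_nonneg _) ?_ 2
    have := intervalIntegral.norm_integral_le_of_norm_le_const
      (f := fun x => f x * z.derivative.eval x) (a := l) (b := r) (C := B * (r - l)⁻¹) ?_
    · rwa [abs_of_pos hh, mul_assoc, inv_mul_cancel₀ hh.ne', mul_one] at this
    · intro x hx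
      rw [uIoc_of_le hlr.le] at hx
      rw [norm_mul, hzder, Real.norm_eq_abs, Real.norm_eq_abs, abs_mul, abs_of_pos (inv_pos.2 hh),
        abs_of_nonneg (pow_nonneg (div_nonneg (by linarith [hx.1]) hh.le) _)]
      refine mul_le_mul (hB x (Ioc_subset_Icc_self hx)) ?_ (mul_nonneg (by positivity)
        (pow_nonneg (div_nonneg (by linarith [hx.1]) hh.le) _)) hB0
      refine mul_le_of_le_one_right (by positivity) (pow_le_one₀ (div_nonneg (by linarith [hx.1])
        hh.le) ((div_le_one hh).2 (by linarith [hx.2])))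
  have hsum : ∑ j ∈ Finset.range k, (∫ y in (0 : ℝ)..1, P.eval y * y ^ j) ^ 2 ≤ k * B ^ 2 := by
    simpa using Finset.sum_le_sum hmom
  have hsum0 : 0 ≤ ∑ j ∈ Finset.range k, (∫ y in (0 : ℝ)..1, P.eval y * y ^ j) ^ 2 :=
    Finset.sum_nonneg fun _ _ => sq_nonneg _
  have hfe : f e ^ 2 ≤ B ^ 2 := by
    rw [← sq_abs]
    refine pow_le_pow_left₀ (abs_nonneg _) (hB e ?_) 2
    rcases he with rfl | rfl
    · exact left_mem_Icc.2 hlr.le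
    · exact right_mem_Icc.2 hlr.le
  have key : (∑ j, |c j|) ^ 2 ≤ (C₀ + C₁) * ((1 + k) * B ^ 2) := by
    have hQ : f e ^ 2 + ∑ j ∈ Finset.range k, (∫ y in (0 : ℝ)..1, P.eval y * y ^ j) ^ 2
        ≤ (1 + k) * B ^ 2 := by linarith
    have hQ0 : 0 ≤ f e ^ 2 + ∑ j ∈ Finset.range k, (∫ y in (0 : ℝ)..1, P.eval y * y ^ j) ^ 2 :=
      add_nonneg (sq_nonneg _) hsum0
    rcases he with rfl | rfl
    · have h := h₀ c
      rw [hPc, show P.eval 0 = f e by rw [hP, eval_refPoly, ← hpe]; simp] at h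
      exact h.trans (mul_le_mul (by linarith) hQ hQ0 (by positivity))
    · have h := h₁ c
      rw [hPc, show P.eval 1 = f e by rw [hP, eval_refPoly, ← hpe]; simp] at h
      exact h.trans (mul_le_mul (by linarith) hQ hQ0 (by positivity))
  have hev : p.eval x = (ofCoeffs c).eval ((x - l) / (r - l)) := by
    rw [hPc, hP, eval_refPoly, mul_div_cancel₀ _ hh.ne', add_sub_cancel]
  have h2 := abs_eval_ofCoeffs_le c (x := (x - l) / (r - l))
    ⟨div_nonneg (by linarith [hx.1]) hh.le, (div_le_one hh).2 (by linarith [hx.2])⟩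
  rw [← hev] at h2
  calc |p.eval x| ≤ ∑ j, |c j| := h2
    _ ≤ √((C₀ + C₁) * ((1 + k) * B ^ 2)) := Real.le_sqrt_of_sq_le key
    _ = √((C₀ + C₁) * (1 + k)) * B := by
        rw [← mul_assoc, Real.sqrt_mul (by positivity), Real.sqrt_sq hB0]

end

end LDG

namespace LDG
open MeasureTheory

/-! ### Antiderivatives, window integrals and Taylor polynomials -/

section
variable {n k : ℕ}

/-- The coefficients of the antiderivative with value `v` at `0`. -/
noncomputable def antiCoeffs (v : ℝ) (c : Fin n → ℝ) : Fin (n + 1) → ℝ :=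
  Fin.cons v fun j => c j / (j + 1)

theorem eval_antiCoeffs (v : ℝ) (c : Fin n → ℝ) (x : ℝ) :
    (ofCoeffs (antiCoeffs v c)).eval x = v + ∑ j, c j / (j + 1) * x ^ ((j : ℕ) + 1) := by
  rw [eval_ofCoeffs, Fin.sum_univ_succ]
  simp [antiCoeffs]

theorem hasDerivAt_antiCoeffs (v : ℝ) (c : Fin n → ℝ) (x : ℝ) :
    HasDerivAt (fun x => (ofCoeffs (antiCoeffs v c)).eval x) ((ofCoeffs c).eval x) x := by
  simp_rw [eval_antiCoeffs, eval_ofCoeffs]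
  refine HasDerivAt.const_add _ (HasDerivAt.fun_sum fun j _ => ?_)
  have h := ((hasDerivAt_id x).pow ((j : ℕ) + 1)).const_mul (c j / ((j : ℝ) + 1))
  refine h.congr_deriv ?_
  have : ((j : ℕ) : ℝ) + 1 ≠ 0 := by positivity
  simp
  field_simp

theorem integral_eval_ofCoeffs (c : Fin n → ℝ) (x y : ℝ) :
    ∫ z in x..y, (ofCoeffs c).eval z
      = (ofCoeffs (antiCoeffs 0 c)).eval y - (ofCoeffs (antiCoeffs 0 c)).eval x :=
  intervalIntegral.integral_eq_sub_of_hasDerivAt (fun z _ => hasDerivAt_antiCoeffs 0 c z)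
    ((Polynomial.continuous _).intervalIntegrable _ _)

/-- If all these window integrals vanish, those starting at `t = 0` say that the antiderivative is
constant on `[1/4, 1/2]`, hence that the polynomial is zero. Compactness does the rest. -/
theorem exists_integral_sq_le_window (k : ℕ) : ∃ C > 0, ∀ c : Fin (k + 1) → ℝ,
    ∫ x in (0 : ℝ)..1, (ofCoeffs c).eval x ^ 2 ≤ C * ∫ ρ in (1 / 4 : ℝ)..1 / 2,
      ∫ t in (0 : ℝ)..1 / 2, (∫ y in t..t + ρ, (ofCoeffs c).eval y) ^ 2 := by
  simp_rw [integral_eval_ofCoeffs]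
  have hc2 : Continuous fun z : ((Fin (k + 1) → ℝ) × ℝ) × ℝ =>
      ((ofCoeffs (antiCoeffs 0 z.1.1)).eval (z.2 + z.1.2)
        - (ofCoeffs (antiCoeffs 0 z.1.1)).eval z.2) ^ 2 := by
    simp_rw [eval_antiCoeffs]
    fun_prop
  have hc1 : Continuous fun z : (Fin (k + 1) → ℝ) × ℝ => ∫ t in (0 : ℝ)..1 / 2,
      ((ofCoeffs (antiCoeffs 0 z.1)).eval (t + z.2)
        - (ofCoeffs (antiCoeffs 0 z.1)).eval t) ^ 2 :=
    intervalIntegral.continuous_parametric_intervalIntegral_of_continuous'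
      (f := fun (z : (Fin (k + 1) → ℝ) × ℝ) t => ((ofCoeffs (antiCoeffs 0 z.1)).eval (t + z.2)
        - (ofCoeffs (antiCoeffs 0 z.1)).eval t) ^ 2) hc2 0 (1 / 2)
  have hsm : ∀ (t : ℝ) (c : Fin (k + 1) → ℝ), antiCoeffs 0 (t • c) = t • antiCoeffs 0 c := by
    intro t c
    ext j
    refine Fin.cases ?_ (fun j => ?_) j
    · simp [antiCoeffs]
    · simp [antiCoeffs, mul_div_assoc]
  refine exists_le_mul_of_homogeneous (Q₁ := fun c : Fin (k + 1) → ℝ => ∫ ρ in (1 / 4 : ℝ)..1 / 2,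
      ∫ t in (0 : ℝ)..1 / 2, ((ofCoeffs (antiCoeffs 0 c)).eval (t + ρ)
        - (ofCoeffs (antiCoeffs 0 c)).eval t) ^ 2)
      (Q₂ := fun c => ∫ x in (0 : ℝ)..1, (ofCoeffs c).eval x ^ 2) ?_ ?_ ?_ ?_ ?_
  · exact intervalIntegral.continuous_parametric_intervalIntegral_of_continuous'
      (f := fun (c : Fin (k + 1) → ℝ) ρ => ∫ t in (0 : ℝ)..1 / 2,
      ((ofCoeffs (antiCoeffs 0 c)).eval (t + ρ) - (ofCoeffs (antiCoeffs 0 c)).eval t) ^ 2) hc1 _ _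
  · exact intervalIntegral.continuous_parametric_intervalIntegral_of_continuous'
      (f := fun (c : Fin (k + 1) → ℝ) x => (ofCoeffs c).eval x ^ 2)
      (continuous_eval_ofCoeffs.pow 2) _ _
  · intro t c
    simp_rw [hsm, eval_ofCoeffs_smul, ← mul_sub, mul_pow, intervalIntegral.integral_const_mul]
  · intro t c
    simp_rw [eval_ofCoeffs_smul, mul_pow, intervalIntegral.integral_const_mul]
  · intro c hc
    by_contra! hn
    have hρ0 : ∀ ρ : ℝ, 0 ≤ ∫ t in (0 : ℝ)..1 / 2, ((ofCoeffs (antiCoeffs 0 c)).eval (t + ρ)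
        - (ofCoeffs (antiCoeffs 0 c)).eval t) ^ 2 := fun ρ =>
      intervalIntegral.integral_nonneg (by norm_num) fun _ _ => sq_nonneg _
    have hz := eqOn_zero_of_integral_eq_zero (hc1.comp (Continuous.prodMk_right c))
      (show (1 / 4 : ℝ) < 1 / 2 by norm_num) (fun ρ _ => hρ0 ρ)
      (le_antisymm hn (intervalIntegral.integral_nonneg (by norm_num) fun ρ _ => hρ0 ρ))
    have hk : ∀ ρ ∈ Icc (1 / 4 : ℝ) (1 / 2), (ofCoeffs (antiCoeffs 0 c)).eval ρ
        = (ofCoeffs (antiCoeffs 0 c)).eval 0 := by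
      intro ρ hρ
      have := eqOn_zero_of_integral_eq_zero
        (hc2.comp (Continuous.prodMk_right (c, ρ))) (show (0 : ℝ) < 1 / 2 by norm_num)
        (fun _ _ => sq_nonneg _) (hz ρ hρ) 0 ⟨le_rfl, by norm_num⟩
      simp only [Function.comp_apply, zero_add] at this
      exact sub_eq_zero.1 (pow_eq_zero_iff two_ne_zero |>.1 this)
    refine ofCoeffs_ne_zero hc (eq_zero_of_eval_eq_zero (show (1 / 4 : ℝ) < 1 / 2 by norm_num)
      fun x hx => ?_)
    refine (hasDerivAt_antiCoeffs 0 c x).unique ((hasDerivAt_const x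
      ((ofCoeffs (antiCoeffs 0 c)).eval 0)).congr_of_eventuallyEq ?_)
    filter_upwards [Ioo_mem_nhds hx.1 hx.2] with y hy
    exact hk y (Ioo_subset_Icc_self hy)

/-- Window integrals control the `L²` norm of a polynomial on a cell. -/
theorem exists_integral_sq_le_window_cell (k : ℕ) : ∃ C > 0, ∀ l r : ℝ, l < r → ∀ p : ℝ[X],
    p.natDegree ≤ k → ∫ x in l..r, p.eval x ^ 2 ≤ C * (((r - l) ^ 3)⁻¹ *
      ∫ ρ in Ioo ((r - l) / 4) ((r - l) / 2), ∫ t in Ioo l (l + (r - l) / 2),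
        (∫ y in t..t + ρ, p.eval y) ^ 2) := by
  obtain ⟨C, hC, h⟩ := exists_integral_sq_le_window k
  refine ⟨C, hC, fun l r hlr p hp => ?_⟩
  have hh : 0 < r - l := sub_pos.2 hlr
  have := h fun j => (refPoly l r p).coeff j
  rw [ofCoeffs_coeff (natDegree_refPoly_le hp)] at this
  simp_rw [eval_refPoly] at this
  have sc : ∀ (F : ℝ → ℝ) (x y d : ℝ), ∫ z in d + (r - l) * x..d + (r - l) * y, F z
      = (r - l) * ∫ z in x..y, F (d + (r - l) * z) := by
    intro F x y d
    rw [intervalIntegral.integral_comp_add_mul F hh.ne', smul_eq_mul, mul_inv_cancel_left₀ hh.ne']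
  have e1 : ∫ x in l..r, p.eval x ^ 2 = (r - l) * ∫ z in (0 : ℝ)..1, p.eval (l + (r - l) * z) ^ 2 := by
    rw [← sc (fun x => p.eval x ^ 2)]
    congr 1 <;> ring
  -- The four powers of the cell width come from `ρ`, from `t`, and twice from the squared inner
  -- integral. The left-hand side has one, whence the inverse cube in the statement.
  have e2 : ∫ ρ in Ioo ((r - l) / 4) ((r - l) / 2), ∫ t in Ioo l (l + (r - l) / 2),
        (∫ y in t..t + ρ, p.eval y) ^ 2 = (r - l) ^ 4 * ∫ ρ in (1 / 4 : ℝ)..1 / 2,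
      ∫ t in (0 : ℝ)..1 / 2, (∫ y in t..t + ρ, p.eval (l + (r - l) * y)) ^ 2 := by
    rw [← integral_Ioc_eq_integral_Ioo, ← intervalIntegral.integral_of_le (by linarith)]
    have a1 : (r - l) / 4 = 0 + (r - l) * (1 / 4) := by ring
    have a2 : (r - l) / 2 = 0 + (r - l) * (1 / 2) := by ring
    rw [a1, a2, sc, show (r - l) ^ 4 = (r - l) * (r - l) ^ 3 by ring, mul_assoc,
      ← intervalIntegral.integral_const_mul ((r - l) ^ 3)]
    refine congrArg _ (intervalIntegral.integral_congr fun ρ _ => ?_)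
    rw [← integral_Ioc_eq_integral_Ioo, ← intervalIntegral.integral_of_le (by linarith)]
    have a3 : ∫ t in l..l + (0 + (r - l) * (1 / 2)), (∫ y in t..t + (0 + (r - l) * ρ), p.eval y) ^ 2
        = ∫ t in l + (r - l) * 0..l + (r - l) * (1 / 2),
          (∫ y in t..t + (0 + (r - l) * ρ), p.eval y) ^ 2 := by
      congr 1 <;> ring
    rw [a3, sc (fun t => (∫ y in t..t + (0 + (r - l) * ρ), p.eval y) ^ 2),
      show (r - l) ^ 3 = (r - l) * (r - l) ^ 2 by ring, mul_assoc,
      ← intervalIntegral.integral_const_mul ((r - l) ^ 2)]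
    refine congrArg _ (intervalIntegral.integral_congr fun t _ => ?_)
    rw [show l + (r - l) * t + (0 + (r - l) * ρ) = l + (r - l) * (t + ρ) by ring, sc, mul_pow]
  rw [e1, e2]
  calc _ ≤ (r - l) * _ := mul_le_mul_of_nonneg_left this hh.le
    _ = _ := by
      field_simp

/-- `f` has `n` derivatives on `[a, b]`, and the last one is bounded by `B`. -/
def DerivChain (a b B : ℝ) : ℕ → (ℝ → ℝ) → Prop
  | 0, f => ∀ x ∈ Icc a b, |f x| ≤ B
  | n + 1, f => ∃ f' : ℝ → ℝ, (∀ x ∈ Icc a b, HasDerivAt f (f' x) x) ∧ DerivChain a b B n f'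

theorem DerivChain.mono {a b B B' : ℝ} (hB : B ≤ B') :
    ∀ {n : ℕ} {f : ℝ → ℝ}, DerivChain a b B n f → DerivChain a b B' n f
  | 0, _, h => fun x hx => (h x hx).trans hB
  | _ + 1, _, ⟨f', hf', h⟩ => ⟨f', hf', h.mono hB⟩

/-- By induction: integrate an approximation of `f'`, choose the constant so that the error vanishes
at `l`, and apply the mean value inequality, which gains one factor `r - l`. -/
theorem DerivChain.exists_taylor {a b B l r : ℝ} (hlr : l ≤ r) (hsub : Icc l r ⊆ Icc a b) :
    ∀ {n : ℕ} {f : ℝ → ℝ}, DerivChain a b B n f →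
      ∃ c : Fin n → ℝ, ∀ x ∈ Icc l r, |f x - (ofCoeffs c).eval x| ≤ B * (r - l) ^ n
  | 0, f, h => ⟨Fin.elim0, fun x hx => by simpa [eval_ofCoeffs] using h x (hsub hx)⟩
  | n + 1, f, ⟨f', hf', h⟩ => by
      obtain ⟨c, hc⟩ := h.exists_taylor hlr hsub
      set v := f l - (ofCoeffs (antiCoeffs 0 c)).eval l with hv
      refine ⟨antiCoeffs v c, fun x hx => ?_⟩
      have hl : l ∈ Icc l r := left_mem_Icc.2 hlr
      have hB : 0 ≤ B * (r - l) ^ n := (abs_nonneg _).trans (hc l hl)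
      have hm := (convex_Icc l r).norm_image_sub_le_of_norm_hasDerivWithin_le
        (f := fun x => f x - (ofCoeffs (antiCoeffs v c)).eval x)
        (f' := fun x => f' x - (ofCoeffs c).eval x)
        (fun y hy => ((hf' y (hsub hy)).sub (hasDerivAt_antiCoeffs v c y)).hasDerivWithinAt)
        (fun y hy => hc y hy) hl hx
      have h0 : f l - (ofCoeffs (antiCoeffs v c)).eval l = 0 := by
        rw [hv, eval_antiCoeffs, eval_antiCoeffs]; ring
      rw [h0, sub_zero, Real.norm_eq_abs, Real.norm_eq_abs, abs_of_nonneg (show 0 ≤ x - l by linarith [hx.1])] at hm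
      refine hm.trans ?_
      rw [pow_succ, ← mul_assoc]
      exact mul_le_mul_of_nonneg_left (by linarith [hx.2]) hB

end

end LDG

namespace LDG
open MeasureTheory

/-! ### Weak derivatives in finite dimensional spaces -/

section
variable {V W : Type*} [AddCommGroup V] [Module ℝ V] [AddCommGroup W] [Module ℝ W]

/-- The derivative of a curve in a finite dimensional space, tested by functionals. -/
def WeakDeriv (f : ℝ → V) (f' : V) (t : ℝ) : Prop :=
  ∀ ℓ : Module.Dual ℝ V, HasDerivAt (fun s => ℓ (f s)) (ℓ f') t

/-- Continuity of a curve in a finite dimensional space, tested by functionals. -/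
def WeakCont (f : ℝ → V) (S : Set ℝ) : Prop :=
  ∀ ℓ : Module.Dual ℝ V, ContinuousOn (fun s => ℓ (f s)) S

theorem WeakDeriv.map {f : ℝ → V} {f' : V} {t : ℝ} (h : WeakDeriv f f' t) (Φ : V →ₗ[ℝ] W) :
    WeakDeriv (fun s => Φ (f s)) (Φ f') t := fun ℓ => h (ℓ.comp Φ)

theorem WeakCont.map {f : ℝ → V} {S : Set ℝ} (h : WeakCont f S) (Φ : V →ₗ[ℝ] W) :
    WeakCont (fun s => Φ (f s)) S := fun ℓ => h (ℓ.comp Φ)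

theorem WeakDeriv.sub {f g : ℝ → V} {f' g' : V} {t : ℝ} (hf : WeakDeriv f f' t)
    (hg : WeakDeriv g g' t) : WeakDeriv (fun s => f s - g s) (f' - g') t := fun ℓ => by
  simp only [map_sub]
  exact (hf ℓ).fun_sub (hg ℓ)

theorem WeakCont.sub {f g : ℝ → V} {S : Set ℝ} (hf : WeakCont f S) (hg : WeakCont g S) :
    WeakCont (fun s => f s - g s) S := fun ℓ => by
  simp only [map_sub]
  exact (hf ℓ).fun_sub (hg ℓ)

/-- Cauchy-Schwarz for a nonnegative symmetric bilinear form. -/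
theorem bilin_sq_le (B : V →ₗ[ℝ] V →ₗ[ℝ] ℝ) (hs : ∀ v w, B v w = B w v) (hp : ∀ v, 0 ≤ B v v)
    (v w : V) : B v w ^ 2 ≤ B v v * B w w := by
  have key : ∀ t : ℝ, 0 ≤ B w w * (t * t) + 2 * B v w * t + B v v := fun t => by
    have := hp (v + t • w)
    simp only [map_add, map_smul, LinearMap.add_apply, LinearMap.smul_apply, smul_eq_mul] at this
    rw [hs w v] at this
    linarith
  have := discrim_le_zero key
  unfold discrim at this
  nlinarith

variable [Module.Finite ℝ V]

theorem bijective_of_separatingLeft {N : V →ₗ[ℝ] V →ₗ[ℝ] ℝ} (hN : ∀ v, (∀ z, N v z = 0) → v = 0) :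
    Function.Bijective (N : V →ₗ[ℝ] Module.Dual ℝ V) := by
  have hi : Function.Injective (N : V →ₗ[ℝ] Module.Dual ℝ V) := by
    rw [injective_iff_map_eq_zero]
    intro v hv
    exact hN v fun z => by rw [hv]; rfl
  exact ⟨hi, (LinearMap.injective_iff_surjective_of_finrank_eq_finrank
    Subspace.dual_finrank_eq.symm).1 hi⟩

theorem exists_rep {N : V →ₗ[ℝ] V →ₗ[ℝ] ℝ} (hN : ∀ v, (∀ z, N v z = 0) → v = 0) :
    ∃ R : Module.Dual ℝ V →ₗ[ℝ] V, ∀ ℓ z, N (R ℓ) z = ℓ z := by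
  refine ⟨(LinearEquiv.ofBijective N (bijective_of_separatingLeft hN)).symm.toLinearMap,
    fun ℓ z => ?_⟩
  have := (LinearEquiv.ofBijective N (bijective_of_separatingLeft hN)).apply_symm_apply ℓ
  exact LinearMap.congr_fun this z

/-- In finite dimension `v ↦ N v` is onto the dual, so a vector annihilated by all `N v` is
annihilated by every functional and is zero; thus the flipped form is nondegenerate as well. -/
theorem exists_right_rep {N : V →ₗ[ℝ] V →ₗ[ℝ] ℝ} (hN : ∀ v, (∀ z, N v z = 0) → v = 0)
    (ℓ : Module.Dual ℝ V) : ∃ z, ∀ v, N v z = ℓ v := by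
  have hf : ∀ z, (∀ v, N.flip z v = 0) → z = 0 := fun z hz => by
    rw [← Module.forall_dual_apply_eq_zero_iff ℝ]
    intro φ
    obtain ⟨v, rfl⟩ := (bijective_of_separatingLeft hN).2 φ
    exact hz v
  obtain ⟨R, hR⟩ := exists_rep hf
  exact ⟨R ℓ, fun v => hR ℓ v⟩

/-- Differentiability in time need only be checked against a nondegenerate form, since every
functional is `N · z` for some `z`. This serves the `L²` projection with `ip` and the Gauss-Radau
projection with `radauForm`. -/
theorem weakDeriv_of_separatingLeft {N : V →ₗ[ℝ] V →ₗ[ℝ] ℝ}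
    (hN : ∀ v, (∀ z, N v z = 0) → v = 0) {f : ℝ → V} {f' : V} {t : ℝ}
    (h : ∀ z, HasDerivAt (fun s => N (f s) z) (N f' z) t) : WeakDeriv f f' t := fun ℓ => by
  obtain ⟨z, hz⟩ := exists_right_rep hN ℓ
  simpa only [hz] using h z

theorem weakCont_of_separatingLeft {N : V →ₗ[ℝ] V →ₗ[ℝ] ℝ}
    (hN : ∀ v, (∀ z, N v z = 0) → v = 0) {f : ℝ → V} {S : Set ℝ}
    (h : ∀ z, ContinuousOn (fun s => N (f s) z) S) : WeakCont f S := fun ℓ => by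
  obtain ⟨z, hz⟩ := exists_right_rep hN ℓ
  simpa only [hz] using h z

theorem bilin_eq_sum (B : V →ₗ[ℝ] V →ₗ[ℝ] ℝ) (v w : V) :
    B v w = ∑ i, (Module.finBasis ℝ V).coord i v * B (Module.finBasis ℝ V i) w := by
  conv_lhs => rw [← (Module.finBasis ℝ V).sum_repr v]
  rw [map_sum, LinearMap.sum_apply]
  refine Finset.sum_congr rfl fun i _ => ?_
  rw [map_smul, LinearMap.smul_apply, smul_eq_mul, Module.Basis.coord_apply]

theorem WeakDeriv.bilin_self {f : ℝ → V} {f' : V} {t : ℝ} (h : WeakDeriv f f' t)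
    (B : V →ₗ[ℝ] V →ₗ[ℝ] ℝ) :
    HasDerivAt (fun s => B (f s) (f s)) (B f' (f t) + B (f t) f') t := by
  have e : (fun s => B (f s) (f s)) = fun s => _ := funext fun s => bilin_eq_sum B (f s) (f s)
  rw [e, bilin_eq_sum B f', bilin_eq_sum B (f t), ← Finset.sum_add_distrib]
  exact HasDerivAt.fun_sum fun i _ => (h _).mul (h _)

theorem WeakCont.bilin_self {f : ℝ → V} {S : Set ℝ} (h : WeakCont f S)
    (B : V →ₗ[ℝ] V →ₗ[ℝ] ℝ) : ContinuousOn (fun s => B (f s) (f s)) S := by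
  have e : (fun s => B (f s) (f s)) = fun s => _ := funext fun s => bilin_eq_sum B (f s) (f s)
  rw [e]
  exact continuousOn_finsetSum _ fun i _ => (h _).mul (h _)

end

/-! ### Piecewise polynomials -/

section
variable {a b : ℝ} {M : Mesh a b} {k : ℕ}

theorem Mesh.left_lt_right (M : Mesh a b) (i : Fin M.K) : M.left i < M.right i :=
  M.strictMono i.castSucc_lt_succ

theorem Mesh.width_pos (M : Mesh a b) (i : Fin M.K) : 0 < M.width i :=
  sub_pos.2 (M.left_lt_right i)

theorem Mesh.node_mem (M : Mesh a b) (j : Fin (M.K + 1)) : M.node j ∈ Icc a b := by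
  have h1 : M.node 0 ≤ M.node j := M.strictMono.monotone (Fin.zero_le j)
  have h2 : M.node j ≤ M.node (Fin.last M.K) := M.strictMono.monotone (Fin.le_last j)
  rw [M.first] at h1
  rw [M.last] at h2
  exact ⟨h1, h2⟩

theorem Mesh.cell_subset (M : Mesh a b) (i : Fin M.K) : Icc (M.left i) (M.right i) ⊆ Icc a b :=
  Icc_subset_Icc (M.node_mem _).1 (M.node_mem _).2

theorem Mesh.K_pos (M : Mesh a b) (hab : a < b) : 0 < M.K := by
  by_contra h
  have h0 : M.K = 0 := by omega
  have : (0 : Fin (M.K + 1)) = Fin.last M.K := by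
    ext; simp [h0]
  have h1 := M.first
  rw [this, M.last] at h1
  exact hab.ne' h1

theorem Mesh.width_le_size (M : Mesh a b) (i : Fin M.K) : M.width i ≤ M.size :=
  le_ciSup (Set.finite_range _).bddAbove i

theorem Mesh.size_pos (M : Mesh a b) (hab : a < b) : 0 < M.size :=
  (M.width_pos ⟨0, M.K_pos hab⟩).trans_le (M.width_le_size _)

theorem Mesh.pairwise_disjoint_Ioc (M : Mesh a b) :
    Pairwise (Function.onFun Disjoint fun i => Ioc (M.left i) (M.right i)) := by
  have key : ∀ i j : Fin M.K, i < j → Disjoint (Ioc (M.left i) (M.right i))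
      (Ioc (M.left j) (M.right j)) := by
    intro i j hij
    rw [Set.disjoint_left]
    intro x hx hx'
    have : M.right i ≤ M.left j := M.strictMono.monotone (by
      rw [Fin.le_def]; simp only [Fin.val_succ, Fin.val_castSucc]; exact hij)
    linarith [hx.2, hx'.1]
  intro i j hij
  rcases lt_or_gt_of_ne hij with h | h
  · exact key i j h
  · exact (key j i h).symm

theorem Mesh.integral_eq_sum (M : Mesh a b) {f : ℝ → ℝ} (hf : IntegrableOn f (Icc a b)) :
    ∫ x in a..b, f x = ∑ i, ∫ x in M.left i..M.right i, f x := by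
  have hi : ∀ p ∈ Icc a b, ∀ q ∈ Icc a b, IntervalIntegrable f volume p q := fun p hp q hq =>
    (hf.mono_set (uIcc_subset_Icc hp hq)).intervalIntegrable
  have ha : a ∈ Icc a b := by simpa [M.first] using M.node_mem 0
  have key : ∀ n (hn : n < M.K + 1), ∫ x in a..M.node ⟨n, hn⟩, f x
      = ∑ i : Fin n, ∫ x in M.left (i.castLE (by omega))..M.right (i.castLE (by omega)), f x := by
    intro n
    induction n with
    | zero =>
      intro hn
      have : M.node ⟨0, hn⟩ = a := M.first
      rw [this]
      simp
    | succ n ih =>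
      intro hn
      rw [Fin.sum_univ_castSucc, ← intervalIntegral.integral_add_adjacent_intervals
        (hi a ha _ (M.node_mem ⟨n, by omega⟩))
        (hi _ (M.node_mem _) _ (M.node_mem _)), ih (by omega)]
      rfl
  have := key M.K (by omega)
  rw [show (⟨M.K, by omega⟩ : Fin (M.K + 1)) = Fin.last M.K from rfl, M.last] at this
  rw [this]
  rfl

instance : Module.Finite ℝ (Polynomial.degreeLE ℝ (k : WithBot ℕ)) := by
  refine Module.Finite.of_injective (LinearMap.pi fun j : Fin (k + 1) =>
    (Polynomial.lcoeff ℝ j).comp (Submodule.subtype (Polynomial.degreeLE ℝ (k : WithBot ℕ))))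
    fun p q h => Subtype.ext ?_
  have hd : ∀ p : Polynomial.degreeLE ℝ (k : WithBot ℕ), (p : ℝ[X]).natDegree ≤ k := fun p =>
    Polynomial.natDegree_le_of_degree_le (Polynomial.mem_degreeLE.1 p.2)
  rw [← ofCoeffs_coeff (hd p), ← ofCoeffs_coeff (hd q)]
  exact congrArg ofCoeffs h

theorem cellVal_add (v w : M.Space k) (i : Fin M.K) (x : ℝ) :
    cellVal (v + w) i x = cellVal v i x + cellVal w i x := by simp [cellVal]

theorem cellVal_smul (c : ℝ) (v : M.Space k) (i : Fin M.K) (x : ℝ) :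
    cellVal (c • v) i x = c * cellVal v i x := by simp [cellVal]

theorem cellDer_add (v w : M.Space k) (i : Fin M.K) (x : ℝ) :
    cellDer (v + w) i x = cellDer v i x + cellDer w i x := by simp [cellDer]

theorem cellDer_smul (c : ℝ) (v : M.Space k) (i : Fin M.K) (x : ℝ) :
    cellDer (c • v) i x = c * cellDer v i x := by simp [cellDer]

theorem continuous_cellVal (v : M.Space k) (i : Fin M.K) : Continuous (cellVal v i) :=
  Polynomial.continuous _

theorem continuous_cellDer (v : M.Space k) (i : Fin M.K) : Continuous (cellDer v i) :=
  Polynomial.continuous _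

theorem hasDerivAt_cellVal (v : M.Space k) (i : Fin M.K) (x : ℝ) :
    HasDerivAt (cellVal v i) (cellDer v i x) x := Polynomial.hasDerivAt _ x

theorem natDegree_le (v : M.Space k) (i : Fin M.K) : (v i : ℝ[X]).natDegree ≤ k :=
  Polynomial.natDegree_le_of_degree_le (Polynomial.mem_degreeLE.1 (v i).2)

/-- A polynomial of degree at most `k` on one cell, extended by zero to the other cells. -/
noncomputable def single (M : Mesh a b) (i : Fin M.K) {p : ℝ[X]} (hp : p.natDegree ≤ k) : M.Space k :=
  Pi.single i ⟨p, Polynomial.mem_degreeLE.2 (Polynomial.degree_le_of_natDegree_le hp)⟩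

theorem cellVal_single_self {i : Fin M.K} {p : ℝ[X]} (hp : p.natDegree ≤ k) (x : ℝ) :
    cellVal (single M i hp) i x = p.eval x := by simp [cellVal, single]

theorem cellDer_single_self {i : Fin M.K} {p : ℝ[X]} (hp : p.natDegree ≤ k) (x : ℝ) :
    cellDer (single M i hp) i x = p.derivative.eval x := by simp [cellDer, single]

theorem cellVal_single_ne {i j : Fin M.K} (h : j ≠ i) {p : ℝ[X]} (hp : p.natDegree ≤ k) (x : ℝ) :
    cellVal (single M i hp) j x = 0 := by simp [cellVal, single, h]

theorem cellDer_single_ne {i j : Fin M.K} (h : j ≠ i) {p : ℝ[X]} (hp : p.natDegree ≤ k) (x : ℝ) :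
    cellDer (single M i hp) j x = 0 := by simp [cellDer, single, h]

theorem toFun_eq_cellVal (v : M.Space k) {i : Fin M.K} {x : ℝ}
    (hx : x ∈ Ioc (M.left i) (M.right i)) : toFun v x = cellVal v i x := by
  rw [toFun, Finset.sum_eq_single i, indicator_of_mem hx]
  · intro j _ hj
    exact indicator_of_notMem (fun h => (Set.disjoint_left.1 (M.pairwise_disjoint_Ioc hj) h) hx) _
  · simp

theorem toFun_add (v w : M.Space k) : toFun (v + w) = fun x => toFun v x + toFun w x := by
  ext x
  simp only [toFun, ← Finset.sum_add_distrib]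
  refine Finset.sum_congr rfl fun i _ => ?_
  by_cases h : x ∈ Ioc (M.left i) (M.right i) <;> simp [h, cellVal_add]

theorem toFun_smul (c : ℝ) (v : M.Space k) : toFun (c • v) = fun x => c * toFun v x := by
  ext x
  simp only [toFun, Finset.mul_sum]
  refine Finset.sum_congr rfl fun i _ => ?_
  by_cases h : x ∈ Ioc (M.left i) (M.right i) <;> simp [h, cellVal_smul]

theorem bddSupp_toFun (v : M.Space k) : BddSupp a b (toFun v) := by
  refine ⟨?_, ?_, ?_⟩
  · exact Finset.measurable_fun_sum _ fun i _ =>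
      (continuous_cellVal v i).measurable.indicator measurableSet_Ioc
  · choose B hB using fun i => (isCompact_Icc (a := M.left i) (b := M.right i)).bddAbove_image
      (continuous_cellVal v i).abs.continuousOn
    refine ⟨∑ i, |B i|, fun x => ?_⟩
    refine (Finset.abs_sum_le_sum_abs _ _).trans (Finset.sum_le_sum fun i _ => ?_)
    by_cases h : x ∈ Ioc (M.left i) (M.right i)
    · rw [indicator_of_mem h]
      exact (hB i (mem_image_of_mem _ (Ioc_subset_Icc_self h))).trans (le_abs_self _)
    · rw [indicator_of_notMem h, abs_zero]
      exact abs_nonneg _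
  · intro x hx
    refine Finset.sum_eq_zero fun i _ => indicator_of_notMem (fun h => hx ?_) _
    exact M.cell_subset i (Ioc_subset_Icc_self h)

theorem integral_toFun (F : ℝ → ℝ → ℝ) (v : M.Space k)
    (h : IntegrableOn (fun x => F x (toFun v x)) (Icc a b)) :
    ∫ x in a..b, F x (toFun v x) = ∑ i, ∫ x in M.left i..M.right i, F x (cellVal v i x) := by
  rw [M.integral_eq_sum h]
  refine Finset.sum_congr rfl fun i _ => intervalIntegral.integral_congr_ae ?_
  refine Filter.Eventually.of_forall fun x hx => ?_
  rw [uIoc_of_le (M.left_lt_right i).le] at hx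
  rw [toFun_eq_cellVal v hx]

theorem intervalIntegrable_cellVal_mul (v w : M.Space k) (i : Fin M.K) :
    IntervalIntegrable (fun x => cellVal v i x * cellVal w i x) volume (M.left i) (M.right i) :=
  ((continuous_cellVal v i).mul (continuous_cellVal w i)).intervalIntegrable _ _

/-- The `L²` inner product of two piecewise polynomials. -/
noncomputable def ip (M : Mesh a b) (k : ℕ) : M.Space k →ₗ[ℝ] M.Space k →ₗ[ℝ] ℝ :=
  LinearMap.mk₂ ℝ (fun v w => ∑ i, ∫ x in M.left i..M.right i, cellVal v i x * cellVal w i x)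
    (fun u v w => by
      rw [← Finset.sum_add_distrib]
      refine Finset.sum_congr rfl fun i _ => ?_
      rw [← intervalIntegral.integral_add (intervalIntegrable_cellVal_mul u w i)
        (intervalIntegrable_cellVal_mul v w i)]
      simp_rw [cellVal_add, add_mul])
    (fun c v w => by
      simp_rw [cellVal_smul, mul_assoc, intervalIntegral.integral_const_mul, smul_eq_mul,
        Finset.mul_sum])
    (fun u v w => by
      rw [← Finset.sum_add_distrib]
      refine Finset.sum_congr rfl fun i _ => ?_
      rw [← intervalIntegral.integral_add (intervalIntegrable_cellVal_mul u v i)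
        (intervalIntegrable_cellVal_mul u w i)]
      simp_rw [cellVal_add, mul_add])
    (fun c v w => by
      simp_rw [cellVal_smul, mul_left_comm _ c, intervalIntegral.integral_const_mul, smul_eq_mul,
        Finset.mul_sum])

theorem ip_apply (v w : M.Space k) :
    ip M k v w = ∑ i, ∫ x in M.left i..M.right i, cellVal v i x * cellVal w i x := rfl

theorem ip_comm (v w : M.Space k) : ip M k v w = ip M k w v := by
  simp_rw [ip_apply, mul_comm]

theorem ip_self_eq_sum (v : M.Space k) :
    ip M k v v = ∑ i, ∫ x in M.left i..M.right i, cellVal v i x ^ 2 := by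
  simp_rw [ip_apply, sq]

theorem ip_self_nonneg (v : M.Space k) : 0 ≤ ip M k v v := by
  rw [ip_self_eq_sum]
  exact Finset.sum_nonneg fun i _ => intervalIntegral.integral_nonneg (M.left_lt_right i).le
    fun _ _ => sq_nonneg _

theorem eq_zero_of_ip_self {v : M.Space k} (h : ip M k v v = 0) : v = 0 := by
  rw [ip_self_eq_sum, Finset.sum_eq_zero_iff_of_nonneg fun i _ =>
    intervalIntegral.integral_nonneg (M.left_lt_right i).le fun _ _ => sq_nonneg _] at h
  ext1 i
  have := eqOn_zero_of_integral_eq_zero ((continuous_cellVal v i).pow 2) (M.left_lt_right i)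
    (fun _ _ => sq_nonneg _) (h i (Finset.mem_univ i))
  exact Subtype.ext (eq_zero_of_eval_eq_zero (M.left_lt_right i) fun x hx =>
    pow_eq_zero_iff two_ne_zero |>.1 (this x (Ioo_subset_Icc_self hx)))

theorem ip_separatingLeft (v : M.Space k) (h : ∀ z, ip M k v z = 0) : v = 0 :=
  eq_zero_of_ip_self (h v)

theorem ip_sq_le (v w : M.Space k) : ip M k v w ^ 2 ≤ ip M k v v * ip M k w w :=
  bilin_sq_le _ ip_comm ip_self_nonneg v w

theorem ip_eq_integral (v w : M.Space k) : ip M k v w = ∫ x in a..b, toFun v x * toFun w x := by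
  have h1 := integral_toFun (fun x y => toFun v x * y) w
    ((bddSupp_toFun w).integrable_mul (bddSupp_toFun v).integrable.integrableOn).integrableOn
  rw [h1, ip_apply]
  refine Finset.sum_congr rfl fun i _ => intervalIntegral.integral_congr_ae ?_
  refine Filter.Eventually.of_forall fun x hx => ?_
  rw [uIoc_of_le (M.left_lt_right i).le] at hx
  rw [toFun_eq_cellVal v hx]

end

end LDG

namespace LDG
open MeasureTheory

/-! ### Testing functions against piecewise polynomials -/

section
variable {a b : ℝ} {M : Mesh a b} {k : ℕ}

/-- Measurable functions which are bounded on `[a, b]`. -/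
structure BddMeas (a b : ℝ) (f : ℝ → ℝ) : Prop where
  meas : Measurable f
  bdd : ∃ B, ∀ x ∈ Icc a b, |f x| ≤ B

theorem BddSupp.bddMeas {f : ℝ → ℝ} (hf : BddSupp a b f) : BddMeas a b f :=
  ⟨hf.meas, hf.bdd.imp fun _ h x _ => h x⟩

theorem bddMeas_of_continuous {f : ℝ → ℝ} (hf : Continuous f) : BddMeas a b f := by
  refine ⟨hf.measurable, ?_⟩
  obtain ⟨B, hB⟩ := (isCompact_Icc (a := a) (b := b)).bddAbove_image hf.abs.continuousOn
  exact ⟨B, fun x hx => hB (mem_image_of_mem _ hx)⟩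

theorem BddMeas.integrableOn {f : ℝ → ℝ} (hf : BddMeas a b f) : IntegrableOn f (Icc a b) := by
  obtain ⟨B, hB⟩ := hf.bdd
  exact Measure.integrableOn_of_bounded (by simp) hf.meas.aestronglyMeasurable (M := B)
    ((ae_restrict_iff' measurableSet_Icc).2 (Filter.Eventually.of_forall hB))

theorem BddMeas.mul {f g : ℝ → ℝ} (hf : BddMeas a b f) (hg : BddMeas a b g) :
    BddMeas a b fun x => f x * g x := by
  obtain ⟨B, hB⟩ := hf.bdd
  obtain ⟨D, hD⟩ := hg.bdd
  refine ⟨hf.meas.mul hg.meas, B * D, fun x hx => ?_⟩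
  rw [abs_mul]
  exact mul_le_mul (hB x hx) (hD x hx) (abs_nonneg _) ((abs_nonneg _).trans (hB x hx))

theorem BddMeas.sub {f g : ℝ → ℝ} (hf : BddMeas a b f) (hg : BddMeas a b g) :
    BddMeas a b fun x => f x - g x := by
  obtain ⟨B, hB⟩ := hf.bdd
  obtain ⟨D, hD⟩ := hg.bdd
  exact ⟨hf.meas.sub hg.meas, B + D, fun x hx => (abs_sub _ _).trans (add_le_add (hB x hx) (hD x hx))⟩

theorem BddMeas.const_mul {f : ℝ → ℝ} (hf : BddMeas a b f) (c : ℝ) :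
    BddMeas a b fun x => c * f x :=
  (bddMeas_of_continuous continuous_const).mul hf

theorem BddMeas.sq {f : ℝ → ℝ} (hf : BddMeas a b f) : BddMeas a b fun x => f x ^ 2 := by
  simpa only [pow_two] using hf.mul hf

theorem BddMeas.intervalIntegrable {f : ℝ → ℝ} (hf : BddMeas a b f) {p q : ℝ} (hp : p ∈ Icc a b)
    (hq : q ∈ Icc a b) : IntervalIntegrable f volume p q :=
  (hf.integrableOn.mono_set (uIcc_subset_Icc hp hq)).intervalIntegrable

theorem Mesh.left_mem (M : Mesh a b) (i : Fin M.K) : M.left i ∈ Icc a b := M.node_mem _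

theorem Mesh.right_mem (M : Mesh a b) (i : Fin M.K) : M.right i ∈ Icc a b := M.node_mem _

theorem Mesh.le (M : Mesh a b) : a ≤ b := (M.node_mem 0).1.trans (M.node_mem 0).2

theorem bddMeas_toFun (v : M.Space k) : BddMeas a b (toFun v) := (bddSupp_toFun v).bddMeas

theorem integral_cell_mul_toFun (f : ℝ → ℝ) (v : M.Space k) (i : Fin M.K) :
    ∫ x in M.left i..M.right i, f x * toFun v x
      = ∫ x in M.left i..M.right i, f x * cellVal v i x := by
  refine intervalIntegral.integral_congr_ae (Filter.Eventually.of_forall fun x hx => ?_)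
  rw [uIoc_of_le (M.left_lt_right i).le] at hx
  rw [toFun_eq_cellVal v hx]

theorem integral_mul_toFun {f : ℝ → ℝ} (hf : BddMeas a b f) (v : M.Space k) :
    ∫ x in a..b, f x * toFun v x = ∑ i, ∫ x in M.left i..M.right i, f x * cellVal v i x := by
  rw [M.integral_eq_sum (hf.mul (bddMeas_toFun v)).integrableOn]
  exact Finset.sum_congr rfl fun i _ => integral_cell_mul_toFun f v i

theorem interval_ab {f : ℝ → ℝ} (M : Mesh a b) (hf : BddMeas a b f) :
    IntervalIntegrable f volume a b :=
  hf.intervalIntegrable (left_mem_Icc.2 M.le) (right_mem_Icc.2 M.le)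

/-- The functional `v ↦ (f, v)` on the space of piecewise polynomials. -/
noncomputable def testInt (M : Mesh a b) (k : ℕ) {f : ℝ → ℝ} (hf : BddMeas a b f) :
    Module.Dual ℝ (M.Space k) where
  toFun v := ∫ x in a..b, f x * toFun v x
  map_add' v w := by
    rw [← intervalIntegral.integral_add (interval_ab M (hf.mul (bddMeas_toFun v)))
      (interval_ab M (hf.mul (bddMeas_toFun w)))]
    simp only [toFun_add, mul_add]
  map_smul' c v := by
    simp only [toFun_smul, mul_left_comm _ c, intervalIntegral.integral_const_mul, smul_eq_mul,
      RingHom.id_apply]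

theorem testInt_apply {f : ℝ → ℝ} (hf : BddMeas a b f) (v : M.Space k) :
    testInt M k hf v = ∫ x in a..b, f x * toFun v x := rfl

/-- The Riesz representation in the space of piecewise polynomials. -/
noncomputable def rep (M : Mesh a b) (k : ℕ) : Module.Dual ℝ (M.Space k) →ₗ[ℝ] M.Space k :=
  Classical.choose (exists_rep (N := ip M k) ip_separatingLeft)

theorem ip_rep (ℓ : Module.Dual ℝ (M.Space k)) (v : M.Space k) : ip M k (rep M k ℓ) v = ℓ v :=
  Classical.choose_spec (exists_rep (N := ip M k) ip_separatingLeft) ℓ v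

theorem integral_sq_sub_toFun {f : ℝ → ℝ} (hf : BddMeas a b f) (v : M.Space k) :
    ∫ x in a..b, (f x - toFun v x) ^ 2
      = (∫ x in a..b, f x ^ 2) - 2 * (∫ x in a..b, f x * toFun v x) + ip M k v v := by
  have hv := bddMeas_toFun v
  have e : ∀ x, (f x - toFun v x) ^ 2
      = (f x ^ 2 - 2 * (f x * toFun v x)) + toFun v x * toFun v x := fun x => by ring
  simp_rw [e]
  rw [intervalIntegral.integral_add (interval_ab M (hf.sq.sub ((hf.mul hv).const_mul 2)))
    (interval_ab M (hv.mul hv)), intervalIntegral.integral_sub (interval_ab M hf.sq)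
    (interval_ab M ((hf.mul hv).const_mul 2)), intervalIntegral.integral_const_mul, ip_eq_integral]

/-- The `L²` projection is the best approximation. -/
theorem integral_sq_sub_rep_le {f : ℝ → ℝ} (hf : BddMeas a b f) (v : M.Space k) :
    ∫ x in a..b, (f x - toFun (rep M k (testInt M k hf)) x) ^ 2
      ≤ ∫ x in a..b, (f x - toFun v x) ^ 2 := by
  have h := integral_sq_sub_toFun hf (rep M k (testInt M k hf))
  have h' := integral_sq_sub_toFun hf v
  rw [← testInt_apply hf, ← ip_rep] at h h'
  -- Pythagoras: the two squared distances differ by the squared distance of the projection from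
  -- `v`.
  have h0 := ip_self_nonneg (rep M k (testInt M k hf) - v)
  simp only [map_sub, LinearMap.sub_apply] at h0
  rw [ip_comm v] at h0
  linarith

/-- The squared distance in `L²` is bounded by distances on the cells. -/
theorem integral_sq_sub_toFun_le {f : ℝ → ℝ} (hf : BddMeas a b f) (v : M.Space k) {η : ℝ}
    (h : ∀ i, ∀ x ∈ Icc (M.left i) (M.right i), |f x - cellVal v i x| ≤ η) :
    ∫ x in a..b, (f x - toFun v x) ^ 2 ≤ (b - a) * η ^ 2 := by
  have hsq := (hf.sub (bddMeas_toFun v)).sq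
  rw [M.integral_eq_sum hsq.integrableOn]
  calc ∑ i, ∫ x in M.left i..M.right i, (f x - toFun v x) ^ 2
      ≤ ∑ i, ∫ x in M.left i..M.right i, η ^ 2 := by
        refine Finset.sum_le_sum fun i _ => ?_
        refine intervalIntegral.integral_mono_on_of_le_Ioo (M.left_lt_right i).le
          (hsq.intervalIntegrable (M.left_mem i) (M.right_mem i)) (by simp) fun x hx => ?_
        rw [toFun_eq_cellVal v (Ioo_subset_Ioc_self hx), ← sq_abs]
        exact pow_le_pow_left₀ (abs_nonneg _) (h i x (Ioo_subset_Icc_self hx)) 2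
    _ = ∫ x in a..b, η ^ 2 := (M.integral_eq_sum (by simp)).symm
    _ = _ := by simp

/-! ### The discrete gradient and the flux identity -/

theorem traceMinus_succ (v : M.Space k) (i : Fin M.K) :
    traceMinus v i.succ = cellVal v i (M.right i) := by
  simp [traceMinus, Mesh.right]

theorem tracePlus_castSucc (v : M.Space k) (i : Fin M.K) :
    tracePlus v i.castSucc = cellVal v i (M.left i) := by
  have : i.castSucc ≠ Fin.last M.K := (Fin.castSucc_lt_last i).ne
  simp [tracePlus, this, Mesh.left]

theorem traceMinus_zero (v : M.Space k) : traceMinus v 0 = 0 := by simp [traceMinus]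

theorem tracePlus_last (v : M.Space k) : tracePlus v (Fin.last M.K) = 0 := by simp [tracePlus]

theorem traceMinus_add (v w : M.Space k) (j : Fin (M.K + 1)) :
    traceMinus (v + w) j = traceMinus v j + traceMinus w j := by
  unfold traceMinus; split_ifs <;> simp [cellVal_add]

theorem tracePlus_add (v w : M.Space k) (j : Fin (M.K + 1)) :
    tracePlus (v + w) j = tracePlus v j + tracePlus w j := by
  unfold tracePlus; split_ifs <;> simp [cellVal_add]

theorem traceMinus_smul (c : ℝ) (v : M.Space k) (j : Fin (M.K + 1)) :
    traceMinus (c • v) j = c * traceMinus v j := by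
  unfold traceMinus; split_ifs <;> simp [cellVal_smul]

theorem tracePlus_smul (c : ℝ) (v : M.Space k) (j : Fin (M.K + 1)) :
    tracePlus (c • v) j = c * tracePlus v j := by
  unfold tracePlus; split_ifs <;> simp [cellVal_smul]

/-- The trace which is penalized by the scheme. -/
noncomputable def endTrace (c : FluxChoice) : Module.Dual ℝ (M.Space k) where
  toFun v := match c with
    | .minusPlus => traceMinus v (Fin.last M.K)
    | .plusMinus => tracePlus v 0
  map_add' v w := by cases c <;> simp [traceMinus_add, tracePlus_add]
  map_smul' t v := by cases c <;> simp [traceMinus_smul, tracePlus_smul]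

theorem fluxU_add (c : FluxChoice) (v w : M.Space k) (j : Fin (M.K + 1)) :
    fluxU c (v + w) j = fluxU c v j + fluxU c w j := by
  unfold fluxU; cases c <;> split_ifs <;> simp [traceMinus_add, tracePlus_add]

theorem fluxU_smul (c : FluxChoice) (t : ℝ) (v : M.Space k) (j : Fin (M.K + 1)) :
    fluxU c (t • v) j = t * fluxU c v j := by
  unfold fluxU; cases c <;> split_ifs <;> simp [traceMinus_smul, tracePlus_smul]

theorem intervalIntegrable_cellVal_mul_cellDer (v w : M.Space k) (i : Fin M.K) :
    IntervalIntegrable (fun x => cellVal v i x * cellDer w i x) volume (M.left i) (M.right i) :=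
  ((continuous_cellVal v i).mul (continuous_cellDer w i)).intervalIntegrable _ _

/-- The form `∑ ∫ v z_x`. -/
noncomputable def derForm (M : Mesh a b) (k : ℕ) : M.Space k →ₗ[ℝ] M.Space k →ₗ[ℝ] ℝ :=
  LinearMap.mk₂ ℝ (fun v w => ∑ i, ∫ x in M.left i..M.right i, cellVal v i x * cellDer w i x)
    (fun u v w => by
      rw [← Finset.sum_add_distrib]
      refine Finset.sum_congr rfl fun i _ => ?_
      rw [← intervalIntegral.integral_add (intervalIntegrable_cellVal_mul_cellDer u w i)
        (intervalIntegrable_cellVal_mul_cellDer v w i)]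
      simp_rw [cellVal_add, add_mul])
    (fun c v w => by
      simp_rw [cellVal_smul, mul_assoc, intervalIntegral.integral_const_mul, smul_eq_mul,
        Finset.mul_sum])
    (fun u v w => by
      rw [← Finset.sum_add_distrib]
      refine Finset.sum_congr rfl fun i _ => ?_
      rw [← intervalIntegral.integral_add (intervalIntegrable_cellVal_mul_cellDer u v i)
        (intervalIntegrable_cellVal_mul_cellDer u w i)]
      simp_rw [cellDer_add, mul_add])
    (fun c v w => by
      simp_rw [cellDer_smul, mul_left_comm _ c, intervalIntegral.integral_const_mul, smul_eq_mul,
        Finset.mul_sum])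

theorem derForm_apply (v w : M.Space k) :
    derForm M k v w = ∑ i, ∫ x in M.left i..M.right i, cellVal v i x * cellDer w i x := rfl

/-- The boundary part of the form of the discrete gradient. -/
noncomputable def bdryForm (M : Mesh a b) (k : ℕ) (c : FluxChoice) :
    M.Space k →ₗ[ℝ] M.Space k →ₗ[ℝ] ℝ :=
  LinearMap.mk₂ ℝ (fun v w => ∑ i, bdry (fluxU c v) w i)
    (fun u v w => by
      rw [← Finset.sum_add_distrib]
      refine Finset.sum_congr rfl fun i _ => ?_
      simp only [bdry, fluxU_add]; ring)
    (fun t v w => by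
      rw [smul_eq_mul, Finset.mul_sum]
      refine Finset.sum_congr rfl fun i _ => ?_
      simp only [bdry, fluxU_smul]; ring)
    (fun u v w => by
      rw [← Finset.sum_add_distrib]
      refine Finset.sum_congr rfl fun i _ => ?_
      simp only [bdry, cellVal_add]; ring)
    (fun t v w => by
      rw [smul_eq_mul, Finset.mul_sum]
      refine Finset.sum_congr rfl fun i _ => ?_
      simp only [bdry, cellVal_smul]; ring)

/-- The form of the discrete gradient. -/
noncomputable def formU (M : Mesh a b) (k : ℕ) (c : FluxChoice) :
    M.Space k →ₗ[ℝ] M.Space k →ₗ[ℝ] ℝ := bdryForm M k c - derForm M k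

theorem formU_apply (c : FluxChoice) (v w : M.Space k) :
    formU M k c v w = ∑ i, (bdry (fluxU c v) w i
      - ∫ x in M.left i..M.right i, cellVal v i x * cellDer w i x) := by
  rw [Finset.sum_sub_distrib]; rfl

/-- The discrete gradient. -/
noncomputable def dgGrad (M : Mesh a b) (k : ℕ) (c : FluxChoice) : M.Space k →ₗ[ℝ] M.Space k :=
  (rep M k).comp (formU M k c)

theorem ip_dgGrad (c : FluxChoice) (v w : M.Space k) :
    ip M k (dgGrad M k c v) w = formU M k c v w := ip_rep _ _

theorem sum_succ_sub_castSucc {n : ℕ} (f : Fin (n + 1) → ℝ) :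
    ∑ i : Fin n, (f i.succ - f i.castSucc) = f (Fin.last n) - f 0 := by
  have h1 := Fin.sum_univ_succ f
  have h2 := Fin.sum_univ_castSucc f
  rw [Finset.sum_sub_distrib]
  linarith

theorem integral_cellVal_mul_cellDer (v w : M.Space k) (i : Fin M.K) :
    (∫ x in M.left i..M.right i, cellVal v i x * cellDer w i x)
      + ∫ x in M.left i..M.right i, cellVal w i x * cellDer v i x
      = cellVal v i (M.right i) * cellVal w i (M.right i)
        - cellVal v i (M.left i) * cellVal w i (M.left i) := by
  rw [← intervalIntegral.integral_add (intervalIntegrable_cellVal_mul_cellDer v w i)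
        (intervalIntegrable_cellVal_mul_cellDer w v i)]
  refine intervalIntegral.integral_eq_sub_of_hasDerivAt (f := fun x => cellVal v i x * cellVal w i x)
    (fun x _ => ?_) ((intervalIntegrable_cellVal_mul_cellDer v w i).add
      (intervalIntegrable_cellVal_mul_cellDer w v i))
  exact ((hasDerivAt_cellVal v i x).mul (hasDerivAt_cellVal w i x)).congr_deriv (by ring)

/-- The alternating fluxes make the discrete gradients adjoint up to the penalty. -/
theorem formQ_add_formU (hab : a < b) (c : FluxChoice) (β : ℝ) (u q v : M.Space k) :
    ∑ i, (bdry (fluxQ c β u q) v i - ∫ x in M.left i..M.right i, cellVal q i x * cellDer v i x)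
      + formU M k c v q = -(β / M.size * (endTrace c u * endTrace c v)) := by
  have hK : (0 : Fin (M.K + 1)) ≠ Fin.last M.K := by
    have := M.K_pos hab
    intro h
    have := congrArg Fin.val h
    simp at this
    omega
  rw [formU_apply, ← Finset.sum_add_distrib]
  cases c with
  | minusPlus =>
    -- After integration by parts the contribution of a cell is an increment of this nodal quantity,
    -- and the sum telescopes. At the two ends one factor of the product is an exterior trace, hence
    -- zero, and only the penalty survives.
    set D : Fin (M.K + 1) → ℝ := fun j => traceMinus v j * tracePlus q j +
      if j = Fin.last M.K then -(β / M.size * (traceMinus u (Fin.last M.K) *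
        traceMinus v (Fin.last M.K))) else 0 with hD
    have key : ∀ i : Fin M.K, (bdry (fluxQ .minusPlus β u q) v i
        - ∫ x in M.left i..M.right i, cellVal q i x * cellDer v i x)
        + (bdry (fluxU .minusPlus v) q i - ∫ x in M.left i..M.right i, cellVal v i x * cellDer q i x)
        = D i.succ - D i.castSucc := by
      intro i
      have hi := integral_cellVal_mul_cellDer q v i
      have h1 : i.castSucc ≠ Fin.last M.K := (Fin.castSucc_lt_last i).ne
      have h2 : i.succ ≠ 0 := Fin.succ_ne_zero i
      simp only [bdry, fluxQ, fluxU, hD, h1, h2, if_false, false_or, or_false, add_zero, jump,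
        ← traceMinus_succ, ← tracePlus_castSucc] at hi ⊢
      split_ifs with h3 h4 h4
      · rw [h4, h3] at hi ⊢
        rw [traceMinus_zero, tracePlus_last, tracePlus_last]
        linear_combination -hi
      · rw [h3] at hi ⊢
        rw [tracePlus_last, tracePlus_last]
        linear_combination -hi
      · rw [h4] at hi ⊢
        rw [traceMinus_zero]
        linear_combination -hi
      · linear_combination -hi
    rw [Finset.sum_congr rfl fun i _ => key i, sum_succ_sub_castSucc]
    simp [hD, hK, tracePlus_last, traceMinus_zero, endTrace]
  | plusMinus =>
    -- The penalty sits at the first node, whose value is subtracted in the telescoping sum; hence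
    -- the plus sign here.
    set D : Fin (M.K + 1) → ℝ := fun j => tracePlus v j * traceMinus q j +
      if j = 0 then β / M.size * (tracePlus u 0 * tracePlus v 0) else 0 with hD
    have key : ∀ i : Fin M.K, (bdry (fluxQ .plusMinus β u q) v i
        - ∫ x in M.left i..M.right i, cellVal q i x * cellDer v i x)
        + (bdry (fluxU .plusMinus v) q i - ∫ x in M.left i..M.right i, cellVal v i x * cellDer q i x)
        = D i.succ - D i.castSucc := by
      intro i
      have hi := integral_cellVal_mul_cellDer q v i
      have h1 : i.castSucc ≠ Fin.last M.K := (Fin.castSucc_lt_last i).ne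
      have h2 : i.succ ≠ 0 := Fin.succ_ne_zero i
      simp only [bdry, fluxQ, fluxU, hD, h1, h2, if_false, false_or, or_false, add_zero, jump,
        ← traceMinus_succ, ← tracePlus_castSucc] at hi ⊢
      split_ifs with h4 h3 h3
      · have h6 := tracePlus_last v
        rw [← h3] at h6
        rw [h4] at hi ⊢
        rw [h6, traceMinus_zero, traceMinus_zero]
        linear_combination -hi
      · rw [h4] at hi ⊢
        rw [traceMinus_zero, traceMinus_zero]
        linear_combination -hi
      · have h6 := tracePlus_last v
        rw [← h3] at h6
        rw [h6]
        linear_combination -hi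
      · linear_combination -hi
    rw [Finset.sum_congr rfl fun i _ => key i, sum_succ_sub_castSucc]
    simp [hD, hK.symm, tracePlus_last, traceMinus_zero, endTrace]

end

end LDG

namespace LDG
open MeasureTheory

/-! ### Gauss-Radau projections -/

section
variable {a b : ℝ} {M : Mesh a b} {k : ℕ}

/-- The other choice of fluxes. -/
def FluxChoice.swap : FluxChoice → FluxChoice
  | .minusPlus => .plusMinus
  | .plusMinus => .minusPlus

/-- The end point of a cell at which the projection of `u` is exact. -/
noncomputable def endPt (M : Mesh a b) (c : FluxChoice) (i : Fin M.K) : ℝ :=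
  match c with
    | .minusPlus => M.right i
    | .plusMinus => M.left i

theorem endPt_eq (c : FluxChoice) (i : Fin M.K) :
    endPt M c i = M.left i ∨ endPt M c i = M.right i := by
  cases c
  · exact Or.inr rfl
  · exact Or.inl rfl

theorem endPt_mem (c : FluxChoice) (i : Fin M.K) :
    endPt M c i ∈ Icc (M.left i) (M.right i) := by
  rcases endPt_eq c i with h | h <;> rw [h]
  · exact left_mem_Icc.2 (M.left_lt_right i).le
  · exact right_mem_Icc.2 (M.left_lt_right i).le

/-- The Gauss-Radau projection of `f`. -/
def IsRadau (c : FluxChoice) (f : ℝ → ℝ) (P : M.Space k) : Prop :=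
  ∀ i, cellVal P i (endPt M c i) = f (endPt M c i) ∧ ∀ z : ℝ[X], z.natDegree ≤ k →
    ∫ x in M.left i..M.right i, cellVal P i x * z.derivative.eval x
      = ∫ x in M.left i..M.right i, f x * z.derivative.eval x

/-- Evaluation of the polynomial on a cell at a point. -/
noncomputable def evalAt (M : Mesh a b) (k : ℕ) (i : Fin M.K) (x : ℝ) : Module.Dual ℝ (M.Space k) where
  toFun v := cellVal v i x
  map_add' v w := cellVal_add v w i x
  map_smul' t v := cellVal_smul t v i x

theorem evalAt_apply (i : Fin M.K) (x : ℝ) (v : M.Space k) : evalAt M k i x v = cellVal v i x := rfl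

/-- The form which defines the Gauss-Radau projection. -/
noncomputable def radauForm (M : Mesh a b) (k : ℕ) (c : FluxChoice) :
    M.Space k →ₗ[ℝ] M.Space k →ₗ[ℝ] ℝ :=
  ∑ i, (LinearMap.mul ℝ ℝ).compl₁₂ (evalAt M k i (endPt M c i)) (evalAt M k i (endPt M c i))
    - derForm M k

theorem radauForm_apply (c : FluxChoice) (v z : M.Space k) :
    radauForm M k c v z = ∑ i, (cellVal v i (endPt M c i) * cellVal z i (endPt M c i)
      - ∫ x in M.left i..M.right i, cellVal v i x * cellDer z i x) := by
  rw [Finset.sum_sub_distrib, ← derForm_apply, radauForm]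
  simp [LinearMap.sum_apply, evalAt_apply]

theorem radauForm_single (c : FluxChoice) (v : M.Space k) (i : Fin M.K) {p : ℝ[X]}
    (hp : p.natDegree ≤ k) :
    radauForm M k c v (single M i hp) = cellVal v i (endPt M c i) * p.eval (endPt M c i)
      - ∫ x in M.left i..M.right i, cellVal v i x * p.derivative.eval x := by
  rw [radauForm_apply, Finset.sum_eq_single i]
  · simp only [cellVal_single_self, cellDer_single_self]
  · intro j _ hj
    simp only [cellVal_single_ne hj, cellDer_single_ne hj, mul_zero,
      intervalIntegral.integral_zero, sub_zero]
  · simp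

/-- Testing with the constant `1` isolates the condition at the end point; subtracting it leaves the
orthogonality to derivatives. -/
theorem isRadau_of_forall {c : FluxChoice} {f : ℝ → ℝ} {P : M.Space k}
    (h : ∀ (i : Fin M.K) (p : ℝ[X]), p.natDegree ≤ k →
      cellVal P i (endPt M c i) * p.eval (endPt M c i)
        - ∫ x in M.left i..M.right i, cellVal P i x * p.derivative.eval x
      = f (endPt M c i) * p.eval (endPt M c i)
        - ∫ x in M.left i..M.right i, f x * p.derivative.eval x) : IsRadau c f P := by
  intro i
  have h1 := h i 1 (by simp)
  simp only [Polynomial.eval_one, mul_one, Polynomial.derivative_one, Polynomial.eval_zero,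
    mul_zero, intervalIntegral.integral_zero, sub_zero] at h1
  refine ⟨h1, fun z hz => ?_⟩
  have h2 := h i z hz
  rw [h1] at h2
  linarith

/-- Sup norm stability of the Gauss-Radau projections, uniformly in the mesh. -/
theorem exists_radau_le (k : ℕ) : ∃ C > 0, ∀ {a b : ℝ} {M : Mesh a b} {c : FluxChoice} {f : ℝ → ℝ}
    {P : M.Space k}, BddMeas a b f → IsRadau c f P → ∀ (i : Fin M.K) (τ : ℝ[X]), τ.natDegree ≤ k →
      ∀ B : ℝ, (∀ x ∈ Icc (M.left i) (M.right i), |f x - τ.eval x| ≤ B) →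
      ∀ x ∈ Icc (M.left i) (M.right i), |cellVal P i x - τ.eval x| ≤ C * B := by
  obtain ⟨C, hC, h⟩ := exists_abs_eval_le_of_radau k
  refine ⟨C, hC, fun {a b M c f P} hf hP i τ hτ B hB x hx => ?_⟩
  have := h (M.left i) (M.right i) (endPt M c i) (M.left_lt_right i) (endPt_eq c i) (P i - τ)
    ((Polynomial.natDegree_sub_le _ _).trans (max_le (natDegree_le P i) hτ))
    (fun x => f x - τ.eval x) B hB
    (by rw [Polynomial.eval_sub, ← (hP i).1]; rfl) ?_ x hx
  · rwa [Polynomial.eval_sub] at this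
  · intro z hz
    have hfi := hf.intervalIntegrable (M.left_mem i) (M.right_mem i)
    simp only [Polynomial.eval_sub, sub_mul]
    rw [intervalIntegral.integral_sub
      (Continuous.intervalIntegrable (by fun_prop) _ _)
      (Continuous.intervalIntegrable (by fun_prop) _ _),
      intervalIntegral.integral_sub
      (hfi.mul_continuousOn (Polynomial.continuous _).continuousOn)
      (Continuous.intervalIntegrable (by fun_prop) _ _)]
    exact congrArg₂ _ ((hP i).2 z hz) rfl

/-- An element of the left kernel is a Gauss-Radau projection of `0`, and the stability estimate
forces it to vanish. Existence of the projection then follows from uniqueness. -/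
theorem radauForm_separatingLeft (c : FluxChoice) (v : M.Space k)
    (h : ∀ z, radauForm M k c v z = 0) : v = 0 := by
  obtain ⟨C, hC, hR⟩ := exists_radau_le k
  have hr : IsRadau c (fun _ => 0) v := isRadau_of_forall fun i p hp => by
    have := h (single M i hp)
    rw [radauForm_single] at this
    simpa using this
  ext1 i
  refine Subtype.ext (eq_zero_of_eval_eq_zero (M.left_lt_right i) fun x hx => ?_)
  have := hR (bddMeas_of_continuous continuous_const) hr i 0 (by simp) 0 (by simp) x
    (Ioo_subset_Icc_self hx)
  have h2 : cellVal v i x = 0 := by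
    simpa only [Polynomial.eval_zero, sub_zero, mul_zero, abs_nonpos_iff] using this
  exact h2

/-- The cellwise derivative. -/
noncomputable def cellDeriv (M : Mesh a b) (k : ℕ) : M.Space k →ₗ[ℝ] M.Space k :=
  LinearMap.pi fun i => ((Polynomial.derivative.comp (Submodule.subtype _)).codRestrict
    (Polynomial.degreeLE ℝ (k : WithBot ℕ)) fun p => Polynomial.mem_degreeLE.2
      ((Polynomial.degree_derivative_le).trans (Polynomial.mem_degreeLE.1 p.2))).comp
        (LinearMap.proj i)

/-- The functional which defines the Gauss-Radau projection of `f`. -/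
noncomputable def radauDual (M : Mesh a b) (k : ℕ) (c : FluxChoice) {f : ℝ → ℝ}
    (hf : BddMeas a b f) : Module.Dual ℝ (M.Space k) :=
  ∑ i, f (endPt M c i) • evalAt M k i (endPt M c i) - (testInt M k hf).comp (cellDeriv M k)

theorem radauDual_apply (c : FluxChoice) {f : ℝ → ℝ} (hf : BddMeas a b f) (z : M.Space k) :
    radauDual M k c hf z = ∑ i, f (endPt M c i) * cellVal z i (endPt M c i)
      - ∫ x in a..b, f x * toFun (cellDeriv M k z) x := by
  simp [radauDual, LinearMap.sum_apply, evalAt_apply, testInt_apply]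

theorem radauDual_apply_sum (c : FluxChoice) {f : ℝ → ℝ} (hf : BddMeas a b f) (z : M.Space k) :
    radauDual M k c hf z = ∑ i, (f (endPt M c i) * cellVal z i (endPt M c i)
      - ∫ x in M.left i..M.right i, f x * cellDer z i x) := by
  rw [radauDual_apply, integral_mul_toFun hf, Finset.sum_sub_distrib]
  rfl

/-- The operator which inverts the Gauss-Radau form. -/
noncomputable def radauRep (M : Mesh a b) (k : ℕ) (c : FluxChoice) :
    Module.Dual ℝ (M.Space k) →ₗ[ℝ] M.Space k :=
  Classical.choose (exists_rep (N := radauForm M k c) (radauForm_separatingLeft c))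

theorem radauForm_radauRep (c : FluxChoice) (ℓ : Module.Dual ℝ (M.Space k)) (v : M.Space k) :
    radauForm M k c (radauRep M k c ℓ) v = ℓ v :=
  Classical.choose_spec (exists_rep (N := radauForm M k c) (radauForm_separatingLeft c)) ℓ v

theorem isRadau_of_radauForm {c : FluxChoice} {f : ℝ → ℝ} (hf : BddMeas a b f) {P : M.Space k}
    (h : ∀ z, radauForm M k c P z = radauDual M k c hf z) : IsRadau c f P := by
  refine isRadau_of_forall fun i p hp => ?_
  rw [← radauForm_single c P i hp, h, radauDual_apply_sum, Finset.sum_eq_single i]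
  · simp only [cellVal_single_self, cellDer_single_self]
  · intro j _ hj
    simp only [cellVal_single_ne hj, cellDer_single_ne hj, mul_zero,
      intervalIntegral.integral_zero, sub_zero]
  · simp

theorem isRadau_radauRep (c : FluxChoice) {f : ℝ → ℝ} (hf : BddMeas a b f) :
    IsRadau c f (radauRep M k c (radauDual M k c hf)) :=
  isRadau_of_radauForm hf fun z => radauForm_radauRep c _ z

theorem IsRadau.traceMinus {f : ℝ → ℝ} {P : M.Space k} (h : IsRadau .minusPlus f P)
    (i : Fin M.K) : traceMinus P i.succ = f (M.node i.succ) := by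
  rw [traceMinus_succ]; exact (h i).1

theorem IsRadau.tracePlus {f : ℝ → ℝ} {P : M.Space k} (h : IsRadau .plusMinus f P)
    (i : Fin M.K) : tracePlus P i.castSucc = f (M.node i.castSucc) := by
  rw [tracePlus_castSucc]; exact (h i).1

theorem IsRadau.fluxU {c : FluxChoice} {f : ℝ → ℝ} {P : M.Space k} (h : IsRadau c f P)
    (ha : f a = 0) (hb : f b = 0) (j : Fin (M.K + 1)) : fluxU c P j = f (M.node j) := by
  unfold LDG.fluxU
  split_ifs with hj
  · rcases hj with rfl | rfl
    · rw [M.first, ha]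
    · rw [M.last, hb]
  · push Not at hj
    cases c with
    | minusPlus =>
      obtain ⟨i, rfl⟩ := Fin.exists_succ_eq.2 hj.1
      exact h.traceMinus i
    | plusMinus =>
      obtain ⟨i, rfl⟩ := Fin.exists_castSucc_eq.2 hj.2
      exact h.tracePlus i

theorem IsRadau.endTrace (hab : a < b) {c : FluxChoice} {f : ℝ → ℝ} {P : M.Space k}
    (h : IsRadau c f P) (ha : f a = 0) (hb : f b = 0) : endTrace c P = 0 := by
  have hK := M.K_pos hab
  cases c with
  | minusPlus =>
    have e : Fin.last M.K = (⟨M.K - 1, by omega⟩ : Fin M.K).succ := by ext; simp; omega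
    change LDG.traceMinus P (Fin.last M.K) = 0
    rw [e, h.traceMinus, ← e, M.last, hb]
  | plusMinus =>
    have e : (0 : Fin (M.K + 1)) = (⟨0, hK⟩ : Fin M.K).castSucc := rfl
    change LDG.tracePlus P 0 = 0
    rw [e, h.tracePlus, ← e, M.first, ha]

theorem integral_deriv_mul_cellVal {f f' : ℝ → ℝ} (hf : Continuous f) (hf' : BddMeas a b f')
    (i : Fin M.K) (hd : ∀ x ∈ Ioo (M.left i) (M.right i), HasDerivAt f (f' x) x) (v : M.Space k) :
    ∫ x in M.left i..M.right i, f' x * cellVal v i x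
      = f (M.right i) * cellVal v i (M.right i) - f (M.left i) * cellVal v i (M.left i)
        - ∫ x in M.left i..M.right i, f x * cellDer v i x := by
  have h1 : IntervalIntegrable (fun x => f' x * cellVal v i x) volume (M.left i) (M.right i) :=
    (hf'.intervalIntegrable (M.left_mem i) (M.right_mem i)).mul_continuousOn
      (continuous_cellVal v i).continuousOn
  have h2 : IntervalIntegrable (fun x => f x * cellDer v i x) volume (M.left i) (M.right i) :=
    (hf.mul (continuous_cellDer v i)).intervalIntegrable _ _
  rw [eq_sub_iff_add_eq, ← intervalIntegral.integral_add h1 h2]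
  exact intervalIntegral.integral_eq_sub_of_hasDerivAt_of_le (M.left_lt_right i).le
    (f := fun x => f x * cellVal v i x) (hf.mul (continuous_cellVal v i)).continuousOn
    (fun x hx => (hd x hx).mul (hasDerivAt_cellVal v i x)) (h1.add h2)

/-- The discrete gradient of the projection is the projection of the gradient. -/
theorem IsRadau.dgGrad {c : FluxChoice} {f f' : ℝ → ℝ} {P : M.Space k} (h : IsRadau c f P)
    (ha : f a = 0) (hb : f b = 0) (hf : Continuous f) (hf' : BddMeas a b f')
    (hd : ∀ i, ∀ x ∈ Ioo (M.left i) (M.right i), HasDerivAt f (f' x) x) :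
    dgGrad M k c P = rep M k (testInt M k hf') := by
  rw [LDG.dgGrad, LinearMap.comp_apply]
  refine congrArg _ (LinearMap.ext fun z => ?_)
  rw [testInt_apply, integral_mul_toFun hf', formU_apply]
  refine Finset.sum_congr rfl fun i _ => ?_
  -- Integration by parts matches term by term: the fluxes of `P` are the nodal values of `f`, at
  -- the boundary because `f` vanishes there, and the volume terms agree by Radau orthogonality.
  rw [integral_deriv_mul_cellVal hf hf' i (hd i), bdry, h.fluxU ha hb, h.fluxU ha hb]
  exact congrArg _ ((h i).2 (z i) (natDegree_le z i))

/-- Consistency of the flux of `q`. -/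
theorem IsRadau.exists_flux (hab : a < b) {c : FluxChoice} {f f' : ℝ → ℝ} {Q : M.Space k} {η : ℝ}
    (h : IsRadau c.swap f Q) (hf : Continuous f) (hf' : BddMeas a b f')
    (hd : ∀ i, ∀ x ∈ Ioo (M.left i) (M.right i), HasDerivAt f (f' x) x)
    (hη : ∀ i, ∀ x ∈ Icc (M.left i) (M.right i), |f x - cellVal Q i x| ≤ η) :
    ∃ d, |d| ≤ η ∧ ∀ v : M.Space k, ∫ x in a..b, f' x * toFun v x
      = -ip M k (LDG.dgGrad M k c v) Q + d * LDG.endTrace c v := by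
  have hK := M.K_pos hab
  -- The volume term of `f` is replaced by that of `Q`, and the nodal values by the flux of `Q`
  -- without penalty plus the mismatch at the nodes.
  have key : ∀ v : M.Space k, ∫ x in a..b, f' x * toFun v x
      = ∑ i, ((bdry (fluxQ c 0 0 Q) v i - ∫ x in M.left i..M.right i, cellVal Q i x * cellDer v i x)
        + (bdry (fun j => f (M.node j) - fluxQ c 0 (0 : M.Space k) Q j) v i)) := by
    intro v
    rw [integral_mul_toFun hf']
    refine Finset.sum_congr rfl fun i _ => ?_
    rw [integral_deriv_mul_cellVal hf hf' i (hd i)]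
    have h2 := (h i).2 (v i) (natDegree_le v i)
    change ∫ x in M.left i..M.right i, cellVal Q i x * cellDer v i x
      = ∫ x in M.left i..M.right i, f x * cellDer v i x at h2
    rw [h2]
    simp only [bdry, Mesh.left, Mesh.right]
    ring
  have hsum : ∀ v : M.Space k, ∑ i, (bdry (fluxQ c 0 0 Q) v i
      - ∫ x in M.left i..M.right i, cellVal Q i x * cellDer v i x) = -ip M k (LDG.dgGrad M k c v) Q := by
    intro v
    have := formQ_add_formU hab c 0 0 Q v
    rw [← ip_dgGrad] at this
    simp only [zero_div, zero_mul, neg_zero] at this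
    linarith
  cases c with
  | minusPlus =>
    have e : Fin.last M.K = (⟨M.K - 1, by omega⟩ : Fin M.K).succ := by ext; simp; omega
    -- At `b` the flux takes the trace from the left, where `Q` is not exact; this is the only node
    -- with a mismatch.
    refine ⟨f b - LDG.traceMinus Q (Fin.last M.K), ?_, fun v => ?_⟩
    · rw [e, traceMinus_succ]
      have : M.right (⟨M.K - 1, by omega⟩ : Fin M.K) = b := by rw [Mesh.right, ← e, M.last]
      have h1 := hη ⟨M.K - 1, by omega⟩ _ (right_mem_Icc.2 (M.left_lt_right _).le)
      rwa [this] at h1 ⊢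
    · rw [key, Finset.sum_add_distrib, hsum]
      congr 1
      rw [Finset.sum_eq_single (⟨M.K - 1, by omega⟩ : Fin M.K)]
      · have h1 : (⟨M.K - 1, by omega⟩ : Fin M.K).castSucc ≠ Fin.last M.K :=
          (Fin.castSucc_lt_last _).ne
        rw [bdry, ← traceMinus_succ, ← e]
        simp only [fluxQ, if_true, h1, if_false, zero_div, zero_mul, add_zero, M.last]
        rw [IsRadau.tracePlus h]
        simp [LDG.endTrace]
      · intro i _ hi
        have h1 : i.castSucc ≠ Fin.last M.K := (Fin.castSucc_lt_last _).ne
        have h3 : i.succ ≠ Fin.last M.K := by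
          rw [e]
          intro h'
          exact hi (Fin.succ_injective _ h')
        obtain ⟨j, hj⟩ := Fin.exists_castSucc_eq.2 h3
        rw [bdry]
        simp only [fluxQ, h1, h3, if_false]
        rw [IsRadau.tracePlus h, ← hj, IsRadau.tracePlus h]
        simp
      · simp
  | plusMinus =>
    have e : (0 : Fin (M.K + 1)) = (⟨0, hK⟩ : Fin M.K).castSucc := rfl
    -- The mismatch sits at `a`, a left end point, where boundary terms carry a minus sign.
    refine ⟨-(f a - LDG.tracePlus Q 0), ?_, fun v => ?_⟩
    · rw [abs_neg, e, tracePlus_castSucc]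
      have : M.left (⟨0, hK⟩ : Fin M.K) = a := by rw [Mesh.left, ← e, M.first]
      have h1 := hη ⟨0, hK⟩ _ (left_mem_Icc.2 (M.left_lt_right _).le)
      rwa [this] at h1 ⊢
    · rw [key, Finset.sum_add_distrib, hsum]
      congr 1
      rw [Finset.sum_eq_single (⟨0, hK⟩ : Fin M.K)]
      · have h1 : (⟨0, hK⟩ : Fin M.K).succ ≠ 0 := Fin.succ_ne_zero _
        rw [bdry, ← tracePlus_castSucc, ← e]
        simp only [fluxQ, if_true, h1, if_false, zero_div, zero_mul, add_zero, M.first]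
        rw [IsRadau.traceMinus h]
        simp [LDG.endTrace]
        ring
      · intro i _ hi
        have h1 : i.succ ≠ 0 := Fin.succ_ne_zero _
        have h3 : i.castSucc ≠ 0 := by
          rw [e]
          intro h'
          exact hi (Fin.castSucc_injective _ h')
        obtain ⟨j, hj⟩ := Fin.exists_succ_eq.2 h3
        rw [bdry]
        simp only [fluxQ, h1, h3, if_false]
        rw [IsRadau.traceMinus h, ← hj, IsRadau.traceMinus h]
        simp
      · simp

end

end LDG

namespace LDG
open MeasureTheory

/-! ### The Riesz form on piecewise polynomials -/

section
variable {s a b : ℝ} {M : Mesh a b} {k : ℕ}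

/-- A mean zero function is controlled through its primitive by its Riesz potential modulo
constants. -/
theorem exists_integral_sq_primitive_le (hs0 : 0 < s) (hs1 : s < 1) (hab : a < b) :
    ∃ C > 0, ∀ ψ : ℝ → ℝ, BddSupp a b ψ → ∫ x in a..b, ψ x = 0 → ∀ κ : ℝ,
      ∫ x in a..b, (∫ y in a..x, ψ y) ^ 2 ≤ C * ∫ x in a..b, (rieszInt s ψ x - κ) ^ 2 := by
  have hL : 0 < b - a := sub_pos.2 hab
  obtain ⟨C₁, hC₁, h₁⟩ := exists_prim_sq_le_rieszInt_sq hs0 hs1 hL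
  obtain ⟨C₂, hC₂, h₂⟩ := exists_rieszInt_sq_le hs0 hs1 hL
  refine ⟨C₁ * C₂, mul_pos hC₁ hC₂, fun ψ hψ h0 κ => ?_⟩
  set φ : ℝ → ℝ := fun y => ψ (y + a) with hφ
  have hφs : BddSupp 0 (b - a) φ := by
    refine ⟨hψ.meas.comp (measurable_id.add_const a), hψ.bdd.imp fun _ h x => h _, fun x hx => ?_⟩
    refine hψ.supp _ fun h => hx ⟨?_, ?_⟩
    · linarith [h.1]
    · linarith [h.2]
  have hp : ∀ x, prim φ x = ∫ y in a..x + a, ψ y := fun x => by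
    rw [prim, hφ, intervalIntegral.integral_comp_add_right, zero_add]
  have hr : ∀ x, rieszInt s φ x = rieszInt s ψ (x + a) := fun x => by
    rw [rieszInt, rieszInt, ← integral_add_right_eq_self (fun y => |x + a - y| ^ (s - 1) * ψ y) a]
    simp only [hφ, add_sub_add_right_eq_sub]
  have hmean : prim φ (b - a) = 0 := by rw [hp, sub_add_cancel, h0]
  have tr : ∀ F : ℝ → ℝ, ∫ x in a..b, F x = ∫ x in Ioo 0 (b - a), F (x + a) := fun F => by
    rw [← integral_Ioc_eq_integral_Ioo, ← intervalIntegral.integral_of_le hL.le,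
      intervalIntegral.integral_comp_add_right, zero_add, sub_add_cancel]
  have g1 := h₁ φ hφs hmean
  have g2 := h₂ φ hφs hmean κ
  simp_rw [hp, hr] at g1 g2
  rw [tr, tr, mul_assoc]
  exact g1.trans (mul_le_mul_of_nonneg_left g2 hC₁.le)

theorem bddMeas_rieszInt (hs0 : 0 < s) {ψ : ℝ → ℝ} (hψ : BddSupp a b ψ) :
    BddMeas a b (rieszInt s ψ) := by
  obtain ⟨B, -, hB⟩ := hψ.exists_bound
  exact ⟨measurable_rieszInt s hψ.meas, _, fun x hx => abs_rieszInt_le hs0 hψ hB hx⟩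

theorem rieszInt_add (hs0 : 0 < s) {φ ψ : ℝ → ℝ} (hφ : BddSupp a b φ) (hψ : BddSupp a b ψ) (x : ℝ) :
    rieszInt s (fun y => φ y + ψ y) x = rieszInt s φ x + rieszInt s ψ x := by
  simp only [rieszInt, mul_add]
  exact integral_add (hφ.integrable_mul (integrableOn_abs_sub_rpow hs0 x a b))
    (hψ.integrable_mul (integrableOn_abs_sub_rpow hs0 x a b))

theorem rieszInt_const_mul (c : ℝ) (ψ : ℝ → ℝ) (x : ℝ) :
    rieszInt s (fun y => c * ψ y) x = c * rieszInt s ψ x := by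
  simp only [rieszInt, mul_left_comm _ c, integral_const_mul]

/-- The form of the Riesz potential on piecewise polynomials. -/
noncomputable def rieszForm (M : Mesh a b) (k : ℕ) (hs0 : 0 < s) :
    M.Space k →ₗ[ℝ] M.Space k →ₗ[ℝ] ℝ where
  toFun v := testInt M k (bddMeas_rieszInt hs0 (bddSupp_toFun v))
  map_add' v w := by
    refine LinearMap.ext fun z => ?_
    rw [LinearMap.add_apply, testInt_apply, testInt_apply, testInt_apply,
      ← intervalIntegral.integral_add
        (interval_ab M ((bddMeas_rieszInt hs0 (bddSupp_toFun v)).mul (bddMeas_toFun z)))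
        (interval_ab M ((bddMeas_rieszInt hs0 (bddSupp_toFun w)).mul (bddMeas_toFun z)))]
    refine intervalIntegral.integral_congr fun x _ => ?_
    rw [toFun_add, rieszInt_add hs0 (bddSupp_toFun v) (bddSupp_toFun w), add_mul]
  map_smul' c v := by
    refine LinearMap.ext fun z => ?_
    rw [LinearMap.smul_apply, testInt_apply, testInt_apply, RingHom.id_apply, smul_eq_mul,
      ← intervalIntegral.integral_const_mul]
    refine intervalIntegral.integral_congr fun x _ => ?_
    rw [toFun_smul, rieszInt_const_mul, mul_assoc]

theorem rieszForm_apply (hs0 : 0 < s) (v w : M.Space k) :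
    rieszForm M k hs0 v w = ∫ x in a..b, rieszInt s (toFun v) x * toFun w x := rfl

/-- Coercivity of the Riesz form. -/
theorem exists_rieszForm_ge (k : ℕ) (hs0 : 0 < s) (hs1 : s < 1) (hab : a < b) {σ : ℝ} (hσ : 0 < σ) :
    ∃ c > 0, ∀ M : Mesh a b, M.IsQuasiUniform σ → ∀ v : M.Space k,
      c * M.size ^ s * ip M k v v ≤ rieszForm M k hs0 v v := by
  obtain ⟨C, hC, hw⟩ := exists_integral_sq_le_window_cell k
  have hc : 0 < (1 - s) * (2 - s) := mul_pos (by linarith) (by linarith)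
  refine ⟨(1 - s) * (2 - s) * (C⁻¹ * (σ⁻¹) ^ s), by positivity, fun M hM v => ?_⟩
  have hsz := M.size_pos hab
  have hform : rieszForm M k hs0 v v = ∫ x, toFun v x * rieszInt s (toFun v) x := by
    rw [rieszForm_apply, intervalIntegral.integral_of_le hab.le, ← integral_Icc_eq_integral_Ioc,
      setIntegral_eq_integral_of_forall_compl_eq_zero]
    · simp_rw [mul_comm]
    · intro x hx
      rw [(bddSupp_toFun v).supp x hx, mul_zero]
  have hsub : ∀ i, Ioo (M.left i) (M.left i + M.width i / 2) ⊆ Ioc (M.left i) (M.right i) :=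
    fun i x hx => ⟨hx.1, by
      have h1 := hx.2
      have h2 := M.width_pos i
      unfold Mesh.width at h1 h2
      linarith⟩
  have hd : Pairwise (Function.onFun Disjoint fun i => Ioo (M.left i) (M.left i + M.width i / 2)) :=
    fun i j hij => (M.pairwise_disjoint_Ioc hij).mono (hsub i) (hsub j)
  have h := riesz_form_ge hs0 hs1 (bddSupp_toFun v) (l := M.left) (h := M.width) M.width_pos hd
  rw [hform]
  refine le_trans ?_ h
  rw [mul_assoc, mul_assoc]
  refine mul_le_mul_of_nonneg_left ?_ hc.le
  rw [ip_self_eq_sum, Finset.mul_sum, Finset.mul_sum]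
  refine Finset.sum_le_sum fun i _ => ?_
  have hwi := M.width_pos i
  have hcell := hw (M.left i) (M.right i) (M.left_lt_right i) (v i) (natDegree_le v i)
  change ∫ x in M.left i..M.right i, cellVal v i x ^ 2 ≤ C * ((M.width i ^ 3)⁻¹ *
    ∫ ρ in Ioo (M.width i / 4) (M.width i / 2), ∫ t in Ioo (M.left i) (M.left i + M.width i / 2),
      (∫ y in t..t + ρ, cellVal v i y) ^ 2) at hcell
  -- A window of length less than half the width which starts in the left half stays in the cell,
  -- where the function is a single polynomial.
  have e : ∫ ρ in Ioo (M.width i / 4) (M.width i / 2),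
      ∫ t in Ioo (M.left i) (M.left i + M.width i / 2), (∫ y in t..t + ρ, toFun v y) ^ 2
      = ∫ ρ in Ioo (M.width i / 4) (M.width i / 2),
      ∫ t in Ioo (M.left i) (M.left i + M.width i / 2), (∫ y in t..t + ρ, cellVal v i y) ^ 2 := by
    refine setIntegral_congr_fun measurableSet_Ioo fun ρ hρ => ?_
    refine setIntegral_congr_fun measurableSet_Ioo fun t ht => ?_
    have hρ0 : 0 < ρ := lt_trans (by linarith) hρ.1
    refine congrArg (· ^ 2) ?_
    refine intervalIntegral.integral_congr_ae (Filter.Eventually.of_forall fun y hy => ?_)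
    rw [uIoc_of_le (by linarith)] at hy
    refine toFun_eq_cellVal v ⟨by linarith [hy.1, ht.1], ?_⟩
    have : M.width i = M.right i - M.left i := rfl
    linarith [hy.2, ht.2, hρ.2]
  rw [e]
  set I := ∫ ρ in Ioo (M.width i / 4) (M.width i / 2),
      ∫ t in Ioo (M.left i) (M.left i + M.width i / 2), (∫ y in t..t + ρ, cellVal v i y) ^ 2
  have hI : 0 ≤ I := integral_nonneg fun _ => integral_nonneg fun _ => sq_nonneg _
  have hsw : (σ⁻¹) ^ s * M.size ^ s ≤ M.width i ^ s := by
    rw [← Real.mul_rpow (by positivity) hsz.le]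
    refine Real.rpow_le_rpow (by positivity) ?_ hs0.le
    rw [inv_mul_le_iff₀ hσ]
    exact hM i
  have hpow : M.width i ^ (s - 3) = M.width i ^ s * (M.width i ^ 3)⁻¹ := by
    rw [Real.rpow_sub hwi, ← Real.rpow_natCast _ 3, div_eq_mul_inv]
    norm_num
  calc C⁻¹ * σ⁻¹ ^ s * (M.size ^ s * ∫ x in M.left i..M.right i, cellVal v i x ^ 2)
      = σ⁻¹ ^ s * M.size ^ s * (C⁻¹ * ∫ x in M.left i..M.right i, cellVal v i x ^ 2) := by ring
    _ ≤ M.width i ^ s * ((M.width i ^ 3)⁻¹ * I) := by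
        refine mul_le_mul hsw ?_ (mul_nonneg (by positivity) (intervalIntegral.integral_nonneg
          (M.left_lt_right i).le fun _ _ => sq_nonneg _)) (by positivity)
        rw [inv_mul_le_iff₀ hC]
        exact hcell
    _ = M.width i ^ (s - 3) * I := by rw [hpow, mul_assoc]

/-- The `L²` projection error of Riesz potentials. -/
theorem exists_integral_sq_sub_rep_rieszInt_le (k : ℕ) (hs0 : 0 < s) (hs1 : s < 1) (hab : a < b)
    {σ : ℝ} (hσ : 0 < σ) : ∃ C > 0, ∀ M : Mesh a b, M.IsQuasiUniform σ → ∀ v : M.Space k,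
      ∫ x in a..b, (rieszInt s (toFun v) x - toFun (rep M k (testInt M k
        (bddMeas_rieszInt hs0 (bddSupp_toFun v)))) x) ^ 2 ≤ C * (M.size ^ s) ^ 2 * ip M k v v := by
  refine ⟨2 * σ * (4 / s) ^ 2, by positivity, fun M hM v => ?_⟩
  set f := rieszInt s (toFun v) with hf
  have hfb := bddMeas_rieszInt hs0 (bddSupp_toFun v)
  -- The `L²` projection is at least as good as the cell averages, for which the variance estimate
  -- is available. Constants suffice, since only `h ^ s` with `s < 1` is claimed.
  set m : Fin M.K → ℝ := fun i => (M.right i - M.left i)⁻¹ * ∫ y in Ioo (M.left i) (M.right i), f y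
  set w : M.Space k := fun i => ⟨Polynomial.C (m i), Polynomial.mem_degreeLE.2
    (Polynomial.degree_le_of_natDegree_le (by simp))⟩ with hw
  have hwv : ∀ i x, cellVal w i x = m i := fun i x => by simp [cellVal, hw]
  refine (integral_sq_sub_rep_le hfb w).trans ?_
  rw [integral_toFun (fun x y => (f x - y) ^ 2) w (hfb.sub (bddMeas_toFun w)).sq.integrableOn]
  have h := sum_integral_sq_rieszInt_sub_average_le hs0 hs1 (bddSupp_toFun v) (l := M.left)
    (r := M.right) (M.size_pos hab) hσ M.left_lt_right M.width_le_size hM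
    (fun i j hij => (M.pairwise_disjoint_Ioc hij).mono Ioo_subset_Ioc_self Ioo_subset_Ioc_self)
    M.cell_subset
  simp_rw [hwv]
  calc ∑ i, ∫ x in M.left i..M.right i, (f x - m i) ^ 2
      = ∑ i, ∫ x in Ioo (M.left i) (M.right i), (f x - m i) ^ 2 := by
        refine Finset.sum_congr rfl fun i _ => ?_
        rw [intervalIntegral.integral_of_le (M.left_lt_right i).le, integral_Ioc_eq_integral_Ioo]
    _ ≤ _ := h
    _ = _ := by
        rw [ip_eq_integral, intervalIntegral.integral_of_le hab.le, ← integral_Icc_eq_integral_Ioc]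
        simp_rw [← pow_two]
        ring

end

end LDG

namespace LDG
open MeasureTheory

/-! ### The corrector -/

section
variable {s a b : ℝ} {M : Mesh a b} {k : ℕ}

theorem BddMeas.add {f g : ℝ → ℝ} (hf : BddMeas a b f) (hg : BddMeas a b g) :
    BddMeas a b fun x => f x + g x := by
  simpa using hf.sub (hg.const_mul (-1))

/-- The constant function `1`. -/
noncomputable def one (M : Mesh a b) (k : ℕ) : M.Space k :=
  fun _ => ⟨1, Polynomial.mem_degreeLE.2 (Polynomial.degree_le_of_natDegree_le (by simp))⟩

theorem cellVal_one (i : Fin M.K) (x : ℝ) : cellVal (one M k) i x = 1 := by simp [cellVal, one]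

theorem cellDer_one (i : Fin M.K) (x : ℝ) : cellDer (one M k) i x = 0 := by simp [cellDer, one]

theorem ip_one (v : M.Space k) : ip M k v (one M k) = ∫ x in a..b, toFun v x := by
  have h := integral_toFun (fun _ y => y) v (bddMeas_toFun v).integrableOn
  rw [h, ip_apply]
  simp only [cellVal_one, mul_one]

/-- The flux of `u` vanishes at both ends, so the sum telescopes to zero: discrete gradients have
mean zero. Hence the Galerkin problem of the corrector lives on mean-zero functions. -/
theorem ip_dgGrad_one (c : FluxChoice) (v : M.Space k) : ip M k (dgGrad M k c v) (one M k) = 0 := by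
  rw [ip_dgGrad, formU_apply]
  simp only [bdry, cellVal_one, cellDer_one, mul_one, mul_zero, intervalIntegral.integral_zero,
    sub_zero]
  rw [sum_succ_sub_castSucc]
  simp [fluxU]

theorem rep_testInt_toFun (v : M.Space k) : rep M k (testInt M k (bddMeas_toFun v)) = v := by
  rw [← sub_eq_zero]
  refine ip_separatingLeft _ fun z => ?_
  rw [map_sub, LinearMap.sub_apply, ip_rep, testInt_apply, ip_eq_integral, sub_self]

/-- Modulo constants, equations tested with mean zero functions are equations. -/
theorem exists_eq_smul_one (hab : a < b) {d : M.Space k}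
    (h : ∀ w, ip M k w (one M k) = 0 → ip M k d w = 0) : ∃ κ : ℝ, d = κ • one M k := by
  have h1 : ip M k (one M k) (one M k) ≠ 0 := by
    rw [ip_apply]
    simp only [cellVal_one, mul_one, intervalIntegral.integral_const, smul_eq_mul]
    have : Nonempty (Fin M.K) := ⟨⟨0, M.K_pos hab⟩⟩
    exact (Finset.sum_pos (fun i _ => sub_pos.2 (M.left_lt_right i)) Finset.univ_nonempty).ne'
  refine ⟨ip M k d (one M k) / ip M k (one M k) (one M k), ?_⟩
  set κ := ip M k d (one M k) / ip M k (one M k) (one M k) with hκ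
  have h2 : ip M k (d - κ • one M k) (one M k) = 0 := by
    rw [map_sub, map_smul, LinearMap.sub_apply, LinearMap.smul_apply, smul_eq_mul, hκ,
      div_mul_cancel₀ _ h1, sub_self]
  rw [← sub_eq_zero]
  refine eq_zero_of_ip_self ?_
  rw [map_sub (ip M k (d - κ • one M k)), map_smul, h2, smul_zero, sub_zero, ip_comm]
  rw [ip_comm] at h2
  set e := d - κ • one M k with he
  have h3 := h e (by rw [ip_comm]; exact h2)
  exact h3

/-- The primitive of a piecewise polynomial. -/
noncomputable def primFun (v : M.Space k) (x : ℝ) : ℝ := ∫ y in a..x, toFun v y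

theorem continuous_primFun (v : M.Space k) : Continuous (primFun v) :=
  intervalIntegral.continuous_primitive
    (fun _ _ => (bddSupp_toFun v).integrable.intervalIntegrable) a

theorem bddMeas_primFun (v : M.Space k) : BddMeas a b (primFun v) :=
  bddMeas_of_continuous (continuous_primFun v)

theorem primFun_add (v w : M.Space k) (x : ℝ) : primFun (v + w) x = primFun v x + primFun w x := by
  simp only [primFun, toFun_add]
  exact intervalIntegral.integral_add (bddSupp_toFun v).integrable.intervalIntegrable
    (bddSupp_toFun w).integrable.intervalIntegrable

theorem primFun_smul (t : ℝ) (v : M.Space k) (x : ℝ) : primFun (t • v) x = t * primFun v x := by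
  simp only [primFun, toFun_smul, intervalIntegral.integral_const_mul]

theorem primFun_sub_primFun (v : M.Space k) (x y : ℝ) :
    primFun v y - primFun v x = ∫ z in x..y, toFun v z :=
  intervalIntegral.integral_interval_sub_left (bddSupp_toFun v).integrable.intervalIntegrable
    (bddSupp_toFun v).integrable.intervalIntegrable

theorem hasDerivAt_primFun (v : M.Space k) (i : Fin M.K) {x : ℝ}
    (hx : x ∈ Ioo (M.left i) (M.right i)) : HasDerivAt (primFun v) (toFun v x) x := by
  have hc : ContinuousAt (toFun v) x := by
    refine (continuous_cellVal v i).continuousAt.congr ?_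
    filter_upwards [Ioo_mem_nhds hx.1 hx.2] with y hy
    exact (toFun_eq_cellVal v (Ioo_subset_Ioc_self hy)).symm
  exact intervalIntegral.integral_hasDerivAt_right
    (bddSupp_toFun v).integrable.intervalIntegrable
    (bddSupp_toFun v).meas.stronglyMeasurable.stronglyMeasurableAtFilter hc

/-- The projection of the primitive. -/
noncomputable def antiGrad (M : Mesh a b) (k : ℕ) (c : FluxChoice) : M.Space k →ₗ[ℝ] M.Space k :=
  (radauRep M k c).comp
    { toFun := fun v => radauDual M k c (bddMeas_primFun v)
      map_add' := fun v w => by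
        refine LinearMap.ext fun z => ?_
        rw [LinearMap.add_apply, radauDual_apply, radauDual_apply, radauDual_apply]
        simp only [primFun_add, add_mul, Finset.sum_add_distrib]
        rw [intervalIntegral.integral_add
          (interval_ab M ((bddMeas_primFun v).mul (bddMeas_toFun _)))
          (interval_ab M ((bddMeas_primFun w).mul (bddMeas_toFun _)))]
        ring
      map_smul' := fun t v => by
        refine LinearMap.ext fun z => ?_
        rw [LinearMap.smul_apply, radauDual_apply, radauDual_apply, RingHom.id_apply, smul_eq_mul]
        simp only [primFun_smul, mul_assoc, ← Finset.mul_sum, intervalIntegral.integral_const_mul]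
        ring }

theorem isRadau_antiGrad (c : FluxChoice) (v : M.Space k) :
    IsRadau c (primFun v) (antiGrad M k c v) := isRadau_radauRep c (bddMeas_primFun v)

theorem primFun_left (v : M.Space k) : primFun v a = 0 := intervalIntegral.integral_same

theorem primFun_right {v : M.Space k} (hv : ip M k v (one M k) = 0) : primFun v b = 0 := by
  rw [← hv, ip_one]; rfl

/-- The primitive of a mean-zero `v` vanishes at both ends, so the commuting property of the
Gauss-Radau projection applies to it: `antiGrad` is a right inverse of the discrete gradient on
mean-zero functions. -/
theorem dgGrad_antiGrad (c : FluxChoice) {v : M.Space k} (hv : ip M k v (one M k) = 0) :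
    dgGrad M k c (antiGrad M k c v) = v := by
  rw [(isRadau_antiGrad c v).dgGrad (primFun_left v) (primFun_right hv) (continuous_primFun v)
    (bddMeas_toFun v) fun i x hx => hasDerivAt_primFun v i hx, rep_testInt_toFun]

theorem endTrace_antiGrad (hab : a < b) (c : FluxChoice) {v : M.Space k}
    (hv : ip M k v (one M k) = 0) : endTrace c (antiGrad M k c v) = 0 :=
  (isRadau_antiGrad c v).endTrace hab (primFun_left v) (primFun_right hv)

/-- Gauss-Radau projections are stable in the sup norm only. On a cell, however, the primitive
oscillates by at most `J = ∫ |v|`, so its supremum is at most `|w x| + J` for every `x` in the cell.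
Squaring and integrating over `x` gives an `L²` bound up to `h ‖v‖`. -/
theorem exists_ip_antiGrad_le (k : ℕ) : ∃ C > 0, ∀ {a b : ℝ} (M : Mesh a b) (c : FluxChoice)
    (v : M.Space k), ip M k (antiGrad M k c v) (antiGrad M k c v)
      ≤ C * ((∫ x in a..b, primFun v x ^ 2) + M.size ^ 2 * ip M k v v) := by
  obtain ⟨C, hC, h⟩ := exists_radau_le k
  refine ⟨2 * C ^ 2, by positivity, fun {a b} M c v => ?_⟩
  set w := primFun v with hw
  set δ := antiGrad M k c v with hδ
  have hwb := bddMeas_primFun v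
  rw [M.integral_eq_sum hwb.sq.integrableOn, ip_self_eq_sum, ip_self_eq_sum, Finset.mul_sum,
    ← Finset.sum_add_distrib, Finset.mul_sum]
  refine Finset.sum_le_sum fun i _ => ?_
  have hlr := (M.left_lt_right i).le
  set J := ∫ y in M.left i..M.right i, |cellVal v i y| with hJ
  have hJ2 : J ^ 2 ≤ M.width i * ∫ x in M.left i..M.right i, cellVal v i x ^ 2 := by
    have hc := (continuous_cellVal v i)
    have h1 : IntegrableOn (fun x => |cellVal v i x| ^ 2) (Ioc (M.left i) (M.right i)) :=
      ((hc.abs.pow 2).integrableOn_Icc).mono_set Ioc_subset_Icc_self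
    have h2 : IntegrableOn (fun x => |cellVal v i x| * 1) (Ioc (M.left i) (M.right i)) :=
      ((hc.abs.mul continuous_const).integrableOn_Icc).mono_set Ioc_subset_Icc_self
    have := sq_integral_mul_le (μ := volume.restrict (Ioc (M.left i) (M.right i)))
      (f := fun x => |cellVal v i x|) (g := fun _ => 1) h1 (by simp) h2
    simp only [mul_one, one_pow, sq_abs] at this
    rw [← intervalIntegral.integral_of_le hlr, ← intervalIntegral.integral_of_le hlr,
      ← intervalIntegral.integral_of_le hlr] at this
    rw [hJ]
    refine this.trans (le_of_eq ?_)
    rw [intervalIntegral.integral_const, smul_eq_mul, mul_one, mul_comm]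
    rfl
  have hvar : ∀ x ∈ Icc (M.left i) (M.right i), ∀ y ∈ Icc (M.left i) (M.right i),
      |w y| ≤ |w x| + J := by
    have key : ∀ x ∈ Icc (M.left i) (M.right i), ∀ y ∈ Icc (M.left i) (M.right i), x ≤ y →
        |w y - w x| ≤ J := by
      intro x hx y hy hxy
      rw [hw, primFun_sub_primFun]
      have e : ∫ z in x..y, toFun v z = ∫ z in x..y, cellVal v i z := by
        refine intervalIntegral.integral_congr_ae (Filter.Eventually.of_forall fun z hz => ?_)
        rw [uIoc_of_le hxy] at hz
        exact toFun_eq_cellVal v ⟨by linarith [hz.1, hx.1], by linarith [hz.2, hy.2]⟩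
      rw [e]
      refine (intervalIntegral.abs_integral_le_integral_abs hxy).trans ?_
      exact intervalIntegral.integral_mono_interval hx.1 hxy hy.2
        (Filter.Eventually.of_forall fun _ => abs_nonneg _)
        ((continuous_cellVal v i).abs.intervalIntegrable _ _)
    intro x hx y hy
    have h2 : |w y - w x| ≤ J := by
      rcases le_total x y with h | h
      · exact key x hx y hy h
      · rw [abs_sub_comm]; exact key y hy x hx h
    have h3 := abs_sub_abs_le_abs_sub (w y) (w x)
    linarith
  have hpt : ∀ x ∈ Icc (M.left i) (M.right i), cellVal δ i x ^ 2 ≤ 2 * C ^ 2 * (w x ^ 2 + J ^ 2) := by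
    intro x hx
    have := h hwb (isRadau_antiGrad c v) i 0 (by simp) (|w x| + J)
      (by simpa using hvar x hx) x hx
    rw [Polynomial.eval_zero, sub_zero] at this
    calc cellVal δ i x ^ 2 = |cellVal δ i x| ^ 2 := (sq_abs _).symm
      _ ≤ (C * (|w x| + J)) ^ 2 := pow_le_pow_left₀ (abs_nonneg _) this 2
      _ ≤ 2 * C ^ 2 * (|w x| ^ 2 + J ^ 2) := by
          have := mul_nonneg (sq_nonneg C) (sq_nonneg (|w x| - J))
          linarith
      _ = _ := by rw [sq_abs]
  have hwi : IntervalIntegrable (fun x => w x ^ 2) volume (M.left i) (M.right i) :=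
    hwb.sq.intervalIntegrable (M.left_mem i) (M.right_mem i)
  have hws : M.width i * (M.width i * ∫ x in M.left i..M.right i, cellVal v i x ^ 2)
      ≤ M.size ^ 2 * ∫ x in M.left i..M.right i, cellVal v i x ^ 2 := by
    rw [← mul_assoc, ← pow_two]
    refine mul_le_mul_of_nonneg_right (pow_le_pow_left₀ (M.width_pos i).le (M.width_le_size i) 2)
      (intervalIntegral.integral_nonneg hlr fun _ _ => sq_nonneg _)
  calc ∫ x in M.left i..M.right i, cellVal δ i x ^ 2
      ≤ ∫ x in M.left i..M.right i, 2 * C ^ 2 * (w x ^ 2 + J ^ 2) :=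
        intervalIntegral.integral_mono_on hlr
          (((continuous_cellVal δ i).pow 2).intervalIntegrable _ _)
          ((hwi.add (by simp)).const_mul _) hpt
    _ = 2 * C ^ 2 * ((∫ x in M.left i..M.right i, w x ^ 2) + M.width i * J ^ 2) := by
        rw [intervalIntegral.integral_const_mul, intervalIntegral.integral_add hwi (by simp),
          intervalIntegral.integral_const, smul_eq_mul]
        rfl
    _ ≤ _ := by
        refine mul_le_mul_of_nonneg_left (add_le_add_right ?_ _) (by positivity)
        exact (mul_le_mul_of_nonneg_left hJ2 (M.width_pos i).le).trans hws

/-- The solution operator of the mean zero Galerkin method for the Riesz form. -/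
theorem exists_meanZero_solution (hs0 : 0 < s) (hs1 : s < 1) (hab : a < b) (M : Mesh a b) (k : ℕ)
    {σ : ℝ} (hσ : 0 < σ) (hM : M.IsQuasiUniform σ) :
    ∃ Ψ : M.Space k →ₗ[ℝ] M.Space k, ∀ r, ip M k (Ψ r) (one M k) = 0 ∧
      ∀ w, ip M k w (one M k) = 0 → rieszForm M k hs0 (Ψ r) w = ip M k r w := by
  obtain ⟨c, hc, h⟩ := exists_rieszForm_ge k hs0 hs1 hab hσ
  have hsz := M.size_pos hab
  set W : Submodule ℝ (M.Space k) := LinearMap.ker ((ip M k).flip (one M k)) with hW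
  have hmem : ∀ v, v ∈ W ↔ ip M k v (one M k) = 0 := fun v => by rw [hW, LinearMap.mem_ker]; rfl
  set N : W →ₗ[ℝ] W →ₗ[ℝ] ℝ := (rieszForm M k hs0).domRestrict₁₂ W W with hN
  have hsep : ∀ v : W, (∀ z, N v z = 0) → v = 0 := by
    intro v hv
    have h1 := h M hM (v : M.Space k)
    have h2 : rieszForm M k hs0 (v : M.Space k) v = 0 := hv v
    rw [h2] at h1
    have h3 := ip_self_nonneg (v : M.Space k)
    have h4 : 0 < c * M.size ^ s := by positivity
    exact Subtype.ext (eq_zero_of_ip_self (le_antisymm (by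
      by_contra hcon
      push Not at hcon
      have := mul_pos h4 hcon
      linarith) h3))
  obtain ⟨R, hR⟩ := exists_rep (V := W) (N := N) hsep
  refine ⟨W.subtype.comp (R.comp ((ip M k).domRestrict₂ W)), fun r => ⟨?_, fun w hw => ?_⟩⟩
  · exact (hmem _).1 (R _).2
  · exact hR ((ip M k).domRestrict₂ W r) ⟨w, (hmem w).2 hw⟩

/-- With `ψ` the mean-zero Galerkin solution, set `Δ r = antiGrad ψ`. Then `dgGrad (Δ r) = ψ`, and
every discrete gradient is an admissible test function. For the bound, coercivity gives `h ^ s ‖ψ‖ ≤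
C ‖r‖`; the potential of `ψ` is close to its projection, which is `r` plus a constant; and the
primitive of `ψ` is controlled by the potential modulo constants. The last bound avoids any negative
power of `h`. -/
theorem exists_corrector (k : ℕ) (hs0 : 0 < s) (hs1 : s < 1) (hab : a < b) {σ : ℝ} (hσ : 0 < σ)
    (c : FluxChoice) : ∃ C > 0, ∀ M : Mesh a b, M.IsQuasiUniform σ → M.size ≤ 1 →
      ∃ Δ : M.Space k →ₗ[ℝ] M.Space k, ∀ r, endTrace c (Δ r) = 0 ∧
        ip M k (Δ r) (Δ r) ≤ C * ip M k r r ∧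
        ∀ v, rieszForm M k hs0 (dgGrad M k c (Δ r)) (dgGrad M k c v) = ip M k r (dgGrad M k c v) := by
  obtain ⟨C₁, hC₁, h₁⟩ := exists_ip_antiGrad_le k
  obtain ⟨C₂, hC₂, h₂⟩ := exists_integral_sq_primitive_le hs0 hs1 hab
  obtain ⟨C₃, hC₃, h₃⟩ := exists_integral_sq_sub_rep_rieszInt_le k hs0 hs1 hab hσ
  obtain ⟨e, he, h₄⟩ := exists_rieszForm_ge k hs0 hs1 hab hσ
  refine ⟨C₁ * (C₂ * (2 * C₃ / e ^ 2 + 2) + 1 / e ^ 2), by positivity, fun M hM hM1 => ?_⟩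
  obtain ⟨Ψ, hΨ⟩ := exists_meanZero_solution hs0 hs1 hab M k hσ hM
  refine ⟨(antiGrad M k c).comp Ψ, fun r => ⟨endTrace_antiGrad hab c (hΨ r).1, ?_, fun v => ?_⟩⟩
  · set ψ := Ψ r with hψ
    obtain ⟨hmean, hgal⟩ := hΨ r
    have hsz := M.size_pos hab
    have hψ0 := ip_self_nonneg ψ
    have hr0 := ip_self_nonneg r
    set H := M.size ^ s with hH
    have hH0 : 0 < H := by positivity
    -- The Galerkin equation is tested with `ψ` itself, and one factor `‖ψ‖` is cancelled.
    have hcoer : (e * H) ^ 2 * ip M k ψ ψ ≤ ip M k r r := by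
      have g1 := h₄ M hM ψ
      rw [hgal ψ hmean] at g1
      have g2 := ip_sq_le r ψ
      have g3 : (e * H * ip M k ψ ψ) ^ 2 ≤ ip M k r r * ip M k ψ ψ :=
        (pow_le_pow_left₀ (by positivity) g1 2).trans g2
      rcases hψ0.eq_or_lt with h0 | h0
      · rw [← h0, mul_zero]; exact hr0
      · rw [mul_pow, pow_two (ip M k ψ ψ), ← mul_assoc] at g3
        exact le_of_mul_le_mul_right g3 h0
    have hHψ : H ^ 2 * ip M k ψ ψ ≤ ip M k r r / e ^ 2 := by
      rw [le_div_iff₀ (by positivity)]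
      linarith
    -- For `h ≤ 1` and `s < 1` one has `h ≤ h ^ s`; this is why the mesh size is restricted.
    have hsH : M.size ^ 2 ≤ H ^ 2 := by
      refine pow_le_pow_left₀ hsz.le ?_ 2
      have := Real.rpow_le_rpow_of_exponent_ge hsz hM1 hs1.le
      rwa [Real.rpow_one] at this
    have hfb := bddMeas_rieszInt hs0 (bddSupp_toFun ψ)
    set f := rieszInt s (toFun ψ) with hf
    set P := rep M k (testInt M k hfb) with hP
    -- The Galerkin equation only sees mean-zero test functions, so the projected potential equals
    -- `r` up to a constant.
    obtain ⟨κ, hκ⟩ := exists_eq_smul_one hab (d := P - r) fun w hw => by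
      rw [map_sub, LinearMap.sub_apply, hP, ip_rep, ← hgal w hw]
      exact sub_self _
    have hres : ∫ x in a..b, (f x - κ) ^ 2 ≤ (2 * C₃ / e ^ 2 + 2) * ip M k r r := by
      have g1 := h₃ M hM ψ
      have g0 : ∀ i, ∀ x ∈ Ioc (M.left i) (M.right i), toFun P x = toFun r x + κ := by
        intro i x hx
        rw [sub_eq_iff_eq_add'.1 hκ, toFun_add, toFun_smul]
        simp only
        rw [toFun_eq_cellVal (one M k) hx, cellVal_one, mul_one]
      have hPb := hfb.sub (bddMeas_toFun P)
      have g2 : ∫ x in a..b, (f x - κ) ^ 2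
          ≤ ∫ x in a..b, (2 * (f x - toFun P x) ^ 2 + 2 * (toFun r x * toFun r x)) := by
        have hκm : BddMeas a b fun _ : ℝ => κ := bddMeas_of_continuous continuous_const
        have hsum : BddMeas a b fun x => 2 * (f x - toFun P x) ^ 2 + 2 * (toFun r x * toFun r x) :=
          (hPb.sq.const_mul 2).add (((bddMeas_toFun r).mul (bddMeas_toFun r)).const_mul 2)
        rw [M.integral_eq_sum (hfb.sub hκm).sq.integrableOn, M.integral_eq_sum hsum.integrableOn]
        refine Finset.sum_le_sum fun i _ => ?_
        refine intervalIntegral.integral_mono_on_of_le_Ioo (M.left_lt_right i).le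
          ((hfb.sub hκm).sq.intervalIntegrable (M.left_mem i) (M.right_mem i))
          (hsum.intervalIntegrable (M.left_mem i) (M.right_mem i)) fun x hx => ?_
        have := g0 i x (Ioo_subset_Ioc_self hx)
        rw [this]
        have := sq_nonneg (f x - (toFun r x + κ) - toFun r x)
        linarith
      rw [intervalIntegral.integral_add (interval_ab M (hPb.sq.const_mul 2))
        (interval_ab M (((bddMeas_toFun r).mul (bddMeas_toFun r)).const_mul 2)),
        intervalIntegral.integral_const_mul, intervalIntegral.integral_const_mul,
        ← ip_eq_integral] at g2
      have g3 : C₃ * H ^ 2 * ip M k ψ ψ ≤ C₃ * (ip M k r r / e ^ 2) := by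
        rw [mul_assoc]; exact mul_le_mul_of_nonneg_left hHψ hC₃.le
      have g4 : (2 * C₃ / e ^ 2 + 2) * ip M k r r
          = 2 * (C₃ * (ip M k r r / e ^ 2)) + 2 * ip M k r r := by ring
      linarith
    have hprim := h₂ (toFun ψ) (bddSupp_toFun ψ) (by rw [← ip_one]; exact hmean) κ
    have hlast : M.size ^ 2 * ip M k ψ ψ ≤ ip M k r r / e ^ 2 :=
      (mul_le_mul_of_nonneg_right hsH hψ0).trans hHψ
    calc ip M k (antiGrad M k c ψ) (antiGrad M k c ψ)
        ≤ C₁ * ((∫ x in a..b, primFun ψ x ^ 2) + M.size ^ 2 * ip M k ψ ψ) := h₁ M c ψ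
      _ ≤ C₁ * (C₂ * ((2 * C₃ / e ^ 2 + 2) * ip M k r r) + ip M k r r / e ^ 2) := by
          refine mul_le_mul_of_nonneg_left (add_le_add ?_ hlast) hC₁.le
          exact hprim.trans (mul_le_mul_of_nonneg_left hres hC₂.le)
      _ = _ := by ring
  · rw [LinearMap.comp_apply, dgGrad_antiGrad c (hΨ r).1]
    exact (hΨ r).2 _ (ip_dgGrad_one c v)

end

end LDG

namespace LDG
open MeasureTheory

/-! ### Kernels and smooth functions -/

section
variable {s a b T : ℝ}

/-- The integral is a convolution of a locally integrable kernel with a compactly supported `C¹`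
function, and the derivative falls on the latter. -/
theorem hasDerivAt_integral_kernel {k f f' : ℝ → ℝ} (hk : LocallyIntegrable k) (hf' : Continuous f')
    (hd : ∀ x, HasDerivAt f (f' x) x) (hs : ∀ x ∉ Icc a b, f x = 0) (x : ℝ) :
    HasDerivAt (fun x => ∫ y, k (x - y) * f y) (∫ y, k (x - y) * f' y) x := by
  have hder : deriv f = f' := funext fun x => (hd x).deriv
  have hc : HasCompactSupport f := HasCompactSupport.intro isCompact_Icc hs
  have hcd : ContDiff ℝ 1 f := by
    rw [contDiff_one_iff_deriv]
    exact ⟨fun x => (hd x).differentiableAt, hder ▸ hf'⟩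
  have h := hc.hasDerivAt_convolution_right (ContinuousLinearMap.mul ℝ ℝ) hk hcd x
  have e : ∀ (g : ℝ → ℝ) x, convolution k g (ContinuousLinearMap.mul ℝ ℝ) volume x
      = ∫ y, k (x - y) * g y := fun g x => by
    rw [convolution_def, ← integral_sub_left_eq_self _ volume x]
    simp
  rw [hder, e] at h
  exact h.congr_of_eventuallyEq (Filter.Eventually.of_forall fun x => (e f x).symm)

theorem continuous_integral_kernel {k f : ℝ → ℝ} (hk : LocallyIntegrable k) (hf : Continuous f)
    (hs : ∀ x ∉ Icc a b, f x = 0) : Continuous fun x => ∫ y, k (x - y) * f y := by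
  have hc : HasCompactSupport f := HasCompactSupport.intro isCompact_Icc hs
  have h := hc.continuous_convolution_right (ContinuousLinearMap.mul ℝ ℝ) hk hf
  convert h using 1
  ext x
  rw [convolution_def, ← integral_sub_left_eq_self _ volume x]
  simp

theorem bddSupp_of_continuous {f : ℝ → ℝ} (hf : Continuous f) (hs : ∀ x ∉ Icc a b, f x = 0) :
    BddSupp a b f := by
  obtain ⟨B, hB⟩ := (bddMeas_of_continuous (a := a) (b := b) hf).bdd
  refine ⟨hf.measurable, ⟨|B|, fun x => ?_⟩, hs⟩
  by_cases hx : x ∈ Icc a b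
  · exact (hB x hx).trans (le_abs_self B)
  · rw [hs x hx, abs_zero]; exact abs_nonneg B

/-- The kernel of the left fractional integral. -/
noncomputable def leftKer (s : ℝ) : ℝ → ℝ := (Ici (0 : ℝ)).indicator fun y => |y| ^ (s - 1)

/-- The kernel of the right fractional integral. -/
noncomputable def rightKer (s : ℝ) : ℝ → ℝ := (Iic (0 : ℝ)).indicator fun y => |y| ^ (s - 1)

theorem locallyIntegrable_leftKer (hs0 : 0 < s) : LocallyIntegrable (leftKer s) :=
  (locallyIntegrable_abs_rpow hs0).indicator measurableSet_Ici

theorem locallyIntegrable_rightKer (hs0 : 0 < s) : LocallyIntegrable (rightKer s) :=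
  (locallyIntegrable_abs_rpow hs0).indicator measurableSet_Iic

theorem leftKer_add_rightKer (hs1 : s < 1) (y : ℝ) : leftKer s y + rightKer s y = |y| ^ (s - 1) := by
  unfold leftKer rightKer
  rcases lt_trichotomy y 0 with h | rfl | h
  · rw [indicator_of_notMem (by simpa using h), indicator_of_mem (by simpa using h.le), zero_add]
  · simp [Real.zero_rpow (sub_ne_zero.2 hs1.ne)]
  · rw [indicator_of_mem (by simpa using h.le), indicator_of_notMem (by simpa using h), add_zero]

theorem leftFracInt_eq (s : ℝ) (u : ℝ → ℝ) (x : ℝ) :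
    leftFracInt s u x = (1 / Real.Gamma s) * ∫ y, leftKer s (x - y) * u y := by
  rw [leftFracInt, ← integral_indicator measurableSet_Iic]
  refine congrArg _ (integral_congr_ae (Filter.Eventually.of_forall fun t => ?_))
  by_cases h : t ≤ x
  · simp [leftKer, h, abs_of_nonneg (sub_nonneg.2 h)]
  · simp [leftKer, h]

theorem rightFracInt_eq (s : ℝ) (u : ℝ → ℝ) (x : ℝ) :
    rightFracInt s u x = (1 / Real.Gamma s) * ∫ y, rightKer s (x - y) * u y := by
  rw [rightFracInt, ← integral_indicator measurableSet_Ici]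
  refine congrArg _ (integral_congr_ae (Filter.Eventually.of_forall fun t => ?_))
  by_cases h : x ≤ t
  · simp [rightKer, h, abs_of_nonpos (sub_nonpos.2 h)]
  · simp [rightKer, h]

theorem integrable_kernel_mul {k u : ℝ → ℝ} (hk : LocallyIntegrable k) (hu : BddSupp a b u)
    (x : ℝ) : Integrable fun y => k (x - y) * u y := by
  refine hu.integrable_mul ?_
  have h := hk.integrableOn_isCompact (isCompact_Icc (a := x - b) (b := x - a))
  have hp : MeasurePreserving (fun y : ℝ => x - y) volume volume :=
    Measure.measurePreserving_sub_left volume x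
  rw [← hp.integrableOn_comp_preimage (MeasurableEquiv.subLeft x).measurableEmbedding] at h
  have e : (fun y => x - y) ⁻¹' (Icc (x - b) (x - a)) = Icc a b := by
    ext y; simp
  rwa [e] at h

theorem integral_leftKer_add (hs0 : 0 < s) (hs1 : s < 1) {u : ℝ → ℝ} (hu : BddSupp a b u) (x : ℝ) :
    (∫ y, leftKer s (x - y) * u y) + ∫ y, rightKer s (x - y) * u y = rieszInt s u x := by
  rw [← integral_add (integrable_kernel_mul (locallyIntegrable_leftKer hs0) hu x)
    (integrable_kernel_mul (locallyIntegrable_rightKer hs0) hu x), rieszInt]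
  refine integral_congr_ae (Filter.Eventually.of_forall fun y => ?_)
  simp only
  rw [← add_mul, leftKer_add_rightKer hs1]

/-- The normalization of the Riesz potential. -/
noncomputable def fracConst (s : ℝ) : ℝ := (1 / Real.Gamma s) / (2 * Real.cos (s * Real.pi / 2))

theorem fracConst_pos (hs0 : 0 < s) (hs1 : s < 1) : 0 < fracConst s := by
  have hpi := Real.pi_pos
  have h1 : 0 < Real.cos (s * Real.pi / 2) := by
    refine Real.cos_pos_of_mem_Ioo ⟨by nlinarith, by nlinarith⟩
  have := Real.Gamma_pos_of_pos hs0
  unfold fracConst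
  positivity

theorem fracLaplacianInt_eq (hs0 : 0 < s) (hs1 : s < 1) {u : ℝ → ℝ} (hu : BddSupp a b u) (x : ℝ) :
    fracLaplacianInt s u x = fracConst s * rieszInt s u x := by
  rw [fracLaplacianInt, leftFracInt_eq, rightFracInt_eq, ← mul_add, integral_leftKer_add hs0 hs1 hu,
    fracConst]
  ring

theorem iteratedDeriv_two_kernel {k u u' u'' : ℝ → ℝ} (hk : LocallyIntegrable k)
    (h1 : ∀ x, HasDerivAt u (u' x) x) (h2 : ∀ x, HasDerivAt u' (u'' x) x) (hc : Continuous u'')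
    (hs : ∀ x ∉ Icc a b, u x = 0) (hs' : ∀ x ∉ Icc a b, u' x = 0) (d x : ℝ) :
    iteratedDeriv 2 (fun x => d * ∫ y, k (x - y) * u y) x = d * ∫ y, k (x - y) * u'' y := by
  have hc' : Continuous u' := continuous_iff_continuousAt.2 fun x => (h2 x).continuousAt
  have e1 : deriv (fun x => d * ∫ y, k (x - y) * u y) = fun x => d * ∫ y, k (x - y) * u' y :=
    funext fun x => ((hasDerivAt_integral_kernel hk hc' h1 hs x).const_mul d).deriv
  rw [iteratedDeriv_succ, iteratedDeriv_one, e1]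
  exact ((hasDerivAt_integral_kernel hk hc h2 hs' x).const_mul d).deriv

/-- Both derivatives are moved onto `u`, and the two one-sided integrals combine to the Riesz
potential of `u''`. The sign comes out positive since `cos (α π / 2) = -cos ((2 - α) π / 2)`. -/
theorem negFracLaplacian_eq {α : ℝ} (h1α : 1 < α) (hα2 : α < 2) {u u' u'' : ℝ → ℝ}
    (h1 : ∀ x, HasDerivAt u (u' x) x) (h2 : ∀ x, HasDerivAt u' (u'' x) x) (hc : Continuous u'')
    (hs : ∀ x ∉ Icc a b, u x = 0) (hs' : ∀ x ∉ Icc a b, u' x = 0)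
    (hs'' : ∀ x ∉ Icc a b, u'' x = 0) (x : ℝ) :
    negFracLaplacian α u x = fracConst (2 - α) * rieszInt (2 - α) u'' x := by
  have hs0 : 0 < 2 - α := by linarith
  have hs1 : 2 - α < 1 := by linarith
  have hceil : ⌈α⌉₊ = 2 := by
    rw [Nat.ceil_eq_iff two_ne_zero]
    norm_num
    exact ⟨h1α, hα2.le⟩
  have hl : leftFracInt (2 - α) u = fun x => (1 / Real.Gamma (2 - α)) * ∫ y,
      leftKer (2 - α) (x - y) * u y := funext fun x => leftFracInt_eq _ _ x
  have hr : rightFracInt (2 - α) u = fun x => (1 / Real.Gamma (2 - α)) * ∫ y,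
      rightKer (2 - α) (x - y) * u y := funext fun x => rightFracInt_eq _ _ x
  rw [negFracLaplacian, leftRLDeriv, rightRLDeriv, hceil, Nat.cast_ofNat, hl, hr,
    iteratedDeriv_two_kernel (locallyIntegrable_leftKer hs0) h1 h2 hc hs hs',
    iteratedDeriv_two_kernel (locallyIntegrable_rightKer hs0) h1 h2 hc hs hs', neg_one_sq, one_mul,
    ← mul_add, integral_leftKer_add hs0 hs1 (bddSupp_of_continuous hc hs''), fracConst,
    show α * Real.pi / 2 = Real.pi - (2 - α) * Real.pi / 2 by ring, Real.cos_pi_sub, mul_neg,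
    neg_div_neg_eq]
  ring

/-! ### Smooth families -/

/-- Functions of class `C^n` on `ℝ × [0, T]` which vanish for `x` outside of `[a, b]`. -/
structure SmoothFam (a b T : ℝ) (n : ℕ) (f : ℝ → ℝ → ℝ) : Prop where
  smooth : IsSmooth n T f
  supp : ∀ t ∈ Icc 0 T, ∀ x ∉ Icc a b, f x t = 0

theorem SmoothFam.of_le {m n : ℕ} {f : ℝ → ℝ → ℝ} (h : SmoothFam a b T n f) (hmn : m ≤ n) :
    SmoothFam a b T m f := ⟨ContDiffOn.of_le h.smooth (by exact_mod_cast hmn), h.supp⟩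

/-- The partial derivatives are components of the derivative within the strip, which is unique
because `T > 0`. They inherit the support condition, so the operation can be iterated. -/
theorem SmoothFam.exists_deriv (hT : 0 < T) {n : ℕ} {f : ℝ → ℝ → ℝ}
    (h : SmoothFam a b T (n + 1) f) : ∃ fx ft : ℝ → ℝ → ℝ, SmoothFam a b T n fx ∧
      SmoothFam a b T n ft ∧ (∀ t ∈ Icc 0 T, ∀ x, HasDerivAt (fun y => f y t) (fx x t) x) ∧
      ∀ t ∈ Icc 0 T, ∀ x, HasDerivWithinAt (fun r => f x r) (ft x t) (Icc 0 T) t := by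
  set S : Set (ℝ × ℝ) := univ ×ˢ Icc 0 T with hS
  set F : ℝ × ℝ → ℝ := fun z => f z.1 z.2 with hF
  have hu : UniqueDiffOn ℝ S := uniqueDiffOn_univ.prod (uniqueDiffOn_Icc hT)
  have hcd : ContDiffOn ℝ ((n : ℕ) + 1 : ℕ) F S := h.smooth
  have hF' : ContDiffOn ℝ n (fderivWithin ℝ F S) S := hcd.fderivWithin hu (by norm_cast)
  have hfd : ∀ z ∈ S, HasFDerivWithinAt F (fderivWithin ℝ F S z) S z := fun z hz =>
    (hcd.differentiableOn (by norm_cast) z hz).hasFDerivWithinAt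
  have hx : ∀ t ∈ Icc 0 T, ∀ x, HasDerivAt (fun y => f y t) (fderivWithin ℝ F S (x, t) (1, 0)) x := by
    intro t ht x
    have h1 : HasDerivWithinAt (fun y : ℝ => (y, t)) ((1 : ℝ), (0 : ℝ)) univ x :=
      ((hasDerivAt_id x).prodMk (hasDerivAt_const x t)).hasDerivWithinAt
    have h2 := (hfd (x, t) ⟨mem_univ x, ht⟩).comp_hasDerivWithinAt x h1
      (show MapsTo (fun y : ℝ => (y, t)) univ S from fun y _ => ⟨mem_univ y, ht⟩)
    exact h2.hasDerivAt Filter.univ_mem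
  have ht : ∀ t ∈ Icc 0 T, ∀ x, HasDerivWithinAt (fun r => f x r)
      (fderivWithin ℝ F S (x, t) (0, 1)) (Icc 0 T) t := by
    intro t ht x
    have h1 : HasDerivWithinAt (fun r : ℝ => (x, r)) ((0 : ℝ), (1 : ℝ)) (Icc 0 T) t :=
      ((hasDerivAt_const t x).prodMk (hasDerivAt_id t)).hasDerivWithinAt
    exact (hfd (x, t) ⟨mem_univ x, ht⟩).comp_hasDerivWithinAt t h1
      (show MapsTo (fun r : ℝ => (x, r)) (Icc 0 T) S from fun r hr => ⟨mem_univ x, hr⟩)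
  refine ⟨fun x t => fderivWithin ℝ F S (x, t) (1, 0), fun x t => fderivWithin ℝ F S (x, t) (0, 1),
    ⟨hF'.clm_apply contDiffOn_const, fun t htt x hxx => ?_⟩,
    ⟨hF'.clm_apply contDiffOn_const, fun t htt x hxx => ?_⟩, hx, ht⟩
  -- The complement of `[a, b]` is open, so `f` vanishes in a neighbourhood of such a point.
  · refine (hx t htt x).unique ((hasDerivAt_const x (0 : ℝ)).congr_of_eventuallyEq ?_)
    filter_upwards [isClosed_Icc.isOpen_compl.mem_nhds hxx] with y hy
    exact h.supp t htt y hy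
  · refine (uniqueDiffOn_Icc hT t htt).eq_deriv _ (ht t htt x)
      ((hasDerivWithinAt_const t (Icc 0 T) (0 : ℝ)).congr_of_mem (fun r hr => h.supp r hr x hxx) htt)

theorem SmoothFam.continuous {f : ℝ → ℝ → ℝ} {n : ℕ} (h : SmoothFam a b T n f) {t : ℝ}
    (ht : t ∈ Icc 0 T) : Continuous fun x => f x t := by
  have h1 : ContinuousOn (fun z : ℝ × ℝ => f z.1 z.2) (univ ×ˢ Icc 0 T) :=
    ContDiffOn.continuousOn h.smooth
  exact h1.comp_continuous (f := fun x : ℝ => (x, t)) (by fun_prop) fun x => ⟨mem_univ x, ht⟩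

theorem SmoothFam.continuousOn {f : ℝ → ℝ → ℝ} {n : ℕ} (h : SmoothFam a b T n f) (x : ℝ) :
    ContinuousOn (fun t => f x t) (Icc 0 T) := by
  have h1 : ContinuousOn (fun z : ℝ × ℝ => f z.1 z.2) (univ ×ˢ Icc 0 T) :=
    ContDiffOn.continuousOn h.smooth
  exact h1.comp (f := fun t : ℝ => (x, t)) (by fun_prop) fun t ht => ⟨mem_univ x, ht⟩

theorem SmoothFam.exists_bound {f : ℝ → ℝ → ℝ} {n : ℕ} (h : SmoothFam a b T n f) :
    ∃ B, ∀ t ∈ Icc 0 T, ∀ x, |f x t| ≤ B := by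
  have h1 : ContinuousOn (fun z : ℝ × ℝ => f z.1 z.2) (univ ×ˢ Icc 0 T) :=
    ContDiffOn.continuousOn h.smooth
  obtain ⟨B, hB⟩ := ((isCompact_Icc (a := a) (b := b)).prod
    (isCompact_Icc (a := (0 : ℝ)) (b := T))).bddAbove_image
    (h1.mono (prod_mono_left (subset_univ (Icc a b)))).abs
  refine ⟨|B|, fun t ht x => ?_⟩
  by_cases hx : x ∈ Icc a b
  · exact (hB (mem_image_of_mem _ (⟨hx, ht⟩ : (x, t) ∈ Icc a b ×ˢ Icc 0 T))).trans (le_abs_self B)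
  · rw [h.supp t ht x hx, abs_zero]; exact abs_nonneg B

theorem SmoothFam.bddSupp {f : ℝ → ℝ → ℝ} {n : ℕ} (h : SmoothFam a b T n f) {t : ℝ}
    (ht : t ∈ Icc 0 T) : BddSupp a b fun x => f x t :=
  bddSupp_of_continuous (h.continuous ht) (h.supp t ht)

theorem SmoothFam.exists_derivChain (hT : 0 < T) : ∀ {n : ℕ} {f : ℝ → ℝ → ℝ},
    SmoothFam a b T n f → ∃ B, ∀ t ∈ Icc 0 T, DerivChain a b B n fun x => f x t
  | 0, f, h => by
      obtain ⟨B, hB⟩ := h.exists_bound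
      exact ⟨B, fun t ht x _ => hB t ht x⟩
  | n + 1, f, h => by
      obtain ⟨fx, ft, hfx, hft, hdx, -⟩ := h.exists_deriv hT
      obtain ⟨B, hB⟩ := hfx.exists_derivChain hT
      exact ⟨B, fun t ht => ⟨fun x => fx x t, fun x _ => hdx t ht x, hB t ht⟩⟩

theorem hasDerivAt_rieszInt (hs0 : 0 < s) {f f' : ℝ → ℝ} (hf' : Continuous f')
    (hd : ∀ x, HasDerivAt f (f' x) x) (hs : ∀ x ∉ Icc a b, f x = 0) (x : ℝ) :
    HasDerivAt (rieszInt s f) (rieszInt s f' x) x :=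
  hasDerivAt_integral_kernel (locallyIntegrable_abs_rpow hs0) hf' hd hs x

/-- For functions vanishing outside `[a, b]` the Riesz potential commutes with differentiation, so
the potential has as many bounded derivatives as the function. There is no loss at the end points,
as the smoothness holds across them. -/
theorem SmoothFam.exists_derivChain_rieszInt (hT : 0 < T) (hs0 : 0 < s) :
    ∀ {n : ℕ} {f : ℝ → ℝ → ℝ}, SmoothFam a b T n f →
      ∃ B, ∀ t ∈ Icc 0 T, DerivChain a b B n (rieszInt s fun x => f x t)
  | 0, f, h => by
      obtain ⟨B, hB⟩ := h.exists_bound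
      exact ⟨_, fun t ht x hx => abs_rieszInt_le hs0 (h.bddSupp ht) (hB t ht) hx⟩
  | n + 1, f, h => by
      obtain ⟨fx, ft, hfx, hft, hdx, -⟩ := h.exists_deriv hT
      obtain ⟨B, hB⟩ := hfx.exists_derivChain_rieszInt hT hs0
      exact ⟨B, fun t ht => ⟨rieszInt s fun x => fx x t, fun x _ =>
        hasDerivAt_rieszInt hs0 (hfx.continuous ht) (hdx t ht) (h.supp t ht) x, hB t ht⟩⟩

/-- Families of functions on `[a, b]` with a bounded time derivative. -/
structure TimeFam (a b T B : ℝ) (f f' : ℝ → ℝ → ℝ) : Prop where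
  cont : ∀ t, Continuous fun x => f x t
  cont' : ∀ t, Continuous fun x => f' x t
  bdd : ∀ t, ∀ x ∈ Icc a b, |f x t| ≤ B
  bdd' : ∀ t, ∀ x ∈ Icc a b, |f' x t| ≤ B
  deriv : ∀ t ∈ Ioo 0 T, ∀ x ∈ Icc a b, HasDerivAt (fun r => f x r) (f' x t) t
  contT : ∀ x ∈ Icc a b, ContinuousOn (fun r => f x r) (Icc 0 T)

theorem TimeFam.integral {B : ℝ} {f f' : ℝ → ℝ → ℝ} (h : TimeFam a b T B f f') {K : ℝ → ℝ}
    (hK : IntegrableOn K (Icc a b)) :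
    (∀ t ∈ Ioo 0 T, HasDerivAt (fun r => ∫ y in Icc a b, K y * f y r)
      (∫ y in Icc a b, K y * f' y t) t) ∧
    ContinuousOn (fun r => ∫ y in Icc a b, K y * f y r) (Icc 0 T) := by
  have hbi : Integrable (fun y => |K y| * B) (volume.restrict (Icc a b)) := hK.abs.mul_const B
  have hm : ∀ r, AEStronglyMeasurable (fun y => K y * f y r) (volume.restrict (Icc a b)) := fun r =>
    hK.aestronglyMeasurable.mul (h.cont r).aestronglyMeasurable
  have hm' : ∀ r, AEStronglyMeasurable (fun y => K y * f' y r) (volume.restrict (Icc a b)) :=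
    fun r => hK.aestronglyMeasurable.mul (h.cont' r).aestronglyMeasurable
  have hb : ∀ r, ∀ᵐ y ∂(volume.restrict (Icc a b)), ‖K y * f y r‖ ≤ |K y| * B := fun r =>
    (ae_restrict_iff' measurableSet_Icc).2 (Filter.Eventually.of_forall fun y hy => by
      rw [norm_mul]
      exact mul_le_mul_of_nonneg_left (h.bdd r y hy) (abs_nonneg _))
  refine ⟨fun t ht => ?_, ?_⟩
  · refine (hasDerivAt_integral_of_dominated_loc_of_deriv_le (Ioo_mem_nhds ht.1 ht.2)
      (F := fun r y => K y * f y r) (F' := fun r y => K y * f' y r) (bound := fun y => |K y| * B)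
      (Filter.Eventually.of_forall hm) (hbi.mono' (hm t) (hb t)) (hm' t) ?_ hbi ?_).2
    · refine (ae_restrict_iff' measurableSet_Icc).2 (Filter.Eventually.of_forall fun y hy r _ => ?_)
      rw [norm_mul]
      exact mul_le_mul_of_nonneg_left (h.bdd' r y hy) (abs_nonneg _)
    · exact (ae_restrict_iff' measurableSet_Icc).2 (Filter.Eventually.of_forall fun y hy r hr =>
        (h.deriv r hr y hy).const_mul _)
  · refine continuousOn_of_dominated (fun r _ => hm r) (fun r _ => hb r) hbi ?_
    exact (ae_restrict_iff' measurableSet_Icc).2 (Filter.Eventually.of_forall fun y hy =>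
      continuousOn_const.mul (h.contT y hy))

theorem TimeFam.rieszInt {B : ℝ} {f f' : ℝ → ℝ → ℝ} (h : TimeFam a b T B f f') (hs0 : 0 < s)
    (hs : ∀ t, ∀ x ∉ Icc a b, f x t = 0) (hs' : ∀ t, ∀ x ∉ Icc a b, f' x t = 0) (hab : a < b) :
    TimeFam a b T (2 * (b - a) ^ s / s * B) (fun x t => rieszInt s (fun y => f y t) x)
      (fun x t => LDG.rieszInt s (fun y => f' y t) x) := by
  have hB0 : 0 ≤ B := (abs_nonneg _).trans (h.bdd 0 a (left_mem_Icc.2 hab.le))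
  have hbd : ∀ t x, |f x t| ≤ B := fun t x => by
    by_cases hx : x ∈ Icc a b
    · exact h.bdd t x hx
    · rw [hs t x hx, abs_zero]; exact hB0
  have hbd' : ∀ t x, |f' x t| ≤ B := fun t x => by
    by_cases hx : x ∈ Icc a b
    · exact h.bdd' t x hx
    · rw [hs' t x hx, abs_zero]; exact hB0
  have hbs := fun t => bddSupp_of_continuous (h.cont t) (hs t)
  have hbs' := fun t => bddSupp_of_continuous (h.cont' t) (hs' t)
  have e : ∀ x t, LDG.rieszInt s (fun y => f y t) x
      = ∫ y in Icc a b, |x - y| ^ (s - 1) * f y t := fun x t => (hbs t).integral_eq _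
  have e' : ∀ x t, LDG.rieszInt s (fun y => f' y t) x
      = ∫ y in Icc a b, |x - y| ^ (s - 1) * f' y t := fun x t => (hbs' t).integral_eq _
  refine ⟨fun t => ?_, fun t => ?_, fun t x hx => ?_, fun t x hx => ?_, fun t ht x hx => ?_,
    fun x hx => ?_⟩
  · exact continuous_integral_kernel (locallyIntegrable_abs_rpow hs0) (h.cont t) (hs t)
  · exact continuous_integral_kernel (locallyIntegrable_abs_rpow hs0) (h.cont' t) (hs' t)
  · exact abs_rieszInt_le hs0 (hbs t) (hbd t) hx
  · exact abs_rieszInt_le hs0 (hbs' t) (hbd' t) hx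
  · simp_rw [e, e']
    exact (h.integral (integrableOn_abs_sub_rpow hs0 x a b)).1 t ht
  · simp_rw [e]
    exact (h.integral (integrableOn_abs_sub_rpow hs0 x a b)).2

/-- The nearest point of `[0, T]`. -/
noncomputable def clamp (T t : ℝ) : ℝ := max 0 (min t T)

theorem clamp_mem (hT : 0 < T) (t : ℝ) : clamp T t ∈ Icc 0 T :=
  ⟨le_max_left _ _, max_le hT.le (min_le_right _ _)⟩

theorem clamp_of_mem {t : ℝ} (ht : t ∈ Icc 0 T) : clamp T t = t := by
  rw [clamp, min_eq_left ht.2, max_eq_right ht.1]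

/-- A smooth family, extended in time by its values at the end points, is a family with a bounded
time derivative. -/
theorem SmoothFam.timeFam (hT : 0 < T) {f ft : ℝ → ℝ → ℝ} (h : SmoothFam a b T 0 f)
    (h' : SmoothFam a b T 0 ft)
    (hd : ∀ t ∈ Icc 0 T, ∀ x, HasDerivWithinAt (fun r => f x r) (ft x t) (Icc 0 T) t) :
    ∃ B, TimeFam a b T B (fun x t => f x (clamp T t)) (fun x t => ft x (clamp T t)) := by
  obtain ⟨B, hB⟩ := h.exists_bound
  obtain ⟨B', hB'⟩ := h'.exists_bound
  refine ⟨max B B', fun t => h.continuous (clamp_mem hT t), fun t => h'.continuous (clamp_mem hT t),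
    fun t x _ => (hB _ (clamp_mem hT t) x).trans (le_max_left _ _),
    fun t x _ => (hB' _ (clamp_mem hT t) x).trans (le_max_right _ _), fun t ht x _ => ?_, fun x _ => ?_⟩
  · have ht' := Ioo_subset_Icc_self ht
    simp only [clamp_of_mem ht']
    refine ((hd t ht' x).hasDerivAt (Icc_mem_nhds ht.1 ht.2)).congr_of_eventuallyEq ?_
    filter_upwards [Ioo_mem_nhds ht.1 ht.2] with r hr
    rw [clamp_of_mem (Ioo_subset_Icc_self hr)]
  · exact (h.continuousOn x).congr fun r hr => by simp only [clamp_of_mem hr]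

end

end LDG

namespace LDG
open MeasureTheory

/-! ### Approximation estimates -/

section
variable {s a b T : ℝ} {M : Mesh a b} {k : ℕ}

/-- Cellwise Taylor polynomials. -/
theorem exists_taylor_space {B : ℝ} {f : ℝ → ℝ} (hf : DerivChain a b B (k + 1) f) (M : Mesh a b) :
    ∃ w : M.Space k, ∀ i, ∀ x ∈ Icc (M.left i) (M.right i),
      |f x - cellVal w i x| ≤ B * M.size ^ (k + 1) := by
  choose c hc using fun i => hf.exists_taylor (M.left_lt_right i).le (M.cell_subset i)
  refine ⟨fun i => ⟨ofCoeffs (c i), Polynomial.mem_degreeLE.2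
    (Polynomial.degree_le_of_natDegree_le (natDegree_ofCoeffs_le _))⟩, fun i x hx => ?_⟩
  refine (hc i x hx).trans ?_
  have h0 : 0 ≤ B * (M.right i - M.left i) ^ (k + 1) := (abs_nonneg _).trans (hc i x hx)
  have hw := M.width_pos i
  have hB : 0 ≤ B := nonneg_of_mul_nonneg_left h0 (pow_pos hw _)
  exact mul_le_mul_of_nonneg_left (pow_le_pow_left₀ hw.le (M.width_le_size i) _) hB

theorem integral_sq_sub_projection_le {B : ℝ} {f : ℝ → ℝ} (hf : DerivChain a b B (k + 1) f)
    (hfb : BddMeas a b f) :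
    ∫ x in a..b, (f x - toFun (rep M k (testInt M k hfb)) x) ^ 2
      ≤ (b - a) * (B * M.size ^ (k + 1)) ^ 2 := by
  obtain ⟨w, hw⟩ := exists_taylor_space hf M
  exact (integral_sq_sub_rep_le hfb w).trans (integral_sq_sub_toFun_le hfb w hw)

/-- The stability estimate is applied to the difference with a Taylor polynomial, which the
projection reproduces. -/
theorem exists_radau_error (k : ℕ) : ∃ C > 0, ∀ {a b B : ℝ} {M : Mesh a b} {c : FluxChoice}
    {f : ℝ → ℝ} {P : M.Space k}, DerivChain a b B (k + 1) f → BddMeas a b f → IsRadau c f P →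
      ∀ i, ∀ x ∈ Icc (M.left i) (M.right i), |f x - cellVal P i x| ≤ C * B * M.size ^ (k + 1) := by
  obtain ⟨C, hC, h⟩ := exists_radau_le k
  refine ⟨1 + C, by positivity, fun {a b B M c f P} hf hfb hP i x hx => ?_⟩
  obtain ⟨w, hw⟩ := exists_taylor_space hf M
  have h1 := h hfb hP i (w i) (natDegree_le w i) _ (hw i) x hx
  have h2 := hw i x hx
  have h3 : |f x - cellVal P i x| ≤ |f x - cellVal w i x| + |cellVal P i x - cellVal w i x| := by
    rw [abs_sub_comm (cellVal P i x)]
    exact abs_sub_le _ _ _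
  have h4 : |cellVal P i x - cellVal w i x| ≤ C * (B * M.size ^ (k + 1)) := h1
  calc _ ≤ B * M.size ^ (k + 1) + C * (B * M.size ^ (k + 1)) := h3.trans (add_le_add h2 h4)
    _ = _ := by ring

theorem integral_sq_rieszInt_le (hs0 : 0 < s) (hab : a < b) {g : ℝ → ℝ} (hg : BddSupp a b g) :
    ∫ x in a..b, rieszInt s g x ^ 2 ≤ (2 * (b - a) ^ s / s) ^ 2 * ∫ x in a..b, g x ^ 2 := by
  have hm := measurable_abs_sub_rpow s
  have hba : 0 ≤ b - a := (sub_pos.2 hab).le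
  have hC : 0 ≤ 2 * (b - a) ^ s / s := by positivity
  have hrow : ∀ x ∈ Icc a b, ∫⁻ y in Icc a b, ENNReal.ofReal |(|x - y| ^ (s - 1))|
      ≤ ENNReal.ofReal (2 * (b - a) ^ s / s) := by
    intro x hx
    rw [← ofReal_integral_eq_lintegral_ofReal (integrableOn_abs_sub_rpow hs0 x a b).abs
      (Filter.Eventually.of_forall fun _ => abs_nonneg _)]
    refine ENNReal.ofReal_le_ofReal (le_trans (le_of_eq ?_) (integral_abs_sub_rpow_le hs0 hx))
    exact integral_congr_ae (Filter.Eventually.of_forall fun y =>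
      abs_of_nonneg (Real.rpow_nonneg (abs_nonneg _) _))
  simp only [intervalIntegral.integral_of_le hab.le, ← integral_Icc_eq_integral_Ioc]
  refine (integral_sq_le_of_schur (K := fun x y => |x - y| ^ (s - 1)) hm (φ := fun _ => 1)
    (χ := fun _ => 1) measurable_const measurable_const (fun _ => one_pos) hC ?_ ?_ hg.meas
    hg.sq.integrable.integrableOn (g := rieszInt s g)
    (measurable_rieszInt s hg.meas).aestronglyMeasurable
    (Filter.Eventually.of_forall fun x => hg.integral_eq _)).2
  · refine (ae_restrict_iff' measurableSet_Icc).2 (Filter.Eventually.of_forall fun x hx => ?_)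
    simpa using hrow x hx
  · refine (ae_restrict_iff' measurableSet_Icc).2 (Filter.Eventually.of_forall fun y hy => ?_)
    simpa [abs_sub_comm] using hrow y hy

theorem bilin_add_self_le (v w : M.Space k) :
    ip M k (v + w) (v + w) ≤ 2 * ip M k v v + 2 * ip M k w w := by
  have := ip_self_nonneg (v - w)
  simp only [map_add, map_sub, LinearMap.add_apply, LinearMap.sub_apply] at this ⊢
  linarith

theorem bilin_sub_self_le (v w : M.Space k) :
    ip M k (v - w) (v - w) ≤ 2 * ip M k v v + 2 * ip M k w w := by
  have := ip_self_nonneg (v + w)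
  simp only [map_add, map_sub, LinearMap.add_apply, LinearMap.sub_apply] at this ⊢
  linarith

/-- The projection of a function minus a piecewise polynomial. -/
theorem ip_rep_testInt_sub_le {f : ℝ → ℝ} (hf : BddMeas a b f) (v : M.Space k) :
    ip M k (rep M k (testInt M k hf) - v) (rep M k (testInt M k hf) - v)
      ≤ ∫ x in a..b, (f x - toFun v x) ^ 2 := by
  have h := integral_sq_sub_toFun hf v
  have h' := integral_sq_sub_toFun hf (rep M k (testInt M k hf))
  rw [← testInt_apply hf, ← ip_rep] at h h'
  have h0 : 0 ≤ ∫ x in a..b, (f x - toFun (rep M k (testInt M k hf)) x) ^ 2 :=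
    intervalIntegral.integral_nonneg M.le fun _ _ => sq_nonneg _
  simp only [map_sub, LinearMap.sub_apply]
  rw [ip_comm v]
  linarith

/-- The consistency error of the discrete Riesz potential. -/
theorem exists_consistency_le (k : ℕ) (hs0 : 0 < s) (hab : a < b) : ∃ C > 0, ∀ {B : ℝ} {M : Mesh a b}
    {c : FluxChoice} {f : ℝ → ℝ} {Q : M.Space k} (hf : BddSupp a b f),
      DerivChain a b B (k + 1) f → DerivChain a b B (k + 1) (rieszInt s f) →
      IsRadau c (rieszInt s f) Q →
      ip M k (rep M k (rieszForm M k hs0 (rep M k (testInt M k hf.bddMeas))) - Q)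
        (rep M k (rieszForm M k hs0 (rep M k (testInt M k hf.bddMeas))) - Q)
        ≤ C * (B * M.size ^ (k + 1)) ^ 2 := by
  obtain ⟨C₁, hC₁, h₁⟩ := exists_radau_error k
  have hba : 0 < b - a := sub_pos.2 hab
  refine ⟨2 * ((2 * (b - a) ^ s / s) ^ 2 * (b - a)) + 2 * ((b - a) * C₁ ^ 2), by positivity,
    fun {B M c f Q} hf hd hd' hQ => ?_⟩
  set P := rep M k (testInt M k hf.bddMeas) with hP
  have hPb := bddMeas_rieszInt hs0 (bddSupp_toFun P)
  have hqb := bddMeas_rieszInt hs0 hf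
  have hg : BddSupp a b fun x => f x + (-1) * toFun P x := by
    refine ⟨hf.meas.add ((bddSupp_toFun P).meas.const_mul _), ?_, fun x hx => by
      rw [hf.supp x hx, (bddSupp_toFun P).supp x hx]; simp⟩
    obtain ⟨B₁, hB₁⟩ := hf.bdd
    obtain ⟨B₂, hB₂⟩ := (bddSupp_toFun P).bdd
    refine ⟨B₁ + B₂, fun x => (abs_add_le _ _).trans (add_le_add (hB₁ x) ?_)⟩
    rw [abs_mul, abs_neg, abs_one, one_mul]
    exact hB₂ x
  have hneg : BddSupp a b fun x => (-1) * toFun P x := by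
    have := bddSupp_toFun ((-1 : ℝ) • P)
    rwa [toFun_smul] at this
  -- The potential of the projected function is the potential of `f` minus the potential of the
  -- projection error; the latter is small because the Riesz potential is bounded on `L²`.
  have e1 : ∀ x, rieszInt s (toFun P) x = rieszInt s f x - rieszInt s (fun x => f x + (-1) * toFun P x) x :=
    fun x => by
      rw [rieszInt_add hs0 hf hneg, rieszInt_const_mul]; ring
  have h1 := ip_rep_testInt_sub_le hPb Q
  change ip M k (rep M k (rieszForm M k hs0 P) - Q) (rep M k (rieszForm M k hs0 P) - Q) ≤ _ at h1
  have h2 := integral_sq_rieszInt_le hs0 hab hg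
  have h3 : ∫ x in a..b, (f x + (-1) * toFun P x) ^ 2 ≤ (b - a) * (B * M.size ^ (k + 1)) ^ 2 := by
    have := integral_sq_sub_projection_le (M := M) hd hf.bddMeas
    simpa only [neg_one_mul, ← sub_eq_add_neg] using this
  have h4 := integral_sq_sub_toFun_le hqb Q (h₁ hd' hqb hQ)
  have hgb := bddMeas_rieszInt hs0 hg
  have hqQ := hqb.sub (bddMeas_toFun Q)
  have h5 : ∫ x in a..b, (rieszInt s (toFun P) x - toFun Q x) ^ 2
      ≤ ∫ x in a..b, (2 * rieszInt s (fun x => f x + (-1) * toFun P x) x ^ 2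
        + 2 * (rieszInt s f x - toFun Q x) ^ 2) := by
    refine intervalIntegral.integral_mono_on hab.le (interval_ab M (hPb.sub (bddMeas_toFun Q)).sq)
      (interval_ab M ((hgb.sq.const_mul 2).add (hqQ.sq.const_mul 2))) fun x _ => ?_
    rw [e1]
    have := sq_nonneg (rieszInt s (fun x => f x + (-1) * toFun P x) x
      + (rieszInt s f x - toFun Q x))
    linarith
  rw [intervalIntegral.integral_add (interval_ab M (hgb.sq.const_mul 2))
    (interval_ab M (hqQ.sq.const_mul 2)), intervalIntegral.integral_const_mul,
    intervalIntegral.integral_const_mul] at h5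
  have h6 : (2 * (b - a) ^ s / s) ^ 2 * ∫ x in a..b, (f x + (-1) * toFun P x) ^ 2
      ≤ (2 * (b - a) ^ s / s) ^ 2 * ((b - a) * (B * M.size ^ (k + 1)) ^ 2) :=
    mul_le_mul_of_nonneg_left h3 (sq_nonneg _)
  have h7 : (C₁ * B * M.size ^ (k + 1)) ^ 2 = C₁ ^ 2 * (B * M.size ^ (k + 1)) ^ 2 := by ring
  rw [h7] at h4
  linarith

/-! ### Time derivatives of projections -/

theorem TimeFam.bddMeas {B : ℝ} {f f' : ℝ → ℝ → ℝ} (h : TimeFam a b T B f f') (t : ℝ) :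
    BddMeas a b fun x => f x t := bddMeas_of_continuous (h.cont t)

theorem TimeFam.bddMeas' {B : ℝ} {f f' : ℝ → ℝ → ℝ} (h : TimeFam a b T B f f') (t : ℝ) :
    BddMeas a b fun x => f' x t := bddMeas_of_continuous (h.cont' t)

theorem integral_mul_toFun_comm (f : ℝ → ℝ) (v : M.Space k) :
    ∫ x in a..b, f x * toFun v x = ∫ x in Icc a b, toFun v x * f x := by
  rw [intervalIntegral.integral_of_le M.le, ← integral_Icc_eq_integral_Ioc]
  simp_rw [mul_comm]

theorem TimeFam.weakDeriv_rep {B : ℝ} {f f' : ℝ → ℝ → ℝ} (h : TimeFam a b T B f f') {t : ℝ}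
    (ht : t ∈ Ioo 0 T) : WeakDeriv (fun r => rep M k (testInt M k (h.bddMeas r)))
      (rep M k (testInt M k (h.bddMeas' t))) t := by
  refine weakDeriv_of_separatingLeft (N := ip M k) ip_separatingLeft fun z => ?_
  simp only [ip_rep, testInt_apply, integral_mul_toFun_comm]
  exact (h.integral (bddSupp_toFun z).integrable.integrableOn).1 t ht

theorem TimeFam.weakCont_rep {B : ℝ} {f f' : ℝ → ℝ → ℝ} (h : TimeFam a b T B f f') :
    WeakCont (fun r => rep M k (testInt M k (h.bddMeas r))) (Icc 0 T) := by
  refine weakCont_of_separatingLeft (N := ip M k) ip_separatingLeft fun z => ?_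
  simp only [ip_rep, testInt_apply, integral_mul_toFun_comm]
  exact (h.integral (bddSupp_toFun z).integrable.integrableOn).2

theorem endPt_mem_Icc (M : Mesh a b) (c : FluxChoice) (i : Fin M.K) : endPt M c i ∈ Icc a b :=
  M.cell_subset i (endPt_mem c i)

theorem TimeFam.weakDeriv_radau {B : ℝ} {f f' : ℝ → ℝ → ℝ} (h : TimeFam a b T B f f')
    (c : FluxChoice) {t : ℝ} (ht : t ∈ Ioo 0 T) :
    WeakDeriv (fun r => radauRep M k c (radauDual M k c (h.bddMeas r)))
      (radauRep M k c (radauDual M k c (h.bddMeas' t))) t := by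
  refine weakDeriv_of_separatingLeft (N := radauForm M k c) (radauForm_separatingLeft c) fun z => ?_
  simp only [radauForm_radauRep, radauDual_apply, integral_mul_toFun_comm]
  refine HasDerivAt.fun_sub (HasDerivAt.fun_sum fun i _ => ?_)
    ((h.integral (bddSupp_toFun (cellDeriv M k z)).integrable.integrableOn).1 t ht)
  exact (h.deriv t ht _ (endPt_mem_Icc M c i)).mul_const _

theorem TimeFam.weakCont_radau {B : ℝ} {f f' : ℝ → ℝ → ℝ} (h : TimeFam a b T B f f')
    (c : FluxChoice) :
    WeakCont (fun r => radauRep M k c (radauDual M k c (h.bddMeas r))) (Icc 0 T) := by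
  refine weakCont_of_separatingLeft (N := radauForm M k c) (radauForm_separatingLeft c) fun z => ?_
  simp only [radauForm_radauRep, radauDual_apply, integral_mul_toFun_comm]
  refine ContinuousOn.sub (continuousOn_finsetSum _ fun i _ => ?_)
    ((h.integral (bddSupp_toFun (cellDeriv M k z)).integrable.integrableOn).2)
  exact (h.contT _ (endPt_mem_Icc M c i)).mul continuousOn_const

/-- Lagrange basis polynomials at the nodes `0, …, k`. -/
noncomputable def lagrangePoly (k j : ℕ) : ℝ[X] :=
  Lagrange.basis (Finset.range (k + 1)) (fun j : ℕ => (j : ℝ)) j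

theorem natDegree_lagrangePoly {j : ℕ} (hj : j ∈ Finset.range (k + 1)) :
    (lagrangePoly k j).natDegree ≤ k := by
  refine Polynomial.natDegree_le_of_degree_le ?_
  rw [lagrangePoly, Lagrange.degree_basis (Nat.cast_injective.injOn) hj]
  simp

theorem eq_sum_lagrangePoly {p : ℝ[X]} (hp : p.natDegree ≤ k) :
    p = ∑ j ∈ Finset.range (k + 1), Polynomial.C (p.eval (j : ℝ)) * lagrangePoly k j := by
  have h := Lagrange.eq_interpolate (s := Finset.range (k + 1)) (v := fun j : ℕ => (j : ℝ))
    (f := p) (Nat.cast_injective.injOn) (by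
      rw [Finset.card_range]
      exact (Polynomial.degree_le_of_natDegree_le hp).trans_lt (by exact_mod_cast Nat.lt_succ_self k))
  rwa [Lagrange.interpolate_apply] at h

/-- Coordinates given by point values: the hypotheses on the time dependence of `u_h` concern values
at fixed points, and finitely many of these determine the whole curve. -/
theorem eq_sum_single (v : M.Space k) : v = ∑ i, ∑ j : Fin (k + 1), cellVal v i ((j : ℕ) : ℝ) •
    single M i (natDegree_lagrangePoly (Finset.mem_range.2 j.2)) := by
  ext1 i
  refine Subtype.ext ?_
  rw [Finset.sum_apply, Finset.sum_eq_single i]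
  · rw [Finset.sum_apply]
    simp only [single, Pi.smul_apply, Pi.single_eq_same, AddSubmonoidClass.coe_finsetSum,
      SetLike.val_smul, Polynomial.smul_eq_C_mul]
    rw [Fin.sum_univ_eq_sum_range fun j => Polynomial.C (cellVal v i (j : ℝ)) * lagrangePoly k j]
    exact eq_sum_lagrangePoly (natDegree_le v i)
  · intro j _ hj
    rw [Finset.sum_apply]
    simp [single, Pi.single_eq_of_ne (Ne.symm hj)]
  · simp

theorem weakCont_of_cellVal {f : ℝ → M.Space k} {S : Set ℝ}
    (h : ∀ i x, ContinuousOn (fun r => cellVal (f r) i x) S) : WeakCont f S := by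
  intro ℓ
  have e : (fun r => ℓ (f r)) = fun r => ∑ i, ∑ j : Fin (k + 1), cellVal (f r) i ((j : ℕ) : ℝ) *
      ℓ (single M i (natDegree_lagrangePoly (Finset.mem_range.2 j.2))) := by
    ext r
    conv_lhs => rw [eq_sum_single (f r)]
    simp
  rw [e]
  exact continuousOn_finsetSum _ fun i _ => continuousOn_finsetSum _ fun j _ =>
    (h i _).mul continuousOn_const

theorem exists_weakDeriv_of_cellVal {f : ℝ → M.Space k} {t : ℝ} {d : Fin M.K → ℝ → ℝ}
    (h : ∀ i x, HasDerivAt (fun r => cellVal (f r) i x) (d i x) t) :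
    ∃ f' : M.Space k, WeakDeriv f f' t ∧ ∀ i x, cellVal f' i x = d i x := by
  set f' : M.Space k := ∑ i, ∑ j : Fin (k + 1), d i ((j : ℕ) : ℝ) •
    single M i (natDegree_lagrangePoly (Finset.mem_range.2 j.2)) with hf'
  have hw : WeakDeriv f f' t := by
    intro ℓ
    have e : (fun r => ℓ (f r)) = fun r => ∑ i, ∑ j : Fin (k + 1), cellVal (f r) i ((j : ℕ) : ℝ) *
        ℓ (single M i (natDegree_lagrangePoly (Finset.mem_range.2 j.2))) := by
      ext r
      conv_lhs => rw [eq_sum_single (f r)]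
      simp
    rw [e, hf']
    simp only [map_sum, map_smul, smul_eq_mul]
    exact HasDerivAt.fun_sum fun i _ => HasDerivAt.fun_sum fun j _ => (h i _).mul_const _
  exact ⟨f', hw, fun i x => (hw (evalAt M k i x)).unique (h i x)⟩

/-- Gronwall's inequality. -/
theorem le_of_hasDerivAt_le (hT : 0 < T) {E E' : ℝ → ℝ} {R : ℝ} (hc : ContinuousOn E (Icc 0 T))
    (hd : ∀ t ∈ Ioo 0 T, HasDerivAt E (E' t) t) (hle : ∀ t ∈ Ioo 0 T, E' t ≤ E t + R) {t : ℝ}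
    (ht : t ∈ Icc 0 T) : E t + R ≤ (E 0 + R) * Real.exp t := by
  -- The derivative is `(E' - E - R) exp (-t)`, which is nonpositive.
  have hanti : AntitoneOn (fun t => (E t + R) * Real.exp (-t)) (Icc 0 T) := by
    have hder : ∀ t ∈ Ioo 0 T, HasDerivAt (fun t => (E t + R) * Real.exp (-t))
        (E' t * Real.exp (-t) + (E t + R) * (Real.exp (-t) * (-1))) t := fun t ht =>
      ((hd t ht).add_const R).mul ((hasDerivAt_neg t).exp)
    refine antitoneOn_of_deriv_nonpos (convex_Icc 0 T)
      ((hc.add continuousOn_const).mul (by fun_prop)) ?_ ?_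
    · rw [interior_Icc]
      exact fun t ht => (hder t ht).differentiableAt.differentiableWithinAt
    · rw [interior_Icc]
      intro t ht
      rw [(hder t ht).deriv]
      have := mul_nonneg (sub_nonneg.2 (hle t ht)) (Real.exp_pos (-t)).le
      linarith
  have h := hanti (left_mem_Icc.2 hT.le) ht ht.1
  simp only [neg_zero, Real.exp_zero, mul_one] at h
  calc E t + R = (E t + R) * Real.exp (-t) * Real.exp t := by
        rw [mul_assoc, ← Real.exp_add, neg_add_cancel, Real.exp_zero, mul_one]
    _ ≤ _ := mul_le_mul_of_nonneg_right h (Real.exp_pos t).le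

end

end LDG

namespace LDG
open MeasureTheory

/-! ### The error equation -/

section
variable {a b T ε α β : ℝ} {M : Mesh a b} {k : ℕ} {c : FluxChoice} {g : ℝ → ℝ → ℝ} {u₀ : ℝ → ℝ}
  {uh ph qh : ℝ → M.Space k}

theorem eq_of_ip_eq {v w : M.Space k} (h : ∀ z, ip M k v z = ip M k w z) : v = w := by
  rw [← sub_eq_zero]
  refine ip_separatingLeft _ fun z => ?_
  rw [map_sub, LinearMap.sub_apply, h, sub_self]

theorem IsLDGSolution.gradient_eq (h : IsLDGSolution c T ε α β g u₀ uh ph qh) {t : ℝ}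
    (ht : t ∈ Ioc 0 T) : ph t = √ε • dgGrad M k c (uh t) := by
  refine eq_of_ip_eq fun z => ?_
  rw [map_smul, LinearMap.smul_apply, ip_dgGrad, formU_apply, ip_apply, smul_eq_mul, Finset.mul_sum]
  refine Finset.sum_congr rfl fun i _ => ?_
  linarith [h.gradient t ht z i]

theorem IsLDGSolution.ip_flux (h : IsLDGSolution c T ε α β g u₀ uh ph qh) (hs0 : 0 < 2 - α)
    (hs1 : 2 - α < 1) {t : ℝ} (ht : t ∈ Ioc 0 T) (w : M.Space k) :
    ip M k (qh t) w = fracConst (2 - α) * rieszForm M k hs0 (ph t) w := by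
  have hb := bddMeas_rieszInt hs0 (bddSupp_toFun (ph t))
  rw [rieszForm_apply, integral_mul_toFun hb, ip_apply, Finset.mul_sum]
  refine Finset.sum_congr rfl fun i _ => ?_
  rw [sub_eq_zero.1 (h.flux t ht w i), ← intervalIntegral.integral_const_mul]
  simp only [fracLaplacianInt_eq hs0 hs1 (bddSupp_toFun (ph t)), mul_assoc]

/-- The reduced scheme: summation over the cells and the adjointness of the fluxes move the gradient
from `q_h` to the test function. Then `q_h` is eliminated by the flux equation and `p_h` by the
gradient equation; the two factors `√ε` combine to `ε`. -/
theorem IsLDGSolution.evolution_eq (h : IsLDGSolution c T ε α β g u₀ uh ph qh) (hab : a < b)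
    (hε : 0 < ε) (hs0 : 0 < 2 - α) (hs1 : 2 - α < 1) {t : ℝ} (ht : t ∈ Ioc 0 T) {uh' : M.Space k}
    (hu : ∀ i x, cellVal uh' i x = derivWithin (fun s => cellVal (uh s) i x) (Icc 0 T) t)
    (v : M.Space k) :
    ip M k uh' v + ε * fracConst (2 - α) * rieszForm M k hs0 (dgGrad M k c (uh t)) (dgGrad M k c v)
      + √ε * β / M.size * (endTrace c (uh t) * endTrace c v)
      = ∑ i, ∫ x in M.left i..M.right i, g x t * cellVal v i x := by
  have h1 : ∀ i, (∫ x in M.left i..M.right i, cellVal uh' i x * cellVal v i x)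
      - √ε * (bdry (fluxQ c β (uh t) (qh t)) v i
        - ∫ x in M.left i..M.right i, cellVal (qh t) i x * cellDer v i x)
      = ∫ x in M.left i..M.right i, g x t * cellVal v i x := fun i => by
    have := h.evolution t ht v i
    simp only [← hu] at this
    linarith
  rw [← Finset.sum_congr rfl fun i _ => h1 i, Finset.sum_sub_distrib, ← Finset.mul_sum, ← ip_apply]
  have h2 := formQ_add_formU hab c β (uh t) (qh t) v
  rw [← ip_dgGrad, ip_comm, h.ip_flux hs0 hs1 ht, h.gradient_eq ht, map_smul, LinearMap.smul_apply,
    smul_eq_mul] at h2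
  rw [eq_sub_of_add_eq h2]
  have h3 : √ε * √ε = ε := Real.mul_self_sqrt hε.le
  calc _ = ip M k uh' v + (√ε * √ε) * fracConst (2 - α) *
          rieszForm M k hs0 (dgGrad M k c (uh t)) (dgGrad M k c v)
        + √ε * β / M.size * (endTrace c (uh t) * endTrace c v) := by rw [h3]
    _ = _ := by ring

theorem IsLDGSolution.initial_eq (h : IsLDGSolution c T ε α β g u₀ uh ph qh)
    (hu₀ : BddMeas a b u₀) : uh 0 = rep M k (testInt M k hu₀) := by
  refine eq_of_ip_eq fun z => ?_
  rw [ip_rep, testInt_apply, integral_mul_toFun hu₀, ip_apply]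
  exact Finset.sum_congr rfl fun i _ => sub_eq_zero.1 (h.initial z i)

/-- The identity which governs the difference of the scheme and a projection of the solution. -/
theorem error_identity {s γ κ d : ℝ} (hs0 : 0 < s) {U U' Q P R w w' δ δ' : M.Space k}
    (hw : ∀ v, ip M k w' v + γ * rieszForm M k hs0 (dgGrad M k c w) (dgGrad M k c v)
      + κ * (endTrace c w * endTrace c v)
      = ip M k P v - γ * (-ip M k (dgGrad M k c v) Q + d * endTrace c v))
    (hU : endTrace c U = 0) (hδ : endTrace c δ = 0)
    (hR : R = rep M k (rieszForm M k hs0 (dgGrad M k c U)) - Q)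
    (hδR : ∀ v, rieszForm M k hs0 (dgGrad M k c δ) (dgGrad M k c v) = ip M k R (dgGrad M k c v)) :
    ip M k (U' - δ' - w') (U - δ - w) = ip M k (U' - P) (U - δ - w) - ip M k δ' (U - δ - w)
      + γ * d * endTrace c (U - δ - w)
      - γ * rieszForm M k hs0 (dgGrad M k c (U - δ - w)) (dgGrad M k c (U - δ - w))
      - κ * endTrace c (U - δ - w) ^ 2 := by
  have h1 : endTrace c w = -endTrace c (U - δ - w) := by
    simp only [map_sub, hU, hδ]; ring
  have h2 := hw (U - δ - w)
  -- The corrector reproduces the whole consistency residual. Subtracting its equation removes every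
  -- term in which the residual is tested with a gradient.
  have h3 : ∀ v, rieszForm M k hs0 (dgGrad M k c δ) (dgGrad M k c v)
      = rieszForm M k hs0 (dgGrad M k c U) (dgGrad M k c v) - ip M k (dgGrad M k c v) Q := fun v => by
    rw [hδR, hR, map_sub, LinearMap.sub_apply, ip_rep, ip_comm Q]
  replace h3 := h3 (U - δ - w)
  rw [h1] at h2
  have h4 : dgGrad M k c w = dgGrad M k c U - dgGrad M k c δ - dgGrad M k c (U - δ - w) := by
    simp only [map_sub]; abel
  rw [h4] at h2
  generalize U - δ - w = ξ at *
  simp only [map_sub, LinearMap.sub_apply] at h2 ⊢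
  linear_combination -h2 - γ * h3

theorem two_mul_ip_le (v w : M.Space k) : 2 * ip M k v w ≤ 2 * ip M k v v + ip M k w w / 2 := by
  have := ip_self_nonneg ((2 : ℝ) • v - w)
  simp only [map_sub, map_smul, LinearMap.sub_apply, LinearMap.smul_apply, smul_eq_mul] at this
  rw [ip_comm w v] at this
  linarith

theorem neg_two_mul_ip_le (v w : M.Space k) :
    -(2 * ip M k v w) ≤ 2 * ip M k v v + ip M k w w / 2 := by
  have := two_mul_ip_le (-v) w
  simp only [map_neg, LinearMap.neg_apply, neg_neg] at this
  linarith

/-- Completing the square: the penalty has strength `κ / h`, so a flux defect `d` costs only `h d²`.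
-/
theorem penalty_le {γ d h κ x : ℝ} (hh : 0 < h) (hκ : 0 < κ) :
    2 * (γ * d * x) - 2 * (κ / h * x ^ 2) ≤ γ ^ 2 * d ^ 2 * h / (2 * κ) := by
  have : γ ^ 2 * d ^ 2 * h / (2 * κ) - (2 * (γ * d * x) - 2 * (κ / h * x ^ 2))
      = (γ * d * h - 2 * κ * x) ^ 2 / (2 * κ * h) := by
    field_simp
    ring
  have h2 : 0 ≤ (γ * d * h - 2 * κ * x) ^ 2 / (2 * κ * h) := by positivity
  linarith

/-- Solutions whose derivatives up to order two in space and one in time are controlled. -/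
structure RegularFam (a b T s B₀ B₁ B : ℝ) (n : ℕ) (u v w ut vt : ℝ → ℝ → ℝ) : Prop where
  famU : TimeFam a b T B₀ u ut
  famV : TimeFam a b T B₁ v vt
  derivU : ∀ t x, HasDerivAt (fun x => u x t) (v x t) x
  derivV : ∀ t x, HasDerivAt (fun x => v x t) (w x t) x
  contW : ∀ t, Continuous fun x => w x t
  suppU : ∀ t, ∀ x ∉ Icc a b, u x t = 0
  suppV : ∀ t, ∀ x ∉ Icc a b, v x t = 0
  suppVt : ∀ t, ∀ x ∉ Icc a b, vt x t = 0
  suppW : ∀ t, ∀ x ∉ Icc a b, w x t = 0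
  chainU : ∀ t, DerivChain a b B n fun x => u x t
  chainUt : ∀ t, DerivChain a b B n fun x => ut x t
  chainV : ∀ t, DerivChain a b B n fun x => v x t
  chainVt : ∀ t, DerivChain a b B n fun x => vt x t
  chainRieszV : ∀ t, DerivChain a b B n (rieszInt s fun x => v x t)
  chainRieszVt : ∀ t, DerivChain a b B n (rieszInt s fun x => vt x t)

theorem eq_zero_of_notMem_Icc {f : ℝ → ℝ} (hf : Continuous f) (hs : ∀ x ∉ Icc a b, f x = 0) :
    f a = 0 ∧ f b = 0 := by
  have hcl : IsClosed {x | f x = 0} := isClosed_singleton.preimage hf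
  constructor
  · have h : Iio a ⊆ {x | f x = 0} := fun x hx => hs x fun h => (not_le.2 hx) h.1
    exact hcl.closure_subset_iff.2 h (by rw [closure_Iio]; exact self_mem_Iic)
  · have h : Ioi b ⊆ {x | f x = 0} := fun x hx => hs x fun h => (not_le.2 hx) h.2
    exact hcl.closure_subset_iff.2 h (by rw [closure_Ioi]; exact self_mem_Ici)

end

end LDG

/-! ### The energy estimate -/

namespace LDG
open MeasureTheory

section
variable {a b T ε α β : ℝ} {M : Mesh a b} {k : ℕ} {c : FluxChoice} {g : ℝ → ℝ → ℝ} {u₀ : ℝ → ℝ}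
  {uh ph qh : ℝ → M.Space k}

theorem IsLDGSolution.weakCont (h : IsLDGSolution c T ε α β g u₀ uh ph qh) :
    WeakCont uh (Icc 0 T) := weakCont_of_cellVal h.continuous

theorem IsLDGSolution.exists_weakDeriv (h : IsLDGSolution c T ε α β g u₀ uh ph qh) {t : ℝ}
    (ht : t ∈ Ioo 0 T) : ∃ uh' : M.Space k, WeakDeriv uh uh' t ∧
      ∀ i x, cellVal uh' i x = derivWithin (fun s => cellVal (uh s) i x) (Icc 0 T) t :=
  exists_weakDeriv_of_cellVal fun i x =>
    (h.differentiable i x t (Ioo_subset_Ioc_self ht)).hasDerivWithinAt.hasDerivAt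
      (Icc_mem_nhds ht.1 ht.2)

theorem ip_sub_self_comm (v w : M.Space k) : ip M k (v - w) (v - w) = ip M k (w - v) (w - v) := by
  simp only [map_sub, LinearMap.sub_apply]; ring

theorem sum_integral_source {γ : ℝ} {f p q : ℝ → ℝ} (hp : BddMeas a b p) (hq : BddMeas a b q)
    (hf : ∀ x ∈ Ioo a b, f x = p x - γ * q x) (v : M.Space k) :
    ∑ i, ∫ x in M.left i..M.right i, f x * cellVal v i x
      = ip M k (rep M k (testInt M k hp)) v - γ * ∫ x in a..b, q x * toFun v x := by
  rw [ip_rep, testInt_apply, ← intervalIntegral.integral_const_mul,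
    ← intervalIntegral.integral_sub (interval_ab M (hp.mul (bddMeas_toFun v)))
      (interval_ab M ((hq.mul (bddMeas_toFun v)).const_mul γ))]
  have e : ∀ x, p x * toFun v x - γ * (q x * toFun v x) = (p x - γ * q x) * toFun v x :=
    fun x => by ring
  simp only [e]
  rw [integral_mul_toFun (hp.sub (hq.const_mul γ))]
  refine Finset.sum_congr rfl fun i _ => ?_
  simp only [intervalIntegral.integral_of_le (M.left_lt_right i).le, integral_Ioc_eq_integral_Ioo]
  refine setIntegral_congr_fun measurableSet_Ioo fun x hx => ?_
  have h1 := M.left_mem i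
  have h2 := M.right_mem i
  simp only [hf x ⟨h1.1.trans_lt hx.1, hx.2.trans_le h2.2⟩]

theorem rieszForm_self_nonneg {s : ℝ} (hs0 : 0 < s) (hs1 : s < 1) (hab : a < b) {σ : ℝ} (hσ : 0 < σ)
    (hM : M.IsQuasiUniform σ) (v : M.Space k) : 0 ≤ rieszForm M k hs0 v v := by
  obtain ⟨C, hC, h⟩ := exists_rieszForm_ge k hs0 hs1 hab hσ
  have := M.size_pos hab
  have h1 : 0 ≤ C * M.size ^ s := by positivity
  exact (mul_nonneg h1 (ip_self_nonneg v)).trans (h M hM v)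

theorem integral_sq_sub_toFun_le_add {f : ℝ → ℝ} (hf : BddMeas a b f) (v w : M.Space k) :
    ∫ x in a..b, (f x - toFun w x) ^ 2
      ≤ 2 * (∫ x in a..b, (f x - toFun v x) ^ 2) + 2 * ip M k (v - w) (v - w) := by
  have hv := bddMeas_toFun v
  have hw := bddMeas_toFun w
  have e : ip M k (v - w) (v - w) = ∫ x in a..b, (toFun v x - toFun w x) ^ 2 := by
    rw [integral_sq_sub_toFun hv, ← ip_eq_integral]
    simp only [pow_two, ← ip_eq_integral, map_sub, LinearMap.sub_apply]
    rw [ip_comm w v]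
    ring
  rw [e, ← intervalIntegral.integral_const_mul, ← intervalIntegral.integral_const_mul,
    ← intervalIntegral.integral_add (interval_ab M ((hf.sub hv).sq.const_mul 2))
      (interval_ab M ((hv.sub hw).sq.const_mul 2))]
  refine intervalIntegral.integral_mono_on M.le (interval_ab M (hf.sub hw).sq)
    (interval_ab M (((hf.sub hv).sq.const_mul 2).add ((hv.sub hw).sq.const_mul 2))) fun x _ => ?_
  linarith [sq_nonneg (f x - toFun v x - (toFun v x - toFun w x))]

/-- The energy is the squared norm of `ξ`, the projection minus the corrector minus `u_h`. In its
time derivative the Riesz form has a good sign and the penalty absorbs the flux defect; the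
projection error of `u_t` and the time derivative of the corrector are of order `h ^ (k + 1)` in
`L²`. -/
theorem exists_energy_le (k : ℕ) (hs0 : 0 < 2 - α) (hs1 : 2 - α < 1) (hab : a < b) (hT : 0 < T)
    (hε : 0 < ε) (hβ : 0 < β) {σ : ℝ} (hσ : 0 < σ) (c : FluxChoice) {B₀ B₁ B : ℝ}
    {u v w ut vt : ℝ → ℝ → ℝ} (hreg : RegularFam a b T (2 - α) B₀ B₁ B (k + 1) u v w ut vt)
    (hg : ∀ t ∈ Ioo 0 T, ∀ x ∈ Ioo a b, g x t
      = ut x t - ε * fracConst (2 - α) * rieszInt (2 - α) (fun x => w x t) x) :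
    ∃ A > 0, ∀ M : Mesh a b, M.IsQuasiUniform σ → M.size ≤ 1 → ∀ uh ph qh : ℝ → M.Space k,
      IsLDGSolution c T ε α β g (fun x => u x 0) uh ph qh → ∀ t ∈ Icc 0 T,
        ∫ x in a..b, (u x t - toFun (uh t) x) ^ 2 ≤ (A * M.size ^ (k + 1)) ^ 2 := by
  obtain ⟨C₁, hC₁, hrad⟩ := exists_radau_error k
  obtain ⟨C₂, hC₂, hcorr⟩ := exists_corrector k hs0 hs1 hab hσ c
  obtain ⟨C₃, hC₃, hcons⟩ := exists_consistency_le k hs0 hab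
  have hba : 0 < b - a := sub_pos.2 hab
  set γ := ε * fracConst (2 - α) with hγ
  set κ := √ε * β with hκ
  have hγ0 : 0 < γ := mul_pos hε (fracConst_pos hs0 hs1)
  have hκ0 : 0 < κ := mul_pos (Real.sqrt_pos.2 hε) hβ
  -- The summands account for the Gauss-Radau error, for the corrector, and for the flux defect
  -- after completing the square.
  set A := 2 * ((b - a) * C₁ ^ 2) + 2 * (C₂ * C₃) + γ ^ 2 * C₁ ^ 2 / (2 * κ) with hA
  have hA0 : 0 < A := by positivity
  set L := √(A + 4 * (A + A) * Real.exp T + 2 * A) * |B| + 1 with hL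
  refine ⟨L, by positivity, fun M hM hM1 uh ph qh hsol => ?_⟩
  obtain ⟨Δ, hΔ⟩ := hcorr M hM hM1
  have hsz := M.size_pos hab
  set η := B * M.size ^ (k + 1) with hη
  have hU := hreg.famU
  have hV := hreg.famV
  have hQ := hV.rieszInt hs0 hreg.suppV hreg.suppVt hab
  have bV := fun t => bddSupp_of_continuous (hV.cont t) (hreg.suppV t)
  have bVt := fun t => bddSupp_of_continuous (hV.cont' t) (hreg.suppVt t)
  have bW := fun t => bddSupp_of_continuous (hreg.contW t) (hreg.suppW t)
  set P : ℝ → M.Space k := fun t => radauRep M k c (radauDual M k c (hU.bddMeas t)) with hP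
  set P' : ℝ → M.Space k := fun t => radauRep M k c (radauDual M k c (hU.bddMeas' t)) with hP'
  set Q : ℝ → M.Space k := fun t => radauRep M k c.swap (radauDual M k c.swap (hQ.bddMeas t)) with hQ'
  set Q' : ℝ → M.Space k := fun t => radauRep M k c.swap (radauDual M k c.swap (hQ.bddMeas' t)) with hQt
  -- This map depends on the mesh only, and so does `Δ`, so the time derivative of the corrector is
  -- the corrector of the differentiated residual.
  set Φ : M.Space k →ₗ[ℝ] M.Space k := (rep M k).comp (rieszForm M k hs0) with hΦ
  set r : ℝ → M.Space k := fun t => Φ (rep M k (testInt M k (hV.bddMeas t))) - Q t with hr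
  set r' : ℝ → M.Space k := fun t => Φ (rep M k (testInt M k (hV.bddMeas' t))) - Q' t with hr'
  set ξ : ℝ → M.Space k := fun t => P t - Δ (r t) - uh t with hξ
  have iP : ∀ t, IsRadau c (fun x => u x t) (P t) := fun t => isRadau_radauRep c _
  have iP' : ∀ t, IsRadau c (fun x => ut x t) (P' t) := fun t => isRadau_radauRep c _
  have iQ : ∀ t, IsRadau c.swap (rieszInt (2 - α) fun x => v x t) (Q t) :=
    fun t => isRadau_radauRep c.swap _
  have iQ' : ∀ t, IsRadau c.swap (rieszInt (2 - α) fun x => vt x t) (Q' t) :=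
    fun t => isRadau_radauRep c.swap _
  -- approximation errors
  have e1 : ∀ t, ∫ x in a..b, (u x t - toFun (P t) x) ^ 2 ≤ (b - a) * C₁ ^ 2 * η ^ 2 := fun t =>
    (integral_sq_sub_toFun_le (hU.bddMeas t) (P t)
      (hrad (hreg.chainU t) (hU.bddMeas t) (iP t))).trans (le_of_eq (by rw [hη]; ring))
  have e2 : ∀ t, ∫ x in a..b, (ut x t - toFun (P' t) x) ^ 2 ≤ (b - a) * C₁ ^ 2 * η ^ 2 := fun t =>
    (integral_sq_sub_toFun_le (hU.bddMeas' t) (P' t)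
      (hrad (hreg.chainUt t) (hU.bddMeas' t) (iP' t))).trans (le_of_eq (by rw [hη]; ring))
  have e3 : ∀ t, ip M k (Δ (r t)) (Δ (r t)) ≤ C₂ * C₃ * η ^ 2 := fun t =>
    ((hΔ (r t)).2.1.trans (mul_le_mul_of_nonneg_left
      (hcons (bV t) (hreg.chainV t) (hreg.chainRieszV t) (iQ t)) hC₂.le)).trans
      (le_of_eq (by ring))
  have e4 : ∀ t, ip M k (Δ (r' t)) (Δ (r' t)) ≤ C₂ * C₃ * η ^ 2 := fun t =>
    ((hΔ (r' t)).2.1.trans (mul_le_mul_of_nonneg_left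
      (hcons (bVt t) (hreg.chainVt t) (hreg.chainRieszVt t) (iQ' t)) hC₂.le)).trans
      (le_of_eq (by ring))
  have hu0 : ∀ t, u a t = 0 ∧ u b t = 0 := fun t => eq_zero_of_notMem_Icc (hU.cont t) (hreg.suppU t)
  have gP : ∀ t, dgGrad M k c (P t) = rep M k (testInt M k (hV.bddMeas t)) := fun t =>
    (iP t).dgGrad (hu0 t).1 (hu0 t).2 (hU.cont t) (hV.bddMeas t) fun i x _ => hreg.derivU t x
  -- the initial error
  have hE0 : ip M k (ξ 0) (ξ 0) ≤ A * η ^ 2 := by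
    have h1 := bilin_sub_self_le (P 0 - uh 0) (Δ (r 0))
    rw [ip_sub_self_comm (P 0), hsol.initial_eq (hU.bddMeas 0)] at h1
    have h2 := ip_rep_testInt_sub_le (hU.bddMeas 0) (P 0)
    have h3 : ξ 0 = P 0 - rep M k (testInt M k (hU.bddMeas 0)) - Δ (r 0) := by
      rw [hξ]; simp only; rw [hsol.initial_eq (hU.bddMeas 0)]; abel
    have h4 : 0 ≤ γ ^ 2 * C₁ ^ 2 / (2 * κ) * η ^ 2 := by positivity
    rw [h3, hA]
    linarith [e1 0, e3 0]
  have hcont : ContinuousOn (fun t => ip M k (ξ t) (ξ t)) (Icc 0 T) :=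
    (((hU.weakCont_radau c).sub (((hV.weakCont_rep.map Φ).sub
      (hQ.weakCont_radau c.swap)).map Δ)).sub hsol.weakCont).bilin_self (ip M k)
  -- the energy inequality
  have hder : ∀ t ∈ Ioo 0 T, ∃ E', HasDerivAt (fun t => ip M k (ξ t) (ξ t)) E' t ∧
      E' ≤ ip M k (ξ t) (ξ t) + A * η ^ 2 := by
    intro t ht
    obtain ⟨uh', hw, hval⟩ := hsol.exists_weakDeriv ht
    have hd := (((hU.weakDeriv_radau c ht).sub ((((hV.weakDeriv_rep ht).map Φ).sub
      (hQ.weakDeriv_radau c.swap ht)).map Δ)).sub hw).bilin_self (ip M k)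
    refine ⟨_, hd, ?_⟩
    change ip M k (P' t - Δ (r' t) - uh') (ξ t) + ip M k (ξ t) (P' t - Δ (r' t) - uh') ≤ _
    obtain ⟨d, hdη, hflux⟩ := (iQ t).exists_flux hab (hQ.cont t) (bddMeas_rieszInt hs0 (bW t))
      (fun i x _ => hasDerivAt_rieszInt hs0 (hreg.contW t) (hreg.derivV t) (hreg.suppV t) x)
      (hrad (hreg.chainRieszV t) (hQ.bddMeas t) (iQ t))
    -- The equation rewrites the source as `u_t` minus `γ` times the potential of `u_xx`, the
    -- derivative of the potential of `u_x`. Flux consistency expresses the latter by `Q` and the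
    -- defect `d`.
    have hid := error_identity (γ := γ) (κ := κ / M.size) (d := d) (c := c) hs0 (U := P t)
      (U' := P' t) (Q := Q t) (P := rep M k (testInt M k (hU.bddMeas' t))) (R := r t) (w := uh t)
      (w' := uh') (δ := Δ (r t)) (δ' := Δ (r' t)) (fun z => by
        rw [hsol.evolution_eq hab hε hs0 hs1 (Ioo_subset_Ioc_self ht) hval,
          sum_integral_source (hU.bddMeas' t) (bddMeas_rieszInt hs0 (bW t)) (hg t ht), hflux])
      ((iP t).endTrace hab (hu0 t).1 (hu0 t).2) (hΔ (r t)).1 (by rw [gP]; rfl) (hΔ (r t)).2.2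
    change ip M k (P' t - Δ (r' t) - uh') (ξ t) = ip M k _ (ξ t) - ip M k _ (ξ t)
      + γ * d * endTrace c (ξ t) - γ * rieszForm M k hs0 (dgGrad M k c (ξ t)) (dgGrad M k c (ξ t))
      - κ / M.size * endTrace c (ξ t) ^ 2 at hid
    rw [ip_comm (ξ t), hid]
    have i1 := two_mul_ip_le (P' t - rep M k (testInt M k (hU.bddMeas' t))) (ξ t)
    have i2 := neg_two_mul_ip_le (Δ (r' t)) (ξ t)
    have i3 := penalty_le (γ := γ) (d := d) (x := endTrace c (ξ t)) hsz hκ0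
    have i4 := ip_rep_testInt_sub_le (hU.bddMeas' t) (P' t)
    rw [ip_sub_self_comm] at i1
    have i5 : 0 ≤ γ * rieszForm M k hs0 (dgGrad M k c (ξ t)) (dgGrad M k c (ξ t)) :=
      mul_nonneg hγ0.le (rieszForm_self_nonneg hs0 hs1 hab hσ hM _)
    -- The extra factor `h` gained from the penalty is not needed; it is bounded by `1`.
    have i6 : γ ^ 2 * d ^ 2 * M.size / (2 * κ) ≤ γ ^ 2 * C₁ ^ 2 / (2 * κ) * η ^ 2 := by
      have : d ^ 2 ≤ (C₁ * B * M.size ^ (k + 1)) ^ 2 := sq_le_sq' (neg_le_of_abs_le hdη)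
        (le_of_abs_le hdη)
      calc γ ^ 2 * d ^ 2 * M.size / (2 * κ)
          ≤ γ ^ 2 * (C₁ * B * M.size ^ (k + 1)) ^ 2 * 1 / (2 * κ) := by gcongr
        _ = _ := by rw [hη]; ring
    rw [hA]
    linarith [e2 t, e4 t]
  choose! E' hE'd hE'le using hder
  intro t ht
  have hgr := le_of_hasDerivAt_le hT hcont hE'd hE'le ht
  have hη2 : 0 ≤ A * η ^ 2 := by positivity
  have hE : ip M k (ξ t) (ξ t) ≤ (A + A) * η ^ 2 * Real.exp T := by
    have h1 : (ip M k (ξ 0) (ξ 0) + A * η ^ 2) * Real.exp t ≤ (A + A) * η ^ 2 * Real.exp T :=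
      mul_le_mul (by linarith) (Real.exp_le_exp.2 ht.2) (Real.exp_pos t).le (by linarith)
    linarith
  have h1 := bilin_add_self_le (ξ t) (Δ (r t))
  -- The total error is the projection error plus the corrector plus `ξ`, each of order `h ^ (k +
  -- 1)`.
  have h2 : ξ t + Δ (r t) = P t - uh t := by rw [hξ]; simp only; abel
  rw [h2] at h1
  have h3 := integral_sq_sub_toFun_le_add (hU.bddMeas t) (P t) (uh t)
  have h4 : ∫ x in a..b, (u x t - toFun (uh t) x) ^ 2
      ≤ (A + 4 * (A + A) * Real.exp T + 2 * A) * η ^ 2 := by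
    have h5 : 0 ≤ γ ^ 2 * C₁ ^ 2 / (2 * κ) * η ^ 2 := by positivity
    have h6 : 0 ≤ (b - a) * C₁ ^ 2 * η ^ 2 := by positivity
    have h7 : A * η ^ 2 = 2 * ((b - a) * C₁ ^ 2 * η ^ 2) + 2 * (C₂ * C₃ * η ^ 2)
      + γ ^ 2 * C₁ ^ 2 / (2 * κ) * η ^ 2 := by rw [hA]; ring
    nlinarith [e1 t, e3 t]
  have h8 : (A + 4 * (A + A) * Real.exp T + 2 * A) * η ^ 2
      = (√(A + 4 * (A + A) * Real.exp T + 2 * A) * |B| * M.size ^ (k + 1)) ^ 2 := by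
    have h9 := Real.sq_sqrt (show 0 ≤ A + 4 * (A + A) * Real.exp T + 2 * A by positivity)
    rw [mul_pow (_ * _), mul_pow (√_), h9, sq_abs, hη]; ring
  rw [h8] at h4
  refine h4.trans (pow_le_pow_left₀ (by positivity) ?_ 2)
  exact mul_le_mul_of_nonneg_right (by rw [hL]; linarith) (by positivity)

end

end LDG

/-! ### The main theorem -/

theorem mainTheorem2 (k : ℕ) :
    ∃ m : ℕ, ∀ (a b T ε α β σ : ℝ), a < b → 0 < T → 0 < ε → 1 < α → α < 2 → 0 < β →
      ∀ (c : LDG.FluxChoice) (g u : ℝ → ℝ → ℝ),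
        LDG.IsExactSolution a b T ε α g u → LDG.IsSmooth m T u →
        ∃ C > 0, ∃ h₀ > 0, ∀ M : LDG.Mesh a b, M.IsQuasiUniform σ → M.size ≤ h₀ →
          ∀ uh ph qh : ℝ → M.Space k,
            LDG.IsLDGSolution c T ε α β g (fun x => u x 0) uh ph qh →
            ∀ t ∈ Set.Icc 0 T,
              LDG.normL2 a b (fun x => u x t - LDG.toFun (uh t) x) ≤ C * M.size ^ (k + 1) := by
  -- The mixed derivative `u_xt` and its Riesz potential must have `k + 1` bounded space
  -- derivatives, and two orders are spent on forming `u_xt`.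
  refine ⟨k + 3, fun a b T ε α β σ hab hT hε h1α hα2 hβ c g u hex hsm => ?_⟩
  -- For `σ ≤ 0` no mesh is quasi-uniform.
  rcases le_or_gt σ 0 with hσ | hσ
  · refine ⟨1, one_pos, 1, one_pos, fun M hM => ?_⟩
    have hM' := hM ⟨0, M.K_pos hab⟩
    have := M.size_pos hab
    have := mul_nonpos_of_nonpos_of_nonneg hσ (M.width_pos ⟨0, M.K_pos hab⟩).le
    linarith
  have hs0 : 0 < 2 - α := by linarith
  have hs1 : 2 - α < 1 := by linarith
  have fu : LDG.SmoothFam a b T (k + 3) u := ⟨hsm, hex.exterior⟩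
  obtain ⟨v, ut, fv, fut, hux, hut⟩ := fu.exists_deriv hT
  obtain ⟨w, vt, fw, fvt, hvx, hvt⟩ := fv.exists_deriv hT
  obtain ⟨B₀, tU⟩ := (fu.of_le (Nat.zero_le _)).timeFam hT (fut.of_le (Nat.zero_le _)) hut
  obtain ⟨B₁, tV⟩ := (fv.of_le (Nat.zero_le _)).timeFam hT (fvt.of_le (Nat.zero_le _)) hvt
  obtain ⟨D₁, d₁⟩ := (fu.of_le (show k + 1 ≤ k + 3 by omega)).exists_derivChain hT
  obtain ⟨D₂, d₂⟩ := (fut.of_le (show k + 1 ≤ k + 2 by omega)).exists_derivChain hT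
  obtain ⟨D₃, d₃⟩ := (fv.of_le (show k + 1 ≤ k + 2 by omega)).exists_derivChain hT
  obtain ⟨D₄, d₄⟩ := fvt.exists_derivChain hT
  obtain ⟨D₅, d₅⟩ := (fv.of_le (show k + 1 ≤ k + 2 by omega)).exists_derivChain_rieszInt hT hs0
  obtain ⟨D₆, d₆⟩ := fvt.exists_derivChain_rieszInt hT hs0
  have hcl := LDG.clamp_mem hT
  set D := max D₁ (max D₂ (max D₃ (max D₄ (max D₅ D₆)))) with hD
  -- Clamping the time to `[0, T]` makes all bounds hold for every real time and does not change
  -- anything on `[0, T]`.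
  have hreg : LDG.RegularFam a b T (2 - α) B₀ B₁ D (k + 1) (fun x t => u x (LDG.clamp T t))
      (fun x t => v x (LDG.clamp T t)) (fun x t => w x (LDG.clamp T t))
      (fun x t => ut x (LDG.clamp T t)) (fun x t => vt x (LDG.clamp T t)) :=
    { famU := tU
      famV := tV
      derivU := fun t => hux _ (hcl t)
      derivV := fun t => hvx _ (hcl t)
      contW := fun t => fw.continuous (hcl t)
      suppU := fun t => fu.supp _ (hcl t)
      suppV := fun t => fv.supp _ (hcl t)
      suppVt := fun t => fvt.supp _ (hcl t)
      suppW := fun t => fw.supp _ (hcl t)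
      chainU := fun t => (d₁ _ (hcl t)).mono (by simp [hD])
      chainUt := fun t => (d₂ _ (hcl t)).mono (by simp [hD])
      chainV := fun t => (d₃ _ (hcl t)).mono (by simp [hD])
      chainVt := fun t => (d₄ _ (hcl t)).mono (by simp [hD])
      chainRieszV := fun t => (d₅ _ (hcl t)).mono (by simp [hD])
      chainRieszVt := fun t => (d₆ _ (hcl t)).mono (by simp [hD]) }
  obtain ⟨A, hA, h⟩ := LDG.exists_energy_le (g := g) k hs0 hs1 hab hT hε hβ hσ c hreg
    fun t ht x hx => by
      have ht' := Ioo_subset_Icc_self ht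
      -- The classical time derivative of the equation is the smooth `ut`, which yields `g` on the
      -- open interval.
      have h1 := (uniqueDiffOn_Icc hT t ht').eq_deriv _ (hut t ht' x)
        (hex.equation t (Ioo_subset_Ioc_self ht) x hx)
      rw [LDG.negFracLaplacian_eq h1α hα2 (hux t ht') (hvx t ht') (fw.continuous ht')
        (fu.supp t ht') (fv.supp t ht') (fw.supp t ht')] at h1
      simp only [LDG.clamp_of_mem ht']
      linarith
  refine ⟨A, hA, 1, one_pos, fun M hM hM1 uh ph qh hsol t ht => ?_⟩
  have hsz := M.size_pos hab
  have h0 : LDG.clamp T 0 = 0 := LDG.clamp_of_mem (left_mem_Icc.2 hT.le)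
  have h2 := h M hM hM1 uh ph qh (by simpa only [h0] using hsol) t ht
  rw [LDG.clamp_of_mem ht] at h2
  exact Real.sqrt_le_iff.2 ⟨by positivity, h2⟩
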